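/- **Constants.** Let $\psi=\tfrac23$, $\chi=\psi/3=\tfrac29$, $L_k=2^{k-1}$ for $k\in\mathbb Z$, and $q_1=\tfrac15$, $q_2=\tfrac16$, $q_3=\tfrac17$, $q_k=q_{k-1}\bigl(1-L_{k-2}^{-\psi/20}\bigr)$ for $k\ge 4$. For $0<\varepsilon<1$ put $\gamma=\varepsilon^4$ and $\varepsilon_k=\varepsilon^{L_k^{\psi}}$. Distances on $\mathbb Z^d$ are measured by $|x|=\sum_i|x_i|$. **Model.** Let $\Lambda\subset\mathbb Z^d$ be a finite rectangle and let $u_x$ ($x\in\Lambda$) be independent and uniformly distributed on $[-1,1]$. On $\mathbb C^{\Lambda}\otimes\mathbb C^2$ let $H=\bigoplus_{x}h_x+\gamma J\otimes I_2$, where $h_x=\begin{pmatrix}u_x&1\\1&-u_x\end{pmatrix}$ has the eigenvalues $\pm t_x=\pm\sqrt{u_x^2+1}$ and $J_{xy}=1$ if $|x-y|=1$, $J_{xy}=0$ otherwise. **Components.** The components of a finite set $S$ on scale $k$ are its connected components for links of length at most $L_k$. A component $B$ of $R$ on scale $k\ge2$ is *isolated on scale $k$* if it has at most $L_k^{2\psi/5}$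 positions, its distance from every other component of $R$ on scale $k$ is at least $4L_k$, and its diameter is at most $L_k$. **Schur complements.** For $\Lambda=R^{(0)}\supseteq R^{(1)}\supseteq\dots$ let $F^{(0)}_\lambda=H$ and let $F^{(k)}_\lambda$ be the Schur complement of $F^{(k-1)}_\lambda-\lambda$ onto the sites over $R^{(k)}$, with $\lambda$ added back. The blocks of $R^{(k-1)}\setminus R^{(k)}$ are single positions if $k=1$ and components of $R^{(k-1)}$ on scale $k$ if $k\ge2$. Taking the block diagonal matrix with blocks $\tilde F^{(k-1)}_\lambda(C)$ as the unperturbed part of the eliminated block of $F^{(k-1)}_\lambda$ and expanding in a Neumann series, $F^{(k)}_\lambda$ becomes a sum over step-$k$ multigraphs: walks through the blocks of $R^{(k-1)}\setminus R^{(k)}$ whose steps are step-$(k-1)$ multigraphs, with a matrix element of $(\tilde F^{(k-1)}_\lambda(C)-\lambda)^{-1}$ for every visit of a block $C$, all positions of which are then contained in the multigraph. Here $\tilde F^{(k-1)}_\lambda(B)$ is the matrix on the sites over $B$ given by the sum over only those multigraphs of $F^{(k-1)}_\lambda$ all of whose positions are at distance less than $L_{k-2}$ from $B$. **Energy-following procedure.**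 Fix $x\in\Lambda$, and let $E_1$ be one of $\pm t_x$. Let $R^{(1)}$ be the set of $z\in\Lambda$ such that $t_z$ or $-t_z$ is within $\varepsilon$ of $E_1$. Given $E_1,\dots,E_{k-1}$ and $R^{(1)},\dots,R^{(k-1)}$, let $B_{x,k-1}$ (the block of $x$) be the component on scale $k-1$ of $R^{(k-1)}$ that contains $x$; let $E_k$ be one of the solutions of $\lambda\in\operatorname{spec}\tilde F^{(k-1)}_\lambda(B_{x,k-1})$ in $[E_{k-1}-\varepsilon_{k-1}/3,\,E_{k-1}+\varepsilon_{k-1}/3]$; and let $R^{(k)}$ be $R^{(k-1)}$ without those components $B$ of $R^{(k-1)}$ on scale $k$ that are isolated on scale $k$ and satisfy $\operatorname{dist}(\operatorname{spec}\tilde F^{(k-1)}_{E_k}(B),E_k)>\varepsilon_k$. A *choice of energies* is given by the sign in $E_1=\pm t_x$ and, for each later step, by the rank of $E_k$ among the possible solutions in increasing order. **Weighted sums.** For a finite $B\subseteq\Lambda$ with $n(B)$ positions let $\hat P^{(1)}(B)=(3\sqrt\varepsilon)^{n(B)-1}$ if $x\in B$ and $(3\sqrt\varepsilon)^{n(B)}$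 if $x\notin B$. For $k\ge2$ let $\hat P^{(k)}(B)=\varepsilon^{L_{k-2}^{3\psi/5}/3}$ if $x\notin B$ and $B$ is isolated on scale $k-2\ge 2$ (that is, connected on that scale, with the above volume and diameter conditions; for the blocks of the procedure in step $k$ the distance condition is then automatic), and $\hat P^{(k)}(B)=\prod_i\hat P^{(k-1)}(B_i)$ over the components $B_i$ of $B$ on scale $k-1$ otherwise. Let $$\hat Q^{(k)}_{x,y}=\sum_{B}\hat P^{(k)}(B)\,\varepsilon^{-q_kn(B)/2},$$ where $B$ runs over the sets $B\subseteq\Lambda$ containing $x$ and $y$ that are connected on scale $k$ and for which $B\ne B'$, where $B'$ is the component of $B$ on scale $k-1$ that contains $x$ ($B'=\{x\}$ if $k=1$). **Theorem.** There is a number $q$ with $0<q<q_k$ for all $k\ge1$ such that for every dimension $d$ there is $\varepsilon_0>0$ such that the following holds for all $0<\varepsilon<\varepsilon_0$, all finite rectangles $\Lambda\subset\mathbb Z^d$, all $x,y\in\Lambda$ and all $k\ge1$: 1. $\displaystyle \hat Q^{(k)}_{x,y}\le\varepsilon^{\,q_k(|x-y|\vee L_{k-2})^{\chi}/2}$; 2.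 for every choice of energies, the probability that the procedure started at $x$ can be carried out with this choice up to step $k$ and that $y$ belongs to the block $B_{x,k}$ is at most $\varepsilon^{\,q|x-y|^{\chi}/2}$. -/

import Mathlib

open scoped ENNReal

noncomputable section

namespace BlockAnderson

open scoped Classical

/-! ### Constants and scales -/

/-- The exponent of the graphical bounds. -/
def psi : ℝ := 2 / 3

/-- The exponent of the probability bounds. -/
def chi : ℝ := psi / 3

/-- The length scales `L_k = 2 ^ (k - 1)`, for every integer `k`. -/
def L (k : ℤ) : ℝ := (2 : ℝ) ^ (k - 1)

/-- The energy windows `ε_k = ε ^ (L_k ^ ψ)`. -/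
def epsAt (ε : ℝ) (k : ℕ) : ℝ := ε ^ (L k ^ psi)

/-- `q_1 = 1/5`, `q_2 = 1/6`, `q_3 = 1/7`, `q_k = q_{k-1} (1 - L_{k-2} ^ (-ψ/20))` for `k ≥ 4`
(the value at `0` is not used). -/
def qSeq : ℕ → ℝ
  | 0 => 1 / 5
  | 1 => 1 / 5
  | 2 => 1 / 6
  | 3 => 1 / 7
  | k + 4 => qSeq (k + 3) * (1 - L ((k : ℤ) + 2) ^ (-psi / 20))

/-! ### Positions, components, isolated components -/

/-- The `ℓ¹` distance on the lattice. -/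
def ldist {d : ℕ} (x y : Fin d → ℤ) : ℝ := ∑ i, |(x i : ℝ) - (y i : ℝ)|

variable {d : ℕ} {Λ : Finset (Fin d → ℤ)}

/-- The connected component of `x` in `S`, for links of length at most `ℓ` between elements of `S`.
It is empty if `x ∉ S`. -/
def comp (ℓ : ℝ) (S : Finset Λ) (x : Λ) : Finset Λ :=
  S.filter fun y =>
    Relation.ReflTransGen (fun a b : Λ => a ∈ S ∧ b ∈ S ∧ ldist a.1 b.1 ≤ ℓ) x y

/-- All connected components of `S` for links of length at most `ℓ`. -/
def comps (ℓ : ℝ) (S : Finset Λ) : Finset (Finset Λ) := S.image (comp ℓ S)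

/-- `B` is a component of `R` on scale `k ≥ 2` that is isolated on scale `k`. -/
def IsIsolated (k : ℕ) (R B : Finset Λ) : Prop :=
  2 ≤ k ∧ B ∈ comps (L k) R ∧
    (B.card : ℝ) ≤ L k ^ (2 * psi / 5) ∧
    (∀ C ∈ comps (L k) R, C ≠ B → ∀ a ∈ B, ∀ b ∈ C, 4 * L k ≤ ldist a.1 b.1) ∧
    (∀ a ∈ B, ∀ b ∈ B, ldist a.1 b.1 ≤ L k)

/-! ### The modified probability bounds and their weighted sum -/

/-- The modified bound `P̂^{(k)}(B)` for a block `B` of step `k`, with starting site `x`.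

The isolation of a block `B` of step `k + 2` on scale `k` is decided by `B` alone: if `B` is a
component on scale `k + 2` of the resonant set of step `k + 2`, then it is isolated on scale `k`
if and only if it is connected on scale `k` and satisfies the volume and the diameter conditions,
because its distance from all other components on scale `k` is then automatically at least
`4 L_k = L_{k+2}` (`isIsolated_iff_of_mem_comps` below). This is what `IsIsolated k B B` says. -/
def Phat (ε : ℝ) (x : Λ) : ℕ → Finset Λ → ℝ
  | 0, _ => 1
  | 1, B => (3 * √ε) ^ (if x ∈ B then B.card - 1 else B.card)
  | k + 2, B =>
      if IsIsolated k B B ∧ x ∉ B then ε ^ (L k ^ (3 * psi / 5) / 3)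
      else ∏ C ∈ comps (L ((k : ℤ) + 1)) B, Phat ε x (k + 1) C

/-- The weighted sum `Q̂^{(k)}_{x,y}`: over all possible blocks `B = B_{x,k}` of step `k`
(sets that are connected on scale `k`) containing `x` and `y`, such that `B_{x,k}` is not
already the block `B_{x,k-1}` of `x` in step `k - 1`. The latter is the subcomponent
of `B` on scale `k - 1` that contains `x`; for `k = 1` it is `{x}`, as `L_0 < 1`. -/
def Qhat (ε : ℝ) (k : ℕ) (x y : Λ) : ℝ :=
  ∑ B : Finset Λ with x ∈ B ∧ y ∈ B ∧ comp (L k) B x = B ∧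
      (B \ comp (L ((k : ℤ) - 1)) B x).Nonempty,
    Phat ε x k B * ε ^ (-(qSeq k * B.card / 2))

/-! ### The random block Hamiltonian -/

/-- The single-position Hamiltonian. -/
def h (v : ℝ) : Matrix (Fin 2) (Fin 2) ℝ := !![v, 1; 1, -v]

/-- The eigenvalues of `h v` are `t v` and `- t v`. -/
def t (v : ℝ) : ℝ := √(v ^ 2 + 1)

/-- The Hamiltonian `H = ⊕ₓ h (u x) + γ J ⊗ I₂` on `Λ`. -/
def H (γ : ℝ) (u : Λ → ℝ) : Matrix (Λ × Fin 2) (Λ × Fin 2) ℝ := fun a b =>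
  (if a.1 = b.1 then h (u a.1) a.2 b.2 else 0) +
    γ * (if ldist a.1.1 b.1.1 = 1 ∧ a.2 = b.2 then 1 else 0)

/-- The joint law of independent random variables, uniformly distributed on `[-1, 1]`. -/
def law (Λ : Finset (Fin d → ℤ)) : MeasureTheory.Measure (Λ → ℝ) :=
  MeasureTheory.Measure.pi fun _ : Λ =>
    (2 : ℝ≥0∞)⁻¹ • MeasureTheory.volume.restrict (Set.Icc (-1 : ℝ) 1)

/-! ### Schur complements and their truncations

Let `R 0 = Λ ⊇ R 1 ⊇ R 2 ⊇ …` be the resonant sets. -/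

/-- The block of `R k \ R (k + 1)` that contains `z`: a single position if `k = 0`, and
a component of `R k` on scale `k + 1` otherwise. -/
def cell (R : ℕ → Finset Λ) (k : ℕ) (z : Λ) : Finset Λ :=
  if k = 0 then {z} else comp (L ((k : ℤ) + 1)) (R k) z

/-- The positions at distance less than `ℓ` from `B`. -/
def nbhd (ℓ : ℝ) (B : Finset Λ) : Finset Λ :=
  Finset.univ.filter fun z => ∃ b ∈ B, ldist z.1 b.1 < ℓ

/-- `schur γ u lam R k X` is the sum over all multigraphs of the `k`-th Schur complement
`F_λ^{(k)}` that remain in the set `X`; so `X = Λ` gives `F_λ^{(k)}` itself. Only its entries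
at positions in `R k` are meaningful.

A multigraph of step `k + 1` is a walk, from `R (k + 1)` to itself through the blocks of
`R k \ R (k + 1)`, whose steps are multigraphs of step `k`. It contains all positions of each
block that it passes through. In a block `C` it picks up the inverse of `F̃_λ^{(k)}(C) - λ`,
where `F̃_λ^{(k)}(C)` is the sum over the multigraphs of step `k` that remain at a distance
less than `L_{k-1}` from `C`; its steps from `C` to `C` are the multigraphs that do not. Summing
the Neumann series over all walks in `X` gives the formula below, in which `D` is the
matrix `D^{(k+1)} = W^{(k+1)} + V^{(k+1)}` with `V^{(k+1)}` restricted to multigraphs in `X`. -/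
def schur (γ : ℝ) (u : Λ → ℝ) (lam : ℝ) (R : ℕ → Finset Λ) :
    ℕ → Finset Λ → Matrix (Λ × Fin 2) (Λ × Fin 2) ℝ
  | 0, X => fun a b => if a.1 ∈ X ∧ b.1 ∈ X then H γ u a b else 0
  | k + 1, X =>
      let F : Finset Λ → Matrix (Λ × Fin 2) (Λ × Fin 2) ℝ := schur γ u lam R k
      -- the sites of the blocks of `R k \ R (k + 1)` that are contained in `X`
      let p : Λ × Fin 2 → Prop := fun a => a.1 ∈ R k \ R (k + 1) ∧ cell R k a.1 ⊆ X
      -- the neighborhood of the block of `a`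
      let N : Λ × Fin 2 → Finset Λ := fun a => nbhd (L ((k : ℤ) - 1)) (cell R k a.1)
      let D : Matrix (Λ × Fin 2) (Λ × Fin 2) ℝ := fun a b =>
        if cell R k a.1 = cell R k b.1 then F (N a) a b + (F X a b - F (X ∩ N a) a b)
        else F X a b
      let Dp : Matrix {a // p a} {a // p a} ℝ := D.submatrix Subtype.val Subtype.val
      let B : Matrix (Λ × Fin 2) {a // p a} ℝ := (F X).submatrix id Subtype.val
      let C : Matrix {a // p a} (Λ × Fin 2) ℝ := (F X).submatrix Subtype.val id
      F X - B * (Dp - lam • (1 : Matrix {a // p a} {a // p a} ℝ))⁻¹ * C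

/-- The truncated Schur complement `F̃_λ^{(k)}(B)`, a matrix on the sites of the block `B`: only
multigraphs that remain at a distance less than `L_{k-1}` from `B` are kept. -/
def truncSchur (γ : ℝ) (u : Λ → ℝ) (lam : ℝ) (R : ℕ → Finset Λ) (k : ℕ) (B : Finset Λ) :
    Matrix {a : Λ × Fin 2 // a.1 ∈ B} {a : Λ × Fin 2 // a.1 ∈ B} ℝ :=
  (schur γ u lam R k (nbhd (L ((k : ℤ) - 1)) B)).submatrix Subtype.val Subtype.val

/-! ### Resonant sets and the energy-following procedure

Throughout, `γ = ε ^ 4`, that is `ε = γ ^ (1/4)`. -/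

/-- A component `B` of `R (k - 1)` on scale `k` is resonant on scale `k`, with respect to `E`: it is
isolated on scale `k` and the distance of `E` from the spectrum of `F̃_E^{(k-1)}(B)`
is at most `ε_k`. -/
def IsResonant (ε : ℝ) (u : Λ → ℝ) (E : ℝ) (R : ℕ → Finset Λ) (k : ℕ) (B : Finset Λ) : Prop :=
  IsIsolated k (R (k - 1)) B ∧
    ∃ μ ∈ spectrum ℝ (truncSchur (ε ^ 4) u E R (k - 1) B), |μ - E| ≤ epsAt ε k

/-- The resonant set of step `k + 1` with central energy `E`, when those of the steps `0, …, k`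
are given by `R`. -/
def nextSet (ε : ℝ) (u : Λ → ℝ) (E : ℝ) (R : ℕ → Finset Λ) : ℕ → Finset Λ
  | 0 => Finset.univ.filter fun z => |t (u z) - E| ≤ ε ∨ |-t (u z) - E| ≤ ε
  | k + 1 => (R (k + 1)).filter fun z =>
      ¬ (IsIsolated (k + 2) (R (k + 1)) (comp (L ((k : ℤ) + 2)) (R (k + 1)) z) ∧
        ¬ IsResonant ε u E R (k + 2) (comp (L ((k : ℤ) + 2)) (R (k + 1)) z))

/-- The resonant sets of the steps `0, …, k`, as the values at `0, …, k`. -/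
def history (ε : ℝ) (u : Λ → ℝ) (E : ℕ → ℝ) : ℕ → ℕ → Finset Λ
  | 0 => fun _ => Finset.univ
  | k + 1 => Function.update (history ε u E k) (k + 1)
      (nextSet ε u (E (k + 1)) (history ε u E k) k)

/-- The resonant set `R^{(k)}` for the central energies `E 1, …, E k` of the first `k` steps,
with `R^{(0)} = Λ`. -/
def resSet (ε : ℝ) (u : Λ → ℝ) (E : ℕ → ℝ) (k : ℕ) : Finset Λ := history ε u E k k

/-- The block `B_{x,k}` of `x` in step `k`. -/
def block (ε : ℝ) (u : Λ → ℝ) (E : ℕ → ℝ) (x : Λ) (k : ℕ) : Finset Λ :=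
  comp (L k) (resSet ε u E k) x

/-- The energies that may follow `E k`: the solutions of `λ ∈ spec F̃_λ^{(k)}(B_{x,k})`
in `[E_k - ε_k/3, E_k + ε_k/3]`. -/
def nextEnergies (ε : ℝ) (u : Λ → ℝ) (E : ℕ → ℝ) (x : Λ) (k : ℕ) : Set ℝ :=
  {lam | |lam - E k| ≤ epsAt ε k / 3 ∧
    lam ∈ spectrum ℝ
      (truncSchur (ε ^ 4) u lam (resSet ε u E) k (block ε u E x k))}

/-- `E 1, …, E k` are the energies of the first `k` steps of the energy-following procedure that
starts at `x`, when the choices are made according to the sign `s` and the numbers `p`: the first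
energy is the eigenvalue `s * t (u x)` of `h (u x)`, and `E (j + 1)` is that one of the energies
that may follow `E j` which is greater than exactly `p j` of them. -/
def Follows (ε : ℝ) (u : Λ → ℝ) (x : Λ) (s : ℝ) (p : ℕ → ℕ) (k : ℕ) (E : ℕ → ℝ) : Prop :=
  E 1 = s * t (u x) ∧
    ∀ j, 1 ≤ j → j < k → E (j + 1) ∈ nextEnergies ε u E x j ∧
      (nextEnergies ε u E x j ∩ Set.Iio (E (j + 1))).encard = p j

/-- The event that the energies `E 1, …, E k` with the given choices exist and that `y` belongs to
the resulting block of `x` in step `k`. -/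
def inBlock (ε : ℝ) (x y : Λ) (s : ℝ) (p : ℕ → ℕ) (k : ℕ) : Set (Λ → ℝ) :=
  {u | ∃ E : ℕ → ℝ, Follows ε u x s p k E ∧ y ∈ block ε u E x k}

/-! ### Isolation of a block two scales earlier

It is shown that isolation of a block of step `k + 2` on scale `k` is a property of the block. -/

theorem mem_comp {ℓ : ℝ} {S : Finset Λ} {x y : Λ} :
    y ∈ comp ℓ S x ↔ y ∈ S ∧
      Relation.ReflTransGen (fun a b : Λ => a ∈ S ∧ b ∈ S ∧ ldist a.1 b.1 ≤ ℓ) x y := by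
  simp [comp]

theorem comp_subset {ℓ : ℝ} {S : Finset Λ} {x : Λ} : comp ℓ S x ⊆ S :=
  Finset.filter_subset _ _

theorem self_mem_comp {ℓ : ℝ} {S : Finset Λ} {x : Λ} (hx : x ∈ S) : x ∈ comp ℓ S x :=
  mem_comp.2 ⟨hx, .refl⟩

theorem ldist_comm (x y : Fin d → ℤ) : ldist x y = ldist y x := by
  simp [ldist, abs_sub_comm]

theorem comp_eq {ℓ : ℝ} {S : Finset Λ} {x y : Λ} (h : y ∈ comp ℓ S x) :
    comp ℓ S y = comp ℓ S x := by
  have h1 := (mem_comp.1 h).2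
  have h2 : Relation.ReflTransGen (fun a b : Λ => a ∈ S ∧ b ∈ S ∧ ldist a.1 b.1 ≤ ℓ) y x := by
    induction h1 with
    | refl => exact .refl
    | @tail b c hb hbc ih =>
      exact (Relation.ReflTransGen.single
        ⟨hbc.2.1, hbc.1, by rw [ldist_comm]; exact hbc.2.2⟩).trans (ih (mem_comp.2 ⟨hbc.1, hb⟩))
  ext z
  rw [mem_comp, mem_comp]
  exact ⟨fun hz => ⟨hz.1, h1.trans hz.2⟩, fun hz => ⟨hz.1, h2.trans hz.2⟩⟩

theorem mem_comp_of_link {ℓ : ℝ} {S : Finset Λ} {x y z : Λ} (h : y ∈ comp ℓ S x) (hz : z ∈ S)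
    (hl : ldist y.1 z.1 ≤ ℓ) : z ∈ comp ℓ S x :=
  mem_comp.2 ⟨hz, (mem_comp.1 h).2.tail ⟨(mem_comp.1 h).1, hz, hl⟩⟩

/-- A component stays connected in every set that contains it, on every larger scale. -/
theorem comp_subset_comp {ℓ ℓ' : ℝ} {S T : Finset Λ} {x : Λ} (hℓ : ℓ ≤ ℓ')
    (hT : comp ℓ S x ⊆ T) : comp ℓ S x ⊆ comp ℓ' T x := by
  intro y hy
  have key : ∀ z, Relation.ReflTransGen
      (fun a b : Λ => a ∈ S ∧ b ∈ S ∧ ldist a.1 b.1 ≤ ℓ) x z → z ∈ comp ℓ S x →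
      Relation.ReflTransGen (fun a b : Λ => a ∈ T ∧ b ∈ T ∧ ldist a.1 b.1 ≤ ℓ') x z := by
    intro z hz
    induction hz with
    | refl => exact fun _ => .refl
    | @tail b c hb hbc ih =>
      intro hc
      have hb' : b ∈ comp ℓ S x := mem_comp.2 ⟨hbc.1, hb⟩
      exact (ih hb').tail ⟨hT hb', hT hc, hbc.2.2.trans hℓ⟩
  exact mem_comp.2 ⟨hT hy, key y (mem_comp.1 hy).2 hy⟩

theorem comp_self {ℓ : ℝ} {S : Finset Λ} {x : Λ} :
    comp ℓ (comp ℓ S x) x = comp ℓ S x :=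
  Finset.Subset.antisymm comp_subset
    (comp_subset_comp le_rfl (Finset.Subset.refl _))

theorem isIsolated_self_of {k : ℕ} {R B : Finset Λ} (hB : IsIsolated k R B) :
    IsIsolated k B B := by
  obtain ⟨hk, hm, hv, -, hd⟩ := hB
  obtain ⟨z, hz, rfl⟩ := Finset.mem_image.1 hm
  have e := comp_self (ℓ := L k) (S := R) (x := z)
  refine ⟨hk, Finset.mem_image.2 ⟨z, self_mem_comp hz, e⟩, hv, ?_, hd⟩
  intro C hC hne
  obtain ⟨c, hc, rfl⟩ := Finset.mem_image.1 hC
  refine absurd ?_ hne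
  have := comp_eq (ℓ := L k) (S := comp (L k) R z) (x := z) (y := c) (by rw [e]; exact hc)
  rw [this, e]

theorem L_mono {a b : ℤ} (h : a ≤ b) : L a ≤ L b :=
  zpow_le_zpow_right₀ (by norm_num) (by omega)

theorem L_pos (a : ℤ) : 0 < L a := by unfold L; positivity

theorem L_add_two (k : ℤ) : L (k + 2) = 4 * L k := by
  unfold L
  rw [show k + 2 - 1 = (k - 1) + 2 by ring, zpow_add₀ (by norm_num)]
  norm_num
  ring

theorem resSet_add_two (ε : ℝ) (u : Λ → ℝ) (E : ℕ → ℝ) (k : ℕ) :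
    ∃ P : Finset Λ → Prop, resSet ε u E (k + 2) = (resSet ε u E (k + 1)).filter fun z =>
      ¬ (IsIsolated (k + 2) (resSet ε u E (k + 1))
          (comp (L ((k : ℤ) + 2)) (resSet ε u E (k + 1)) z) ∧
        ¬ P (comp (L ((k : ℤ) + 2)) (resSet ε u E (k + 1)) z)) :=
  ⟨IsResonant ε u (E (k + 2)) (history ε u E (k + 1)) (k + 2), by
    simp only [resSet]
    rw [history, Function.update_self, nextSet]
    rfl⟩

/-- For a block of step `k + 2`, isolation on scale `k` depends on the block alone. -/
theorem isIsolated_iff_of_mem_comps (ε : ℝ) (u : Λ → ℝ) (E : ℕ → ℝ) {k : ℕ} {B : Finset Λ}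
    (hB : B ∈ comps (L ((k : ℤ) + 2)) (resSet ε u E (k + 2))) :
    IsIsolated k (resSet ε u E (k - 1)) B ↔ IsIsolated k B B := by
  refine ⟨isIsolated_self_of, fun hi => ?_⟩
  obtain ⟨hk, hm, hv, -, hd⟩ := hi
  obtain ⟨m, rfl⟩ : ∃ m, k = m + 2 := ⟨k - 2, by omega⟩
  -- one step of the construction
  have step : ∀ j : ℕ, resSet ε u E (j + 2) ⊆ resSet ε u E (j + 1) ∧
      (∀ z ∈ resSet ε u E (j + 2),
        comp (L ((j : ℤ) + 2)) (resSet ε u E (j + 1)) z ⊆ resSet ε u E (j + 2)) ∧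
      (∀ z ∈ resSet ε u E (j + 1), z ∉ resSet ε u E (j + 2) →
        IsIsolated (j + 2) (resSet ε u E (j + 1))
          (comp (L ((j : ℤ) + 2)) (resSet ε u E (j + 1)) z)) := by
    intro j
    obtain ⟨P, hP⟩ := resSet_add_two ε u E j
    rw [hP]
    refine ⟨Finset.filter_subset _ _, ?_, ?_⟩
    · intro z hz w hw
      refine Finset.mem_filter.2 ⟨comp_subset hw, ?_⟩
      rw [comp_eq hw]
      exact (Finset.mem_filter.1 hz).2
    · intro z hz hz'
      by_contra hcon
      exact hz' (Finset.mem_filter.2 ⟨hz, fun h => hcon h.1⟩)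
  obtain ⟨s0, c0, i0⟩ := step m
  obtain ⟨s1, c1, i1⟩ := step (m + 1)
  obtain ⟨s2, c2, i2⟩ := step (m + 2)
  rw [show m + 2 - 1 = m + 1 by omega]
  simp only [show m + 1 + 2 = m + 3 by ring, show m + 1 + 1 = m + 2 by ring,
    show m + 2 + 2 = m + 4 by ring] at s0 c0 i0 s1 c1 i1 s2 c2 i2 hB
  push_cast at c0 i0 c1 i1 c2 i2 hB hm hv hd ⊢
  set A0 := resSet ε u E (m + 1)
  set A1 := resSet ε u E (m + 2)
  set A2 := resSet ε u E (m + 3)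
  set A3 := resSet ε u E (m + 4)
  obtain ⟨b, hb, rfl⟩ := Finset.mem_image.1 hB
  set B := comp (L ((m : ℤ) + 2 + 2)) A3 b with hBdef
  have hbB : b ∈ B := self_mem_comp hb
  have hBc : comp (L ((m : ℤ) + 2)) B b = B := by
    obtain ⟨z, hz, e⟩ := Finset.mem_image.1 hm
    have := comp_eq (ℓ := L ((m : ℤ) + 2)) (S := B) (x := z) (y := b) (by rw [e]; exact hbB)
    rw [this, e]
  have hBA3 : B ⊆ A3 := comp_subset
  have hBA0 : B ⊆ A0 := hBA3.trans (s2.trans (s1.trans s0))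
  have e0 : B ⊆ comp (L ((m : ℤ) + 2)) A0 b := by
    have := comp_subset_comp (ℓ := L ((m : ℤ) + 2)) (ℓ' := L ((m : ℤ) + 2)) (S := B) (T := A0)
      (x := b) le_rfl (by rw [hBc]; exact hBA0)
    rwa [hBc] at this
  have e1 : comp (L ((m : ℤ) + 2)) A0 b ⊆ comp (L ((m : ℤ) + 1 + 2)) A1 b :=
    comp_subset_comp (L_mono (by omega)) (c0 b (s1 (s2 hb)))
  have e2 : comp (L ((m : ℤ) + 1 + 2)) A1 b ⊆ comp (L ((m : ℤ) + 2 + 2)) A2 b :=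
    comp_subset_comp (L_mono (by omega)) (c1 b (s2 hb))
  have e3 : comp (L ((m : ℤ) + 2 + 2)) A2 b ⊆ B :=
    comp_subset_comp le_rfl (c2 b hb)
  have f0 : comp (L ((m : ℤ) + 2)) A0 b = B := (e1.trans (e2.trans e3)).antisymm e0
  have f1 : comp (L ((m : ℤ) + 1 + 2)) A1 b = B := (e2.trans e3).antisymm (e0.trans e1)
  refine ⟨by omega, Finset.mem_image.2 ⟨b, s0 (s1 (s2 hb)), by push_cast; exact f0⟩,
    by push_cast; exact hv, ?_, by push_cast; exact hd⟩
  push_cast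
  intro D hD hne a ha c hc
  by_contra hlt
  push Not at hlt
  obtain ⟨z, hz, rfl⟩ := Finset.mem_image.1 hD
  rw [← comp_eq hc] at hne
  have hcA0 : c ∈ A0 := comp_subset hc
  have hcB : c ∉ B := fun h => hne (by rw [← f0] at h ⊢; exact comp_eq h)
  have haA3 : a ∈ A3 := hBA3 ha
  have hlink : ldist a.1 c.1 ≤ L ((m : ℤ) + 2 + 2) := by rw [L_add_two]; exact hlt.le
  have hcA1 : c ∈ A1 := by
    by_contra hn
    have := (i0 c hcA0 hn).2.2.2.1 B (Finset.mem_image.2 ⟨b, s0 (s1 (s2 hb)), by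
      push_cast; exact f0⟩) (Ne.symm hne) c (self_mem_comp hcA0) a ha
    push_cast at this
    rw [ldist_comm] at this
    exact absurd hlt (not_lt.2 this)
  have hcA2 : c ∈ A2 := by
    by_contra hn
    have hne' : B ≠ comp (L ((m : ℤ) + 1 + 2)) A1 c := fun h =>
      hcB (h ▸ self_mem_comp hcA1)
    have := (i1 c hcA1 hn).2.2.2.1 B (Finset.mem_image.2 ⟨b, s1 (s2 hb), by
      rw [show ((m + 3 : ℕ) : ℤ) = (m : ℤ) + 1 + 2 by push_cast; ring]; exact f1⟩) hne' c
      (self_mem_comp hcA1) a ha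
    rw [ldist_comm] at this
    have h2 : L ((m : ℤ) + 2) ≤ L ((m + 3 : ℕ) : ℤ) := L_mono (by push_cast; omega)
    linarith
  have hcA3 : c ∈ A3 :=
    c2 a haA3 (mem_comp_of_link (self_mem_comp (s2 haA3)) hcA2 hlink)
  exact hcB (mem_comp_of_link ha hcA3 hlink)

end BlockAnderson

end

open BlockAnderson

open scoped ENNReal

noncomputable section

namespace BlockAnderson

open scoped Classical

variable {d : ℕ} {Λ : Finset (Fin d → ℤ)}

/-! ### Lattice distance and components -/

/-! The argument has a combinatorial and a probabilistic half, which meet in the product `Phat`.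

Combinatorics. For small ε, `Phat` is at most ε to the power `action` (`Phat_le_rpow_action`): a
position other than x that is counted singly contributes 1/3, and a part that is isolated on scale j
and does not contain x contributes L_j^(3ψ/5)/3. The action dominates the number of positions. It
also dominates diameter and scale to the power χ, because v ↦ v^(1/χ) = v^(9/2) is superadditive
with a gain that pays for the link between two components (`add_rpow_nine_halves`, `action_bounds`,
`ldist_le_action`). Nine tenths of the action therefore pay for the weight ε^(-q_k n/2) and for the
claimed decay (`weight_add_le_action`). The last tenth pays for the sum over B: every block is
exactly the set visited by a closed walk whose steps cost distance^(1/9), with total cost bounded by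
the action (`exists_tour`), and for small ε the sum over all walks is dominated by a geometric
series (`sum_tour_le`). This gives `Qhat_le`.

Probability. The heart is P(B_{x,k} = B) ≤ Phat(B), which is `law_blockEvent_le`. The factors of
`Phat` belong to disjoint parts of B, the `leaves`, each of which is resonant with the energy of its
own step. On the event, fixing the potential outside the leaves of steps ≥ j fixes the energies and
the resonant sets up to step j (`Follows.agree`, `agree_of_leaves`), so one may integrate over the
leaves in the order of decreasing step (`pi_le_prod_of_sections`). On an isolated leaf C the
potential enters F̃(C) only through ⊕h (`schur_add_potDiff`). Resonance makes det(F̃(C) - E_j)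
small, and this determinant is quadratic in every u_z, its leading coefficient being up to sign the
determinant with z removed (`det_rowMatrix_update`). Hence small values are improbable
(`pi_det_lt_le`).

Analysis. The determinant estimate needs a norm bound on the Schur complements, and the
measurability of the events needs their continuity in λ. Both are contained in `LevelBounds`, proved
by induction over the steps together with exponential decay of the entries and locality of their
dependence on the region. A resolvent costs about 1/ε_k, the exponential of a multiple of L_k^ψ with
ψ < 1; the couplings between eliminated cells are smaller by enough, since the decay rate shrinks so
slowly that rate times length outgrows this exponent.

Conclusion. If y ≠ x lies in B_{x,k}, consider the first step m in which y lies in the block of x.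
The union bound over m and over the possible blocks gives the sum of the `Qhat` of the steps m ≤ k.
Their bounds contain L_{m-2}^χ and are summable in m, at the price of replacing q_m by a smaller
uniform q. -/

theorem ldist_nonneg (x y : Fin d → ℤ) : 0 ≤ ldist x y :=
  Finset.sum_nonneg fun _ _ => abs_nonneg _

@[simp] theorem ldist_self (x : Fin d → ℤ) : ldist x x = 0 := by simp [ldist]

theorem ldist_triangle (x y z : Fin d → ℤ) : ldist x z ≤ ldist x y + ldist y z := by
  unfold ldist
  rw [← Finset.sum_add_distrib]
  exact Finset.sum_le_sum fun i _ => abs_sub_le _ _ _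

theorem one_le_ldist {x y : Fin d → ℤ} (h : x ≠ y) : 1 ≤ ldist x y := by
  obtain ⟨i, hi⟩ := Function.ne_iff.1 h
  have h1 : (1 : ℝ) ≤ |(x i : ℝ) - y i| := by
    exact_mod_cast Int.one_le_abs (sub_ne_zero.2 hi)
  exact h1.trans (Finset.single_le_sum (f := fun i => |(x i : ℝ) - y i|)
    (fun _ _ => abs_nonneg _) (Finset.mem_univ i))

theorem one_le_ldist' {x y : Λ} (h : x ≠ y) : 1 ≤ ldist x.1 y.1 :=
  one_le_ldist fun h' => h (Subtype.ext h')

/-- In a connected set, every proper part is linked to the rest. -/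
theorem exists_link {ℓ : ℝ} {B T : Finset Λ} {x : Λ} (hB : comp ℓ B x = B) (hx : x ∈ T)
    (hne : ¬ B ⊆ T) : ∃ a ∈ T, ∃ b ∈ B, b ∉ T ∧ ldist a.1 b.1 ≤ ℓ := by
  obtain ⟨b0, hb0, hb0T⟩ := Finset.not_subset.1 hne
  rw [← hB] at hb0
  have h := (mem_comp.1 hb0).2
  by_contra hcon
  push Not at hcon
  have key : ∀ z, Relation.ReflTransGen
      (fun a b : Λ => a ∈ B ∧ b ∈ B ∧ ldist a.1 b.1 ≤ ℓ) x z → z ∈ T := by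
    intro z hz
    induction hz with
    | refl => exact hx
    | @tail b c _ hbc ih =>
      by_contra hc
      exact absurd hbc.2.2 (not_le.2 (hcon b ih c hbc.2.1 hc))
  exact hb0T (key b0 h)

theorem comp_eq_empty {ℓ : ℝ} {S : Finset Λ} {x : Λ} (hx : x ∉ S) : comp ℓ S x = ∅ := by
  refine Finset.eq_empty_of_forall_notMem fun y hy => ?_
  have h := mem_comp.1 hy
  rcases Relation.ReflTransGen.cases_head h.2 with rfl | ⟨c, hc, -⟩
  · exact hx h.1
  · exact hx hc.1

theorem mem_of_mem_comp {ℓ : ℝ} {S : Finset Λ} {x y : Λ} (h : y ∈ comp ℓ S x) : x ∈ S := by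
  by_contra hx
  rw [comp_eq_empty hx] at h
  exact absurd h (Finset.notMem_empty _)

theorem mem_comp_comm {ℓ : ℝ} {S : Finset Λ} {x y : Λ} : y ∈ comp ℓ S x ↔ x ∈ comp ℓ S y := by
  have : ∀ {x y : Λ}, y ∈ comp ℓ S x → x ∈ comp ℓ S y := fun h => by
    rw [comp_eq h]; exact self_mem_comp (mem_of_mem_comp h)
  exact ⟨this, this⟩

theorem comp_mem_comps {ℓ : ℝ} {S : Finset Λ} {x : Λ} (hx : x ∈ S) : comp ℓ S x ∈ comps ℓ S :=
  Finset.mem_image_of_mem _ hx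

theorem comp_eq_of_mem_comps {ℓ : ℝ} {S C : Finset Λ} {x : Λ} (hC : C ∈ comps ℓ S)
    (hx : x ∈ C) : comp ℓ S x = C := by
  obtain ⟨z, -, rfl⟩ := Finset.mem_image.1 hC
  exact comp_eq hx

theorem nonempty_of_mem_comps {ℓ : ℝ} {S C : Finset Λ} (hC : C ∈ comps ℓ S) : C.Nonempty := by
  obtain ⟨z, hz, rfl⟩ := Finset.mem_image.1 hC
  exact ⟨z, self_mem_comp hz⟩

theorem subset_of_mem_comps {ℓ : ℝ} {S C : Finset Λ} (hC : C ∈ comps ℓ S) : C ⊆ S := by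
  obtain ⟨z, hz, rfl⟩ := Finset.mem_image.1 hC
  exact comp_subset

theorem eq_of_mem_comps {ℓ : ℝ} {S C D : Finset Λ} {x : Λ} (hC : C ∈ comps ℓ S)
    (hD : D ∈ comps ℓ S) (hx : x ∈ C) (hx' : x ∈ D) : C = D := by
  rw [← comp_eq_of_mem_comps hC hx, comp_eq_of_mem_comps hD hx']

theorem comps_pairwiseDisjoint (ℓ : ℝ) (S : Finset Λ) :
    ((comps ℓ S : Finset (Finset Λ)) : Set (Finset Λ)).PairwiseDisjoint id := by
  intro C hC D hD hne
  exact Finset.disjoint_left.2 fun x hx hx' => hne (eq_of_mem_comps hC hD hx hx')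

theorem biUnion_comps (ℓ : ℝ) (S : Finset Λ) : (comps ℓ S).biUnion id = S := by
  ext z
  simp only [Finset.mem_biUnion, id]
  exact ⟨fun ⟨C, hC, hz⟩ => subset_of_mem_comps hC hz,
    fun hz => ⟨_, comp_mem_comps hz, self_mem_comp hz⟩⟩

theorem comp_self_of_mem_comps {ℓ : ℝ} {S C : Finset Λ} {x : Λ} (hC : C ∈ comps ℓ S)
    (hx : x ∈ C) : comp ℓ C x = C := by
  have := comp_eq_of_mem_comps hC hx
  conv_lhs => rw [← this]
  rw [comp_self, this]

theorem comp_eq_of_forall {ℓ : ℝ} {B : Finset Λ} {x y : Λ} (hB : comp ℓ B x = B) (hy : y ∈ B) :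
    comp ℓ B y = B := by
  rw [comp_eq (x := x) (by rwa [hB]), hB]

theorem comps_eq_singleton {ℓ : ℝ} {B : Finset Λ} {x : Λ} (hx : x ∈ B) (hB : comp ℓ B x = B) :
    comps ℓ B = {B} := by
  ext C
  rw [Finset.mem_singleton]
  constructor
  · intro hC
    obtain ⟨z, hz⟩ := nonempty_of_mem_comps hC
    rw [← comp_eq_of_mem_comps hC hz, comp_eq_of_forall hB (subset_of_mem_comps hC hz)]
  · rintro rfl
    have := comp_mem_comps (ℓ := ℓ) hx
    rwa [hB] at this

/-- A set of diameter at most `ℓ` is connected. -/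
theorem comp_eq_self_of_diam {ℓ : ℝ} {B : Finset Λ} {x : Λ} (hx : x ∈ B)
    (h : ∀ y ∈ B, ldist x.1 y.1 ≤ ℓ) : comp ℓ B x = B :=
  Finset.Subset.antisymm comp_subset fun y hy =>
    mem_comp.2 ⟨hy, .single ⟨hx, hy, h y hy⟩⟩

/-- Distinct lattice points have distance at least 1. With `L 0 = 1/2`, the components on scale 0
are the single positions, which makes scale 0 a convenient start of inductions. -/
theorem comp_of_lt_one {ℓ : ℝ} (hℓ : ℓ < 1) {B : Finset Λ} {x : Λ} (hx : x ∈ B) :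
    comp ℓ B x = {x} := by
  refine Finset.Subset.antisymm (fun y hy => ?_) (by simpa using self_mem_comp hx)
  rw [Finset.mem_singleton]
  have h := (mem_comp.1 hy).2
  induction h with
  | refl => rfl
  | @tail b c hb hbc ih =>
    have hb' := ih (mem_comp.2 ⟨hbc.1, hb⟩)
    by_contra hne
    have : b ≠ c := fun h => hne (by rw [← h, hb'])
    exact absurd (one_le_ldist' this) (by linarith [hbc.2.2])

theorem L_succ (k : ℤ) : L (k + 1) = 2 * L k := by
  unfold L
  rw [show k + 1 - 1 = (k - 1) + 1 by ring, zpow_add₀ (by norm_num)]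
  ring

theorem L_nat_succ (n : ℕ) : L ((n : ℤ) + 1) = 2 ^ n := by
  unfold L
  rw [add_sub_cancel_right, zpow_natCast]

/-! ### One elimination step on the full index set -/

/-- The sites over the positions of `Λ`. -/
abbrev Site (Λ : Finset (Fin d → ℤ)) := Λ × Fin 2

/-- The unperturbed part of the eliminated block: block diagonal on the sites over `Q`, with blocks
given by `cl`, and the identity elsewhere. -/
def blockPart (F : Finset Λ → Matrix (Site Λ) (Site Λ) ℝ) (cl : Λ → Finset Λ) (Q : Finset Λ)
    (N : Λ → Finset Λ) (lam : ℝ) : Matrix (Site Λ) (Site Λ) ℝ := fun a b =>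
  if a.1 ∈ Q ∧ b.1 ∈ Q ∧ cl a.1 = cl b.1 then
    F (N a.1) a b - lam * (1 : Matrix (Site Λ) (Site Λ) ℝ) a b
  else (1 : Matrix (Site Λ) (Site Λ) ℝ) a b

/-- The perturbation of the eliminated block. -/
def hopPart (F : Finset Λ → Matrix (Site Λ) (Site Λ) ℝ) (cl : Λ → Finset Λ) (Q : Finset Λ)
    (N : Λ → Finset Λ) (X : Finset Λ) : Matrix (Site Λ) (Site Λ) ℝ := fun a b =>
  if (a.1 ∈ Q ∧ cl a.1 ⊆ X) ∧ (b.1 ∈ Q ∧ cl b.1 ⊆ X) then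
    if cl a.1 = cl b.1 then F X a b - F (X ∩ N a.1) a b else F X a b
  else 0

/-- The coupling to the eliminated block. -/
def legPart (F : Finset Λ → Matrix (Site Λ) (Site Λ) ℝ) (cl : Λ → Finset Λ) (Q : Finset Λ)
    (X : Finset Λ) : Matrix (Site Λ) (Site Λ) ℝ := fun a b =>
  if b.1 ∈ Q ∧ cl b.1 ⊆ X then F X a b else 0

/-- The coupling from the eliminated block. -/
def legPart' (F : Finset Λ → Matrix (Site Λ) (Site Λ) ℝ) (cl : Λ → Finset Λ) (Q : Finset Λ)
    (X : Finset Λ) : Matrix (Site Λ) (Site Λ) ℝ := fun a b =>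
  if a.1 ∈ Q ∧ cl a.1 ⊆ X then F X a b else 0

theorem sum_subtype_of_eq_zero {ι : Type*} [Fintype ι] (p : ι → Prop) [Fintype {a // p a}]
    (f : ι → ℝ) (h : ∀ a, ¬ p a → f a = 0) : ∑ a : {a // p a}, f a.1 = ∑ a, f a := by
  rw [← Finset.sum_subtype (Finset.univ.filter p) (by simp) f]
  exact Finset.sum_subset (Finset.subset_univ _) fun a _ ha => h a (by simpa using ha)

/-- The inverse over the subtype of eliminated sites is replaced by that of a matrix on all sites,
padded with the identity and with the cells not contained in `X` kept as decoupled blocks.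
Elimination steps for different regions `X` then live on one index set and can be compared by
resolvent identities. -/
theorem schur_succ (γ : ℝ) (u : Λ → ℝ) (lam : ℝ) (R : ℕ → Finset Λ) (k : ℕ) (X : Finset Λ)
    (hdet : IsUnit (blockPart (schur γ u lam R k) (cell R k) (R k \ R (k + 1))
      (fun z => nbhd (L ((k : ℤ) - 1)) (cell R k z)) lam +
      hopPart (schur γ u lam R k) (cell R k) (R k \ R (k + 1))
      (fun z => nbhd (L ((k : ℤ) - 1)) (cell R k z)) X).det) :
    schur γ u lam R (k + 1) X = schur γ u lam R k X -
      legPart (schur γ u lam R k) (cell R k) (R k \ R (k + 1)) X *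
      (blockPart (schur γ u lam R k) (cell R k) (R k \ R (k + 1))
      (fun z => nbhd (L ((k : ℤ) - 1)) (cell R k z)) lam +
      hopPart (schur γ u lam R k) (cell R k) (R k \ R (k + 1))
      (fun z => nbhd (L ((k : ℤ) - 1)) (cell R k z)) X)⁻¹ *
      legPart' (schur γ u lam R k) (cell R k) (R k \ R (k + 1)) X := by
  set F := schur γ u lam R k with hF
  set cl := cell R k with hcl
  set Q := R k \ R (k + 1) with hQ
  set N : Λ → Finset Λ := fun z => nbhd (L ((k : ℤ) - 1)) (cl z) with hN
  set A := blockPart F cl Q N lam + hopPart F cl Q N X with hA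
  rw [schur]
  simp only
  rw [← hF, ← hQ]
  set p : Site Λ → Prop := fun a => a.1 ∈ Q ∧ cl a.1 ⊆ X with hp
  set D : Matrix (Site Λ) (Site Λ) ℝ := fun a b =>
    if cl a.1 = cl b.1 then F (N a.1) a b + (F X a b - F (X ∩ N a.1) a b) else F X a b with hD
  change F X - (F X).submatrix id (Subtype.val : {a // p a} → Site Λ) *
    (D.submatrix (Subtype.val : {a // p a} → Site Λ)
      (Subtype.val : {a // p a} → Site Λ) - lam • 1)⁻¹ *
    (F X).submatrix (Subtype.val : {a // p a} → Site Λ) id = _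
  have hAp : ∀ a b : {a // p a},
      (D.submatrix (Subtype.val : {a // p a} → Site Λ)
      (Subtype.val : {a // p a} → Site Λ) - lam • 1) a b = A a b := by
    rintro ⟨a, ha⟩ ⟨b, hb⟩
    have hone : (1 : Matrix {a // p a} {a // p a} ℝ) ⟨a, ha⟩ ⟨b, hb⟩ =
        (1 : Matrix (Site Λ) (Site Λ) ℝ) a b := by
      simp [Matrix.one_apply]
    have ha' : a.1 ∈ Q ∧ cl a.1 ⊆ X := ha
    have hb' : b.1 ∈ Q ∧ cl b.1 ⊆ X := hb
    change D a b - lam * (1 : Matrix {a // p a} {a // p a} ℝ) ⟨a, ha⟩ ⟨b, hb⟩ =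
      blockPart F cl Q N lam a b + hopPart F cl Q N X a b
    rw [hone]
    simp only [blockPart, hopPart, hD]
    rw [if_pos (⟨ha', hb'⟩ : (a.1 ∈ Q ∧ cl a.1 ⊆ X) ∧ (b.1 ∈ Q ∧ cl b.1 ⊆ X))]
    by_cases h : cl a.1 = cl b.1
    · rw [if_pos h, if_pos ⟨ha'.1, hb'.1, h⟩, if_pos h]; ring
    · rw [if_neg h, if_neg (fun h' => h h'.2.2), if_neg h]
      have : a ≠ b := fun h' => h (by rw [h'])
      rw [Matrix.one_apply_ne this]; ring
  -- The rows of `A` over `p` vanish off `p`; therefore the inverse of the restriction to `p` is the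
  -- restriction of the inverse.
  have hA0 : ∀ a c : Site Λ, p a → ¬ p c → A a c = 0 := by
    intro a c ha hc
    have hac : a ≠ c := fun h => hc (h ▸ ha)
    have h1 : ¬ (a.1 ∈ Q ∧ c.1 ∈ Q ∧ cl a.1 = cl c.1) := fun h => hc ⟨h.2.1, h.2.2 ▸ ha.2⟩
    have h2 : ¬ ((a.1 ∈ Q ∧ cl a.1 ⊆ X) ∧ (c.1 ∈ Q ∧ cl c.1 ⊆ X)) := fun h => hc h.2
    simp only [hA, Matrix.add_apply, blockPart, hopPart]
    rw [if_neg h1, if_neg h2, Matrix.one_apply_ne hac, add_zero]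
  have hinv : (D.submatrix (Subtype.val : {a // p a} → Site Λ)
      (Subtype.val : {a // p a} → Site Λ) - lam • 1)⁻¹ =
      A⁻¹.submatrix (Subtype.val : {a // p a} → Site Λ) (Subtype.val : {a // p a} → Site Λ) := by
    refine Matrix.inv_eq_right_inv ?_
    ext a b
    rw [Matrix.mul_apply]
    simp only [hAp, Matrix.submatrix_apply]
    rw [sum_subtype_of_eq_zero p (fun c => A a c * A⁻¹ c b)
      (fun c hc => by rw [hA0 a.1 c a.2 hc, zero_mul]), ← Matrix.mul_apply,
      Matrix.mul_nonsing_inv _ hdet]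
    simp [Matrix.one_apply, Subtype.ext_iff]
  rw [hinv]
  congr 1
  ext a b
  simp only [Matrix.mul_apply, Matrix.submatrix_apply, id]
  rw [← sum_subtype_of_eq_zero p (fun c => (∑ e, legPart F cl Q X a e * A⁻¹ e c) *
    legPart' F cl Q X c b) (fun c hc => by
      simp only [legPart']; rw [if_neg hc, mul_zero])]
  refine Finset.sum_congr rfl fun c _ => ?_
  rw [← sum_subtype_of_eq_zero p (fun e => legPart F cl Q X a e * A⁻¹ e c) (fun e he => by
      simp only [legPart]; rw [if_neg he, zero_mul])]
  have hc : c.1.1 ∈ Q ∧ cl c.1.1 ⊆ X := c.2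
  simp only [legPart']
  rw [if_pos hc]
  congr 1
  refine Finset.sum_congr rfl fun e _ => ?_
  have he : e.1.1 ∈ Q ∧ cl e.1.1 ⊆ X := e.2
  simp only [legPart]
  rw [if_pos he]

theorem h_symm (v : ℝ) (i j : Fin 2) : h v i j = h v j i := by
  fin_cases i <;> fin_cases j <;> simp [h]

theorem H_symm (γ : ℝ) (u : Λ → ℝ) (a b : Site Λ) : H γ u a b = H γ u b a := by
  unfold H
  congr 1
  · by_cases h : a.1 = b.1
    · rw [if_pos h, if_pos h.symm, h, h_symm]
    · rw [if_neg h, if_neg (Ne.symm h)]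
  · simp only [ldist_comm a.1.1, eq_comm (a := a.2)]

theorem transpose_schurComplement {ι κ : Type*} [Fintype ι] [Fintype κ] [DecidableEq κ]
    {F D : Matrix ι ι ℝ} (hF : F.transpose = F) (hD : D.transpose = D) (v : κ → ι) (c : ℝ) :
    (F - F.submatrix id v * (D.submatrix v v - c • (1 : Matrix κ κ ℝ))⁻¹ *
      F.submatrix v id).transpose =
    F - F.submatrix id v * (D.submatrix v v - c • (1 : Matrix κ κ ℝ))⁻¹ * F.submatrix v id := by
  rw [Matrix.transpose_sub, hF, Matrix.transpose_mul, Matrix.transpose_mul,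
    Matrix.transpose_nonsing_inv, ← Matrix.mul_assoc, Matrix.transpose_submatrix,
    Matrix.transpose_submatrix, hF, Matrix.transpose_sub, Matrix.transpose_smul,
    Matrix.transpose_one, Matrix.transpose_submatrix, hD]

theorem schur_symm (γ : ℝ) (u : Λ → ℝ) (lam : ℝ) (R : ℕ → Finset Λ) (k : ℕ) (X : Finset Λ) :
    (schur γ u lam R k X).transpose = schur γ u lam R k X := by
  induction k generalizing X with
  | zero =>
    ext a b
    change (if b.1 ∈ X ∧ a.1 ∈ X then H γ u b a else 0) =
      if a.1 ∈ X ∧ b.1 ∈ X then H γ u a b else 0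
    rw [H_symm]
    simp only [and_comm]
  | succ k ih =>
    have ih' : ∀ X a b, schur γ u lam R k X a b = schur γ u lam R k X b a := fun X a b => by
      conv_lhs => rw [← ih X]
      rfl
    rw [schur]
    set p : Site Λ → Prop := fun a => a.1 ∈ R k \ R (k + 1) ∧ cell R k a.1 ⊆ X
    set D : Matrix (Site Λ) (Site Λ) ℝ := fun a b =>
      if cell R k a.1 = cell R k b.1 then
        schur γ u lam R k (nbhd (L ((k : ℤ) - 1)) (cell R k a.1)) a b + (schur γ u lam R k X a b -
          schur γ u lam R k (X ∩ nbhd (L ((k : ℤ) - 1)) (cell R k a.1)) a b)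
      else schur γ u lam R k X a b with hD
    have hDt : D.transpose = D := by
      ext a b
      change D b a = D a b
      simp only [hD]
      by_cases hc : cell R k a.1 = cell R k b.1
      · rw [if_pos hc, if_pos hc.symm, hc, ih' _ a b, ih' _ a b, ih' _ a b]
      · rw [if_neg hc, if_neg (Ne.symm hc), ih']
    exact transpose_schurComplement (ih X) hDt _ _

theorem schur_symm_apply (γ : ℝ) (u : Λ → ℝ) (lam : ℝ) (R : ℕ → Finset Λ) (k : ℕ) (X : Finset Λ)
    (a b : Site Λ) : schur γ u lam R k X a b = schur γ u lam R k X b a := by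
  conv_lhs => rw [← schur_symm]
  rfl

/-! ### Weighted inverses and chains of matrices -/

section Chains

variable {ι : Type*} [Fintype ι]

theorem rowSum_mul_le (A B : Matrix ι ι ℝ) (s : Finset ι) (a : ι) {α β : ℝ} (hβ : 0 ≤ β)
    (hA : ∑ c, |A a c| ≤ α) (hB : ∀ c, A a c ≠ 0 → ∑ b ∈ s, |B c b| ≤ β) :
    ∑ b ∈ s, |(A * B) a b| ≤ α * β := by
  calc ∑ b ∈ s, |(A * B) a b| ≤ ∑ b ∈ s, ∑ c, |A a c| * |B c b| := by
        refine Finset.sum_le_sum fun b _ => ?_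
        rw [Matrix.mul_apply]
        refine (Finset.abs_sum_le_sum_abs _ _).trans (Finset.sum_le_sum fun c _ => ?_)
        rw [abs_mul]
    _ = ∑ c, |A a c| * ∑ b ∈ s, |B c b| := by
        rw [Finset.sum_comm]
        exact Finset.sum_congr rfl fun c _ => (Finset.mul_sum _ _ _).symm
    _ ≤ ∑ c, |A a c| * β := by
        refine Finset.sum_le_sum fun c _ => ?_
        by_cases hc : A a c = 0
        · simp [hc]
        · exact mul_le_mul_of_nonneg_left (hB c hc) (abs_nonneg _)
    _ ≤ α * β := by
        rw [← Finset.sum_mul]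
        exact mul_le_mul_of_nonneg_right hA hβ

/-- Entries of the inverse of a small perturbation of `W` decay with respect to `m`. -/
theorem weighted_inverse [DecidableEq ι] {W U V : Matrix ι ι ℝ} (hWU : W * U = 1)
    {m : ι → ι → ℝ} (hm0 : ∀ a b, 0 ≤ m a b) (tri : ∀ a b c, m a c ≤ m a b + m b c)
    (hU : ∀ a b, U a b ≠ 0 → m a b = 0) {S : ℝ} (hS : ∀ a, ∑ b, |U a b| ≤ S)
    (hV : ∀ a, ∑ b, |U a b| * ∑ c, |V b c| * Real.exp (m b c) ≤ 1 / 2) :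
    IsUnit (W + V).det ∧ ∀ a, ∑ b, |(W + V)⁻¹ a b| * Real.exp (m a b) ≤ 2 * S := by
  have hUW : U * W = 1 := mul_eq_one_comm.1 hWU
  have key : ∀ a, ∑ c, |(U * V) a c| * Real.exp (m a c) ≤ 1 / 2 := by
    intro a
    refine le_trans ?_ (hV a)
    calc ∑ c, |(U * V) a c| * Real.exp (m a c)
        ≤ ∑ c, ∑ b, |U a b| * (|V b c| * Real.exp (m b c)) := by
          refine Finset.sum_le_sum fun c _ => ?_
          rw [Matrix.mul_apply]
          refine (mul_le_mul_of_nonneg_right (Finset.abs_sum_le_sum_abs _ _)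
            (Real.exp_pos _).le).trans ?_
          rw [Finset.sum_mul]
          refine Finset.sum_le_sum fun b _ => ?_
          rw [abs_mul, mul_assoc]
          by_cases hb : U a b = 0
          · simp [hb]
          · have := tri a b c
            rw [hU a b hb, zero_add] at this
            gcongr
      _ = _ := by
          rw [Finset.sum_comm]
          exact Finset.sum_congr rfl fun b _ => (Finset.mul_sum _ _ _).symm
  have key' : ∀ a, ∑ c, |(U * V) a c| ≤ 1 / 2 := fun a =>
    (Finset.sum_le_sum fun c _ => le_mul_of_one_le_right (abs_nonneg _)
      (Real.one_le_exp (hm0 a c))).trans (key a)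
  -- The row sums of `U * V` are at most 1/2, so `1 + U * V` is strictly diagonally dominant.
  have hdet1 : (1 + U * V).det ≠ 0 := by
    refine det_ne_zero_of_sum_row_lt_diag fun a => ?_
    have h1 := key' a
    rw [← Finset.add_sum_erase _ _ (Finset.mem_univ a)] at h1
    have h2 : ∑ j ∈ Finset.univ.erase a, ‖(1 + U * V) a j‖ =
        ∑ j ∈ Finset.univ.erase a, |(U * V) a j| := by
      refine Finset.sum_congr rfl fun j hj => ?_
      rw [Matrix.add_apply, Matrix.one_apply_ne (Finset.ne_of_mem_erase hj).symm, zero_add,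
        Real.norm_eq_abs]
    rw [h2, Matrix.add_apply, Matrix.one_apply_eq, Real.norm_eq_abs]
    have h3 : 1 - |(U * V) a a| ≤ |1 + (U * V) a a| := by
      have := abs_sub_abs_le_abs_sub (1 : ℝ) (-(U * V) a a)
      rwa [abs_one, abs_neg, sub_neg_eq_add] at this
    linarith
  have hfac : W + V = W * (1 + U * V) := by
    rw [Matrix.mul_add, Matrix.mul_one, ← Matrix.mul_assoc, hWU, Matrix.one_mul]
  have hdet : IsUnit (W + V).det := by
    rw [hfac, Matrix.det_mul]
    refine IsUnit.mul ?_ (isUnit_iff_ne_zero.2 hdet1)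
    have := congrArg Matrix.det hWU
    rw [Matrix.det_mul, Matrix.det_one] at this
    exact IsUnit.of_mul_eq_one _ this
  refine ⟨hdet, ?_⟩
  set G := (W + V)⁻¹ with hG
  have hGeq : G = U - U * V * G := by
    have h1 : (W + V) * G = 1 := Matrix.mul_nonsing_inv _ hdet
    have h2 : U * ((W + V) * G) = U := by rw [h1, Matrix.mul_one]
    rw [Matrix.add_mul, Matrix.mul_add, ← Matrix.mul_assoc, hUW, Matrix.one_mul,
      ← Matrix.mul_assoc] at h2
    exact eq_sub_of_add_eq h2
  intro a
  -- For the largest weighted row sum `K`, the identity `G = U - U * V * G` yields `K ≤ S + K / 2`;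
  -- no Neumann series is needed. The unperturbed inverse carries weight one on its support.
  obtain ⟨a0, -, ha0⟩ := Finset.exists_max_image Finset.univ
    (fun a => ∑ b, |G a b| * Real.exp (m a b)) ⟨a, Finset.mem_univ a⟩
  refine (ha0 a (Finset.mem_univ a)).trans ?_
  set K := ∑ b, |G a0 b| * Real.exp (m a0 b) with hK
  have hK0 : 0 ≤ K := Finset.sum_nonneg fun b _ => mul_nonneg (abs_nonneg _) (Real.exp_pos _).le
  have hKle : K ≤ S + 1 / 2 * K := by
    calc K ≤ ∑ b, (|U a0 b| + ∑ c, |(U * V) a0 c| * Real.exp (m a0 c) *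
          (|G c b| * Real.exp (m c b))) := by
          refine Finset.sum_le_sum fun b _ => ?_
          have e : G a0 b = U a0 b - ∑ c, (U * V) a0 c * G c b := by
            conv_lhs => rw [hGeq]
            rw [Matrix.sub_apply, Matrix.mul_apply]
          rw [e]
          have h1 : |U a0 b - ∑ c, (U * V) a0 c * G c b| ≤
              |U a0 b| + ∑ c, |(U * V) a0 c| * |G c b| := by
            refine (abs_sub _ _).trans (add_le_add le_rfl ?_)
            refine (Finset.abs_sum_le_sum_abs _ _).trans (Finset.sum_le_sum fun c _ => ?_)
            rw [abs_mul]
          refine (mul_le_mul_of_nonneg_right h1 (Real.exp_pos _).le).trans ?_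
          rw [add_mul, Finset.sum_mul]
          refine add_le_add ?_ (Finset.sum_le_sum fun c _ => ?_)
          · by_cases hb : U a0 b = 0
            · simp [hb]
            · rw [hU a0 b hb, Real.exp_zero, mul_one]
          · have h2 : Real.exp (m a0 b) ≤ Real.exp (m a0 c) * Real.exp (m c b) := by
              rw [← Real.exp_add]
              exact Real.exp_le_exp.2 (tri a0 c b)
            calc |(U * V) a0 c| * |G c b| * Real.exp (m a0 b)
                ≤ |(U * V) a0 c| * |G c b| * (Real.exp (m a0 c) * Real.exp (m c b)) := by gcongr
              _ = _ := by ring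
      _ = ∑ b, |U a0 b| + ∑ c, |(U * V) a0 c| * Real.exp (m a0 c) *
          ∑ b, |G c b| * Real.exp (m c b) := by
          rw [Finset.sum_add_distrib, Finset.sum_comm]
          congr 1
          exact Finset.sum_congr rfl fun c _ => (Finset.mul_sum _ _ _).symm
      _ ≤ S + ∑ c, |(U * V) a0 c| * Real.exp (m a0 c) * K := by
          refine add_le_add (hS a0) (Finset.sum_le_sum fun c _ => ?_)
          exact mul_le_mul_of_nonneg_left (ha0 c (Finset.mem_univ c))
            (mul_nonneg (abs_nonneg _) (Real.exp_pos _).le)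
      _ ≤ _ := by
          rw [← Finset.sum_mul]
          exact add_le_add le_rfl (mul_le_mul_of_nonneg_right (key a0) hK0)
  linarith

/-- The entries of `D` are allowed to grow with the weight `w`, as the weighted sum over the other
two factors absorbs this growth. -/
theorem abs_mul_three_le (D G Q : Matrix ι ι ℝ) (a b : ι) {w : ι → ι → ℝ} {A c : ℝ}
    (hc : 0 ≤ c)
    (hA : ∑ p, ∑ q, |G p q| * |Q q b| * Real.exp (w p q) ≤ A)
    (hD : ∀ p q, Q q b ≠ 0 → |D a p| ≤ c * Real.exp (w p q)) :
    |(D * G * Q) a b| ≤ c * A := by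
  calc |(D * G * Q) a b| ≤ ∑ p, ∑ q, |D a p| * |G p q| * |Q q b| := by
        rw [Matrix.mul_assoc, Matrix.mul_apply]
        refine (Finset.abs_sum_le_sum_abs _ _).trans (Finset.sum_le_sum fun p _ => ?_)
        rw [Matrix.mul_apply, Finset.mul_sum]
        refine (Finset.abs_sum_le_sum_abs _ _).trans (Finset.sum_le_sum fun q _ => ?_)
        rw [abs_mul, abs_mul, mul_assoc]
    _ ≤ ∑ p, ∑ q, c * (|G p q| * |Q q b| * Real.exp (w p q)) := by
        refine Finset.sum_le_sum fun p _ => Finset.sum_le_sum fun q _ => ?_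
        by_cases hq : Q q b = 0
        · simp [hq]
        · calc |D a p| * |G p q| * |Q q b| = |D a p| * (|G p q| * |Q q b|) := by ring
            _ ≤ c * Real.exp (w p q) * (|G p q| * |Q q b|) :=
              mul_le_mul_of_nonneg_right (hD p q hq) (by positivity)
            _ = _ := by ring
    _ ≤ c * A := by
        simp only [← Finset.mul_sum]
        exact mul_le_mul_of_nonneg_left hA hc

/-- Meant for `G - G'` written as `G * D * G'` by the resolvent identity, with a leg at either end:
the weighted sums at the two ends absorb the growth of the middle factor. -/
theorem abs_mul_five_le (P G D G' Q : Matrix ι ι ℝ) (a b : ι) {w w' : ι → ι → ℝ} {A A' c : ℝ}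
    (hc : 0 ≤ c) (hA0 : 0 ≤ A)
    (hA : ∑ p, ∑ q, |P a p| * |G p q| * Real.exp (w p q) ≤ A)
    (hA' : ∑ p, ∑ q, |G' p q| * |Q q b| * Real.exp (w' p q) ≤ A')
    (hD : ∀ p q p' q', P a p ≠ 0 → Q q' b ≠ 0 →
      |D q p'| ≤ c * (Real.exp (w p q) * Real.exp (w' p' q'))) :
    |(P * G * D * G' * Q) a b| ≤ c * (A * A') := by
  have h1 : ∀ p' q', Q q' b ≠ 0 → |(P * G * D) a p'| ≤ c * A * Real.exp (w' p' q') := by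
    intro p' q' hq'
    calc |(P * G * D) a p'| ≤ ∑ p, ∑ q, |P a p| * |G p q| * |D q p'| := by
          rw [Matrix.mul_assoc, Matrix.mul_apply]
          refine (Finset.abs_sum_le_sum_abs _ _).trans (Finset.sum_le_sum fun p _ => ?_)
          rw [Matrix.mul_apply, Finset.mul_sum]
          refine (Finset.abs_sum_le_sum_abs _ _).trans (Finset.sum_le_sum fun q _ => ?_)
          rw [abs_mul, abs_mul, mul_assoc]
      _ ≤ ∑ p, ∑ q, c * Real.exp (w' p' q') * (|P a p| * |G p q| * Real.exp (w p q)) := by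
          refine Finset.sum_le_sum fun p _ => Finset.sum_le_sum fun q _ => ?_
          by_cases hp : P a p = 0
          · simp [hp]
          · calc |P a p| * |G p q| * |D q p'|
                ≤ |P a p| * |G p q| * (c * (Real.exp (w p q) * Real.exp (w' p' q'))) :=
                mul_le_mul_of_nonneg_left (hD p q p' q' hp hq') (by positivity)
              _ = _ := by ring
      _ ≤ _ := by
          simp only [← Finset.mul_sum]
          calc _ ≤ c * Real.exp (w' p' q') * A :=
                mul_le_mul_of_nonneg_left hA (mul_nonneg hc (Real.exp_pos _).le)
            _ = _ := by ring
  have := abs_mul_three_le (P * G * D) G' Q a b (mul_nonneg hc hA0) hA' h1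
  calc _ ≤ _ := this
    _ = _ := by ring

end Chains

/-! ### Decay of kernels under elimination -/

/-- The geometry of one elimination step: the set `Q` is split into cells `cl z` of diameter at most
`D`, at mutual distance at least `s`, and `m` is a pseudometric that contracts the cells. -/
structure CellGeometry (cl : Λ → Finset Λ) (Q P : Finset Λ) (m : Λ → Λ → ℝ) (D s n : ℝ) :
    Prop where
  mem : ∀ z ∈ Q, z ∈ cl z
  sub : ∀ z ∈ Q, cl z ⊆ Q
  eq : ∀ z ∈ Q, ∀ w ∈ cl z, cl w = cl z
  card : ∀ z ∈ Q, ((cl z).card : ℝ) ≤ n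
  sepQ : ∀ z ∈ Q, ∀ w ∈ Q, cl z ≠ cl w → s ≤ ldist z.1 w.1
  sepP : ∀ z ∈ P, ∀ w ∈ Q, s ≤ ldist z.1 w.1
  s_pos : 0 < s
  D_nonneg : 0 ≤ D
  m_nonneg : ∀ z w, 0 ≤ m z w
  m_tri : ∀ x y z, m x z ≤ m x y + m y z
  m_zero : ∀ z ∈ Q, ∀ w ∈ cl z, m z w = 0
  m_self : ∀ z, m z z = 0
  m_comm : ∀ z w, m z w = m w z
  m_le : ∀ z w, m z w ≤ ldist z.1 w.1 + D
  le_m : ∀ z w, ldist z.1 w.1 ≤ m z w + D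

/-- Decay of the entries of a family of kernels, and of their dependence on the region. -/
structure KernelDecay (F : Finset Λ → Matrix (Site Λ) (Site Λ) ℝ) (S : Finset Λ)
    (σ s β : ℝ) : Prop where
  symm : ∀ X a b, F X a b = F X b a
  far : ∀ X a b, a.1 ∈ S → b.1 ∈ S → s ≤ ldist a.1.1 b.1.1 →
    |F X a b| ≤ Real.exp (-(σ * ldist a.1.1 b.1.1 + β))
  loc : ∀ X Y, Y ⊆ X → ∀ a b, a.1 ∈ S → b.1 ∈ S → a.1 ∈ Y → b.1 ∈ Y → ∀ r,
    (∀ z ∈ X, z ∉ Y → r ≤ ldist a.1.1 z.1 + ldist z.1 b.1.1) →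
    |F X a b - F Y a b| ≤ Real.exp (-(σ * r))

theorem card_site_fiber (S : Finset Λ) :
    ((Finset.univ.filter fun a : Site Λ => a.1 ∈ S).card : ℝ) = 2 * S.card := by
  have : (Finset.univ.filter fun a : Site Λ => a.1 ∈ S) = S ×ˢ (Finset.univ : Finset (Fin 2)) := by
    ext a; simp
  rw [this, Finset.card_product]
  simp [mul_comm]

/-- The weighted sum of the couplings to the eliminated block. -/
def legBound (σ τ h s β Z : ℝ) : ℝ := Z * Real.exp (-((σ - τ - h) * s + β))

/-- The data of one elimination step. -/
structure StepSetup (F : Finset Λ → Matrix (Site Λ) (Site Λ) ℝ) (cl : Λ → Finset Λ)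
    (Q P : Finset Λ) (N : Λ → Finset Λ) (lam : ℝ) (U : Matrix (Site Λ) (Site Λ) ℝ)
    (m : Λ → Λ → ℝ) (σ τ h s β D n r S Z : ℝ) : Prop where
  geo : CellGeometry cl Q P m D s n
  ker : KernelDecay F (Q ∪ P) σ s β
  N_sup : ∀ z ∈ Q, cl z ⊆ N z
  N_far : ∀ z ∈ Q, ∀ w ∈ cl z, ∀ y, y ∉ N z → r ≤ ldist w.1 y.1
  N_eq : ∀ z ∈ Q, ∀ w ∈ cl z, N w = N z
  inv : blockPart F cl Q N lam * U = 1
  U_supp : ∀ a b, U a b ≠ 0 → a = b ∨ (a.1 ∈ Q ∧ b.1 ∈ cl a.1)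
  U_sum : ∀ a, ∑ b, |U a b| ≤ S
  Z_sum : ∀ a : Site Λ, ∑ b : Site Λ, Real.exp (-(h * ldist a.1.1 b.1.1)) ≤ Z
  one_le_Z : 1 ≤ Z
  S_nonneg : 0 ≤ S
  n_nonneg : 0 ≤ n
  τ_nonneg : 0 ≤ τ
  h_nonneg : 0 ≤ h
  rate : τ + h ≤ σ
  small : S * (2 * n * Real.exp (-(σ * (2 * r))) + legBound σ τ h s β Z * Real.exp (τ * D)) ≤ 1 / 2

namespace StepSetup

variable {F : Finset Λ → Matrix (Site Λ) (Site Λ) ℝ} {cl : Λ → Finset Λ}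
    {Q P : Finset Λ} {N : Λ → Finset Λ} {lam : ℝ} {U : Matrix (Site Λ) (Site Λ) ℝ}
    {m : Λ → Λ → ℝ} {σ τ h s β D n r S Z : ℝ}

theorem legBound_nonneg (st : StepSetup F cl Q P N lam U m σ τ h s β D n r S Z) :
    0 ≤ legBound σ τ h s β Z :=
  mul_nonneg (zero_le_one.trans st.one_le_Z) (Real.exp_pos _).le

/-- The rate σ is split: τ is kept as decay, h serves to sum over the lattice, and the rest,
evaluated at the minimal distance `s`, is the small factor. -/
theorem exp_far_le (st : StepSetup F cl Q P N lam U m σ τ h s β D n r S Z) {ℓ : ℝ} (hℓ : s ≤ ℓ) :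
    Real.exp (-(σ * ℓ + β)) * Real.exp (τ * ℓ) ≤
      Real.exp (-((σ - τ - h) * s + β)) * Real.exp (-(h * ℓ)) := by
  rw [← Real.exp_add, ← Real.exp_add]
  refine Real.exp_le_exp.2 ?_
  nlinarith [mul_le_mul_of_nonneg_left hℓ (sub_nonneg.2 st.rate)]

theorem far_sum (st : StepSetup F cl Q P N lam U m σ τ h s β D n r S Z)
    (a : Site Λ) (K : Site Λ → ℝ)
    (hK : ∀ b, K b ≠ 0 → s ≤ ldist a.1.1 b.1.1 ∧
      |K b| ≤ Real.exp (-(σ * ldist a.1.1 b.1.1 + β))) :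
    ∑ b, |K b| * Real.exp (τ * ldist a.1.1 b.1.1) ≤ legBound σ τ h s β Z := by
  calc ∑ b, |K b| * Real.exp (τ * ldist a.1.1 b.1.1)
      ≤ ∑ b : Site Λ, Real.exp (-((σ - τ - h) * s + β)) * Real.exp (-(h * ldist a.1.1 b.1.1)) := by
        refine Finset.sum_le_sum fun b _ => ?_
        by_cases hb : K b = 0
        · rw [hb, abs_zero, zero_mul]; positivity
        · obtain ⟨h1, h2⟩ := hK b hb
          exact (mul_le_mul_of_nonneg_right h2 (Real.exp_pos _).le).trans (st.exp_far_le h1)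
    _ ≤ _ := by
        rw [← Finset.mul_sum, legBound, mul_comm Z]
        exact mul_le_mul_of_nonneg_left (st.Z_sum a) (Real.exp_pos _).le

/-- Within a cell the perturbation consists of the multigraphs that leave the neighbourhood `N`;
they go at least `r` away and back, whence the rate times `2 * r`. Between different cells the
distance is at least `s` and the far decay applies; `exp (τ * D)` is the price of measuring with `m`
instead of the lattice distance. -/
theorem hop_sum (st : StepSetup F cl Q P N lam U m σ τ h s β D n r S Z) (X : Finset Λ)
    (a : Site Λ) :
    ∑ c, |hopPart F cl Q N X a c| * Real.exp (τ * m a.1 c.1) ≤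
      2 * n * Real.exp (-(σ * (2 * r))) + legBound σ τ h s β Z * Real.exp (τ * D) := by
  have hn : 0 ≤ legBound σ τ h s β Z * Real.exp (τ * D) :=
    mul_nonneg st.legBound_nonneg (Real.exp_pos _).le
  by_cases ha : a.1 ∈ Q ∧ cl a.1 ⊆ X
  swap
  · have : ∀ c, hopPart F cl Q N X a c = 0 := fun c => if_neg fun h => ha h.1
    simp only [this, abs_zero, zero_mul, Finset.sum_const_zero]
    have := st.n_nonneg
    positivity
  rw [← Finset.sum_filter_add_sum_filter_not Finset.univ (fun c : Site Λ => c.1 ∈ cl a.1)]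
  refine add_le_add ?_ ?_
  · calc _ ≤ ∑ c : Site Λ with c.1 ∈ cl a.1, Real.exp (-(σ * (2 * r))) := by
          refine Finset.sum_le_sum fun c hc => ?_
          rw [Finset.mem_filter] at hc
          rw [st.geo.m_zero _ ha.1 _ hc.2, mul_zero, Real.exp_zero, mul_one]
          have hcc := st.geo.eq _ ha.1 _ hc.2
          have hcQ := st.geo.sub _ ha.1 hc.2
          simp only [hopPart]
          rw [if_pos ⟨ha, hcQ, hcc ▸ ha.2⟩, if_pos hcc.symm]
          refine st.ker.loc X _ Finset.inter_subset_left a c (Finset.mem_union_left _ ha.1)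
            (Finset.mem_union_left _ hcQ)
            (Finset.mem_inter.2 ⟨ha.2 (st.geo.mem _ ha.1), st.N_sup _ ha.1 (st.geo.mem _ ha.1)⟩)
            (Finset.mem_inter.2 ⟨ha.2 hc.2, st.N_sup _ ha.1 hc.2⟩) _ fun z hz hz' => ?_
          have hzN : z ∉ N a.1 := fun h => hz' (Finset.mem_inter.2 ⟨hz, h⟩)
          have h1 := st.N_far _ ha.1 _ (st.geo.mem _ ha.1) z hzN
          have h2 := st.N_far _ ha.1 _ hc.2 z hzN
          rw [ldist_comm] at h2
          linarith
      _ ≤ 2 * n * Real.exp (-(σ * (2 * r))) := by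
          rw [Finset.sum_const, nsmul_eq_mul, card_site_fiber]
          have := st.geo.card _ ha.1
          gcongr
  · calc _ ≤ ∑ c : Site Λ with ¬ c.1 ∈ cl a.1, |hopPart F cl Q N X a c| *
            Real.exp (τ * ldist a.1.1 c.1.1) * Real.exp (τ * D) := by
          refine Finset.sum_le_sum fun c _ => ?_
          rw [mul_assoc, ← Real.exp_add, ← mul_add]
          have := st.geo.m_le a.1 c.1
          have := st.τ_nonneg
          gcongr
      _ ≤ _ := by
          rw [← Finset.sum_mul, Finset.sum_filter]
          refine mul_le_mul_of_nonneg_right ?_ (Real.exp_pos _).le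
          have := st.far_sum a (fun c => if ¬ c.1 ∈ cl a.1 then hopPart F cl Q N X a c else 0) ?_
          · refine le_trans (le_of_eq (Finset.sum_congr rfl fun c _ => ?_)) this
            split_ifs <;> simp
          · intro c hc
            have hc1 : c.1 ∉ cl a.1 := fun h => hc (if_neg (not_not.2 h))
            simp only [if_pos hc1] at hc ⊢
            have hc2 : c.1 ∈ Q ∧ cl c.1 ⊆ X := by
              by_contra h
              exact hc (if_neg fun h' => h h'.2)
            have hne : cl a.1 ≠ cl c.1 := fun h => hc1 (h ▸ st.geo.mem _ hc2.1)
            have hs := st.geo.sepQ _ ha.1 _ hc2.1 hne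
            refine ⟨hs, ?_⟩
            simp only [hopPart]
            rw [if_pos ⟨ha, hc2⟩, if_neg hne]
            exact st.ker.far X a c (Finset.mem_union_left _ ha.1) (Finset.mem_union_left _ hc2.1) hs

/-- The weight `τ * m` vanishes inside the cells, which is where the unperturbed inverse lives.
Large inverses of cells therefore cost only `S` and no decay, and `weighted_inverse` applies. -/
theorem inverse (st : StepSetup F cl Q P N lam U m σ τ h s β D n r S Z) (X : Finset Λ) :
    IsUnit (blockPart F cl Q N lam + hopPart F cl Q N X).det ∧
    ∀ a, ∑ b, |(blockPart F cl Q N lam + hopPart F cl Q N X)⁻¹ a b| *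
      Real.exp (τ * m a.1 b.1) ≤ 2 * S := by
  refine weighted_inverse (U := U) st.inv (m := fun a b => τ * m a.1 b.1)
    (fun a b => mul_nonneg st.τ_nonneg (st.geo.m_nonneg _ _)) (fun a b c => ?_) ?_ st.U_sum ?_
  · rw [← mul_add]
    exact mul_le_mul_of_nonneg_left (st.geo.m_tri _ _ _) st.τ_nonneg
  · intro a b hab
    rcases st.U_supp a b hab with rfl | ⟨h1, h2⟩
    · simp [st.geo.m_self]
    · simp [st.geo.m_zero _ h1 _ h2]
  · intro a
    have hp : 0 ≤ 2 * n * Real.exp (-(σ * (2 * r))) + legBound σ τ h s β Z * Real.exp (τ * D) :=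
      (Finset.sum_nonneg fun _ _ => by positivity).trans (st.hop_sum X a)
    calc _ ≤ ∑ b, |U a b| * (2 * n * Real.exp (-(σ * (2 * r))) +
          legBound σ τ h s β Z * Real.exp (τ * D)) :=
          Finset.sum_le_sum fun b _ => mul_le_mul_of_nonneg_left (st.hop_sum X b) (abs_nonneg _)
      _ ≤ _ := by
          rw [← Finset.sum_mul]
          exact (mul_le_mul_of_nonneg_right (st.U_sum a) hp).trans st.small

/-- The inverse of the eliminated block. -/
abbrev green (F : Finset Λ → Matrix (Site Λ) (Site Λ) ℝ) (cl : Λ → Finset Λ) (Q : Finset Λ)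
    (N : Λ → Finset Λ) (lam : ℝ) (X : Finset Λ) : Matrix (Site Λ) (Site Λ) ℝ :=
  (blockPart F cl Q N lam + hopPart F cl Q N X)⁻¹

theorem green_symm (st : StepSetup F cl Q P N lam U m σ τ h s β D n r S Z) (X : Finset Λ)
    (a b : Site Λ) : green F cl Q N lam X a b = green F cl Q N lam X b a := by
  have : (blockPart F cl Q N lam + hopPart F cl Q N X).transpose =
      blockPart F cl Q N lam + hopPart F cl Q N X := by
    have hone : ∀ a b : Site Λ, (1 : Matrix (Site Λ) (Site Λ) ℝ) a b =
        (1 : Matrix (Site Λ) (Site Λ) ℝ) b a := fun a b => by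
      simp [Matrix.one_apply, eq_comm]
    ext a b
    simp only [Matrix.transpose_apply, Matrix.add_apply]
    have e : ∀ a b : Site Λ, (a.1 ∈ Q ∧ b.1 ∈ Q ∧ cl a.1 = cl b.1) → N a.1 = N b.1 :=
      fun a b h => st.N_eq _ h.2.1 _ (h.2.2 ▸ st.geo.mem _ h.1)
    have e1 : ∀ a b : Site Λ, (a.1 ∈ Q ∧ b.1 ∈ Q ∧ cl a.1 = cl b.1) ↔
        (b.1 ∈ Q ∧ a.1 ∈ Q ∧ cl b.1 = cl a.1) := fun a b => by tauto
    congr 1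
    · simp only [blockPart]
      by_cases hab : a.1 ∈ Q ∧ b.1 ∈ Q ∧ cl a.1 = cl b.1
      · rw [if_pos hab, if_pos ((e1 a b).1 hab), e a b hab, hone, st.ker.symm]
      · rw [if_neg hab, if_neg (fun h => hab ((e1 a b).2 h)), hone]
    · simp only [hopPart]
      by_cases hab : (a.1 ∈ Q ∧ cl a.1 ⊆ X) ∧ (b.1 ∈ Q ∧ cl b.1 ⊆ X)
      · rw [if_pos hab, if_pos hab.symm]
        by_cases hc : cl a.1 = cl b.1
        · rw [if_pos hc, if_pos hc.symm, e a b ⟨hab.1.1, hab.2.1, hc⟩, st.ker.symm X b a,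
            st.ker.symm _ b a]
        · rw [if_neg hc, if_neg (Ne.symm hc), st.ker.symm]
      · rw [if_neg hab, if_neg (fun h => hab h.symm)]
  have h2 : (green F cl Q N lam X).transpose = green F cl Q N lam X := by
    rw [green, Matrix.transpose_nonsing_inv, this]
  conv_lhs => rw [← h2]
  rfl

theorem leg_symm (st : StepSetup F cl Q P N lam U m σ τ h s β D n r S Z) (X : Finset Λ)
    (a b : Site Λ) : legPart' F cl Q X a b = legPart F cl Q X b a := by
  simp only [legPart, legPart', st.ker.symm X a b]

theorem leg_far (st : StepSetup F cl Q P N lam U m σ τ h s β D n r S Z) (X : Finset Λ)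
    {a b : Site Λ} (ha : a.1 ∈ P) (hb : legPart F cl Q X a b ≠ 0) :
    b.1 ∈ Q ∧ s ≤ ldist a.1.1 b.1.1 ∧
      |legPart F cl Q X a b| ≤ Real.exp (-(σ * ldist a.1.1 b.1.1 + β)) := by
  have hb' : b.1 ∈ Q ∧ cl b.1 ⊆ X := by
    by_contra h
    exact hb (if_neg h)
  have hs := st.geo.sepP _ ha _ hb'.1
  refine ⟨hb'.1, hs, ?_⟩
  simp only [legPart]
  rw [if_pos hb']
  exact st.ker.far X a b (Finset.mem_union_right _ ha) (Finset.mem_union_left _ hb'.1) hs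

/-- The weight is the exponential of τ times the length of the path from `a` over `p` to `q`, in
which passing through a cell is free. -/
theorem leg_chain (st : StepSetup F cl Q P N lam U m σ τ h s β D n r S Z) (X X' : Finset Λ)
    {a : Site Λ} (ha : a.1 ∈ P) :
    ∑ p, ∑ q, |legPart F cl Q X a p| * |green F cl Q N lam X' p q| *
      Real.exp (τ * (ldist a.1.1 p.1.1 + m p.1 q.1)) ≤ legBound σ τ h s β Z * (2 * S) := by
  calc _ = ∑ p, |legPart F cl Q X a p| * Real.exp (τ * ldist a.1.1 p.1.1) *
        ∑ q, |green F cl Q N lam X' p q| * Real.exp (τ * m p.1 q.1) := by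
        refine Finset.sum_congr rfl fun p _ => ?_
        rw [Finset.mul_sum]
        refine Finset.sum_congr rfl fun q _ => ?_
        rw [mul_add, Real.exp_add]; ring
    _ ≤ ∑ p, |legPart F cl Q X a p| * Real.exp (τ * ldist a.1.1 p.1.1) * (2 * S) :=
        Finset.sum_le_sum fun p _ => mul_le_mul_of_nonneg_left ((st.inverse X').2 p)
          (by positivity)
    _ ≤ _ := by
        rw [← Finset.sum_mul]
        refine mul_le_mul_of_nonneg_right ?_ (by linarith [st.S_nonneg])
        exact st.far_sum a _ fun b hb => (st.leg_far X ha hb).2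

theorem leg_chain' (st : StepSetup F cl Q P N lam U m σ τ h s β D n r S Z) (X X' : Finset Λ)
    {b : Site Λ} (hb : b.1 ∈ P) :
    ∑ p, ∑ q, |green F cl Q N lam X' p q| * |legPart' F cl Q X q b| *
      Real.exp (τ * (ldist b.1.1 q.1.1 + m q.1 p.1)) ≤ legBound σ τ h s β Z * (2 * S) := by
  refine le_trans (le_of_eq ?_) (st.leg_chain X X' hb)
  rw [Finset.sum_comm]
  refine Finset.sum_congr rfl fun q _ => Finset.sum_congr rfl fun p _ => ?_
  rw [st.leg_symm, st.green_symm]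
  ring

end StepSetup

/-! ### Decay and locality of the correction in one step. -/

namespace StepSetup

variable {F : Finset Λ → Matrix (Site Λ) (Site Λ) ℝ} {cl : Λ → Finset Λ}
    {Q P : Finset Λ} {N : Λ → Finset Λ} {lam : ℝ} {U : Matrix (Site Λ) (Site Λ) ℝ}
    {m : Λ → Λ → ℝ} {σ τ h s β D n r S Z : ℝ}

/-- The correction that is subtracted from the kernel in one elimination step. -/
abbrev corr (F : Finset Λ → Matrix (Site Λ) (Site Λ) ℝ) (cl : Λ → Finset Λ) (Q : Finset Λ)
    (N : Λ → Finset Λ) (lam : ℝ) (X : Finset Λ) : Matrix (Site Λ) (Site Λ) ℝ :=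
  legPart F cl Q X * green F cl Q N lam X * legPart' F cl Q X

theorem leg_le_legBound (st : StepSetup F cl Q P N lam U m σ τ h s β D n r S Z) (X : Finset Λ)
    {a b : Site Λ} (ha : a.1 ∈ P) : |legPart F cl Q X a b| ≤
      legBound σ τ h s β Z * Real.exp (-(τ * ldist a.1.1 b.1.1)) := by
  have hl := st.legBound_nonneg
  by_cases hb : legPart F cl Q X a b = 0
  · rw [hb, abs_zero]; positivity
  obtain ⟨-, h2, h3⟩ := st.leg_far X ha hb
  refine h3.trans ?_
  have h4 := st.exp_far_le h2
  have h5 : Real.exp (-(h * ldist a.1.1 b.1.1)) ≤ 1 :=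
    Real.exp_le_one_iff.2 (neg_nonpos.2 (mul_nonneg st.h_nonneg (ldist_nonneg _ _)))
  rw [Real.exp_neg (τ * _), ← div_eq_mul_inv, le_div_iff₀ (Real.exp_pos _)]
  refine h4.trans ?_
  calc _ ≤ Real.exp (-((σ - τ - h) * s + β)) * 1 := by gcongr
    _ ≤ _ := by
      rw [mul_one, legBound]
      exact le_mul_of_one_le_left (Real.exp_pos _).le st.one_le_Z

/-- The path from `a` over `p` and `q` to `b` has at least the length `ldist a b` up to one cell
diameter. The left leg is estimated pointwise, and the decay of the chain consisting of the inverse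
and the right leg is stored in its weighted sum. -/
theorem corr_far (st : StepSetup F cl Q P N lam U m σ τ h s β D n r S Z) (X : Finset Λ)
    {a b : Site Λ} (ha : a.1 ∈ P) (hb : b.1 ∈ P) : |corr F cl Q N lam X a b| ≤
      legBound σ τ h s β Z * (2 * S) * Real.exp (τ * D) * legBound σ τ h s β Z *
        Real.exp (-(τ * ldist a.1.1 b.1.1)) := by
  have hl := st.legBound_nonneg
  have := abs_mul_three_le (legPart F cl Q X) (green F cl Q N lam X) (legPart' F cl Q X) a b
    (c := legBound σ τ h s β Z * Real.exp (τ * D) * Real.exp (-(τ * ldist a.1.1 b.1.1)))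
    (by positivity) (st.leg_chain' X X hb) ?_
  · refine this.trans (le_of_eq (by ring))
  · intro p q _
    refine (st.leg_le_legBound X ha).trans ?_
    rw [mul_assoc, mul_assoc]
    refine mul_le_mul_of_nonneg_left ?_ hl
    rw [← Real.exp_add, ← Real.exp_add]
    refine Real.exp_le_exp.2 ?_
    have h1 := ldist_triangle a.1.1 p.1.1 b.1.1
    have h2 := ldist_triangle p.1.1 q.1.1 b.1.1
    have h3 := st.geo.le_m p.1 q.1
    rw [st.geo.m_comm] at h3
    rw [ldist_comm q.1.1] at h2
    have := st.τ_nonneg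
    have h4 : ldist a.1.1 b.1.1 - ldist a.1.1 p.1.1 ≤ D + (ldist b.1.1 q.1.1 + m q.1 p.1) := by
      linarith
    nlinarith [mul_le_mul_of_nonneg_left h4 this]

theorem leg_rowSum (st : StepSetup F cl Q P N lam U m σ τ h s β D n r S Z) (X : Finset Λ)
    {a : Site Λ} (ha : a.1 ∈ P) :
    ∑ b, |legPart F cl Q X a b| ≤ legBound σ τ h s β Z := by
  refine le_trans ?_ (st.far_sum a _ fun b hb => (st.leg_far X ha hb).2)
  exact Finset.sum_le_sum fun b _ => le_mul_of_one_le_right (abs_nonneg _)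
    (Real.one_le_exp (mul_nonneg st.τ_nonneg (ldist_nonneg _ _)))

theorem leg'_rowSum (st : StepSetup F cl Q P N lam U m σ τ h s β D n r S Z) (X : Finset Λ)
    (c : Site Λ) :
    ∑ b with b.1 ∈ P, |legPart' F cl Q X c b| ≤ legBound σ τ h s β Z := by
  have := st.far_sum c (fun b => if b.1 ∈ P then legPart' F cl Q X c b else 0) ?_
  · rw [Finset.sum_filter]
    refine le_trans (Finset.sum_le_sum fun b _ => ?_) this
    split_ifs with hb
    · exact le_mul_of_one_le_right (abs_nonneg _)
        (Real.one_le_exp (mul_nonneg st.τ_nonneg (ldist_nonneg _ _)))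
    · simp
  · intro b hb
    have hbP : b.1 ∈ P := by
      by_contra h
      exact hb (if_neg h)
    simp only [if_pos hbP, st.leg_symm] at hb ⊢
    have := (st.leg_far X hbP hb).2
    rwa [ldist_comm] at this

theorem green_rowSum (st : StepSetup F cl Q P N lam U m σ τ h s β D n r S Z) (X : Finset Λ)
    (a : Site Λ) : ∑ b, |green F cl Q N lam X a b| ≤ 2 * S :=
  le_trans (Finset.sum_le_sum fun _ _ => le_mul_of_one_le_right (abs_nonneg _)
    (Real.one_le_exp (mul_nonneg st.τ_nonneg (st.geo.m_nonneg _ _)))) ((st.inverse X).2 a)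

theorem leg_green_rowSum (st : StepSetup F cl Q P N lam U m σ τ h s β D n r S Z)
    (X X' : Finset Λ) {a : Site Λ} (ha : a.1 ∈ P) :
    ∑ b, |(legPart F cl Q X * green F cl Q N lam X') a b| ≤ legBound σ τ h s β Z * (2 * S) :=
  rowSum_mul_le _ _ Finset.univ a (by linarith [st.S_nonneg]) (st.leg_rowSum X ha)
    fun c _ => st.green_rowSum X' c

theorem corr_rowSum (st : StepSetup F cl Q P N lam U m σ τ h s β D n r S Z) (X : Finset Λ)
    {a : Site Λ} (ha : a.1 ∈ P) :
    ∑ b with b.1 ∈ P, |corr F cl Q N lam X a b| ≤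
      legBound σ τ h s β Z * (2 * S) * legBound σ τ h s β Z :=
  rowSum_mul_le _ _ _ a st.legBound_nonneg (st.leg_green_rowSum X X ha)
    fun c _ => st.leg'_rowSum X c

/-- The lower bound `t` for a detour may be replaced by `max t 0`. This makes it harmless to lower
the rate from σ to τ even if `t` is negative, as happens when `t` is diminished by the length of the
rest of a path. -/
theorem loc_max (st : StepSetup F cl Q P N lam U m σ τ h s β D n r S Z) {X Y : Finset Λ}
    (hYX : Y ⊆ X) {a b : Site Λ} (ha : a.1 ∈ Q ∪ P) (hb : b.1 ∈ Q ∪ P) (haY : a.1 ∈ Y)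
    (hbY : b.1 ∈ Y) {t : ℝ}
    (ht : ∀ z ∈ X, z ∉ Y → t ≤ ldist a.1.1 z.1 + ldist z.1 b.1.1) :
    |F X a b - F Y a b| ≤ Real.exp (-(τ * t)) := by
  refine (st.ker.loc X Y hYX a b ha hb haY hbY (max t 0) fun z hz hz' =>
    max_le (ht z hz hz') (add_nonneg (ldist_nonneg _ _) (ldist_nonneg _ _))).trans ?_
  refine Real.exp_le_exp.2 (neg_le_neg ?_)
  have h1 : τ * t ≤ τ * max t 0 := mul_le_mul_of_nonneg_left (le_max_left _ _) st.τ_nonneg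
  refine h1.trans (mul_le_mul_of_nonneg_right ?_ (le_max_right _ _))
  linarith [st.rate, st.h_nonneg]

/-- The condition `mid` says that the minimal distance `s` and the gain β pay for prolonging a jump
by one cell diameter. -/
theorem far_le (st : StepSetup F cl Q P N lam U m σ τ h s β D n r S Z)
    (mid : τ * D ≤ (σ - τ) * s + β) {ℓ : ℝ} (hℓ : s ≤ ℓ) :
    Real.exp (-(σ * ℓ + β)) ≤ Real.exp (-(τ * (ℓ + D))) := by
  refine Real.exp_le_exp.2 (neg_le_neg ?_)
  have : 0 ≤ σ - τ := by linarith [st.rate, st.h_nonneg]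
  nlinarith [mul_le_mul_of_nonneg_left hℓ this]

/-- If the cell of `p` lies in `Y`, only the kernel changes, and its locality applies to the detour
from `a` to `p`. Otherwise the leg exists for `X` only, but then the cell contains a point outside
`Y`, so that the path from `a` over `p` and `q` to `b` already has length `t` up to cell diameters.
-/
theorem leg_sub (st : StepSetup F cl Q P N lam U m σ τ h s β D n r S Z)
    (mid : τ * D ≤ (σ - τ) * s + β) {X Y : Finset Λ}
    (hYX : Y ⊆ X) {a b : Site Λ} (ha : a.1 ∈ P) (haY : a.1 ∈ Y) {t : ℝ}
    (ht : ∀ z ∈ X, z ∉ Y → t ≤ ldist a.1.1 z.1 + ldist z.1 b.1.1) (p q : Site Λ) :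
    |(legPart F cl Q X - legPart F cl Q Y) a p| ≤
      Real.exp (τ * D) * Real.exp (-(τ * t)) *
        Real.exp (τ * (ldist b.1.1 q.1.1 + m q.1 p.1)) := by
  have hτ := st.τ_nonneg
  rw [← Real.exp_add, ← Real.exp_add, Matrix.sub_apply]
  simp only [legPart]
  by_cases hX : p.1 ∈ Q ∧ cl p.1 ⊆ X
  swap
  · rw [if_neg hX, if_neg (fun h => hX ⟨h.1, h.2.trans hYX⟩), sub_zero, abs_zero]
    positivity
  have h2 := ldist_triangle p.1.1 q.1.1 b.1.1
  have h3 := st.geo.le_m p.1 q.1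
  rw [st.geo.m_comm] at h3
  rw [ldist_comm q.1.1] at h2
  by_cases hY : cl p.1 ⊆ Y
  · rw [if_pos hX, if_pos ⟨hX.1, hY⟩]
    refine (st.loc_max hYX (Finset.mem_union_right _ ha) (Finset.mem_union_left _ hX.1) haY
      (hY (st.geo.mem _ hX.1)) (t := t - ldist p.1.1 b.1.1) fun z hz hz' => ?_).trans ?_
    · have := ldist_triangle z.1 p.1.1 b.1.1
      linarith [ht z hz hz']
    · refine Real.exp_le_exp.2 ?_
      have h4 : -(t - ldist p.1.1 b.1.1) ≤ D + -t + (ldist b.1.1 q.1.1 + m q.1 p.1) := by linarith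
      nlinarith [mul_le_mul_of_nonneg_left h4 hτ]
  · rw [if_pos hX, if_neg (fun h => hY h.2), sub_zero]
    obtain ⟨z, hz, hzY⟩ := Finset.not_subset.1 hY
    have hs := st.geo.sepP _ ha _ hX.1
    refine (st.ker.far X a p (Finset.mem_union_right _ ha) (Finset.mem_union_left _ hX.1) hs).trans
      ((st.far_le mid hs).trans (Real.exp_le_exp.2 ?_))
    have h4 := ht z (hX.2 hz) hzY
    have h5 := ldist_triangle a.1.1 p.1.1 z.1
    have h6 := st.geo.le_m p.1 z
    rw [st.geo.m_zero _ hX.1 _ hz] at h6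
    have h7 := ldist_triangle z.1 q.1.1 b.1.1
    rw [ldist_comm q.1.1] at h7
    have h8 := st.geo.le_m z q.1
    have h9 := st.geo.m_tri q.1 p.1 z
    rw [st.geo.m_zero _ hX.1 _ hz, st.geo.m_comm q.1 z] at h9
    have h10 : -(ldist a.1.1 p.1.1 + D) ≤ D + -t + (ldist b.1.1 q.1.1 + m q.1 p.1) := by
      linarith
    nlinarith [mul_le_mul_of_nonneg_left h10 hτ]

/-- The alternatives are those of `leg_sub`, for the cells of both end points. The factor 2 comes
from the two kernels, for `X` and for `X ∩ N`, that occur inside a cell. -/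
theorem hop_sub (st : StepSetup F cl Q P N lam U m σ τ h s β D n r S Z)
    (mid : τ * D ≤ (σ - τ) * s + β) {X Y : Finset Λ}
    (hYX : Y ⊆ X) {a b : Site Λ} {t : ℝ}
    (ht : ∀ z ∈ X, z ∉ Y → t ≤ ldist a.1.1 z.1 + ldist z.1 b.1.1) (p q p' q' : Site Λ) :
    |(hopPart F cl Q N Y - hopPart F cl Q N X) q p'| ≤
      2 * Real.exp (τ * D) * Real.exp (τ * D) * Real.exp (-(τ * t)) *
        (Real.exp (τ * (ldist a.1.1 p.1.1 + m p.1 q.1)) *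
          Real.exp (τ * (ldist b.1.1 q'.1.1 + m q'.1 p'.1))) := by
  have hτ := st.τ_nonneg
  set W := (ldist a.1.1 p.1.1 + m p.1 q.1) + (ldist b.1.1 q'.1.1 + m q'.1 p'.1) with hW
  have hR : 2 * Real.exp (τ * D) * Real.exp (τ * D) * Real.exp (-(τ * t)) *
        (Real.exp (τ * (ldist a.1.1 p.1.1 + m p.1 q.1)) *
          Real.exp (τ * (ldist b.1.1 q'.1.1 + m q'.1 p'.1))) =
      2 * Real.exp (τ * (2 * D - t + W)) := by
    rw [mul_assoc 2, mul_assoc 2, mul_assoc 2, ← Real.exp_add, ← Real.exp_add, ← Real.exp_add,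
      ← Real.exp_add]
    congr 2
    rw [hW]; ring
  rw [hR, Matrix.sub_apply]
  have hexp : ∀ {x : ℝ}, -x ≤ 2 * D - t + W → Real.exp (-(τ * x)) ≤
      Real.exp (τ * (2 * D - t + W)) := fun {x} hx => Real.exp_le_exp.2 (by
    nlinarith [mul_le_mul_of_nonneg_left hx hτ])
  have hpos := Real.exp_pos (τ * (2 * D - t + W))
  simp only [hopPart]
  by_cases hX : (q.1 ∈ Q ∧ cl q.1 ⊆ X) ∧ (p'.1 ∈ Q ∧ cl p'.1 ⊆ X)
  swap
  · rw [if_neg hX, if_neg (fun h => hX ⟨⟨h.1.1, h.1.2.trans hYX⟩, h.2.1, h.2.2.trans hYX⟩),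
      sub_zero, abs_zero]
    positivity
  obtain ⟨⟨hq, hqX⟩, hp', hpX'⟩ := hX
  have hqS := Finset.mem_union_left P hq
  have hpS := Finset.mem_union_left P hp'
  -- distances from the end points
  have a1 : ∀ z, ldist a.1.1 z.1 ≤ ldist a.1.1 p.1.1 + m p.1 q.1 + m q.1 z + D := fun z => by
    have := ldist_triangle a.1.1 p.1.1 z.1
    have := st.geo.le_m p.1 z
    have := st.geo.m_tri p.1 q.1 z
    linarith
  have b1 : ∀ z, ldist z.1 b.1.1 ≤ ldist b.1.1 q'.1.1 + m q'.1 p'.1 + m p'.1 z + D := fun z => by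
    have h1 := ldist_triangle z.1 q'.1.1 b.1.1
    rw [ldist_comm q'.1.1] at h1
    have h2 := st.geo.le_m z q'.1
    have h3 := st.geo.m_tri q'.1 p'.1 z
    rw [st.geo.m_comm z] at h2
    linarith
  have hsum : ∀ z ∈ X, z ∉ Y →
      t - (ldist a.1.1 q.1.1 + ldist p'.1.1 b.1.1) ≤ ldist q.1.1 z.1 + ldist z.1 p'.1.1 := by
    intro z hz hz'
    have := ht z hz hz'
    have := ldist_triangle a.1.1 q.1.1 z.1
    have := ldist_triangle z.1 p'.1.1 b.1.1
    linarith
  have hW1 : -(t - (ldist a.1.1 q.1.1 + ldist p'.1.1 b.1.1)) ≤ 2 * D - t + W := by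
    have h1 := a1 q.1
    have h2 := b1 p'.1
    rw [st.geo.m_self] at h1 h2
    linarith
  rw [if_pos (⟨⟨hq, hqX⟩, hp', hpX'⟩ : (q.1 ∈ Q ∧ cl q.1 ⊆ X) ∧ (p'.1 ∈ Q ∧ cl p'.1 ⊆ X))]
  by_cases hY : cl q.1 ⊆ Y ∧ cl p'.1 ⊆ Y
  · rw [if_pos ⟨⟨hq, hY.1⟩, hp', hY.2⟩]
    have hqY := hY.1 (st.geo.mem _ hq)
    have hpY := hY.2 (st.geo.mem _ hp')
    have e1 := (st.loc_max hYX hqS hpS hqY hpY hsum).trans (hexp hW1)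
    by_cases hc : cl q.1 = cl p'.1
    · rw [if_pos hc, if_pos hc]
      have hqN : q.1 ∈ N q.1 := st.N_sup _ hq (st.geo.mem _ hq)
      have hpN : p'.1 ∈ N q.1 := st.N_sup _ hq (hc ▸ st.geo.mem _ hp')
      have e2 := (st.loc_max (Finset.inter_subset_inter_right (u := N q.1) hYX) hqS hpS
        (Finset.mem_inter.2 ⟨hqY, hqN⟩) (Finset.mem_inter.2 ⟨hpY, hpN⟩)
        (fun z hz hz' => hsum z (Finset.mem_inter.1 hz).1 fun h => hz'
          (Finset.mem_inter.2 ⟨h, (Finset.mem_inter.1 hz).2⟩))).trans (hexp hW1)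
      have : F Y q p' - F (Y ∩ N q.1) q p' - (F X q p' - F (X ∩ N q.1) q p') =
          (F (X ∩ N q.1) q p' - F (Y ∩ N q.1) q p') - (F X q p' - F Y q p') := by ring
      rw [this]
      refine (abs_sub _ _).trans ?_
      linarith
    · rw [if_neg hc, if_neg hc, abs_sub_comm]
      linarith
  · rw [if_neg (fun h => hY ⟨h.1.2, h.2.2⟩), zero_sub, abs_neg]
    by_cases hc : cl q.1 = cl p'.1
    · rw [if_pos hc]
      have hqN : q.1 ∈ N q.1 := st.N_sup _ hq (st.geo.mem _ hq)
      have hpN : p'.1 ∈ N q.1 := st.N_sup _ hq (hc ▸ st.geo.mem _ hp')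
      -- The trivial bound 1 is sufficient here: the common cell contains a point outside `Y`, so
      -- the outer parts of the path already have length `t` up to cell diameters.
      have e3 := st.loc_max (Finset.inter_subset_left (s₁ := X) (s₂ := N q.1)) hqS hpS
        (Finset.mem_inter.2 ⟨hqX (st.geo.mem _ hq), hqN⟩)
        (Finset.mem_inter.2 ⟨hpX' (st.geo.mem _ hp'), hpN⟩) (t := 0)
        (fun z _ _ => add_nonneg (ldist_nonneg _ _) (ldist_nonneg _ _))
      have hY' : ¬ cl q.1 ⊆ Y := fun h => hY ⟨h, hc ▸ h⟩
      obtain ⟨z, hz, hzY⟩ := Finset.not_subset.1 hY'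
      have h1 := a1 z
      have h2 := b1 z
      rw [st.geo.m_zero _ hq _ hz] at h1
      rw [st.geo.m_zero _ hp' _ (hc ▸ hz)] at h2
      have h3 := ht z (hqX hz) hzY
      have := hexp (x := 0) (by linarith)
      linarith
    · rw [if_neg hc]
      have hs := st.geo.sepQ _ hq _ hp' hc
      have e4 := (st.ker.far X q p' hqS hpS hs).trans (st.far_le mid hs)
      refine (e4.trans (hexp ?_)).trans (by linarith)
      rcases not_and_or.1 hY with h | h
      · obtain ⟨z, hz, hzY⟩ := Finset.not_subset.1 h
        have h1 := a1 z
        rw [st.geo.m_zero _ hq _ hz] at h1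
        have h2 := b1 p'.1
        rw [st.geo.m_self] at h2
        have h3 := ht z (hqX hz) hzY
        have h4 := ldist_triangle z.1 p'.1.1 b.1.1
        have h5 := ldist_triangle z.1 q.1.1 p'.1.1
        have h6 := st.geo.le_m z q.1
        rw [st.geo.m_comm, st.geo.m_zero _ hq _ hz] at h6
        linarith
      · obtain ⟨z, hz, hzY⟩ := Finset.not_subset.1 h
        have h1 := b1 z
        rw [st.geo.m_zero _ hp' _ hz] at h1
        have h2 := a1 q.1
        rw [st.geo.m_self] at h2
        have h3 := ht z (hpX' hz) hzY
        have h4 := ldist_triangle a.1.1 q.1.1 z.1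
        have h5 := ldist_triangle q.1.1 p'.1.1 z.1
        have h6 := st.geo.le_m p'.1 z
        rw [st.geo.m_zero _ hp' _ hz] at h6
        linarith

theorem corr_transpose (st : StepSetup F cl Q P N lam U m σ τ h s β D n r S Z) (A B : Site Λ → Site Λ → ℝ)
    (X : Finset Λ) (a b : Site Λ) :
    ((Matrix.of A * green F cl Q N lam X * (Matrix.of B).transpose) a b) =
      ((Matrix.of B * green F cl Q N lam X * (Matrix.of A).transpose) b a) := by
  have h2 : (green F cl Q N lam X).transpose = green F cl Q N lam X := by
    ext i j; exact st.green_symm X j i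
  have : (Matrix.of A * green F cl Q N lam X * (Matrix.of B).transpose).transpose =
      Matrix.of B * green F cl Q N lam X * (Matrix.of A).transpose := by
    rw [Matrix.transpose_mul, Matrix.transpose_mul, h2, Matrix.transpose_transpose,
      Matrix.mul_assoc]
  rw [← this]
  rfl

/-- Passing from `X` to `Y` changes the inverse, which the resolvent identity expresses by the
change of the hops, and each of the two legs. In every resulting chain the change can only be due to
a point of `X` outside `Y`, so the chain has length at least `t` up to cell diameters. The change of
the right leg is reduced to that of the left one by symmetry. -/
theorem corr_loc (st : StepSetup F cl Q P N lam U m σ τ h s β D n r S Z)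
    (mid : τ * D ≤ (σ - τ) * s + β) {X Y : Finset Λ}
    (hYX : Y ⊆ X) {a b : Site Λ} (ha : a.1 ∈ P) (hb : b.1 ∈ P) (haY : a.1 ∈ Y) (hbY : b.1 ∈ Y)
    {t : ℝ} (ht : ∀ z ∈ X, z ∉ Y → t ≤ ldist a.1.1 z.1 + ldist z.1 b.1.1) {A : ℝ}
    (hA : A = legBound σ τ h s β Z * (2 * S) * Real.exp (τ * D)) :
    |corr F cl Q N lam X a b - corr F cl Q N lam Y a b| ≤
      (2 * A + 2 * A ^ 2) * Real.exp (-(τ * t)) := by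
  have hl := st.legBound_nonneg
  have hS := st.S_nonneg
  set LX := legPart F cl Q X with hLX
  set LY := legPart F cl Q Y with hLY
  set GX := green F cl Q N lam X with hGX
  set GY := green F cl Q N lam Y with hGY
  have hLX' : legPart' F cl Q X = LX.transpose := by ext i j; exact st.leg_symm X i j
  have hLY' : legPart' F cl Q Y = LY.transpose := by ext i j; exact st.leg_symm Y i j
  have hres : GX - GY = GX * (hopPart F cl Q N Y - hopPart F cl Q N X) * GY := by
    have e1 : GX * (blockPart F cl Q N lam + hopPart F cl Q N X) = 1 :=
      Matrix.nonsing_inv_mul _ (st.inverse X).1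
    have e2 : (blockPart F cl Q N lam + hopPart F cl Q N Y) * GY = 1 :=
      Matrix.mul_nonsing_inv _ (st.inverse Y).1
    have e3 : hopPart F cl Q N Y - hopPart F cl Q N X =
        (blockPart F cl Q N lam + hopPart F cl Q N Y) -
        (blockPart F cl Q N lam + hopPart F cl Q N X) := by abel
    rw [e3, Matrix.mul_sub, e1, Matrix.sub_mul, Matrix.mul_assoc, e2, Matrix.mul_one,
      Matrix.one_mul]
  have hdec : corr F cl Q N lam X - corr F cl Q N lam Y =
      LX * GX * (hopPart F cl Q N Y - hopPart F cl Q N X) * GY * legPart' F cl Q X +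
      (LX - LY) * GY * legPart' F cl Q X + LY * GY * (LX - LY).transpose := by
    have e : LX * GX * (hopPart F cl Q N Y - hopPart F cl Q N X) * GY = LX * (GX - GY) := by
      rw [hres]; simp only [Matrix.mul_assoc]
    rw [e, corr, corr, ← hLX, ← hLY, ← hGX, ← hGY, hLX', hLY', Matrix.transpose_sub,
      Matrix.mul_sub, Matrix.mul_sub, Matrix.sub_mul, Matrix.sub_mul, Matrix.sub_mul]
    abel
  have t1 : |(LX * GX * (hopPart F cl Q N Y - hopPart F cl Q N X) * GY *
      legPart' F cl Q X) a b| ≤ 2 * A ^ 2 * Real.exp (-(τ * t)) := by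
    refine (abs_mul_five_le LX GX _ GY (legPart' F cl Q X) a b
      (c := 2 * Real.exp (τ * D) * Real.exp (τ * D) * Real.exp (-(τ * t))) (by positivity)
      (by positivity)
      (st.leg_chain X X ha) (st.leg_chain' X Y hb)
      fun p q p' q' _ _ => st.hop_sub mid hYX ht p q p' q').trans (le_of_eq ?_)
    rw [hA]; ring
  have t2 : |((LX - LY) * GY * legPart' F cl Q X) a b| ≤ A * Real.exp (-(τ * t)) := by
    refine (abs_mul_three_le (LX - LY) GY (legPart' F cl Q X) a b
      (c := Real.exp (τ * D) * Real.exp (-(τ * t))) (by positivity)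
      (st.leg_chain' X Y hb) fun p q _ => st.leg_sub mid hYX ha haY ht p q).trans (le_of_eq ?_)
    rw [hA]; ring
  have t3 : |(LY * GY * (LX - LY).transpose) a b| ≤ A * Real.exp (-(τ * t)) := by
    have e : (LY * GY * (LX - LY).transpose) a b = ((LX - LY) * GY * LY.transpose) b a :=
      st.corr_transpose LY (LX - LY) Y a b
    rw [e, ← hLY']
    refine (abs_mul_three_le (LX - LY) GY (legPart' F cl Q Y) b a
      (c := Real.exp (τ * D) * Real.exp (-(τ * t))) (by positivity)
      (st.leg_chain' Y Y ha) fun p q _ => st.leg_sub mid hYX hb hbY (fun z hz hz' => by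
        have := ht z hz hz'
        have := ldist_comm b.1.1 z.1
        have := ldist_comm a.1.1 z.1
        linarith) p q).trans (le_of_eq ?_)
    rw [hA]; ring
  rw [← Matrix.sub_apply, hdec, Matrix.add_apply, Matrix.add_apply]
  refine (abs_add_three _ _ _).trans ?_
  linarith

end StepSetup

/-! ### Lipschitz dependence of the correction on the spectral parameter. -/

namespace StepSetup

variable {F F' : Finset Λ → Matrix (Site Λ) (Site Λ) ℝ} {cl : Λ → Finset Λ}
    {Q P : Finset Λ} {N : Λ → Finset Λ} {lam mu : ℝ} {U U' : Matrix (Site Λ) (Site Λ) ℝ}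
    {m : Λ → Λ → ℝ} {σ τ h s β D n r S Z : ℝ}

/-- The kernel enters with the three regions `N a`, `X` and `X ∩ N a`, and the spectral parameter
enters once; this explains `1 + 3 * c`. -/
theorem block_rowSum_sub {c : ℝ} (hc : 0 ≤ c)
    (hF : ∀ X a, a.1 ∈ Q ∪ P → ∑ b with b.1 ∈ Q ∪ P, |F X a b - F' X a b| ≤ c * |lam - mu|)
    (X : Finset Λ) (a : Site Λ) :
    ∑ b, |((blockPart F' cl Q N mu + hopPart F' cl Q N X) -
      (blockPart F cl Q N lam + hopPart F cl Q N X)) a b| ≤ (1 + 3 * c) * |lam - mu| := by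
  have hone : ∑ b, |lam - mu| * (1 : Matrix (Site Λ) (Site Λ) ℝ) a b = |lam - mu| := by
    simp [Matrix.one_apply]
  have hone0 : ∀ b, 0 ≤ (1 : Matrix (Site Λ) (Site Λ) ℝ) a b := fun b => by
    rw [Matrix.one_apply]; split_ifs <;> norm_num
  by_cases ha : a.1 ∈ Q
  swap
  · have : ∀ b, ((blockPart F' cl Q N mu + hopPart F' cl Q N X) -
      (blockPart F cl Q N lam + hopPart F cl Q N X)) a b = 0 := fun b => by
      simp only [Matrix.sub_apply, Matrix.add_apply, blockPart, hopPart]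
      rw [if_neg (fun h => ha h.1), if_neg (fun h => ha h.1.1), if_neg (fun h => ha h.1),
        if_neg (fun h => ha h.1.1), sub_self]
    simp only [this, abs_zero, Finset.sum_const_zero]
    positivity
  have haS := Finset.mem_union_left P ha
  have hpt : ∀ b, |((blockPart F' cl Q N mu + hopPart F' cl Q N X) -
      (blockPart F cl Q N lam + hopPart F cl Q N X)) a b| ≤
      |lam - mu| * (1 : Matrix (Site Λ) (Site Λ) ℝ) a b +
      (if b.1 ∈ Q ∪ P then |F (N a.1) a b - F' (N a.1) a b| else 0) +
      (if b.1 ∈ Q ∪ P then |F X a b - F' X a b| else 0) +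
      (if b.1 ∈ Q ∪ P then |F (X ∩ N a.1) a b - F' (X ∩ N a.1) a b| else 0) := by
    intro b
    have hp := mul_nonneg (abs_nonneg (lam - mu)) (hone0 b)
    by_cases hb : b.1 ∈ Q
    swap
    · have : ((blockPart F' cl Q N mu + hopPart F' cl Q N X) -
        (blockPart F cl Q N lam + hopPart F cl Q N X)) a b = 0 := by
        simp only [Matrix.sub_apply, Matrix.add_apply, blockPart, hopPart]
        rw [if_neg (fun h => hb h.2.1), if_neg (fun h => hb h.2.1), if_neg (fun h => hb h.2.1),
          if_neg (fun h => hb h.2.1), sub_self]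
      rw [this, abs_zero]
      refine add_nonneg (add_nonneg (add_nonneg hp ?_) ?_) ?_ <;> split_ifs <;> positivity
    · have hbS := Finset.mem_union_left P hb
      rw [if_pos hbS, if_pos hbS, if_pos hbS]
      set x := F (N a.1) a b
      set x' := F' (N a.1) a b
      set y := F X a b
      set y' := F' X a b
      set w := F (X ∩ N a.1) a b
      set w' := F' (X ∩ N a.1) a b
      set e := (1 : Matrix (Site Λ) (Site Λ) ℝ) a b
      have hx := abs_nonneg (x - x')
      have hy := abs_nonneg (y - y')
      have hw := abs_nonneg (w - w')
      have habs : |(lam - mu) * e| = |lam - mu| * e := by rw [abs_mul, abs_of_nonneg (hone0 b)]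
      simp only [Matrix.sub_apply, Matrix.add_apply, blockPart, hopPart]
      by_cases hc : cl a.1 = cl b.1
      · have hblk : a.1 ∈ Q ∧ b.1 ∈ Q ∧ cl a.1 = cl b.1 := ⟨ha, hb, hc⟩
        by_cases hX : (a.1 ∈ Q ∧ cl a.1 ⊆ X) ∧ (b.1 ∈ Q ∧ cl b.1 ⊆ X)
        · simp only [if_pos hblk, if_pos hX, if_pos hc]
          have : x' - mu * e + (y' - w') - (x - lam * e + (y - w)) =
            (lam - mu) * e - (x - x') - (y - y') + (w - w') := by ring
          change |x' - mu * e + (y' - w') - (x - lam * e + (y - w))| ≤ _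
          rw [this]
          have h1 := abs_add_le ((lam - mu) * e - (x - x') - (y - y')) (w - w')
          have h2 := abs_sub ((lam - mu) * e - (x - x')) (y - y')
          have h3 := abs_sub ((lam - mu) * e) (x - x')
          linarith
        · simp only [if_pos hblk, if_neg hX]
          have : x' - mu * e + 0 - (x - lam * e + 0) = (lam - mu) * e - (x - x') := by ring
          change |x' - mu * e + 0 - (x - lam * e + 0)| ≤ _
          rw [this]
          have h3 := abs_sub ((lam - mu) * e) (x - x')
          linarith
      · have hblk : ¬(a.1 ∈ Q ∧ b.1 ∈ Q ∧ cl a.1 = cl b.1) := fun h => hc h.2.2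
        by_cases hX : (a.1 ∈ Q ∧ cl a.1 ⊆ X) ∧ (b.1 ∈ Q ∧ cl b.1 ⊆ X)
        · simp only [if_neg hblk, if_pos hX, if_neg hc]
          have : e + y' - (e + y) = -(y - y') := by ring
          change |e + y' - (e + y)| ≤ _
          rw [this, abs_neg]
          linarith
        · simp only [if_neg hblk, if_neg hX]
          rw [sub_self, abs_zero]
          positivity
  refine (Finset.sum_le_sum fun b _ => hpt b).trans ?_
  rw [Finset.sum_add_distrib, Finset.sum_add_distrib, Finset.sum_add_distrib, hone,
    ← Finset.sum_filter, ← Finset.sum_filter, ← Finset.sum_filter]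
  have h1 := hF (N a.1) a haS
  have h2 := hF X a haS
  have h3 := hF (X ∩ N a.1) a haS
  linarith

/-- The same telescoping as in `corr_loc`, with plain row sums: the decay of the entries is not
needed for the dependence on the energy. -/
theorem corr_lip (st : StepSetup F cl Q P N lam U m σ τ h s β D n r S Z)
    (st' : StepSetup F' cl Q P N mu U' m σ τ h s β D n r S Z) {c : ℝ} (hc : 0 ≤ c)
    (hF : ∀ X a, a.1 ∈ Q ∪ P → ∑ b with b.1 ∈ Q ∪ P, |F X a b - F' X a b| ≤ c * |lam - mu|)
    (X : Finset Λ) {a : Site Λ} (ha : a.1 ∈ P) {B : ℝ}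
    (hB : B = legBound σ τ h s β Z * (2 * S)) :
    ∑ b with b.1 ∈ P, |corr F cl Q N lam X a b - corr F' cl Q N mu X a b| ≤
      (2 * c * B + (1 + 3 * c) * B ^ 2) * |lam - mu| := by
  have hl := st.legBound_nonneg
  have hS := st.S_nonneg
  have hc' : 0 ≤ c * |lam - mu| := by positivity
  set LX := legPart F cl Q X with hLX
  set LY := legPart F' cl Q X with hLY
  set RX := legPart' F cl Q X with hRX
  set RY := legPart' F' cl Q X with hRY
  set GX := green F cl Q N lam X with hGX
  set GY := green F' cl Q N mu X with hGY
  set E := (blockPart F' cl Q N mu + hopPart F' cl Q N X) -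
    (blockPart F cl Q N lam + hopPart F cl Q N X) with hE
  have hres : GX - GY = GX * E * GY := by
    have e1 : GX * (blockPart F cl Q N lam + hopPart F cl Q N X) = 1 :=
      Matrix.nonsing_inv_mul _ (st.inverse X).1
    have e2 : (blockPart F' cl Q N mu + hopPart F' cl Q N X) * GY = 1 :=
      Matrix.mul_nonsing_inv _ (st'.inverse X).1
    rw [hE, Matrix.mul_sub, e1, Matrix.sub_mul, Matrix.mul_assoc, e2, Matrix.mul_one,
      Matrix.one_mul]
  have hdec : corr F cl Q N lam X - corr F' cl Q N mu X =
      LX * GX * E * GY * RX + (LX - LY) * GY * RX + LY * GY * (RX - RY) := by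
    have e : LX * GX * E * GY = LX * (GX - GY) := by
      rw [hres]; simp only [Matrix.mul_assoc]
    rw [e, corr, corr, ← hLX, ← hLY, ← hGX, ← hGY, Matrix.mul_sub, Matrix.mul_sub,
      Matrix.sub_mul, Matrix.sub_mul, Matrix.sub_mul]
    abel
  have hsub : ∀ b, |LX a b - LY a b| ≤ if b.1 ∈ Q ∪ P then |F X a b - F' X a b| else 0 := by
    intro b
    simp only [hLX, hLY, legPart]
    by_cases hb : b.1 ∈ Q ∧ cl b.1 ⊆ X
    · rw [if_pos hb, if_pos hb, if_pos (Finset.mem_union_left _ hb.1)]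
    · rw [if_neg hb, if_neg hb, sub_self, abs_zero]; split_ifs <;> positivity
  have t2L : ∑ b, |(LX - LY) a b| ≤ c * |lam - mu| := by
    refine (Finset.sum_le_sum fun b _ => hsub b).trans ?_
    rw [← Finset.sum_filter]
    exact hF X a (Finset.mem_union_right _ ha)
  have t3R : ∀ q, ∑ b with b.1 ∈ P, |(RX - RY) q b| ≤ c * |lam - mu| := by
    intro q
    by_cases hq : q.1 ∈ Q ∧ cl q.1 ⊆ X
    · refine le_trans ?_ (hF X q (Finset.mem_union_left _ hq.1))
      have : ∀ b, (RX - RY) q b = F X q b - F' X q b := fun b => by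
        simp only [hRX, hRY, legPart', Matrix.sub_apply]
        rw [if_pos hq, if_pos hq]
      simp only [this]
      exact Finset.sum_le_sum_of_subset_of_nonneg (fun b hb => by
        simp only [Finset.mem_filter, Finset.mem_univ, true_and, Finset.mem_union] at hb ⊢
        exact Or.inr hb) fun _ _ _ => abs_nonneg _
    · have : ∀ b, (RX - RY) q b = 0 := fun b => by
        simp only [hRX, hRY, legPart', Matrix.sub_apply]
        rw [if_neg hq, if_neg hq, sub_self]
      simp only [this, abs_zero, Finset.sum_const_zero]
      exact hc'
  have t1 : ∑ b with b.1 ∈ P, |(LX * GX * E * GY * RX) a b| ≤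
      B * ((1 + 3 * c) * |lam - mu|) * (2 * S) * legBound σ τ h s β Z :=
    rowSum_mul_le _ _ _ a hl (rowSum_mul_le _ _ Finset.univ a (by positivity)
      (rowSum_mul_le _ _ Finset.univ a (by positivity)
        ((st.leg_green_rowSum X X ha).trans hB.ge) fun q _ => block_rowSum_sub hc hF X q)
      fun q _ => st'.green_rowSum X q) fun q _ => st.leg'_rowSum X q
  have t2 : ∑ b with b.1 ∈ P, |((LX - LY) * GY * RX) a b| ≤
      c * |lam - mu| * (2 * S) * legBound σ τ h s β Z :=
    rowSum_mul_le _ _ _ a hl (rowSum_mul_le _ _ Finset.univ a (by positivity) t2L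
      fun q _ => st'.green_rowSum X q) fun q _ => st.leg'_rowSum X q
  have t3 : ∑ b with b.1 ∈ P, |(LY * GY * (RX - RY)) a b| ≤ B * (c * |lam - mu|) :=
    rowSum_mul_le _ _ _ a hc' ((st'.leg_green_rowSum X X ha).trans hB.ge) fun q _ => t3R q
  have hptw : ∀ b, |corr F cl Q N lam X a b - corr F' cl Q N mu X a b| ≤
      |(LX * GX * E * GY * RX) a b| + |((LX - LY) * GY * RX) a b| +
      |(LY * GY * (RX - RY)) a b| := fun b => by
    rw [← Matrix.sub_apply, hdec, Matrix.add_apply, Matrix.add_apply]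
    exact abs_add_three _ _ _
  refine (Finset.sum_le_sum fun b _ => hptw b).trans ?_
  rw [Finset.sum_add_distrib, Finset.sum_add_distrib]
  refine (add_le_add (add_le_add t1 t2) t3).trans (le_of_eq ?_)
  rw [hB]; ring

end StepSetup

/-! ### The pseudometric that contracts the cells -/

/-- The distance of two sets of positions. -/
def setDist (A B : Finset Λ) : ℝ := ⨅ p : A × B, ldist p.1.1.1 p.2.1.1

theorem setDist_le {A B : Finset Λ} {a b : Λ} (ha : a ∈ A) (hb : b ∈ B) :
    setDist A B ≤ ldist a.1 b.1 :=
  ciInf_le (Set.finite_range fun p : A × B => ldist p.1.1.1 p.2.1.1).bddBelow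
    ((⟨a, ha⟩, ⟨b, hb⟩) : A × B)

theorem exists_setDist_eq {A B : Finset Λ} (hA : A.Nonempty) (hB : B.Nonempty) :
    ∃ a ∈ A, ∃ b ∈ B, setDist A B = ldist a.1 b.1 := by
  have : Nonempty (A × B) := ⟨(⟨_, hA.choose_spec⟩, ⟨_, hB.choose_spec⟩)⟩
  obtain ⟨p, hp⟩ := exists_eq_ciInf_of_finite (f := fun p : A × B => ldist p.1.1.1 p.2.1.1)
  exact ⟨p.1.1, p.1.2, p.2.1, p.2.2, hp.symm⟩

/-- The distance of the cells of two positions, increased by `D` if the cells are different. -/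
def cellDist (c : Λ → Finset Λ) (D : ℝ) (z w : Λ) : ℝ :=
  if c z = c w then 0 else setDist (c z) (c w) + D

section CellDist

variable {c : Λ → Finset Λ} {D : ℝ}

theorem setDist_nonneg (A B : Finset Λ) : 0 ≤ setDist A B :=
  Real.iInf_nonneg fun _ => ldist_nonneg _ _

theorem setDist_comm {A B : Finset Λ} (hA : A.Nonempty) (hB : B.Nonempty) :
    setDist A B = setDist B A := by
  have : ∀ {A B : Finset Λ}, A.Nonempty → B.Nonempty → setDist A B ≤ setDist B A := by
    intro A B hA hB
    obtain ⟨b, hb, a, ha, h⟩ := exists_setDist_eq hB hA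
    rw [h, ldist_comm]
    exact setDist_le ha hb
  exact le_antisymm (this hA hB) (this hB hA)

theorem cellDist_nonneg (hD : 0 ≤ D) (z w : Λ) : 0 ≤ cellDist c D z w := by
  unfold cellDist
  split_ifs
  · exact le_rfl
  · exact add_nonneg (setDist_nonneg _ _) hD

theorem cellDist_comm (hc : ∀ z, z ∈ c z) (z w : Λ) : cellDist c D z w = cellDist c D w z := by
  unfold cellDist
  by_cases h : c z = c w
  · rw [if_pos h, if_pos h.symm]
  · rw [if_neg h, if_neg (Ne.symm h), setDist_comm ⟨_, hc z⟩ ⟨_, hc w⟩]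

theorem cellDist_le (hD : 0 ≤ D) (hc : ∀ z, z ∈ c z) (z w : Λ) :
    cellDist c D z w ≤ ldist z.1 w.1 + D := by
  unfold cellDist
  split_ifs
  · exact add_nonneg (ldist_nonneg _ _) hD
  · exact add_le_add (setDist_le (hc z) (hc w)) le_rfl

theorem ldist_le_cellDist (hc : ∀ z, z ∈ c z) (hd : ∀ z, ∀ w ∈ c z, ldist z.1 w.1 ≤ D)
    (z w : Λ) : ldist z.1 w.1 ≤ cellDist c D z w + D := by
  unfold cellDist
  split_ifs with h
  · rw [zero_add]
    exact hd z w (h ▸ hc w)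
  · obtain ⟨a, ha, b, hb, hab⟩ := exists_setDist_eq ⟨_, hc z⟩ ⟨_, hc w⟩
    rw [hab]
    have h1 := ldist_triangle z.1 a.1 w.1
    have h2 := ldist_triangle a.1 b.1 w.1
    have h3 := hd z a ha
    have h4 := hd w b hb
    rw [ldist_comm] at h4
    linarith

/-- A path through an intermediate cell may have to cross it, over a distance of at most `D`. The
summand `D` contained in each of the two distances on the right covers this, and also the one on the
left. -/
theorem cellDist_triangle (hD : 0 ≤ D) (hc : ∀ z, z ∈ c z)
    (hd : ∀ z, ∀ a ∈ c z, ∀ w ∈ c z, ldist a.1 w.1 ≤ D) (x y z : Λ) :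
    cellDist c D x z ≤ cellDist c D x y + cellDist c D y z := by
  by_cases hxz : c x = c z
  · have : cellDist c D x z = 0 := if_pos hxz
    rw [this]
    exact add_nonneg (cellDist_nonneg hD _ _) (cellDist_nonneg hD _ _)
  by_cases hxy : c x = c y
  · have h1 : cellDist c D x y = 0 := if_pos hxy
    rw [h1, zero_add]
    simp only [cellDist, hxy, le_refl]
  by_cases hyz : c y = c z
  · have h1 : cellDist c D y z = 0 := if_pos hyz
    rw [h1, add_zero]
    simp only [cellDist, hyz, le_refl]
  simp only [cellDist]
  rw [if_neg hxz, if_neg hxy, if_neg hyz]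
  obtain ⟨a, ha, b, hb, hab⟩ := exists_setDist_eq ⟨_, hc x⟩ ⟨_, hc y⟩
  obtain ⟨b', hb', e, he, hbe⟩ := exists_setDist_eq ⟨_, hc y⟩ ⟨_, hc z⟩
  have h1 := setDist_le ha he
  have h2 := ldist_triangle a.1 b.1 e.1
  have h3 := ldist_triangle b.1 b'.1 e.1
  have h4 := hd y b hb b' hb'
  rw [hab, hbe]
  linarith

end CellDist

/-- Cells of bounded diameter at large mutual distance have the geometry of an elimination step. -/
theorem cellGeometry_cellDist {cl : Λ → Finset Λ} {Q P : Finset Λ} {D s n : ℝ}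
    (mem : ∀ z ∈ Q, z ∈ cl z) (sub : ∀ z ∈ Q, cl z ⊆ Q)
    (eq : ∀ z ∈ Q, ∀ w ∈ cl z, cl w = cl z) (card : ∀ z ∈ Q, ((cl z).card : ℝ) ≤ n)
    (diam : ∀ z ∈ Q, ∀ a ∈ cl z, ∀ b ∈ cl z, ldist a.1 b.1 ≤ D)
    (sepQ : ∀ z ∈ Q, ∀ w ∈ Q, cl z ≠ cl w → s ≤ ldist z.1 w.1)
    (sepP : ∀ z ∈ P, ∀ w ∈ Q, s ≤ ldist z.1 w.1) (hs : 0 < s) (hD : 0 ≤ D) :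
    CellGeometry cl Q P (cellDist (fun z => if z ∈ Q then cl z else {z}) D) D s n := by
  set c : Λ → Finset Λ := fun z => if z ∈ Q then cl z else {z} with hcdef
  have hcQ : ∀ z ∈ Q, c z = cl z := fun z hz => if_pos hz
  have hcN : ∀ z, z ∉ Q → c z = {z} := fun z hz => if_neg hz
  have hc : ∀ z, z ∈ c z := fun z => by
    by_cases hz : z ∈ Q
    · rw [hcQ z hz]; exact mem z hz
    · rw [hcN z hz]; exact Finset.mem_singleton_self z
  have hd : ∀ z, ∀ a ∈ c z, ∀ b ∈ c z, ldist a.1 b.1 ≤ D := fun z a ha b hb => by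
    by_cases hz : z ∈ Q
    · rw [hcQ z hz] at ha hb; exact diam z hz a ha b hb
    · rw [hcN z hz, Finset.mem_singleton] at ha hb
      rw [ha, hb, ldist_self]; exact hD
  exact
    { mem := mem, sub := sub, eq := eq, card := card, sepQ := sepQ, sepP := sepP, s_pos := hs
      D_nonneg := hD
      m_nonneg := cellDist_nonneg hD
      m_tri := cellDist_triangle hD hc hd
      m_zero := fun z hz w hw => if_pos (by rw [hcQ z hz, hcQ w (sub z hz hw), eq z hz w hw])
      m_self := fun z => if_pos rfl
      m_comm := cellDist_comm hc
      m_le := cellDist_le hD hc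
      le_m := ldist_le_cellDist hc fun z w hw => hd z z (hc z) w hw }

/-! ### Exponential sums over the lattice -/

theorem sum_exp_natCast_le {h : ℝ} (hh : 0 < h) (M : ℕ) :
    ∑ m ∈ Finset.range M, Real.exp (-(h * m)) ≤ 1 + 1 / h := by
  have h1 : Real.exp (-h) < 1 := by
    rw [← Real.exp_zero]; exact Real.exp_lt_exp.2 (by linarith)
  have h2 : ∀ m : ℕ, Real.exp (-(h * m)) = Real.exp (-h) ^ m := fun m => by
    rw [← Real.exp_nat_mul]; ring_nf
  simp only [h2]
  have h5 : ∑ m ∈ Finset.range M, Real.exp (-h) ^ m ≤ (1 - Real.exp (-h))⁻¹ := by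
    have := (summable_geometric_of_lt_one (Real.exp_pos (-h)).le h1).sum_le_tsum
      (Finset.range M) fun m _ => pow_nonneg (Real.exp_pos _).le m
    rwa [tsum_geometric_of_lt_one (Real.exp_pos (-h)).le h1] at this
  refine h5.trans ?_
  rw [inv_le_comm₀ (by linarith) (by positivity)]
  have h3 : Real.exp (-h) ≤ 1 / (1 + h) := by
    rw [Real.exp_neg, ← one_div]
    exact one_div_le_one_div_of_le (by linarith) (by linarith [Real.add_one_le_exp h])
  have h4 : (1 + 1 / h)⁻¹ = 1 - 1 / (1 + h) := by field_simp; ring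
  rw [h4]; linarith

theorem sum_exp_int_le {h : ℝ} (hh : 0 < h) (a : ℤ) (I : Finset ℤ) :
    ∑ n ∈ I, Real.exp (-(h * |(a : ℝ) - n|)) ≤ 2 + 2 / h := by
  set M := (I.sup fun n => (a - n).natAbs) + 1 with hM
  have hsub : I ⊆ (Finset.range M).image (fun m : ℕ => a - m) ∪
      (Finset.range M).image (fun m : ℕ => a + m) := by
    intro n hn
    have h1 : (a - n).natAbs < M := Nat.lt_succ_of_le
      (Finset.le_sup (f := fun n => (a - n).natAbs) hn)
    rw [Finset.mem_union, Finset.mem_image, Finset.mem_image]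
    rcases Int.natAbs_eq (a - n) with h2 | h2
    · exact Or.inl ⟨(a - n).natAbs, Finset.mem_range.2 h1, by omega⟩
    · exact Or.inr ⟨(a - n).natAbs, Finset.mem_range.2 h1, by omega⟩
  have hp : ∀ n : ℤ, 0 ≤ Real.exp (-(h * |(a : ℝ) - n|)) := fun n => (Real.exp_pos _).le
  refine (Finset.sum_le_sum_of_subset_of_nonneg hsub fun n _ _ => hp n).trans ?_
  have hu := Finset.sum_union_inter (s₁ := (Finset.range M).image (fun m : ℕ => a - m))
    (s₂ := (Finset.range M).image (fun m : ℕ => a + m))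
    (f := fun n : ℤ => Real.exp (-(h * |(a : ℝ) - n|)))
  have hi := Finset.sum_nonneg (s := (Finset.range M).image (fun m : ℕ => a - m) ∩
    (Finset.range M).image (fun m : ℕ => a + m)) fun n _ => hp n
  rw [Finset.sum_image (fun x _ y _ e => by simpa using e),
    Finset.sum_image (fun x _ y _ e => by simpa using e)] at hu
  have e1 : ∀ m : ℕ, |(a : ℝ) - ((a - m : ℤ) : ℝ)| = m := fun m => by
    push_cast; rw [sub_sub_cancel, abs_of_nonneg (Nat.cast_nonneg m)]
  have e2 : ∀ m : ℕ, |(a : ℝ) - ((a + m : ℤ) : ℝ)| = m := fun m => by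
    push_cast; rw [sub_add_cancel_left, abs_neg, abs_of_nonneg (Nat.cast_nonneg m)]
  simp only [e1, e2] at hu
  have h1 := sum_exp_natCast_le hh M
  have h2 : 2 + 2 / h = (1 + 1 / h) + (1 + 1 / h) := by ring
  linarith

theorem sum_exp_ldist_le {h : ℝ} (hh : 0 < h) (x : Fin d → ℤ) (S : Finset (Fin d → ℤ)) :
    ∑ z ∈ S, Real.exp (-(h * ldist x z)) ≤ (2 + 2 / h) ^ d := by
  have hsub : S ⊆ Fintype.piFinset fun i => S.image fun z => z i := fun z hz =>
    Fintype.mem_piFinset.2 fun i => Finset.mem_image_of_mem _ hz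
  refine (Finset.sum_le_sum_of_subset_of_nonneg hsub fun n _ _ => (Real.exp_pos _).le).trans ?_
  have e : ∀ z : Fin d → ℤ, Real.exp (-(h * ldist x z)) =
      ∏ i, Real.exp (-(h * |(x i : ℝ) - z i|)) := fun z => by
    rw [← Real.exp_sum, ldist, Finset.mul_sum, Finset.sum_neg_distrib]
  simp only [e]
  rw [← Finset.prod_univ_sum (fun i => S.image fun z => z i)
    (fun i (n : ℤ) => Real.exp (-(h * |(x i : ℝ) - n|)))]
  refine (Finset.prod_le_prod (fun i _ => Finset.sum_nonneg fun n _ => (Real.exp_pos _).le)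
    fun i _ => sum_exp_int_le hh (x i) _).trans ?_
  simp

theorem sum_exp_pos_le {h : ℝ} (hh : 0 < h) (x : Λ) (S : Finset Λ) :
    ∑ z ∈ S, Real.exp (-(h * ldist x.1 z.1)) ≤ (2 + 2 / h) ^ d := by
  refine le_trans (le_of_eq ?_) (sum_exp_ldist_le hh x.1 (S.image Subtype.val))
  rw [Finset.sum_image fun a _ b _ e => Subtype.ext e]

theorem sum_exp_site_le {h : ℝ} (hh : 0 < h) (a : Site Λ) :
    ∑ b : Site Λ, Real.exp (-(h * ldist a.1.1 b.1.1)) ≤ 2 * (2 + 2 / h) ^ d := by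
  rw [Fintype.sum_prod_type]
  simp only [Finset.sum_const, Finset.card_univ, Fintype.card_fin, nsmul_eq_mul, Nat.cast_ofNat]
  rw [← Finset.mul_sum]
  exact mul_le_mul_of_nonneg_left (sum_exp_pos_le hh a.1 Finset.univ) zero_le_two

/-! ### Inverses of blocks with a spectral gap -/

/-- The Schur test: by Cauchy–Schwarz and symmetry, the row sums bound the operator norm on ℓ². -/
theorem dotProduct_mulVec_le {ι : Type*} [Fintype ι] {p : ℝ} (hp : 0 ≤ p) {A : Matrix ι ι ℝ}
    (hA : ∀ a b, A a b = A b a) (hr : ∀ a, ∑ b, |A a b| ≤ p) (v : ι → ℝ) :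
    ∑ a, (A.mulVec v a) ^ 2 ≤ p ^ 2 * ∑ a, v a ^ 2 := by
  calc ∑ a, (A.mulVec v a) ^ 2 ≤ ∑ a, p * ∑ b, |A a b| * v b ^ 2 := by
        refine Finset.sum_le_sum fun a _ => ?_
        have h1 : (∑ b, A a b * v b) ^ 2 ≤ (∑ b, |A a b|) * ∑ b, |A a b| * v b ^ 2 := by
          refine Finset.sum_sq_le_sum_mul_sum_of_sq_le_mul _ (fun _ _ => abs_nonneg _)
            (fun _ _ => by positivity) fun b _ => ?_
          rw [mul_pow, ← sq_abs (A a b)]; exact le_of_eq (by ring)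
        exact h1.trans (mul_le_mul_of_nonneg_right (hr a)
          (Finset.sum_nonneg fun _ _ => by positivity))
    _ = p * ∑ b, (∑ a, |A b a|) * v b ^ 2 := by
        rw [← Finset.mul_sum, Finset.sum_comm]
        congr 1
        refine Finset.sum_congr rfl fun b _ => ?_
        rw [Finset.sum_mul]
        exact Finset.sum_congr rfl fun a _ => by rw [hA]
    _ ≤ p * ∑ b, p * v b ^ 2 := by
        refine mul_le_mul_of_nonneg_left (Finset.sum_le_sum fun b _ => ?_) hp
        exact mul_le_mul_of_nonneg_right (hr b) (sq_nonneg _)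
    _ = _ := by rw [← Finset.mul_sum]; ring

/-- Expand in an orthonormal basis of eigenvectors, on which `A - E` acts by factors of modulus at
least `e`. -/
theorem le_mulVec_of_spectrum {ι : Type*} [Fintype ι] [DecidableEq ι] {A : Matrix ι ι ℝ}
    (hA : A.IsHermitian) {E e : ℝ} (he : 0 ≤ e) (hs : ∀ μ ∈ spectrum ℝ A, e ≤ |μ - E|)
    (v : ι → ℝ) :
    e ^ 2 * ∑ a, v a ^ 2 ≤ ∑ a, ((A - E • (1 : Matrix ι ι ℝ)).mulVec v a) ^ 2 := by
  set w : EuclideanSpace ℝ ι := WithLp.toLp 2 v with hw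
  set y : EuclideanSpace ℝ ι := WithLp.toLp 2 ((A - E • (1 : Matrix ι ι ℝ)).mulVec v) with hy
  have e1 : ∑ a, v a ^ 2 = ∑ i, inner ℝ (hA.eigenvectorBasis i) w ^ 2 := by
    have h1 := hA.eigenvectorBasis.sum_sq_norm_inner_right w
    rw [EuclideanSpace.norm_sq_eq] at h1
    simp only [Real.norm_eq_abs, sq_abs] at h1
    exact h1.symm
  have e2 : ∑ a, ((A - E • (1 : Matrix ι ι ℝ)).mulVec v a) ^ 2 =
      ∑ i, inner ℝ (hA.eigenvectorBasis i) y ^ 2 := by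
    have h1 := hA.eigenvectorBasis.sum_sq_norm_inner_right y
    rw [EuclideanSpace.norm_sq_eq] at h1
    simp only [Real.norm_eq_abs, sq_abs] at h1
    exact h1.symm
  have hAt : A.transpose = A := by
    have := hA.eq
    rwa [Matrix.conjTranspose_eq_transpose_of_trivial] at this
  have e3 : ∀ i, inner ℝ (hA.eigenvectorBasis i) y =
      (hA.eigenvalues i - E) * inner ℝ (hA.eigenvectorBasis i) w := by
    intro i
    have h1 := hA.mulVec_eigenvectorBasis i
    have h3 : ∀ f g : EuclideanSpace ℝ ι, inner ℝ f g = (f : ι → ℝ) ⬝ᵥ (g : ι → ℝ) := fun f g => by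
      rw [EuclideanSpace.inner_eq_star_dotProduct, dotProduct_comm]; simp
    rw [h3, h3]
    change (hA.eigenvectorBasis i : ι → ℝ) ⬝ᵥ ((A - E • (1 : Matrix ι ι ℝ)).mulVec v) = _ *
      ((hA.eigenvectorBasis i : ι → ℝ) ⬝ᵥ v)
    rw [Matrix.sub_mulVec, dotProduct_sub, Matrix.dotProduct_mulVec, ← Matrix.mulVec_transpose,
      hAt, h1, Matrix.smul_mulVec, Matrix.one_mulVec, smul_dotProduct, dotProduct_smul]
    simp only [smul_eq_mul]
    ring
  rw [e1, e2, Finset.mul_sum]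
  refine Finset.sum_le_sum fun i _ => ?_
  rw [e3, mul_pow]
  refine mul_le_mul_of_nonneg_right ?_ (sq_nonneg _)
  have h1 := hs _ (hA.eigenvalues_mem_spectrum_real i)
  rw [← sq_abs (hA.eigenvalues i - E)]
  gcongr

/-- A small perturbation of a symmetric matrix with a spectral gap has a bounded inverse. -/
theorem exists_inverse_of_gap {ι : Type*} [Fintype ι] [DecidableEq ι] {A T : Matrix ι ι ℝ}
    (hA : A.IsHermitian) {E e : ℝ} (he : 0 < e) (hs : ∀ μ ∈ spectrum ℝ A, e ≤ |μ - E|)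
    (hT : ∀ a b, T a b = T b a) (hr : ∀ a, ∑ b, |T a b| ≤ e / 2) :
    ∃ U : Matrix ι ι ℝ, (A - E • (1 : Matrix ι ι ℝ) + T) * U = 1 ∧ ∀ a b, |U a b| ≤ 2 / e := by
  set M := A - E • (1 : Matrix ι ι ℝ) + T with hM
  -- The gap `e` of `A - E` minus the norm `e / 2` of `T` is a lower bound for `M` on ℓ². It yields
  -- injectivity, hence invertibility, and applied to the columns of the inverse it bounds their
  -- entries.
  have key : ∀ v : ι → ℝ, (e / 2) ^ 2 * ∑ a, v a ^ 2 ≤ ∑ a, (M.mulVec v a) ^ 2 := by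
    intro v
    set n := √(∑ a, v a ^ 2) with hn
    have h0 : 0 ≤ ∑ a, v a ^ 2 := Finset.sum_nonneg fun _ _ => sq_nonneg _
    have hnn : n ^ 2 = ∑ a, v a ^ 2 := Real.sq_sqrt h0
    have hN : ∀ f : ι → ℝ, ‖(WithLp.toLp 2 f : EuclideanSpace ℝ ι)‖ ^ 2 = ∑ a, f a ^ 2 := fun f => by
      rw [EuclideanSpace.norm_sq_eq]; simp
    have h1 := le_mulVec_of_spectrum hA he.le hs v
    have h2 := dotProduct_mulVec_le (by positivity) hT hr v
    rw [← hN, ← hN] at h1 h2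
    rw [← hN]
    have h3 : (WithLp.toLp 2 (M.mulVec v) : EuclideanSpace ℝ ι) =
        WithLp.toLp 2 ((A - E • (1 : Matrix ι ι ℝ)).mulVec v) + WithLp.toLp 2 (T.mulVec v) := by
      rw [hM, Matrix.add_mulVec]; rfl
    rw [← hN (M.mulVec v), h3]
    set x := (WithLp.toLp 2 ((A - E • (1 : Matrix ι ι ℝ)).mulVec v) : EuclideanSpace ℝ ι)
    set y := (WithLp.toLp 2 (T.mulVec v) : EuclideanSpace ℝ ι)
    set w := (WithLp.toLp 2 v : EuclideanSpace ℝ ι)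
    have h4 : e * ‖w‖ ≤ ‖x‖ := by
      refine le_of_sq_le_sq ?_ (norm_nonneg _); rw [mul_pow]; exact h1
    have h5 : ‖y‖ ≤ e / 2 * ‖w‖ := by
      refine le_of_sq_le_sq ?_ (by positivity); rw [mul_pow]; exact h2
    have h6 : ‖x‖ ≤ ‖x + y‖ + ‖y‖ := by
      have := norm_sub_le (x + y) y
      rwa [add_sub_cancel_right] at this
    rw [← mul_pow]
    have h7 : e / 2 * ‖w‖ ≤ ‖x + y‖ := by linarith
    gcongr
  have hu : IsUnit M := by
    rw [← Matrix.mulVec_injective_iff_isUnit]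
    intro v w hvw
    have h1 := key (v - w)
    rw [Matrix.mulVec_sub, hvw, sub_self] at h1
    simp only [Pi.zero_apply, ne_eq, OfNat.ofNat_ne_zero, not_false_eq_true, zero_pow,
      Finset.sum_const_zero] at h1
    have h2 : ∑ a, (v - w) a ^ 2 = 0 := le_antisymm
      (nonpos_of_mul_nonpos_right h1 (by positivity)) (Finset.sum_nonneg fun _ _ => sq_nonneg _)
    rw [Finset.sum_eq_zero_iff_of_nonneg fun _ _ => sq_nonneg _] at h2
    ext a
    have := h2 a (Finset.mem_univ a)
    simpa [sub_eq_zero] using this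
  have hdet := (Matrix.isUnit_iff_isUnit_det M).1 hu
  refine ⟨M⁻¹, Matrix.mul_nonsing_inv _ hdet, fun a b => ?_⟩
  have h1 := key (M⁻¹.mulVec (Pi.single b 1))
  rw [Matrix.mulVec_mulVec, Matrix.mul_nonsing_inv _ hdet, Matrix.one_mulVec] at h1
  have h2 : ∑ a, (Pi.single b 1 : ι → ℝ) a ^ 2 = 1 := by
    rw [Finset.sum_eq_single b] <;> simp +contextual
  rw [h2, Matrix.mulVec_single_one] at h1
  have h3 : M⁻¹ a b ^ 2 ≤ ∑ a, M⁻¹.col b a ^ 2 :=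
    Finset.single_le_sum (f := fun a => M⁻¹.col b a ^ 2) (fun _ _ => sq_nonneg _)
      (Finset.mem_univ a)
  refine abs_le_of_sq_le_sq ?_ (by positivity)
  have h4 : (e / 2) ^ 2 * M⁻¹ a b ^ 2 ≤ 1 :=
    (mul_le_mul_of_nonneg_left h3 (by positivity)).trans h1
  rw [div_pow, le_div_iff₀ (by positivity)]
  nlinarith

/-! ### Rates of the elimination steps -/

/-- The decay rates, in units of `log (1 / γ)`. -/
def rate : ℕ → ℝ
  | 0 => 9 / 10
  | j + 1 => 57 / 100 * (82 / 100) ^ j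

/-- The gains, in units of `log (1 / γ)`. -/
def gain : ℕ → ℝ
  | 0 => 1 / 10
  | j + 1 => rate (j + 1) * 2 ^ j

/-- The minimal distance of different cells. -/
def cellSep : ℕ → ℝ
  | 0 => 1
  | j + 1 => 4 * 2 ^ (j + 1)

/-- The maximal diameter of a cell. -/
def cellDiam : ℕ → ℝ
  | 0 => 0
  | j + 1 => 2 ^ (j + 1)

/-- The loss of rate that is used to sum over the lattice. -/
def rateLoss (j : ℕ) : ℝ := (rate j - rate (j + 1)) / 100

/-- The cost of a resolvent, in units of `log (1 / γ)`. -/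
def cost (j : ℕ) : ℝ := ((2 : ℝ) ^ j) ^ (2 / 3 : ℝ) / 4

/-- A bound on the sums over the lattice. -/
def latticeSum (d j : ℕ) : ℝ := 2 * 2 ^ ((j + 11) * d)

theorem rate_pos (j : ℕ) : 0 < rate j := by
  cases j <;> simp only [rate] <;> positivity

theorem rateLoss_lower (j : ℕ) : 1 / 1000 * (1 / 2) ^ j ≤ rateLoss j := by
  cases j with
  | zero => norm_num [rateLoss, rate]
  | succ j =>
    have h1 : (1 / 2 : ℝ) ^ j ≤ (82 / 100) ^ j :=
      pow_le_pow_left₀ (by norm_num) (by norm_num) j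
    have h2 : (0 : ℝ) < (1 / 2) ^ j := by positivity
    simp only [rateLoss, rate, pow_succ]
    linarith

theorem rateLoss_pos (j : ℕ) : 0 < rateLoss j :=
  lt_of_lt_of_le (by positivity) (rateLoss_lower j)

theorem rate_succ_le (j : ℕ) : rate (j + 1) + rateLoss j ≤ rate j := by
  have := rateLoss_pos j
  have h2 : rateLoss j = (rate j - rate (j + 1)) / 100 := rfl
  linarith

theorem cost_succ_le (j : ℕ) : cost (j + 1) ≤ 15875 / 40000 * (15875 / 10000) ^ j := by
  have h1 : (2 : ℝ) ^ (2 / 3 : ℝ) ≤ 15875 / 10000 := by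
    have h2 : ((2 : ℝ) ^ (2 / 3 : ℝ)) ^ 3 = 4 := by
      rw [← Real.rpow_natCast, ← Real.rpow_mul (by norm_num)]; norm_num
    refine le_of_pow_le_pow_left₀ (n := 3) (by norm_num) (by norm_num) ?_
    rw [h2]; norm_num
  have h3 : ((2 : ℝ) ^ (j + 1)) ^ (2 / 3 : ℝ) = ((2 : ℝ) ^ (2 / 3 : ℝ)) ^ (j + 1) := by
    rw [← Real.rpow_natCast, ← Real.rpow_mul (by norm_num), mul_comm, Real.rpow_mul (by norm_num),
      Real.rpow_natCast]
  have h4 : ((2 : ℝ) ^ (2 / 3 : ℝ)) ^ (j + 1) ≤ (15875 / 10000) ^ (j + 1) := by gcongr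
  rw [cost, h3]
  rw [pow_succ (15875 / 10000 : ℝ)] at h4
  linarith

/-- The exponent of the coupling between the blocks. -/
def legExp (j : ℕ) : ℝ := (rate j - rate (j + 1) - rateLoss j) * cellSep j + gain j

/-- The reason for the factor 82/100 in `rate`: twice this number is 1.64 and exceeds 2^(2/3) <
1.5875. Rate times length thus grows faster with the scale than the exponent of the resolvent, and a
surplus of order 1.5^j remains for the prefactors. -/
theorem pow_scale (j : ℕ) : (15 / 10 : ℝ) ^ j ≤ (15875 / 10000) ^ j ∧
    (15875 / 10000 : ℝ) ^ j ≤ (82 / 100) ^ j * 2 ^ j ∧ (0 : ℝ) < (15 / 10) ^ j := by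
  rw [← mul_pow]
  exact ⟨pow_le_pow_left₀ (by norm_num) (by norm_num) j,
    pow_le_pow_left₀ (by norm_num) (by norm_num) j, by positivity⟩

/-- One leg beats one resolvent and the crossing of one cell. -/
theorem legExp_ge (j : ℕ) :
    3 / 100 * (15 / 10) ^ j ≤ legExp j - rate (j + 1) * cellDiam j - cost j := by
  cases j with
  | zero => norm_num [legExp, rate, cellSep, gain, cellDiam, cost, rateLoss]
  | succ j =>
    obtain ⟨h1, h2, h3⟩ := pow_scale j
    have h4 := cost_succ_le j
    have e : legExp (j + 1) - rate (j + 1 + 1) * cellDiam (j + 1) =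
        (57 / 100 * ((18 / 100 * (99 / 100)) * 8 + 1 - 82 / 100 * 2)) *
          ((82 / 100) ^ j * 2 ^ j) := by
      simp only [legExp, rate, cellSep, gain, cellDiam, rateLoss, pow_succ]; ring
    rw [e, pow_succ]
    linarith

/-- A multigraph that leaves the neighbourhood of a cell, of radius `2 ^ j / 4`, and returns to the
cell beats one resolvent. -/
theorem loop_ge (j : ℕ) : 3 / 100 * (15 / 10) ^ j ≤ rate j * (2 * (2 ^ j / 4)) - cost j := by
  cases j with
  | zero => norm_num [rate, cost]
  | succ j =>
    obtain ⟨h1, h2, h3⟩ := pow_scale j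
    have h4 := cost_succ_le j
    have e : rate (j + 1) * (2 * (2 ^ (j + 1) / 4)) = 57 / 100 * ((82 / 100) ^ j * 2 ^ j) := by
      simp only [rate, pow_succ]; ring
    rw [e, pow_succ]
    linarith

/-- Two legs beat a resolvent, the crossing of a cell and the gain that is required in the next
step. -/
theorem two_legExp_ge (j : ℕ) : 3 / 100 * (15 / 10) ^ j ≤
    2 * legExp j - rate (j + 1) * cellDiam j - cost j - gain (j + 1) := by
  cases j with
  | zero => norm_num [legExp, rate, cellSep, gain, cellDiam, cost, rateLoss]
  | succ j =>
    obtain ⟨h1, h2, h3⟩ := pow_scale j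
    have h4 := cost_succ_le j
    have e : 2 * legExp (j + 1) - rate (j + 1 + 1) * cellDiam (j + 1) - gain (j + 1 + 1) =
        (57 / 100 * (2 * ((18 / 100 * (99 / 100)) * 8 + 1) - 82 / 100 * 2 - 82 / 100 * 2)) *
          ((82 / 100) ^ j * 2 ^ j) := by
      simp only [legExp, rate, cellSep, gain, cellDiam, rateLoss, pow_succ]; ring
    rw [show 2 * legExp (j + 1) - rate (j + 1 + 1) * cellDiam (j + 1) - cost (j + 1) -
      gain (j + 1 + 1) = 2 * legExp (j + 1) - rate (j + 1 + 1) * cellDiam (j + 1) -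
      gain (j + 1 + 1) - cost (j + 1) by ring, e, pow_succ]
    linarith

/-- At the larger separation of step `j + 1`, the drop of the rate pays for the larger gain. -/
theorem far_ge (j : ℕ) : 3 / 100 * (15 / 10) ^ j ≤
    (rate j - rate (j + 1)) * cellSep (j + 1) + gain j - gain (j + 1) := by
  cases j with
  | zero => norm_num [rate, cellSep, gain]
  | succ j =>
    obtain ⟨h1, h2, h3⟩ := pow_scale j
    have e : (rate (j + 1) - rate (j + 1 + 1)) * cellSep (j + 1 + 1) + gain (j + 1) -
        gain (j + 1 + 1) = (57 / 100 * (18 / 100 * 16 + 1 - 82 / 100 * 2)) *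
          ((82 / 100) ^ j * 2 ^ j) := by
      simp only [rate, cellSep, gain, pow_succ]; ring
    rw [e, pow_succ]
    linarith

theorem mid_ge (j : ℕ) :
    rate (j + 1) * cellDiam j ≤ (rate j - rate (j + 1)) * cellSep j + gain j := by
  cases j with
  | zero => norm_num [rate, cellSep, gain, cellDiam]
  | succ j =>
    obtain ⟨h1, h2, h3⟩ := pow_scale j
    have e : (rate (j + 1) - rate (j + 1 + 1)) * cellSep (j + 1) + gain (j + 1) -
        rate (j + 1 + 1) * cellDiam (j + 1) = (57 / 100 * (18 / 100 * 8 + 1 - 82 / 100 * 2)) *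
          ((82 / 100) ^ j * 2 ^ j) := by
      simp only [rate, cellSep, gain, cellDiam, pow_succ]; ring
    nlinarith

/-- The numerical smallness of the couplings in step `j + 1`. -/
structure StepSmall (d : ℕ) (G : ℝ) (j : ℕ) : Prop where
  pref : 512 * (2 ^ j) ^ 2 * latticeSum d j ^ 2 * 2 ^ (j + 1) *
    Real.exp (-(G * (3 / 100 * (15 / 10) ^ j))) ≤ 1
  sum : 2 * (2 + 2 / (G * rateLoss j)) ^ d ≤ latticeSum d j
  one_le : 1 ≤ G

/-- The prefactors are exponential in `j`, whereas the small factor is the exponential of `-G` times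
a multiple of 1.5^j. Bernoulli's inequality for 1.5^j already suffices, so that one `G` serves all
steps. -/
theorem exists_stepSmall (d : ℕ) : ∃ G₀ : ℝ, 1 ≤ G₀ ∧ ∀ G, G₀ ≤ G → ∀ j, StepSmall d G j := by
  set K : ℝ := 12 + 22 * d with hK
  refine ⟨max 1 (100 * K), le_max_left _ _, fun G hG j => ?_⟩
  have hG1 : 1 ≤ G := (le_max_left _ _).trans hG
  have hGK : 100 * K ≤ G := (le_max_right _ _).trans hG
  have hK0 : 0 < K := by positivity
  refine ⟨?_, ?_, hG1⟩
  · have e : (512 : ℝ) * (2 ^ j) ^ 2 * latticeSum d j ^ 2 * 2 ^ (j + 1) =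
        2 ^ (12 + 3 * j + 2 * ((j + 11) * d)) := by
      rw [latticeSum, mul_pow, ← pow_mul, ← pow_mul, show (512 : ℝ) = 2 ^ 9 by norm_num, pow_add,
        pow_add, pow_add, show (2 : ℝ) ^ (2 * ((j + 11) * d)) = 2 ^ ((j + 11) * d * 2) by ring_nf,
        show (3 * j) = j * 2 + j by ring, pow_add]
      ring
    rw [e, Real.exp_neg, ← div_eq_mul_inv, div_le_one (Real.exp_pos _)]
    have h1 : (2 : ℝ) ^ (12 + 3 * j + 2 * ((j + 11) * d)) ≤
        Real.exp ((12 + 3 * j + 2 * ((j + 11) * d) : ℕ)) := by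
      rw [← Real.exp_one_pow]
      have : (2 : ℝ) ≤ Real.exp 1 := by linarith [Real.add_one_le_exp (1 : ℝ)]
      gcongr
    refine h1.trans (Real.exp_le_exp.2 ?_)
    have h2 : 1 + (j : ℝ) * (1 / 2) ≤ (15 / 10) ^ j := by
      have := one_add_mul_le_pow (show (-2 : ℝ) ≤ 1 / 2 by norm_num) j
      norm_num at this ⊢
      linarith
    have h3 : 100 * K * (3 / 100 * (1 + (j : ℝ) * (1 / 2))) ≤ G * (3 / 100 * (15 / 10) ^ j) := by
      gcongr
    refine le_trans ?_ h3
    push_cast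
    have h4 : (0 : ℝ) ≤ j * d := by positivity
    have h5 : (0 : ℝ) ≤ d := by positivity
    have h6 : (0 : ℝ) ≤ j := by positivity
    rw [hK]
    nlinarith
  · have h1 := rateLoss_lower j
    have h2 : 1 / 1000 * (1 / 2) ^ j ≤ G * rateLoss j :=
      h1.trans (le_mul_of_one_le_left (rateLoss_pos j).le hG1)
    have h3 : 2 + 2 / (G * rateLoss j) ≤ 2 ^ (j + 11) := by
      have h4 : 2 / (G * rateLoss j) ≤ 2 / (1 / 1000 * (1 / 2) ^ j) := by
        gcongr
      have h5 : (2 : ℝ) / (1 / 1000 * (1 / 2) ^ j) = 2000 * 2 ^ j := by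
        rw [one_div_pow]; field_simp; norm_num
      have h6 : (1 : ℝ) ≤ 2 ^ j := one_le_pow₀ (by norm_num)
      rw [pow_add]
      norm_num
      linarith
    rw [latticeSum, pow_mul]
    have h4 : 0 ≤ 2 + 2 / (G * rateLoss j) := by
      have := rateLoss_pos j
      positivity
    gcongr

theorem one_le_latticeSum (d j : ℕ) : 1 ≤ latticeSum d j := by
  have : (1 : ℝ) ≤ 2 ^ ((j + 11) * d) := one_le_pow₀ (by norm_num)
  rw [latticeSum]; linarith

/-! ### Numerical size of the couplings of one step. -/

section

variable {G : ℝ} {j : ℕ}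

/-- The bound on the inverses of the cells. -/
def cellInv (G : ℝ) (j : ℕ) : ℝ := 4 * 2 ^ j * Real.exp (G * cost j)

/-- All estimates of a step are brought into one form: a prefactor dominated by the common one of
`pref`, times an exponential with at least the common surplus. -/
theorem StepSmall.pref_le (hs : StepSmall d G j) {a b : ℝ}
    (hab : a ≤ 512 * (2 ^ j) ^ 2 * latticeSum d j ^ 2 * 2 ^ (j + 1) * b) {e : ℝ}
    (he : 3 / 100 * (15 / 10) ^ j ≤ e) (hb : 0 ≤ b) : a * Real.exp (-(G * e)) ≤ b := by
  have h1 : Real.exp (-(G * e)) ≤ Real.exp (-(G * (3 / 100 * (15 / 10) ^ j))) := by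
    refine Real.exp_le_exp.2 (neg_le_neg ?_)
    have := hs.one_le
    gcongr
  calc a * Real.exp (-(G * e)) ≤ (512 * (2 ^ j) ^ 2 * latticeSum d j ^ 2 * 2 ^ (j + 1) * b) *
        Real.exp (-(G * (3 / 100 * (15 / 10) ^ j))) := by gcongr
    _ = b * (512 * (2 ^ j) ^ 2 * latticeSum d j ^ 2 * 2 ^ (j + 1) *
        Real.exp (-(G * (3 / 100 * (15 / 10) ^ j)))) := by ring
    _ ≤ b * 1 := mul_le_mul_of_nonneg_left hs.pref hb
    _ = b := mul_one b

/-- The legs of step `j + 1`. -/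
def leg (d : ℕ) (G : ℝ) (j : ℕ) : ℝ :=
  legBound (G * rate j) (G * rate (j + 1)) (G * rateLoss j) (cellSep j) (G * gain j)
    (latticeSum d j)

theorem leg_eq (d : ℕ) (G : ℝ) (j : ℕ) :
    leg d G j = latticeSum d j * Real.exp (-(G * legExp j)) := by
  rw [leg, legBound, legExp]; ring_nf

theorem leg_nonneg (d : ℕ) (G : ℝ) (j : ℕ) : 0 ≤ leg d G j := by
  rw [leg_eq]
  have := one_le_latticeSum d j
  positivity

/-- The factor of a passage through a leg, an inverse and a cell is summable in `j`, so that the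
constants in `LevelBounds` stay bounded uniformly in the step. -/
theorem StepSmall.A_le (hs : StepSmall d G j) :
    leg d G j * (2 * cellInv G j) * Real.exp (G * rate (j + 1) * cellDiam j) ≤
      (1 / 2) ^ (j + 1) / 64 := by
  have e : leg d G j * (2 * cellInv G j) * Real.exp (G * rate (j + 1) * cellDiam j) =
      (8 * 2 ^ j * latticeSum d j) *
        Real.exp (-(G * (legExp j - rate (j + 1) * cellDiam j - cost j))) := by
    rw [show -(G * (legExp j - rate (j + 1) * cellDiam j - cost j)) =
      -(G * legExp j) + G * cost j + G * rate (j + 1) * cellDiam j by ring, Real.exp_add,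
      Real.exp_add, leg_eq, cellInv]
    ring
  have h1 := one_le_latticeSum d j
  have h2 : (1 : ℝ) ≤ 2 ^ j := one_le_pow₀ (by norm_num)
  rw [e]
  refine hs.pref_le ?_ (legExp_ge j) (by positivity)
  have h3 : (2 : ℝ) ^ (j + 1) * (1 / 2) ^ (j + 1) = 1 := by rw [← mul_pow]; norm_num
  calc 8 * 2 ^ j * latticeSum d j ≤ 8 * (2 ^ j) ^ 2 * latticeSum d j ^ 2 := by
        gcongr
        · nlinarith
        · nlinarith
    _ = 512 * (2 ^ j) ^ 2 * latticeSum d j ^ 2 * (2 ^ (j + 1) * (1 / 2) ^ (j + 1)) / 64 := by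
        rw [h3]; ring
    _ = _ := by ring

theorem StepSmall.loop_le (hs : StepSmall d G j) :
    cellInv G j * (2 * 2 ^ j * Real.exp (-(G * rate j * (2 * (2 ^ j / 4))))) ≤ 1 / 4 := by
  have e : cellInv G j * (2 * 2 ^ j * Real.exp (-(G * rate j * (2 * (2 ^ j / 4))))) =
      (8 * (2 ^ j) ^ 2) * Real.exp (-(G * (rate j * (2 * (2 ^ j / 4)) - cost j))) := by
    rw [show -(G * (rate j * (2 * (2 ^ j / 4)) - cost j)) =
      -(G * rate j * (2 * (2 ^ j / 4))) + G * cost j by ring, Real.exp_add, cellInv]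
    ring
  have h1 := one_le_latticeSum d j
  have h2 : (1 : ℝ) ≤ 2 ^ (j + 1) := one_le_pow₀ (by norm_num)
  rw [e]
  refine hs.pref_le ?_ (loop_ge j) (by positivity)
  calc 8 * ((2 : ℝ) ^ j) ^ 2 = 8 * (2 ^ j) ^ 2 * 1 * 1 := by ring
    _ ≤ 128 * (2 ^ j) ^ 2 * latticeSum d j ^ 2 * 2 ^ (j + 1) := by
      gcongr
      · norm_num
      · nlinarith
    _ = _ := by ring

theorem StepSmall.corr_le (hs : StepSmall d G j) :
    leg d G j * (2 * cellInv G j) * Real.exp (G * rate (j + 1) * cellDiam j) * leg d G j ≤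
      Real.exp (-(G * gain (j + 1))) / 2 := by
  have e : leg d G j * (2 * cellInv G j) * Real.exp (G * rate (j + 1) * cellDiam j) * leg d G j =
      (8 * 2 ^ j * latticeSum d j ^ 2) * Real.exp (-(G * (2 * legExp j - rate (j + 1) *
        cellDiam j - cost j - gain (j + 1)))) * Real.exp (-(G * gain (j + 1))) := by
    rw [mul_assoc (8 * 2 ^ j * latticeSum d j ^ 2), ← Real.exp_add,
      show -(G * (2 * legExp j - rate (j + 1) * cellDiam j - cost j - gain (j + 1))) +
        -(G * gain (j + 1)) = -(G * legExp j) + -(G * legExp j) + G * cost j +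
          G * rate (j + 1) * cellDiam j by ring, Real.exp_add,
      Real.exp_add, Real.exp_add, leg_eq, cellInv]
    ring
  have h1 := one_le_latticeSum d j
  have h2 : (1 : ℝ) ≤ 2 ^ j := one_le_pow₀ (by norm_num)
  have h3 : (1 : ℝ) ≤ 2 ^ (j + 1) := one_le_pow₀ (by norm_num)
  rw [e, mul_comm, div_eq_mul_inv]
  refine mul_le_mul_of_nonneg_left ?_ (Real.exp_pos _).le
  refine hs.pref_le ?_ (two_legExp_ge j) (by positivity)
  calc 8 * 2 ^ j * latticeSum d j ^ 2 ≤ 8 * (2 ^ j) ^ 2 * latticeSum d j ^ 2 * 1 := by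
        rw [mul_one]
        gcongr
        nlinarith
    _ ≤ 256 * (2 ^ j) ^ 2 * latticeSum d j ^ 2 * 2 ^ (j + 1) := by
        gcongr
        norm_num
    _ = _ := by ring

/-- The old kernel uses up half of the bound of the next step; the other half is left for the
correction, see `StepSmall.corr_le`. -/
theorem StepSmall.far_le (hs : StepSmall d G j) {ℓ : ℝ} (hℓ : cellSep (j + 1) ≤ ℓ) :
    Real.exp (-(G * rate j * ℓ + G * gain j)) ≤
      Real.exp (-(G * rate (j + 1) * ℓ + G * gain (j + 1))) / 2 := by
  have h0 := hs.one_le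
  have h1 : -(G * rate j * ℓ + G * gain j) ≤ -(G * rate (j + 1) * ℓ + G * gain (j + 1)) +
      -(G * ((rate j - rate (j + 1)) * cellSep (j + 1) + gain j - gain (j + 1))) := by
    have h2 : G * ((rate j - rate (j + 1)) * cellSep (j + 1)) ≤
        G * ((rate j - rate (j + 1)) * ℓ) := by
      have := rate_succ_le j
      have := rateLoss_pos j
      gcongr
      linarith
    nlinarith
  refine (Real.exp_le_exp.2 h1).trans ?_
  rw [Real.exp_add, div_eq_mul_inv]
  refine mul_le_mul_of_nonneg_left ?_ (Real.exp_pos _).le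
  rw [← one_mul (Real.exp (-(G * _)))]
  refine hs.pref_le ?_ (far_ge j) (by norm_num)
  have h1 := one_le_latticeSum d j
  have h2 : (1 : ℝ) ≤ (2 ^ j) ^ 2 := one_le_pow₀ (one_le_pow₀ (by norm_num))
  have h3 : (1 : ℝ) ≤ 2 ^ (j + 1) := one_le_pow₀ (by norm_num)
  calc (1 : ℝ) = 1 * 1 * 1 * 1 := by ring
    _ ≤ 256 * (2 ^ j) ^ 2 * latticeSum d j ^ 2 * 2 ^ (j + 1) := by
      gcongr
      · norm_num
      · nlinarith
    _ = _ := by ring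

end

/-! ### Bounds on the Schur complements -/

/-- The energies at which the first `j` resonant sets control the Schur complements. -/
def InWindow (ε : ℝ) (E : ℕ → ℝ) (j : ℕ) (lam : ℝ) : Prop :=
  ∀ i, 1 ≤ i → i ≤ j → |lam - E i| ≤ 2 / 5 * epsAt ε i

/-- The properties of the blocks of `R j \ R (j + 1)`. -/
structure ElimData (ε : ℝ) (u : Λ → ℝ) (E : ℕ → ℝ) (R : ℕ → Finset Λ) (j : ℕ) : Prop where
  sub : R (j + 1) ⊆ R j
  win : InWindow ε E (j + 1) (E (j + 1))
  cell_sub : ∀ z ∈ R j \ R (j + 1), cell R j z ⊆ R j \ R (j + 1)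
  card : ∀ z ∈ R j \ R (j + 1), ((cell R j z).card : ℝ) ≤ 2 ^ j
  diam : ∀ z ∈ R j \ R (j + 1), ∀ a ∈ cell R j z, ∀ b ∈ cell R j z, ldist a.1 b.1 ≤ cellDiam j
  sep : ∀ z ∈ R j \ R (j + 1), ∀ w ∈ R j, w ∉ cell R j z → cellSep j ≤ ldist z.1 w.1
  spec : ∀ z ∈ R j \ R (j + 1), ∀ μ ∈ spectrum ℝ (truncSchur (ε ^ 4) u (E (j + 1)) R j
    (cell R j z)), epsAt ε (j + 1) ≤ |μ - E (j + 1)|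

/-- The bounds on the Schur complement of step `j`. -/
structure LevelBounds (ε G : ℝ) (u : Λ → ℝ) (E : ℕ → ℝ) (R : ℕ → Finset Λ) (j : ℕ) : Prop where
  far : ∀ lam, InWindow ε E j lam → ∀ X a b, a.1 ∈ R j → b.1 ∈ R j →
    cellSep j ≤ ldist a.1.1 b.1.1 →
    |schur (ε ^ 4) u lam R j X a b| ≤ Real.exp (-(G * rate j * ldist a.1.1 b.1.1 + G * gain j))
  loc : ∀ lam, InWindow ε E j lam → ∀ X Y, Y ⊆ X → ∀ a b, a.1 ∈ R j → b.1 ∈ R j →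
    a.1 ∈ Y → b.1 ∈ Y → ∀ r, (∀ z ∈ X, z ∉ Y → r ≤ ldist a.1.1 z.1 + ldist z.1 b.1.1) →
    |schur (ε ^ 4) u lam R j X a b - schur (ε ^ 4) u lam R j Y a b| ≤
      (1 - (1 / 2) ^ j) * Real.exp (-(G * rate j * r))
  lip : ∀ lam mu, InWindow ε E j lam → InWindow ε E j mu → ∀ X a, a.1 ∈ R j →
    ∑ b with b.1 ∈ R j, |schur (ε ^ 4) u lam R j X a b - schur (ε ^ 4) u mu R j X a b| ≤
      (1 - (1 / 2) ^ j) / 4 * |lam - mu|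
  norm : ∀ lam, InWindow ε E j lam → ∀ X a, a.1 ∈ R j →
    ∑ b with b.1 ∈ R j, |schur (ε ^ 4) u lam R j X a b - schur (ε ^ 4) u lam R 0 X a b| ≤
      (1 - (1 / 2) ^ j) / 4

theorem levelBounds_zero {ε G : ℝ} (hG : Real.exp (-G) = ε ^ 4) (u : Λ → ℝ)
    (E : ℕ → ℝ) (R : ℕ → Finset Λ) : LevelBounds ε G u E R 0 where
  far := by
    intro lam _ X a b _ _ hab
    have hpos := Real.exp_pos (-(G * rate 0 * ldist a.1.1 b.1.1 + G * gain 0))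
    change |if a.1 ∈ X ∧ b.1 ∈ X then H (ε ^ 4) u a b else 0| ≤ _
    split_ifs with hX
    swap
    · simpa using hpos.le
    have hne : a.1 ≠ b.1 := fun h => by
      rw [h, ldist_self] at hab
      norm_num [cellSep] at hab
    rw [H, if_neg hne, zero_add]
    split_ifs with h1
    · rw [mul_one, abs_of_nonneg (by positivity), ← hG, h1.1]
      refine Real.exp_le_exp.2 (neg_le_neg ?_)
      -- The hopping is γ = exp(-G) at distance 1, and `rate 0 + gain 0 = 1`.
      simp only [rate, gain]
      linarith
    · rw [mul_zero, abs_zero]; exact hpos.le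
  loc := by
    intro lam _ X Y hYX a b _ _ ha hb r _
    change |(if a.1 ∈ X ∧ b.1 ∈ X then H (ε ^ 4) u a b else 0) -
      (if a.1 ∈ Y ∧ b.1 ∈ Y then H (ε ^ 4) u a b else 0)| ≤ _
    rw [if_pos ⟨hYX ha, hYX hb⟩, if_pos ⟨ha, hb⟩]
    simp
  lip := by
    intro lam mu _ _ X a _
    have : ∀ b, schur (ε ^ 4) u lam R 0 X a b - schur (ε ^ 4) u mu R 0 X a b = 0 := fun b =>
      sub_self _
    simp [this]
  norm := by
    intro lam _ X a _
    simp

theorem LevelBounds.kernelDecay {ε G : ℝ} {u : Λ → ℝ} {E : ℕ → ℝ} {R : ℕ → Finset Λ} {j : ℕ}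
    (hb : LevelBounds ε G u E R j) {lam : ℝ} (hl : InWindow ε E j lam) :
    KernelDecay (schur (ε ^ 4) u lam R j) (R j) (G * rate j) (cellSep j) (G * gain j) where
  symm := schur_symm_apply _ _ _ _ _
  far := hb.far lam hl
  loc := fun X Y hYX a b ha hb' haY hbY r hr =>
    (hb.loc lam hl X Y hYX a b ha hb' haY hbY r hr).trans
      (mul_le_of_le_one_left (Real.exp_pos _).le (sub_le_self _ (by positivity)))

section Cell

variable {R : ℕ → Finset Λ} {j : ℕ} {z w : Λ}

theorem self_mem_cell (hz : z ∈ R j) : z ∈ cell R j z := by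
  unfold cell
  split_ifs
  · exact Finset.mem_singleton_self z
  · exact self_mem_comp hz

theorem cell_eq (hw : w ∈ cell R j z) : cell R j w = cell R j z := by
  by_cases hj : j = 0
  · simp only [cell, if_pos hj, Finset.mem_singleton] at hw ⊢
    rw [hw]
  · simp only [cell, if_neg hj] at hw ⊢
    exact comp_eq hw

theorem L_pred_eq (j : ℕ) : L ((j : ℤ) - 1) = 2 ^ j / 4 := by
  unfold L
  rw [show (j : ℤ) - 1 - 1 = j - 2 by ring, zpow_sub₀ (by norm_num), zpow_natCast]
  norm_num

theorem subset_nbhd {ℓ : ℝ} (hℓ : 0 < ℓ) (B : Finset Λ) : B ⊆ nbhd ℓ B := fun z hz =>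
  Finset.mem_filter.2 ⟨Finset.mem_univ _, z, hz, by rwa [ldist_self]⟩

theorem le_ldist_of_notMem_nbhd {ℓ : ℝ} {B : Finset Λ} {y : Λ} (hy : y ∉ nbhd ℓ B) {w : Λ}
    (hw : w ∈ B) : ℓ ≤ ldist w.1 y.1 := by
  by_contra h
  exact hy (Finset.mem_filter.2 ⟨Finset.mem_univ _, w, hw, by rw [ldist_comm]; linarith⟩)

end Cell

theorem ElimData.geometry {ε : ℝ} {u : Λ → ℝ} {E : ℕ → ℝ} {R : ℕ → Finset Λ} {j : ℕ}
    (hE : ElimData ε u E R j) : CellGeometry (cell R j) (R j \ R (j + 1)) (R (j + 1))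
      (cellDist (fun z => if z ∈ R j \ R (j + 1) then cell R j z else {z}) (cellDiam j))
      (cellDiam j) (cellSep j) (2 ^ j) := by
  have hQ : ∀ z ∈ R j \ R (j + 1), z ∈ R j := fun z hz => (Finset.mem_sdiff.1 hz).1
  refine cellGeometry_cellDist (fun z hz => self_mem_cell (hQ z hz)) hE.cell_sub
    (fun z _ w hw => cell_eq hw) hE.card hE.diam ?_ ?_ ?_ ?_
  · intro z hz w hw hne
    refine hE.sep z hz w (hQ w hw) fun h => hne (cell_eq h).symm
  · intro z hz w hw
    rw [ldist_comm]
    exact hE.sep w hw z (hE.sub hz) fun h =>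
      (Finset.mem_sdiff.1 (hE.cell_sub w hw h)).2 hz
  · cases j <;> simp only [cellSep] <;> positivity
  · cases j <;> simp only [cellDiam] <;> positivity

/-- The unperturbed part of the eliminated block is invertible. -/
theorem ElimData.exists_inverse {ε : ℝ} (hε : 0 < ε) {u : Λ → ℝ} {E : ℕ → ℝ} {R : ℕ → Finset Λ}
    {j : ℕ} (hE : ElimData ε u E R j) {c : ℝ} (hc : c ≤ 1 / 4)
    (hlip : ∀ lam mu, InWindow ε E j lam → InWindow ε E j mu → ∀ X a, a.1 ∈ R j →
      ∑ b with b.1 ∈ R j, |schur (ε ^ 4) u lam R j X a b - schur (ε ^ 4) u mu R j X a b| ≤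
      c * |lam - mu|) {lam : ℝ} (hl : InWindow ε E (j + 1) lam) :
    ∃ U : Matrix (Site Λ) (Site Λ) ℝ,
      blockPart (schur (ε ^ 4) u lam R j) (cell R j) (R j \ R (j + 1))
        (fun z => nbhd (L ((j : ℤ) - 1)) (cell R j z)) lam * U = 1 ∧
      (∀ a b, U a b ≠ 0 → a = b ∨ (a.1 ∈ R j \ R (j + 1) ∧ b.1 ∈ cell R j a.1)) ∧
      ∀ a, ∑ b, |U a b| ≤ max 1 (4 * 2 ^ j / epsAt ε (j + 1)) := by
  set Q := R j \ R (j + 1) with hQdef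
  set cl := cell R j with hcl
  set e := epsAt ε (j + 1) with he
  have he0 : 0 < e := Real.rpow_pos_of_pos hε _
  have hQ : ∀ z ∈ Q, z ∈ R j := fun z hz => (Finset.mem_sdiff.1 hz).1
  have hEw : InWindow ε E j (E (j + 1)) := fun i h1 h2 => hE.win i h1 (by omega)
  have hlw : InWindow ε E j lam := fun i h1 h2 => hl i h1 (by omega)
  have hle : |lam - E (j + 1)| ≤ 2 / 5 * e := hl (j + 1) (by omega) le_rfl
  -- Inverses are chosen for sets `C` rather than for positions, so that all positions of a cell
  -- share the same one when the pieces are put together.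
  have key : ∀ C : Finset Λ, ∃ U : Matrix {a : Site Λ // a.1 ∈ C} {a : Site Λ // a.1 ∈ C} ℝ,
      (∃ z ∈ Q, cl z = C) →
      (∀ a b : {a : Site Λ // a.1 ∈ C}, ∑ x : {a : Site Λ // a.1 ∈ C}, (schur (ε ^ 4) u lam R j (nbhd (L ((j : ℤ) - 1)) C) a.1 x.1 -
        lam * (1 : Matrix (Site Λ) (Site Λ) ℝ) a.1 x.1) * U x b =
          (1 : Matrix (Site Λ) (Site Λ) ℝ) a.1 b.1) ∧ ∀ a b, |U a b| ≤ 2 / e := by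
    intro C
    by_cases hC : ∃ z ∈ Q, cl z = C
    swap
    · exact ⟨0, fun h => absurd h hC⟩
    obtain ⟨z, hz, rfl⟩ := hC
    set C := cl z
    have hCR : C ⊆ R j := (hE.cell_sub z hz).trans Finset.sdiff_subset
    have hone : ∀ a b : {a : Site Λ // a.1 ∈ C},
        (1 : Matrix {a : Site Λ // a.1 ∈ C} {a : Site Λ // a.1 ∈ C} ℝ) a b =
        (1 : Matrix (Site Λ) (Site Λ) ℝ) a.1 b.1 := fun a b => by
      simp [Matrix.one_apply, Subtype.ext_iff]
    set F := schur (ε ^ 4) u lam R j (nbhd (L ((j : ℤ) - 1)) C) with hF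
    set F' := schur (ε ^ 4) u (E (j + 1)) R j (nbhd (L ((j : ℤ) - 1)) C) with hF'
    set A := truncSchur (ε ^ 4) u (E (j + 1)) R j C with hA
    have hAe : ∀ a b, A a b = F' a.1 b.1 := fun a b => rfl
    -- `T` is the change from the energy `E (j + 1)`, where there is a gap `e`, to `lam`. By the
    -- Lipschitz bound its row sums are at most (1/4 + 1) · (2/5) · e = e/2, which is what
    -- `exists_inverse_of_gap` admits.
    set T : Matrix {a : Site Λ // a.1 ∈ C} {a : Site Λ // a.1 ∈ C} ℝ := fun a b =>
      (F a.1 b.1 - F' a.1 b.1) - (lam - E (j + 1)) *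
        (1 : Matrix {a : Site Λ // a.1 ∈ C} {a : Site Λ // a.1 ∈ C} ℝ) a b with hT
    have hTe : ∀ a b, T a b = (F a.1 b.1 - F' a.1 b.1) - (lam - E (j + 1)) *
        (1 : Matrix {a : Site Λ // a.1 ∈ C} {a : Site Λ // a.1 ∈ C} ℝ) a b := fun _ _ => rfl
    have hAh : A.IsHermitian := by
      ext a b
      rw [Matrix.conjTranspose_apply, hAe, hAe, star_trivial]
      exact schur_symm_apply _ _ _ _ _ _ _ _
    obtain ⟨U, hU1, hU2⟩ := exists_inverse_of_gap (T := T) hAh he0 (hE.spec z hz) (fun a b => by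
        rw [hTe, hTe, hF, hF', schur_symm_apply, schur_symm_apply _ _ _ _ _ _ a.1]
        congr 2
        simp [Matrix.one_apply, eq_comm]) (fun a => by
        have h1 : ∀ b, |T a b| ≤ |F a.1 b.1 - F' a.1 b.1| + |lam - E (j + 1)| *
            (1 : Matrix {a : Site Λ // a.1 ∈ C} {a : Site Λ // a.1 ∈ C} ℝ) a b := fun b => by
          rw [hTe]
          refine (abs_sub _ _).trans (add_le_add le_rfl (le_of_eq ?_))
          rw [abs_mul]
          congr 1
          rw [Matrix.one_apply]; split_ifs <;> simp
        refine (Finset.sum_le_sum fun b _ => h1 b).trans ?_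
        rw [Finset.sum_add_distrib, ← Finset.mul_sum]
        have h2 : ∑ b, (1 : Matrix {a : Site Λ // a.1 ∈ C} {a : Site Λ // a.1 ∈ C} ℝ) a b = 1 := by
          simp [Matrix.one_apply]
        have h3 : ∑ b : {a : Site Λ // a.1 ∈ C}, |F a.1 b.1 - F' a.1 b.1| ≤
            ∑ b with b.1 ∈ R j, |F a.1 b - F' a.1 b| := by
          rw [← Finset.sum_subtype (Finset.univ.filter fun b : Site Λ => b.1 ∈ C) (by simp)
            (fun b => |F a.1 b - F' a.1 b|)]
          exact Finset.sum_le_sum_of_subset_of_nonneg (fun b hb => by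
            simp only [Finset.mem_filter, Finset.mem_univ, true_and] at hb ⊢
            exact hCR hb) fun _ _ _ => abs_nonneg _
        have h4 := hlip lam (E (j + 1)) hlw hEw (nbhd (L ((j : ℤ) - 1)) C) a.1 (hCR a.2)
        have h5 : c * |lam - E (j + 1)| ≤ 1 / 4 * |lam - E (j + 1)| :=
          mul_le_mul_of_nonneg_right hc (abs_nonneg _)
        rw [h2, mul_one]
        linarith)
    refine ⟨U, fun _ => ⟨fun a b => ?_, hU2⟩⟩
    have h1 := congrFun (congrFun hU1 a) b
    rw [Matrix.mul_apply, hone] at h1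
    rw [← h1]
    refine Finset.sum_congr rfl fun x _ => ?_
    congr 1
    change _ = A a x - E (j + 1) *
      (1 : Matrix {a : Site Λ // a.1 ∈ C} {a : Site Λ // a.1 ∈ C} ℝ) a x + T a x
    rw [hTe, hAe, hone]
    ring
  choose V hV using key
  set U : Matrix (Site Λ) (Site Λ) ℝ := fun a b =>
    if h : a.1 ∈ Q ∧ b.1 ∈ cl a.1 then
      V (cl a.1) ⟨a, self_mem_cell (hQ _ h.1)⟩ ⟨b, h.2⟩
    else if a.1 ∈ Q then 0 else (1 : Matrix (Site Λ) (Site Λ) ℝ) a b with hU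
  have hUpos : ∀ a b (h : a.1 ∈ Q ∧ b.1 ∈ cl a.1), U a b =
      V (cl a.1) ⟨a, self_mem_cell (hQ _ h.1)⟩ ⟨b, h.2⟩ := fun a b h => dif_pos h
  have hU0 : ∀ a b, a.1 ∈ Q → b.1 ∉ cl a.1 → U a b = 0 := fun a b h1 h2 =>
    (dif_neg fun h => h2 h.2).trans (if_pos h1)
  have hU1 : ∀ a b, a.1 ∉ Q → U a b = (1 : Matrix (Site Λ) (Site Λ) ℝ) a b := fun a b h1 =>
    (dif_neg fun h => h1 h.1).trans (if_neg h1)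
  have hUC : ∀ C, (∃ z ∈ Q, cl z = C) → ∀ a b (ha : a.1 ∈ C) (hb : b.1 ∈ C),
      U a b = V C ⟨a, ha⟩ ⟨b, hb⟩ := by
    rintro C ⟨z, hz, rfl⟩ a b ha hb
    have haQ := hE.cell_sub z hz ha
    have hcc : cl a.1 = cl z := cell_eq ha
    rw [hUpos a b ⟨haQ, hcc ▸ hb⟩]
    have : ∀ (C C' : Finset Λ) (_ : C = C') (a b) (ha : a.1 ∈ C) (hb : b.1 ∈ C)
        (ha' : a.1 ∈ C') (hb' : b.1 ∈ C'), V C ⟨a, ha⟩ ⟨b, hb⟩ = V C' ⟨a, ha'⟩ ⟨b, hb'⟩ := by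
      rintro C _ rfl a b ha hb ha' hb'; rfl
    exact this _ _ hcc _ _ _ _ _ _
  refine ⟨U, ?_, ?_, ?_⟩
  · ext a b
    rw [Matrix.mul_apply]
    by_cases ha : a.1 ∈ Q
    swap
    · have h1 : ∀ x, blockPart (schur (ε ^ 4) u lam R j) cl Q
          (fun z => nbhd (L ((j : ℤ) - 1)) (cl z)) lam a x =
          (1 : Matrix (Site Λ) (Site Λ) ℝ) a x := fun x => if_neg fun h => ha h.1
      simp only [h1]
      rw [← Matrix.mul_apply, Matrix.one_mul, hU1 a b ha]
    · have haC : a.1 ∈ cl a.1 := self_mem_cell (hQ _ ha)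
      have h1 : ∀ x, x.1 ∈ cl a.1 → blockPart (schur (ε ^ 4) u lam R j) cl Q
          (fun z => nbhd (L ((j : ℤ) - 1)) (cl z)) lam a x =
          schur (ε ^ 4) u lam R j (nbhd (L ((j : ℤ) - 1)) (cl a.1)) a x -
            lam * (1 : Matrix (Site Λ) (Site Λ) ℝ) a x := fun x hx =>
        if_pos ⟨ha, hE.cell_sub _ ha hx, (cell_eq hx).symm⟩
      have h2 : ∀ x, x.1 ∉ cl a.1 → blockPart (schur (ε ^ 4) u lam R j) cl Q
          (fun z => nbhd (L ((j : ℤ) - 1)) (cl z)) lam a x = 0 := fun x hx => by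
        have h3 : ¬ (a.1 ∈ Q ∧ x.1 ∈ Q ∧ cl a.1 = cl x.1) := fun h =>
          hx (h.2.2 ▸ self_mem_cell (hQ _ h.2.1))
        have h4 : a ≠ x := fun h => hx (h ▸ haC)
        simp only [blockPart]
        rw [if_neg h3, Matrix.one_apply_ne h4]
      by_cases hb : b.1 ∈ cl a.1
      · have h3 := ((hV (cl a.1) ⟨a.1, ha, rfl⟩).1 ⟨a, haC⟩ ⟨b, hb⟩)
        rw [← h3, ← sum_subtype_of_eq_zero (fun x : Site Λ => x.1 ∈ cl a.1) _ (fun x hx => by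
          rw [h2 x hx, zero_mul])]
        refine Finset.sum_congr rfl fun x _ => ?_
        rw [h1 x.1 x.2, hUC (cl a.1) ⟨a.1, ha, rfl⟩ x.1 b x.2 hb]
      · rw [Matrix.one_apply_ne (fun h : a = b => hb (by rw [← h]; exact haC))]
        refine Finset.sum_eq_zero fun x _ => ?_
        by_cases hx : x.1 ∈ cl a.1
        · rw [hU0 x b (hE.cell_sub _ ha hx) (by rw [hcl, cell_eq hx]; exact hb), mul_zero]
        · rw [h2 x hx, zero_mul]
  · intro a b hab
    by_cases ha : a.1 ∈ Q
    · right
      by_contra h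
      exact hab (hU0 a b ha fun h' => h ⟨ha, h'⟩)
    · left
      by_contra h
      exact hab (by rw [hU1 a b ha, Matrix.one_apply_ne h])
  · intro a
    by_cases ha : a.1 ∈ Q
    · refine le_trans ?_ (le_max_right _ _)
      have h1 : ∀ b, |U a b| ≤ if b.1 ∈ cl a.1 then 2 / e else 0 := fun b => by
        split_ifs with hb
        · rw [hUpos a b ⟨ha, hb⟩]
          exact (hV (cl a.1) ⟨a.1, ha, rfl⟩).2 _ _
        · rw [hU0 a b ha hb, abs_zero]
      refine (Finset.sum_le_sum fun b _ => h1 b).trans ?_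
      rw [← Finset.sum_filter, Finset.sum_const, nsmul_eq_mul, card_site_fiber]
      have h2 := hE.card _ ha
      calc 2 * ((cl a.1).card : ℝ) * (2 / e) ≤ 2 * 2 ^ j * (2 / e) := by gcongr
        _ = _ := by ring
    · refine le_trans (le_of_eq ?_) (le_max_left _ _)
      simp only [hU1 a _ ha]
      rw [Finset.sum_eq_single a] <;> simp +contextual [eq_comm]

/-! ### The induction over the elimination steps -/

section Step

variable {ε G : ℝ} {u : Λ → ℝ} {E : ℕ → ℝ} {R : ℕ → Finset Λ} {j : ℕ}

theorem epsAt_succ_eq (hε : 0 < ε) (hG : Real.exp (-G) = ε ^ 4) (j : ℕ) :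
    epsAt ε (j + 1) = Real.exp (-(G * cost j)) := by
  have h1 : Real.log ε = -G / 4 := by
    have := congrArg Real.log hG
    rw [Real.log_exp, Real.log_pow] at this
    push_cast at this
    linarith
  rw [epsAt, Real.rpow_def_of_pos hε, h1]
  push_cast
  rw [L_nat_succ, cost, psi]
  ring_nf

theorem cellInv_eq (hε : 0 < ε) (hG : Real.exp (-G) = ε ^ 4) (j : ℕ) :
    cellInv G j = 4 * 2 ^ j / epsAt ε (j + 1) := by
  rw [epsAt_succ_eq hε hG, Real.exp_neg, div_inv_eq_mul, cellInv]

theorem one_le_cellInv (hG : 0 ≤ G) (j : ℕ) : 1 ≤ cellInv G j := by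
  have h1 : (1 : ℝ) ≤ 2 ^ j := one_le_pow₀ (by norm_num)
  have h2 : 1 ≤ Real.exp (G * cost j) := Real.one_le_exp (by unfold cost; positivity)
  rw [cellInv]
  nlinarith

theorem LevelBounds.exists_stepSetup (hε : 0 < ε) (hG : Real.exp (-G) = ε ^ 4)
    (hs : StepSmall d G j) (hE : ElimData ε u E R j) (hb : LevelBounds ε G u E R j) {lam : ℝ}
    (hl : InWindow ε E (j + 1) lam) :
    ∃ U, StepSetup (schur (ε ^ 4) u lam R j) (cell R j) (R j \ R (j + 1)) (R (j + 1))
      (fun z => nbhd (L ((j : ℤ) - 1)) (cell R j z)) lam U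
      (cellDist (fun z => if z ∈ R j \ R (j + 1) then cell R j z else {z}) (cellDiam j))
      (G * rate j) (G * rate (j + 1)) (G * rateLoss j) (cellSep j) (G * gain j) (cellDiam j)
      (2 ^ j) (2 ^ j / 4) (cellInv G j) (latticeSum d j) := by
  have h0 := hs.one_le
  have hpow : (0 : ℝ) < (1 / 2) ^ j := by positivity
  obtain ⟨U, hU1, hU2, hU3⟩ := hE.exists_inverse hε (c := (1 - (1 / 2) ^ j) / 4) (by linarith)
    hb.lip hl
  have hinv := one_le_cellInv (G := G) (by linarith) j
  have hA := hs.A_le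
  have hB := hs.loop_le
  refine ⟨U, ?_⟩
  exact
    { geo := hE.geometry
      ker := by
        rw [Finset.sdiff_union_of_subset hE.sub]
        exact hb.kernelDecay fun i h1 h2 => hl i h1 (by omega)
      N_sup := fun z _ => subset_nbhd (L_pos _) _
      N_far := fun z _ w hw y hy => by
        rw [← L_pred_eq]
        exact le_ldist_of_notMem_nbhd hy hw
      N_eq := fun z _ w hw => by
        simp only [cell_eq hw]
      inv := hU1
      U_supp := hU2
      U_sum := fun a => (hU3 a).trans (by
        rw [← cellInv_eq hε hG]
        exact max_le hinv le_rfl)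
      Z_sum := fun a => (sum_exp_site_le (mul_pos (by linarith) (rateLoss_pos j)) a).trans hs.sum
      one_le_Z := one_le_latticeSum d j
      S_nonneg := by linarith
      n_nonneg := by positivity
      τ_nonneg := mul_nonneg (by linarith) (rate_pos _).le
      h_nonneg := mul_nonneg (by linarith) (rateLoss_pos _).le
      rate := by
        rw [← mul_add]
        exact mul_le_mul_of_nonneg_left (rate_succ_le j) (by linarith)
      small := by
        have e : legBound (G * BlockAnderson.rate j) (G * BlockAnderson.rate (j + 1))
          (G * rateLoss j) (cellSep j) (G * gain j) (latticeSum d j) = leg d G j := rfl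
        have h1 : (1 / 2 : ℝ) ^ (j + 1) ≤ 1 := pow_le_one₀ (by norm_num) (by norm_num)
        rw [e, mul_add]
        nlinarith }

/-- The new kernel is the old one minus the correction, and each bound is the sum of the two. For
`far` either part takes one half. In the other three bounds the correction adds at most the
increment of `1 - (1 / 2) ^ j` (divided by 4 in `lip` and `norm`), because it carries the factor `A`
of size `(1 / 2) ^ (j + 1) / 64`. -/
theorem LevelBounds.succ (hε : 0 < ε) (hG : Real.exp (-G) = ε ^ 4) (hs : StepSmall d G j)
    (hE : ElimData ε u E R j) (hb : LevelBounds ε G u E R j) :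
    LevelBounds ε G u E R (j + 1) := by
  have h0 := hs.one_le
  have hinv := one_le_cellInv (G := G) (by linarith) j
  have hA := hs.A_le
  have hleg := leg_nonneg d G j
  have hp : (0 : ℝ) < (1 / 2) ^ j := by positivity
  have hps : (1 / 2 : ℝ) ^ (j + 1) = (1 / 2) ^ j / 2 := by rw [pow_succ]; ring
  have hp1 : (1 / 2 : ℝ) ^ j ≤ 1 := pow_le_one₀ (by norm_num) (by norm_num)
  have hrate := rate_succ_le j
  have hloss := rateLoss_pos j
  have hD : 0 ≤ cellDiam j := by cases j <;> simp only [cellDiam] <;> positivity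
  set A := leg d G j * (2 * cellInv G j) * Real.exp (G * rate (j + 1) * cellDiam j) with hAdef
  have hexp : 1 ≤ Real.exp (G * rate (j + 1) * cellDiam j) :=
    Real.one_le_exp (mul_nonneg (mul_nonneg (by linarith) (rate_pos _).le) hD)
  have hBA : leg d G j * (2 * cellInv G j) ≤ A :=
    le_mul_of_one_le_right (mul_nonneg hleg (by linarith)) hexp
  have hlA : leg d G j ≤ A := (le_mul_of_one_le_right hleg (by linarith)).trans hBA
  have hB0 : 0 ≤ leg d G j * (2 * cellInv G j) := mul_nonneg hleg (by linarith)
  have hA0 : 0 ≤ A := hB0.trans hBA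
  have hwin : ∀ {lam}, InWindow ε E (j + 1) lam → InWindow ε E j lam := fun hl i h1 h2 =>
    hl i h1 (by omega)
  have hmid : G * rate (j + 1) * cellDiam j ≤
      (G * rate j - G * rate (j + 1)) * cellSep j + G * gain j := by
    have := mul_le_mul_of_nonneg_left (mid_ge j) (show 0 ≤ G by linarith)
    linarith
  set cl := cell R j
  set Q := R j \ R (j + 1)
  set P := R (j + 1)
  have hPR : ∀ {z}, z ∈ P → z ∈ R j := fun h => hE.sub h
  have hQP : Q ∪ P = R j := Finset.sdiff_union_of_subset hE.sub
  set N : Λ → Finset Λ := fun z => nbhd (L ((j : ℤ) - 1)) (cl z)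
  have hstep : ∀ {lam}, InWindow ε E (j + 1) lam → ∀ X,
      schur (ε ^ 4) u lam R (j + 1) X = schur (ε ^ 4) u lam R j X -
        StepSetup.corr (schur (ε ^ 4) u lam R j) cl Q N lam X := by
    intro lam hl X
    obtain ⟨U, st⟩ := hb.exists_stepSetup hε hG hs hE hl
    exact schur_succ (ε ^ 4) u lam R j X (st.inverse X).1
  have hsubsum : ∀ (f : Site Λ → ℝ), (∀ b, 0 ≤ f b) →
      ∑ b with b.1 ∈ P, f b ≤ ∑ b with b.1 ∈ R j, f b := fun f hf =>
    Finset.sum_le_sum_of_subset_of_nonneg (fun b hb => by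
      simp only [Finset.mem_filter, Finset.mem_univ, true_and] at hb ⊢
      exact hPR hb) fun b _ _ => hf b
  refine ⟨?_, ?_, ?_, ?_⟩
  · intro lam hl X a b ha hb' hab
    obtain ⟨U, st⟩ := hb.exists_stepSetup hε hG hs hE hl
    have hsep : cellSep j ≤ cellSep (j + 1) := by
      cases j with
      | zero => norm_num [cellSep]
      | succ j => simp only [cellSep, pow_succ]; linarith [show (0 : ℝ) < 2 ^ j by positivity]
    have h1 := hb.far lam (hwin hl) X a b (hPR ha) (hPR hb') (hsep.trans hab)
    have h2 := hs.far_le hab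
    have h3 := st.corr_far X ha hb'
    have h4 := mul_le_mul_of_nonneg_right hs.corr_le
      (Real.exp_pos (-(G * rate (j + 1) * ldist a.1.1 b.1.1))).le
    rw [hstep hl, Matrix.sub_apply]
    refine (abs_sub _ _).trans ?_
    have h5 : Real.exp (-(G * rate (j + 1) * ldist a.1.1 b.1.1 + G * gain (j + 1))) =
        Real.exp (-(G * gain (j + 1))) * Real.exp (-(G * rate (j + 1) * ldist a.1.1 b.1.1)) := by
      rw [← Real.exp_add]; ring_nf
    rw [h5] at h2 ⊢
    have h6 := h3.trans h4
    linarith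
  · intro lam hl X Y hYX a b ha hb' haY hbY r hr
    obtain ⟨U, st⟩ := hb.exists_stepSetup hε hG hs hE hl
    have h1 := hb.loc lam (hwin hl) X Y hYX a b (hPR ha) (hPR hb') haY hbY (max r 0)
      fun z hz hz' => max_le (hr z hz hz') (add_nonneg (ldist_nonneg _ _) (ldist_nonneg _ _))
    have h2 := st.corr_loc hmid hYX ha hb' haY hbY hr (A := A) rfl
    have h3 : Real.exp (-(G * rate j * max r 0)) ≤ Real.exp (-(G * rate (j + 1) * r)) := by
      refine Real.exp_le_exp.2 (neg_le_neg ?_)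
      have e1 : G * rate (j + 1) * r ≤ G * rate (j + 1) * max r 0 :=
        mul_le_mul_of_nonneg_left (le_max_left _ _) (mul_nonneg (by linarith) (rate_pos _).le)
      refine e1.trans (mul_le_mul_of_nonneg_right ?_ (le_max_right _ _))
      exact mul_le_mul_of_nonneg_left (by linarith) (by linarith)
    rw [hstep hl, hstep hl, Matrix.sub_apply, Matrix.sub_apply, sub_sub_sub_comm]
    refine (abs_sub _ _).trans ?_
    have h4 : (1 - (1 / 2 : ℝ) ^ j) * Real.exp (-(G * rate j * max r 0)) ≤
        (1 - (1 / 2 : ℝ) ^ j) * Real.exp (-(G * rate (j + 1) * r)) :=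
      mul_le_mul_of_nonneg_left h3 (by linarith)
    have h5 : 2 * A + 2 * A ^ 2 ≤ (1 / 2) ^ (j + 1) := by nlinarith
    have h6 := mul_le_mul_of_nonneg_right h5 (Real.exp_pos (-(G * rate (j + 1) * r))).le
    rw [hps] at h6 ⊢
    linarith
  · intro lam mu hl hm X a ha
    obtain ⟨U, st⟩ := hb.exists_stepSetup hε hG hs hE hl
    obtain ⟨U', st'⟩ := hb.exists_stepSetup hε hG hs hE hm
    set c : ℝ := (1 - (1 / 2) ^ j) / 4 with hc
    have hc0 : 0 ≤ c := by rw [hc]; linarith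
    have hlip := fun X a ha => hb.lip lam mu (hwin hl) (hwin hm) X a ha
    have h1 := st.corr_lip st' hc0 (fun X a ha => by
      rw [hQP] at ha ⊢
      exact hlip X a ha) X ha (B := leg d G j * (2 * cellInv G j)) rfl
    have h2 := (hsubsum _ fun b => abs_nonneg _).trans (hlip X a (hPR ha))
    have h3 : ∀ b, |schur (ε ^ 4) u lam R (j + 1) X a b - schur (ε ^ 4) u mu R (j + 1) X a b| ≤
        |schur (ε ^ 4) u lam R j X a b - schur (ε ^ 4) u mu R j X a b| +
        |StepSetup.corr (schur (ε ^ 4) u lam R j) cl Q N lam X a b -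
          StepSetup.corr (schur (ε ^ 4) u mu R j) cl Q N mu X a b| := fun b => by
      rw [hstep hl, hstep hm, Matrix.sub_apply, Matrix.sub_apply, sub_sub_sub_comm]
      exact abs_sub _ _
    refine (Finset.sum_le_sum fun b _ => h3 b).trans ?_
    rw [Finset.sum_add_distrib]
    refine (add_le_add h2 h1).trans ?_
    rw [← add_mul]
    refine mul_le_mul_of_nonneg_right ?_ (abs_nonneg _)
    set B := leg d G j * (2 * cellInv G j)
    have hB : B ≤ (1 / 2) ^ (j + 1) / 64 := hBA.trans hA
    rw [hps] at hB ⊢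
    have hc1 : c ≤ 1 / 4 := by rw [hc]; linarith
    have hB1 : B ≤ 1 := by linarith
    have e1 : 2 * c * B ≤ 2 * (1 / 4) * B := by gcongr
    have e2 : (1 + 3 * c) * B ^ 2 ≤ (1 + 3 * (1 / 4)) * B := by
      have : B ^ 2 ≤ B := by nlinarith
      gcongr
    linarith
  · intro lam hl X a ha
    obtain ⟨U, st⟩ := hb.exists_stepSetup hε hG hs hE hl
    have h1 := st.corr_rowSum X ha
    have h2 := (hsubsum _ fun b => abs_nonneg _).trans (hb.norm lam (hwin hl) X a (hPR ha))
    have h3 : ∀ b, |schur (ε ^ 4) u lam R (j + 1) X a b - schur (ε ^ 4) u lam R 0 X a b| ≤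
        |schur (ε ^ 4) u lam R j X a b - schur (ε ^ 4) u lam R 0 X a b| +
        |StepSetup.corr (schur (ε ^ 4) u lam R j) cl Q N lam X a b| := fun b => by
      rw [hstep hl, Matrix.sub_apply, sub_right_comm]
      exact abs_sub _ _
    refine (Finset.sum_le_sum fun b _ => h3 b).trans ?_
    rw [Finset.sum_add_distrib]
    refine (add_le_add h2 h1).trans ?_
    have e : legBound (G * rate j) (G * rate (j + 1)) (G * rateLoss j) (cellSep j) (G * gain j)
      (latticeSum d j) = leg d G j := rfl
    rw [e]
    have h4 : leg d G j * (2 * cellInv G j) * leg d G j ≤ A * A :=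
      mul_le_mul hBA hlA hleg hA0
    rw [hps] at hA ⊢
    nlinarith

theorem levelBounds (hε : 0 < ε) (hG : Real.exp (-G) = ε ^ 4) {k : ℕ}
    (hs : ∀ j < k, StepSmall d G j) (hE : ∀ j < k, ElimData ε u E R j) :
    LevelBounds ε G u E R k := by
  induction k with
  | zero => exact levelBounds_zero hG u E R
  | succ k ih =>
    exact (ih (fun j hj => hs j (by omega)) (fun j hj => hE j (by omega))).succ hε hG
      (hs k (by omega)) (hE k (by omega))

end Step

/-! ### The resonant sets of the energy-following procedure -/

/-- One elimination step, for general kernels and blocks. -/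
def schurStep (F : Finset Λ → Matrix (Site Λ) (Site Λ) ℝ) (cl : Λ → Finset Λ) (Q : Finset Λ)
    (ℓ lam : ℝ) (X : Finset Λ) : Matrix (Site Λ) (Site Λ) ℝ :=
  let p : Λ × Fin 2 → Prop := fun a => a.1 ∈ Q ∧ cl a.1 ⊆ X
  let N : Λ × Fin 2 → Finset Λ := fun a => nbhd ℓ (cl a.1)
  let D : Matrix (Λ × Fin 2) (Λ × Fin 2) ℝ := fun a b =>
    if cl a.1 = cl b.1 then F (N a) a b + (F X a b - F (X ∩ N a) a b)
    else F X a b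
  let Dp : Matrix {a // p a} {a // p a} ℝ := D.submatrix Subtype.val Subtype.val
  let B : Matrix (Λ × Fin 2) {a // p a} ℝ := (F X).submatrix id Subtype.val
  let C : Matrix {a // p a} (Λ × Fin 2) ℝ := (F X).submatrix Subtype.val id
  F X - B * (Dp - lam • (1 : Matrix {a // p a} {a // p a} ℝ))⁻¹ * C

theorem schur_succ_eq (γ : ℝ) (u : Λ → ℝ) (lam : ℝ) (R : ℕ → Finset Λ) (k : ℕ) (X : Finset Λ) :
    schur γ u lam R (k + 1) X =
      schurStep (schur γ u lam R k) (cell R k) (R k \ R (k + 1)) (L ((k : ℤ) - 1)) lam X := rfl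

theorem schur_congr (γ : ℝ) (u : Λ → ℝ) (lam : ℝ) {R R' : ℕ → Finset Λ} {k : ℕ}
    (h : ∀ i ≤ k, R i = R' i) : schur γ u lam R k = schur γ u lam R' k := by
  induction k with
  | zero => rfl
  | succ k ih =>
    funext X
    have hc : cell R k = cell R' k := by
      funext z; simp only [cell, h k (by omega)]
    rw [schur_succ_eq, schur_succ_eq, ih fun i hi => h i (by omega), h k (by omega),
      h (k + 1) le_rfl, hc]

theorem truncSchur_congr (γ : ℝ) (u : Λ → ℝ) (lam : ℝ) {R R' : ℕ → Finset Λ} {k : ℕ}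
    (h : ∀ i ≤ k, R i = R' i) (B : Finset Λ) :
    truncSchur γ u lam R k B = truncSchur γ u lam R' k B := by
  rw [truncSchur, truncSchur, schur_congr γ u lam h]

section Resonant

variable {ε : ℝ} {u : Λ → ℝ} {E : ℕ → ℝ}

theorem history_apply {i k : ℕ} (hik : i ≤ k) : history ε u E k i = resSet ε u E i := by
  induction k with
  | zero =>
    obtain rfl : i = 0 := by omega
    rfl
  | succ k ih =>
    by_cases h : i = k + 1
    · rw [h]; rfl
    · rw [history, Function.update_of_ne h, ih (by omega)]

theorem resSet_one : resSet ε u E 1 =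
    Finset.univ.filter fun z => |t (u z) - E 1| ≤ ε ∨ |-t (u z) - E 1| ≤ ε := by
  rw [resSet, history, Function.update_self, nextSet]

theorem isResonant_congr {e : ℝ} {R R' : ℕ → Finset Λ} {k : ℕ} (h : ∀ i ≤ k, R i = R' i)
    (B : Finset Λ) : IsResonant ε u e R (k + 1) B ↔ IsResonant ε u e R' (k + 1) B := by
  rw [IsResonant, IsResonant, Nat.add_sub_cancel, h k le_rfl, truncSchur_congr _ _ _ h]

theorem mem_resSet_add_two {j : ℕ} {z : Λ} : z ∈ resSet ε u E (j + 2) ↔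
    z ∈ resSet ε u E (j + 1) ∧
      ¬ (IsIsolated (j + 2) (resSet ε u E (j + 1))
          (comp (L ((j : ℤ) + 2)) (resSet ε u E (j + 1)) z) ∧
        ¬ IsResonant ε u (E (j + 2)) (resSet ε u E) (j + 2)
          (comp (L ((j : ℤ) + 2)) (resSet ε u E (j + 1)) z)) := by
  conv_lhs => rw [resSet, history, Function.update_self, nextSet]
  rw [Finset.mem_filter, history_apply le_rfl,
    isResonant_congr (R' := resSet ε u E) fun i hi => history_apply hi]

theorem resSet_succ_subset (j : ℕ) : resSet ε u E (j + 1) ⊆ resSet ε u E j := by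
  cases j with
  | zero => exact fun z _ => Finset.mem_univ z
  | succ j => exact fun z hz => (mem_resSet_add_two.1 hz).1

theorem resSet_antitone {i j : ℕ} (h : i ≤ j) : resSet ε u E j ⊆ resSet ε u E i := by
  induction j, h using Nat.le_induction with
  | base => exact Finset.Subset.refl _
  | succ j _ ih => exact (resSet_succ_subset j).trans ih

theorem L_natCast_succ (j : ℕ) : L (((j + 1 : ℕ) : ℤ)) = 2 ^ j := by
  rw [Nat.cast_succ, L_nat_succ]

theorem comp_resSet_subset {j : ℕ} {z : Λ} (hz : z ∈ resSet ε u E (j + 2)) :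
    comp (L ((j : ℤ) + 2)) (resSet ε u E (j + 1)) z ⊆ resSet ε u E (j + 2) := by
  intro w hw
  rw [mem_resSet_add_two] at hz ⊢
  exact ⟨comp_subset hw, by rw [comp_eq hw]; exact hz.2⟩

theorem epsAt_pos (hε : 0 < ε) (k : ℕ) : 0 < epsAt ε k := Real.rpow_pos_of_pos hε _

/-- The exponent L_i^ψ increases by at least 1/2 from one step to the next, and ε^(1/2) ≤ 1/6. -/
theorem epsAt_succ_le (hε : 0 < ε) (hε' : ε ≤ 1 / 36) {i : ℕ} (hi : 1 ≤ i) :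
    epsAt ε (i + 1) ≤ epsAt ε i / 6 := by
  have hL : 1 ≤ L (i : ℤ) ^ psi := by
    refine Real.one_le_rpow ?_ (by norm_num [psi])
    obtain ⟨j, rfl⟩ := Nat.exists_eq_add_of_le' hi
    rw [L_natCast_succ]
    exact one_le_pow₀ (by norm_num)
  have h2 : (3 / 2 : ℝ) ≤ 2 ^ psi := by
    have h3 : ((2 : ℝ) ^ psi) ^ 3 = 4 := by
      rw [← Real.rpow_natCast, ← Real.rpow_mul (by norm_num), psi]; norm_num
    refine le_of_pow_le_pow_left₀ (n := 3) (by norm_num) (by positivity) ?_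
    rw [h3]; norm_num
  have h4 : L ((i + 1 : ℕ) : ℤ) ^ psi = 2 ^ psi * L (i : ℤ) ^ psi := by
    rw [Nat.cast_succ, L_succ, Real.mul_rpow (by norm_num) (L_pos _).le]
  have h5 : L (i : ℤ) ^ psi + 1 / 2 ≤ L ((i + 1 : ℕ) : ℤ) ^ psi := by
    rw [h4]; nlinarith
  have h6 : ε ^ (1 / 2 : ℝ) ≤ 1 / 6 := by
    rw [← Real.sqrt_eq_rpow]
    refine Real.sqrt_le_iff.2 ⟨by norm_num, hε'.trans (by norm_num)⟩
  calc epsAt ε (i + 1) ≤ ε ^ (L (i : ℤ) ^ psi + 1 / 2) :=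
        Real.rpow_le_rpow_of_exponent_ge hε (by linarith) h5
    _ = epsAt ε i * ε ^ (1 / 2 : ℝ) := by rw [Real.rpow_add hε]; rfl
    _ ≤ epsAt ε i * (1 / 6) := mul_le_mul_of_nonneg_left h6 (epsAt_pos hε i).le
    _ = _ := by ring

/-- Backward induction: one step moves the energy by at most ε_i/3 and all later ones by at most
(2/5)ε_{i+1} ≤ ε_i/15, and 1/3 + 1/15 = 2/5. All later energies thus stay in the windows in which
the Schur complements are controlled. -/
theorem energy_dist_le (hε : 0 < ε) (hε' : ε ≤ 1 / 36) {k : ℕ}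
    (hE : ∀ j, 1 ≤ j → j < k → |E (j + 1) - E j| ≤ epsAt ε j / 3) {i : ℕ} (hi : 1 ≤ i) {m : ℕ}
    (him : i ≤ m) (hm : m ≤ k) : |E m - E i| ≤ 2 / 5 * epsAt ε i := by
  induction him using Nat.decreasingInduction with
  | self =>
    rw [sub_self, abs_zero]
    have := epsAt_pos hε m
    positivity
  | of_succ i him ih =>
    have h1 := ih (by omega)
    have h2 := hE i hi (by omega)
    have h3 := abs_sub_le (E m) (E (i + 1)) (E i)
    have h4 := epsAt_succ_le hε hε' hi
    have := epsAt_pos hε i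
    linarith

theorem spectrum_h {v μ : ℝ} {A : Matrix (Fin 2) (Fin 2) ℝ} (hA : ∀ i j, A i j = h v i j)
    (hμ : μ ∈ spectrum ℝ A) : μ = t v ∨ μ = -t v := by
  obtain rfl : A = h v := by ext i j; exact hA i j
  rw [spectrum.mem_iff, Matrix.isUnit_iff_isUnit_det, isUnit_iff_ne_zero, not_not,
    Matrix.det_fin_two] at hμ
  simp [Matrix.algebraMap_eq_diagonal, h] at hμ
  have h1 : μ ^ 2 = t v ^ 2 := by
    rw [t, Real.sq_sqrt (by positivity)]; linarith
  exact sq_eq_sq_iff_eq_or_eq_neg.1 h1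

/-- The sites over one position. -/
def siteEquiv (z : Λ) : {a : Site Λ // a.1 ∈ ({z} : Finset Λ)} ≃ Fin 2 where
  toFun a := a.1.2
  invFun i := ⟨(z, i), Finset.mem_singleton_self z⟩
  left_inv a := Subtype.ext (Prod.ext (Finset.mem_singleton.1 a.2).symm rfl)
  right_inv _ := rfl

theorem spectrum_truncSchur_zero {lam μ : ℝ} {R : ℕ → Finset Λ} {z : Λ}
    (hμ : μ ∈ spectrum ℝ (truncSchur (ε ^ 4) u lam R 0 {z})) : μ = t (u z) ∨ μ = -t (u z) := by
  rw [← AlgEquiv.spectrum_eq (Matrix.reindexAlgEquiv ℝ ℝ (siteEquiv z))] at hμ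
  refine spectrum_h (fun i j => ?_) hμ
  change (if z ∈ nbhd (L (((0 : ℕ) : ℤ) - 1)) {z} ∧ z ∈ nbhd (L (((0 : ℕ) : ℤ) - 1)) {z} then
    H (ε ^ 4) u (z, i) (z, j) else 0) = _
  have h1 : z ∈ nbhd (L (((0 : ℕ) : ℤ) - 1)) {z} :=
    subset_nbhd (L_pos _) _ (Finset.mem_singleton_self z)
  rw [if_pos ⟨h1, h1⟩]
  simp [H]

/-- The blocks that are eliminated in the energy-following procedure are non-resonant. -/
theorem elimData_resSet (hε : 0 < ε) (hε' : ε ≤ 1 / 36) {k : ℕ}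
    (hE : ∀ j, 1 ≤ j → j < k → |E (j + 1) - E j| ≤ epsAt ε j / 3) {j : ℕ} (hj : j < k) :
    ElimData ε u E (resSet ε u E) j where
  sub := resSet_succ_subset j
  win := fun i h1 h2 => energy_dist_le hε hε' hE h1 h2 (by omega)
  cell_sub := by
    intro z hz w hw
    cases j with
    | zero =>
      rw [cell, if_pos rfl, Finset.mem_singleton] at hw
      rwa [hw]
    | succ j =>
      rw [cell, if_neg (by omega)] at hw
      have e : ((j + 1 : ℕ) : ℤ) + 1 = j + 2 := by push_cast; ring
      rw [e] at hw
      rw [Finset.mem_sdiff] at hz ⊢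
      refine ⟨comp_subset hw, fun h => hz.2 (comp_resSet_subset h ?_)⟩
      rw [comp_eq hw]
      exact self_mem_comp hz.1
  card := by
    intro z hz
    cases j with
    | zero => simp [cell]
    | succ j =>
      rw [Finset.mem_sdiff, mem_resSet_add_two, not_and, not_not] at hz
      have h1 := (hz.2 hz.1).1.2.2.1
      rw [cell, if_neg (by omega)]
      have e : ((j + 1 : ℕ) : ℤ) + 1 = j + 2 := by push_cast; ring
      rw [e]
      refine h1.trans ?_
      rw [show ((j + 2 : ℕ) : ℤ) = ((j + 1 : ℕ) : ℤ) + 1 by push_cast; ring, L_nat_succ]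
      conv_rhs => rw [← Real.rpow_one (2 ^ (j + 1) : ℝ)]
      exact Real.rpow_le_rpow_of_exponent_le (one_le_pow₀ (by norm_num)) (by norm_num [psi])
  diam := by
    intro z hz a ha b hb
    cases j with
    | zero =>
      rw [cell, if_pos rfl, Finset.mem_singleton] at ha hb
      rw [ha, hb, ldist_self]
      exact le_rfl
    | succ j =>
      rw [Finset.mem_sdiff, mem_resSet_add_two, not_and, not_not] at hz
      have h1 := (hz.2 hz.1).1.2.2.2.2
      rw [cell, if_neg (by omega)] at ha hb
      have e : ((j + 1 : ℕ) : ℤ) + 1 = j + 2 := by push_cast; ring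
      rw [e] at ha hb
      have h2 := h1 a ha b hb
      rwa [show ((j + 2 : ℕ) : ℤ) = ((j + 1 : ℕ) : ℤ) + 1 by push_cast; ring, L_nat_succ] at h2
  sep := by
    intro z hz w hw hwz
    cases j with
    | zero =>
      rw [cell, if_pos rfl, Finset.mem_singleton] at hwz
      exact one_le_ldist' (Ne.symm hwz)
    | succ j =>
      rw [Finset.mem_sdiff, mem_resSet_add_two, not_and, not_not] at hz
      have h1 := (hz.2 hz.1).1.2.2.2.1
      rw [cell, if_neg (by omega)] at hwz
      have e : ((j + 1 : ℕ) : ℤ) + 1 = j + 2 := by push_cast; ring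
      rw [e] at hwz
      have h2 := h1 _ (comp_mem_comps hw) (fun h => hwz (by
        have h3 := self_mem_comp (ℓ := L ((j + 2 : ℕ) : ℤ)) hw
        rw [h] at h3
        exact h3)) z (self_mem_comp hz.1) w (self_mem_comp hw)
      rwa [show ((j + 2 : ℕ) : ℤ) = ((j + 1 : ℕ) : ℤ) + 1 by push_cast; ring, L_nat_succ] at h2
  spec := by
    intro z hz μ hμ
    cases j with
    | zero =>
      rw [Finset.mem_sdiff, zero_add, resSet_one, Finset.mem_filter, not_and, not_or] at hz
      have h1 := hz.2 (Finset.mem_univ z)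
      have h2 : epsAt ε (0 + 1) = ε := by
        rw [epsAt, L_natCast_succ, pow_zero, Real.one_rpow, Real.rpow_one]
      rw [cell, if_pos rfl] at hμ
      rw [h2, zero_add]
      rcases spectrum_truncSchur_zero hμ with rfl | rfl
      · exact (not_le.1 h1.1).le
      · exact (not_le.1 h1.2).le
    | succ j =>
      rw [Finset.mem_sdiff, mem_resSet_add_two, not_and, not_not] at hz
      obtain ⟨h1, h2⟩ := hz.2 hz.1
      have e : ((j + 1 : ℕ) : ℤ) + 1 = j + 2 := by push_cast; ring
      rw [cell, if_neg (by omega), e] at hμ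
      by_contra h3
      exact h2 ⟨h1, μ, hμ, (not_le.1 h3).le⟩

end Resonant

/-! ### The change of a Schur complement under a change of the potential -/

/-- A perturbation that vanishes in the rows and columns of the eliminated sites enters neither the
inverse nor the legs, and is carried along unchanged. -/
theorem schurStep_add {F F' Δ : Finset Λ → Matrix (Site Λ) (Site Λ) ℝ} {cl : Λ → Finset Λ}
    {Q : Finset Λ} (hF : ∀ X, F' X = F X + Δ X) (hl : ∀ X a b, a.1 ∈ Q → Δ X a b = 0)
    (hr : ∀ X a b, b.1 ∈ Q → Δ X a b = 0) (ℓ lam : ℝ) (X : Finset Λ) :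
    schurStep F' cl Q ℓ lam X = schurStep F cl Q ℓ lam X + Δ X := by
  have h1 : ∀ X a b, a.1 ∈ Q → F' X a b = F X a b := fun X a b ha => by
    rw [hF, Matrix.add_apply, hl X a b ha, add_zero]
  have h2 : ∀ X a b, b.1 ∈ Q → F' X a b = F X a b := fun X a b ha => by
    rw [hF, Matrix.add_apply, hr X a b ha, add_zero]
  set p : Λ × Fin 2 → Prop := fun a => a.1 ∈ Q ∧ cl a.1 ⊆ X with hp
  have e1 : (F' X).submatrix id (Subtype.val : {a // p a} → Site Λ) =
      (F X).submatrix id (Subtype.val : {a // p a} → Site Λ) := by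
    ext a b; exact h2 X a b.1 b.2.1
  have e2 : (F' X).submatrix (Subtype.val : {a // p a} → Site Λ) id =
      (F X).submatrix (Subtype.val : {a // p a} → Site Λ) id := by
    ext a b; exact h1 X a.1 b a.2.1
  have e3 : Matrix.submatrix (fun a b : Site Λ => if cl a.1 = cl b.1 then
        F' (nbhd ℓ (cl a.1)) a b + (F' X a b - F' (X ∩ nbhd ℓ (cl a.1)) a b) else F' X a b)
        (Subtype.val : {a // p a} → Site Λ) (Subtype.val : {a // p a} → Site Λ) =
      Matrix.submatrix (fun a b : Site Λ => if cl a.1 = cl b.1 then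
        F (nbhd ℓ (cl a.1)) a b + (F X a b - F (X ∩ nbhd ℓ (cl a.1)) a b) else F X a b)
        (Subtype.val : {a // p a} → Site Λ) (Subtype.val : {a // p a} → Site Λ) := by
    ext a b
    change (if cl a.1.1 = cl b.1.1 then _ else _) = (if cl a.1.1 = cl b.1.1 then _ else _)
    rw [h1 _ _ _ a.2.1, h1 _ _ _ a.2.1, h1 _ _ _ a.2.1]
  change F' X - (F' X).submatrix id (Subtype.val : {a // p a} → Site Λ) *
      (Matrix.submatrix (fun a b : Site Λ => if cl a.1 = cl b.1 then
        F' (nbhd ℓ (cl a.1)) a b + (F' X a b - F' (X ∩ nbhd ℓ (cl a.1)) a b) else F' X a b)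
        (Subtype.val : {a // p a} → Site Λ) (Subtype.val : {a // p a} → Site Λ) -
        lam • (1 : Matrix {a // p a} {a // p a} ℝ))⁻¹ *
      (F' X).submatrix (Subtype.val : {a // p a} → Site Λ) id =
    F X - (F X).submatrix id (Subtype.val : {a // p a} → Site Λ) *
      (Matrix.submatrix (fun a b : Site Λ => if cl a.1 = cl b.1 then
        F (nbhd ℓ (cl a.1)) a b + (F X a b - F (X ∩ nbhd ℓ (cl a.1)) a b) else F X a b)
        (Subtype.val : {a // p a} → Site Λ) (Subtype.val : {a // p a} → Site Λ) -
        lam • (1 : Matrix {a // p a} {a // p a} ℝ))⁻¹ *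
      (F X).submatrix (Subtype.val : {a // p a} → Site Λ) id + Δ X
  rw [e1, e2, e3, hF]
  abel

/-- The change of `H` restricted to `X` under a change of the potential. -/
def potDiff (u u' : Λ → ℝ) (X : Finset Λ) : Matrix (Site Λ) (Site Λ) ℝ := fun a b =>
  if a.1 ∈ X ∧ b.1 ∈ X then (if a.1 = b.1 then h (u' a.1) a.2 b.2 - h (u a.1) a.2 b.2 else 0) else 0

theorem potDiff_eq_zero {u u' : Λ → ℝ} {X : Finset Λ} {a b : Site Λ} (h : u' a.1 = u a.1) :
    potDiff u u' X a b = 0 := by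
  rw [potDiff, h]; simp

theorem potDiff_eq_zero' {u u' : Λ → ℝ} {X : Finset Λ} {a b : Site Λ} (h : u' b.1 = u b.1) :
    potDiff u u' X a b = 0 := by
  by_cases hab : a.1 = b.1
  · exact potDiff_eq_zero (by rw [hab, h])
  · simp [potDiff, hab]

/-- A change of the potential on `R k` changes the `k`-th Schur complement as it changes `H`. -/
theorem schur_add_potDiff (γ : ℝ) {u u' : Λ → ℝ} (lam : ℝ) {R : ℕ → Finset Λ} {k : ℕ}
    (hR : ∀ i < k, R (i + 1) ⊆ R i) (hu : ∀ z, z ∉ R k → u' z = u z) (X : Finset Λ) :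
    schur γ u' lam R k X = schur γ u lam R k X + potDiff u u' X := by
  induction k generalizing X with
  | zero =>
    ext a b
    change (if a.1 ∈ X ∧ b.1 ∈ X then H γ u' a b else 0) =
      (if a.1 ∈ X ∧ b.1 ∈ X then H γ u a b else 0) + potDiff u u' X a b
    simp only [potDiff, H]
    split_ifs <;> ring
  | succ k ih =>
    have hsub := hR k (by omega)
    rw [schur_succ_eq, schur_succ_eq]
    refine schurStep_add (ih (fun i hi => hR i (by omega)) fun z hz => hu z fun h => hz (hsub h))
      (fun X a b ha => potDiff_eq_zero (hu _ (Finset.mem_sdiff.1 ha).2))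
      (fun X a b hb => potDiff_eq_zero' (hu _ (Finset.mem_sdiff.1 hb).2)) _ _ X

/-! ### Determinants of resonant matrices -/

theorem abs_eigenvalue_le {ι : Type*} [Fintype ι] [DecidableEq ι] {A : Matrix ι ι ℝ} {K : ℝ}
    (hr : ∀ a, ∑ b, |A a b| ≤ K) {μ : ℝ} (hμ : μ ∈ spectrum ℝ A) : |μ| ≤ K := by
  rw [← Matrix.spectrum_toLin', ← Module.End.hasEigenvalue_iff_mem_spectrum] at hμ
  obtain ⟨k, hk⟩ := eigenvalue_mem_ball hμ
  rw [Metric.mem_closedBall, Real.dist_eq] at hk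
  have h1 := hr k
  rw [← Finset.add_sum_erase _ _ (Finset.mem_univ k)] at h1
  have h2 := abs_sub_abs_le_abs_sub μ (A k k)
  simp only [Real.norm_eq_abs] at hk
  linarith

/-- The determinant is the product of the eigenvalues: one is at most `e` by resonance, and the
others are at most `K` by Gershgorin's theorem. -/
theorem abs_det_le {ι : Type*} [Fintype ι] [DecidableEq ι] {A : Matrix ι ι ℝ}
    (hA : A.IsHermitian) {K E e : ℝ} (hK : 1 ≤ K)
    (hr : ∀ a, ∑ b, |(A - E • (1 : Matrix ι ι ℝ)) a b| ≤ K)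
    (hs : ∃ μ ∈ spectrum ℝ A, |μ - E| ≤ e) :
    |(A - E • (1 : Matrix ι ι ℝ)).det| ≤ e * K ^ Fintype.card ι := by
  obtain ⟨μ, hμ, hμe⟩ := hs
  have hB : (A - E • (1 : Matrix ι ι ℝ)).IsHermitian := by
    refine hA.sub ?_
    ext a b
    simp [Matrix.one_apply, eq_comm]
  have h1 : μ - E ∈ spectrum ℝ (A - E • (1 : Matrix ι ι ℝ)) := by
    have h2 : A - E • (1 : Matrix ι ι ℝ) = A - algebraMap ℝ _ E := by
      rw [Algebra.algebraMap_eq_smul_one]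
    rw [h2, spectrum.mem_iff, map_sub, sub_sub_sub_cancel_right]
    exact spectrum.mem_iff.1 hμ
  rw [hB.spectrum_real_eq_range_eigenvalues] at h1
  obtain ⟨i, hi⟩ := h1
  rw [hB.det_eq_prod_eigenvalues, Finset.abs_prod, ← Finset.mul_prod_erase _ _ (Finset.mem_univ i)]
  have h3 : ∏ x ∈ Finset.univ.erase i, |((hB.eigenvalues x : ℝ) : ℝ)| ≤ K ^ Fintype.card ι := by
    refine (Finset.prod_le_prod (fun _ _ => abs_nonneg _) fun x _ =>
      abs_eigenvalue_le hr (hB.eigenvalues_mem_spectrum_real x)).trans ?_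
    rw [Finset.prod_const]
    refine pow_le_pow_right₀ hK ?_
    rw [Finset.card_erase_of_mem (Finset.mem_univ i), Finset.card_univ]
    omega
  have he : 0 ≤ e := (abs_nonneg _).trans hμe
  have h4 : |hB.eigenvalues i| ≤ e := by rw [hi]; exact hμe
  exact mul_le_mul h4 h3 (Finset.prod_nonneg fun _ _ => abs_nonneg _) he

/-! ### Small values of determinants with random diagonal blocks -/

/-- The uniform distribution on `[-1, 1]`. -/
def unif : MeasureTheory.Measure ℝ :=
  (2 : ℝ≥0∞)⁻¹ • MeasureTheory.volume.restrict (Set.Icc (-1 : ℝ) 1)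

instance : MeasureTheory.IsProbabilityMeasure unif := ⟨by
  rw [unif, MeasureTheory.Measure.smul_apply, MeasureTheory.Measure.restrict_apply_univ,
    Real.volume_Icc, smul_eq_mul]
  norm_num
  exact ENNReal.inv_mul_cancel (by norm_num) (by norm_num)⟩

theorem unif_le (S : Set ℝ) : unif S ≤ (2 : ℝ≥0∞)⁻¹ * MeasureTheory.volume S := by
  rw [unif, MeasureTheory.Measure.smul_apply, smul_eq_mul]
  gcongr
  exact MeasureTheory.Measure.restrict_le_self

/-- The set is contained in two intervals ±[α, β] with β² - α² ≤ 2η, hence of length at most √(2η).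
-/
theorem volume_sq_sub_le (D : ℝ) {η : ℝ} (hη : 0 ≤ η) :
    MeasureTheory.volume {s : ℝ | |s ^ 2 - D| ≤ η} ≤ ENNReal.ofReal (2 * √(2 * η)) := by
  set α := √(max (D - η) 0) with hα
  set β := √(D + η) with hβ
  have hsub : {s : ℝ | |s ^ 2 - D| ≤ η} ⊆ Set.Icc α β ∪ Set.Icc (-β) (-α) := by
    intro s hs
    rw [Set.mem_ofPred_eq, abs_le] at hs
    have h1 : |s| ≤ β := Real.abs_le_sqrt (by linarith)
    have h2 : α ≤ |s| := by
      rw [← Real.sqrt_sq_eq_abs]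
      exact Real.sqrt_le_sqrt (max_le (by linarith) (sq_nonneg _))
    rcases le_total 0 s with h0 | h0
    · rw [abs_of_nonneg h0] at h1 h2
      exact Or.inl ⟨h2, h1⟩
    · rw [abs_of_nonpos h0] at h1 h2
      exact Or.inr ⟨by linarith, by linarith⟩
  have hlen : β - α ≤ √(2 * η) := by
    have h0 : 0 ≤ √(2 * η) + α := add_nonneg (Real.sqrt_nonneg _) (Real.sqrt_nonneg _)
    rw [sub_le_iff_le_add, hβ]
    refine Real.sqrt_le_iff.2 ⟨h0, ?_⟩
    have h1 : √(2 * η) ^ 2 = 2 * η := Real.sq_sqrt (by positivity)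
    have h2 : α ^ 2 = max (D - η) 0 := Real.sq_sqrt (le_max_right _ _)
    have h3 := le_max_left (D - η) 0
    have h4 : 0 ≤ √(2 * η) * α := mul_nonneg (Real.sqrt_nonneg _) (Real.sqrt_nonneg _)
    nlinarith
  calc MeasureTheory.volume {s : ℝ | |s ^ 2 - D| ≤ η}
      ≤ MeasureTheory.volume (Set.Icc α β) + MeasureTheory.volume (Set.Icc (-β) (-α)) :=
        (MeasureTheory.measure_mono hsub).trans (MeasureTheory.measure_union_le _ _)
    _ = ENNReal.ofReal (β - α) + ENNReal.ofReal (β - α) := by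
        rw [Real.volume_Icc, Real.volume_Icc]; ring_nf
    _ ≤ ENNReal.ofReal √(2 * η) + ENNReal.ofReal √(2 * η) := by gcongr
    _ = _ := by
        rw [← ENNReal.ofReal_add (Real.sqrt_nonneg _) (Real.sqrt_nonneg _)]; ring_nf

theorem unif_sq_sub_le (D : ℝ) {η : ℝ} (hη : 0 ≤ η) :
    unif {s : ℝ | |s ^ 2 - D| ≤ η} ≤ ENNReal.ofReal √(2 * η) := by
  refine (unif_le _).trans ((mul_le_mul_right (volume_sq_sub_le D hη) _).trans (le_of_eq ?_))
  rw [show (2 : ℝ≥0∞)⁻¹ = ENNReal.ofReal (2⁻¹) by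
    rw [ENNReal.ofReal_inv_of_pos two_pos]; norm_num, ← ENNReal.ofReal_mul (by norm_num)]
  congr 1
  ring

/-- Completing the square reduces the claim, after a translation, to `volume_sq_sub_le`; the density
1/2 cancels the factor 2 from the two intervals. -/
theorem unif_quadratic_le (a b c : ℝ) {η θ : ℝ} (hη : 0 ≤ η) (hθ : 0 < θ) (ha : θ ≤ |a|) :
    unif {s : ℝ | |-(s ^ 2 * a) + s * b + c| ≤ θ * η} ≤ ENNReal.ofReal √(2 * η) := by
  have ha0 : a ≠ 0 := fun h => by rw [h, abs_zero] at ha; linarith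
  set m := b / (2 * a) with hm
  set D := m ^ 2 + c / a with hD
  have hsub : {s : ℝ | |-(s ^ 2 * a) + s * b + c| ≤ θ * η} ⊆
      (fun s => -m + s) ⁻¹' {s : ℝ | |s ^ 2 - D| ≤ η} := by
    intro s hs
    rw [Set.mem_ofPred_eq] at hs
    have h1 : -(s ^ 2 * a) + s * b + c = -a * ((-m + s) ^ 2 - D) := by
      rw [hD, hm]; field_simp; ring
    rw [h1, abs_mul, abs_neg] at hs
    have h2 : θ * |(-m + s) ^ 2 - D| ≤ θ * η :=
      (mul_le_mul_of_nonneg_right ha (abs_nonneg _)).trans hs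
    exact le_of_mul_le_mul_left h2 hθ
  refine (unif_le _).trans ?_
  have h3 : MeasureTheory.volume {s : ℝ | |-(s ^ 2 * a) + s * b + c| ≤ θ * η} ≤
      ENNReal.ofReal (2 * √(2 * η)) := by
    refine (MeasureTheory.measure_mono hsub).trans ?_
    rw [MeasureTheory.measure_preimage_add]
    exact volume_sq_sub_le D hη
  refine (mul_le_mul_right h3 _).trans (le_of_eq ?_)
  rw [show (2 : ℝ≥0∞)⁻¹ = ENNReal.ofReal (2⁻¹) by
    rw [ENNReal.ofReal_inv_of_pos two_pos]; norm_num, ← ENNReal.ofReal_mul (by norm_num)]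
  congr 1
  ring

section Det

variable {ι : Type*} [Fintype ι]

/-- The matrix `M + ⊕ h (w z)`, in which the rows over `S` are replaced by those of the identity. -/
def rowMatrix (M : Matrix (ι × Fin 2) (ι × Fin 2) ℝ) (S : Finset ι) (w : ι → ℝ) :
    Matrix (ι × Fin 2) (ι × Fin 2) ℝ := fun a b =>
  if a.1 ∈ S then (1 : Matrix (ι × Fin 2) (ι × Fin 2) ℝ) a b
  else M a b + if a.1 = b.1 then h (w a.1) a.2 b.2 else 0

theorem continuous_det_rowMatrix (M : Matrix (ι × Fin 2) (ι × Fin 2) ℝ) (S : Finset ι) :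
    Continuous fun w => (rowMatrix M S w).det := by
  refine Continuous.matrix_det (continuous_matrix fun a b => ?_)
  simp only [rowMatrix]
  split_ifs
  · exact continuous_const
  · refine continuous_const.add ?_
    generalize a.2 = i
    generalize b.2 = j
    fin_cases i <;> fin_cases j <;> simp only [h] <;> simp <;> fun_prop
  · exact continuous_const

/-- The variable occurs only on the diagonal, as `s` in the row `(z, 0)` and as `-s` in the row `(z,
1)`. By linearity of the determinant in these two rows it is quadratic in `s`, and its leading
coefficient is minus the determinant with both rows replaced by unit vectors. -/
theorem det_rowMatrix_update (M : Matrix (ι × Fin 2) (ι × Fin 2) ℝ) {S : Finset ι} {z : ι}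
    (hz : z ∉ S) (w : ι → ℝ) : ∃ b c : ℝ, ∀ s, (rowMatrix M S (Function.update w z s)).det =
      -(s ^ 2 * (rowMatrix M (insert z S) w).det) + s * b + c := by
  set N := rowMatrix M S (Function.update w z 0) with hN
  set I : Matrix (ι × Fin 2) (ι × Fin 2) ℝ := 1
  set f : (ι × Fin 2 → ℝ) → (ι × Fin 2 → ℝ) → ℝ := fun x y =>
    ((N.updateRow (z, 0) x).updateRow (z, 1) y).det with hf
  have hne : ((z, 0) : ι × Fin 2) ≠ (z, 1) := by simp
  have hcomm : ∀ x y, (N.updateRow (z, 0) x).updateRow (z, 1) y =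
      (N.updateRow (z, 1) y).updateRow (z, 0) x := fun x y => by
    exact Function.update_comm hne.symm _ _ _ |>.symm
  have hadd2 : ∀ x y y' s, f x (y + s • y') = f x y + s * f x y' := fun x y y' s => by
    simp only [hf]
    rw [Matrix.det_updateRow_add, Matrix.det_updateRow_smul]
  have hadd1 : ∀ x x' y s, f (x + s • x') y = f x y + s * f x' y := fun x x' y s => by
    simp only [hf]
    rw [hcomm, hcomm, hcomm, Matrix.det_updateRow_add, Matrix.det_updateRow_smul]
  have key : ∀ s, rowMatrix M S (Function.update w z s) =
      (N.updateRow (z, 0) (N (z, 0) + s • I (z, 0))).updateRow (z, 1)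
        (N (z, 1) + (-s) • I (z, 1)) := by
    intro s
    ext ⟨y, i⟩ b
    by_cases hy : y = z
    · subst hy
      have h1 : ∀ (v : ℝ) (i : Fin 2), rowMatrix M S (Function.update w y v) (y, i) b =
          M (y, i) b + if y = b.1 then h v i b.2 else 0 := fun v i => by
        simp only [rowMatrix]
        rw [if_neg hz, Function.update_self]
      rcases (show i = 0 ∨ i = 1 by fin_cases i <;> simp) with rfl | rfl
      · change rowMatrix M S (Function.update w y s) (y, 0) b = _
        rw [h1, Matrix.updateRow_ne hne, Matrix.updateRow_self]
        change _ = rowMatrix M S (Function.update w y 0) (y, 0) b + s * (1 : Matrix _ _ ℝ) (y, 0) b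
        rw [h1]
        obtain ⟨b1, b2⟩ := b
        by_cases hb : y = b1
        · subst hb
          rcases (show b2 = 0 ∨ b2 = 1 by fin_cases b2 <;> simp) with rfl | rfl <;> simp [h]
        · simp [hb]
      · change rowMatrix M S (Function.update w y s) (y, 1) b = _
        rw [h1, Matrix.updateRow_self]
        change _ = rowMatrix M S (Function.update w y 0) (y, 1) b + -s * (1 : Matrix _ _ ℝ) (y, 1) b
        rw [h1]
        obtain ⟨b1, b2⟩ := b
        by_cases hb : y = b1
        · subst hb
          rcases (show b2 = 0 ∨ b2 = 1 by fin_cases b2 <;> simp) with rfl | rfl <;> simp [h]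
        · simp [hb]
    · rw [Matrix.updateRow_ne (by simp [hy]), Matrix.updateRow_ne (by simp [hy])]
      simp only [hN, rowMatrix, Function.update_of_ne hy]
  have key' : rowMatrix M (insert z S) w =
      (N.updateRow (z, 0) (I (z, 0))).updateRow (z, 1) (I (z, 1)) := by
    ext ⟨y, i⟩ b
    by_cases hy : y = z
    · subst hy
      have h1 : ∀ i, rowMatrix M (insert y S) w (y, i) b = (1 : Matrix _ _ ℝ) (y, i) b := fun i =>
        if_pos (Finset.mem_insert_self y S)
      rcases (show i = 0 ∨ i = 1 by fin_cases i <;> simp) with rfl | rfl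
      · rw [Matrix.updateRow_ne hne, Matrix.updateRow_self]
        exact h1 0
      · rw [Matrix.updateRow_self]
        exact h1 1
    · rw [Matrix.updateRow_ne (by simp [hy]), Matrix.updateRow_ne (by simp [hy])]
      simp only [hN, rowMatrix, Function.update_of_ne hy, Finset.mem_insert, hy, false_or]
  refine ⟨f (I (z, 0)) (N (z, 1)) - f (N (z, 0)) (I (z, 1)), f (N (z, 0)) (N (z, 1)), fun s => ?_⟩
  have h1 : (rowMatrix M S (Function.update w z s)).det =
      f (N (z, 0) + s • I (z, 0)) (N (z, 1) + (-s) • I (z, 1)) := by rw [key s]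
  have h2 : (rowMatrix M (insert z S) w).det = f (I (z, 0)) (I (z, 1)) := by rw [key']
  rw [h1, h2, hadd2, hadd1, hadd1]
  ring

theorem rowMatrix_update_of_mem (M : Matrix (ι × Fin 2) (ι × Fin 2) ℝ) {S : Finset ι} {z : ι}
    (hz : z ∈ S) (w : ι → ℝ) (s : ℝ) :
    rowMatrix M S (Function.update w z s) = rowMatrix M S w := by
  ext a b
  simp only [rowMatrix]
  split_ifs with ha hab
  · rfl
  · rw [Function.update_of_ne fun h' : a.1 = z => ha (by rw [h']; exact hz)]
  · rfl

/-- Fubini's theorem, with the coordinate `z` integrated first. -/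
theorem pi_le_of_update {A : Set (ι → ℝ)} (hA : MeasurableSet A) (z : ι) {c : ℝ≥0∞}
    (hc : ∀ w, unif {s | Function.update w z s ∈ A} ≤ c) :
    MeasureTheory.Measure.pi (fun _ : ι => unif) A ≤ c := by
  have h1 := MeasureTheory.lintegral_le_of_lmarginal_le (μ := fun _ : ι => unif) {z}
    (f := A.indicator 1) (g := fun _ => c) (measurable_one.indicator hA) measurable_const ?_
  · rwa [MeasureTheory.lintegral_indicator_one hA, MeasureTheory.lintegral_const,
      MeasureTheory.measure_univ, mul_one] at h1
  · intro w
    rw [MeasureTheory.lmarginal_singleton, MeasureTheory.lmarginal_singleton]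
    simp only [MeasureTheory.lintegral_const, MeasureTheory.measure_univ, mul_one]
    have h2 : ∀ s, A.indicator (1 : (ι → ℝ) → ℝ≥0∞) (Function.update w z s) =
        {s | Function.update w z s ∈ A}.indicator 1 s := fun s => rfl
    simp only [h2]
    have h3 : MeasurableSet {s | Function.update w z s ∈ A} := hA.preimage (measurable_update w)
    rw [MeasureTheory.lintegral_indicator_one h3]
    exact hc w

/-- Small values of the determinant of `M + ⊕ h (w z)` are improbable. -/
theorem pi_det_lt_le (M : Matrix (ι × Fin 2) (ι × Fin 2) ℝ) {η : ℝ} (hη : 0 < η) (S : Finset ι) :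
    MeasureTheory.Measure.pi (fun _ : ι => unif) {w | |(rowMatrix M Sᶜ w).det| < η ^ S.card} ≤
      ENNReal.ofReal (S.card * √(2 * η)) := by
  induction S using Finset.induction_on with
  | empty =>
    have h1 : ∀ w : ι → ℝ, rowMatrix M (∅ : Finset ι)ᶜ w = 1 := fun w => by
      ext a b
      simp [rowMatrix]
    simp only [h1, Matrix.det_one, abs_one, Finset.card_empty, pow_zero, lt_irrefl]
    simp
  | insert z S hz ih =>
    have hins : insert z (insert z S)ᶜ = Sᶜ := by
      ext y
      by_cases hy : y = z
      · simp [hy, hz]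
      · simp [hy]
    set T := (insert z S)ᶜ with hT
    have hzT : z ∉ T := by simp [hT]
    rw [Finset.card_insert_of_notMem hz]
    -- On this event the determinant falls by more than a factor η when the rows over `z` are
    -- restored. For fixed other coordinates the leading coefficient of the quadratic polynomial is
    -- then at least `η ^ S.card`, so every position costs a probability √(2η).
    set A : Set (ι → ℝ) := {w | |(rowMatrix M T w).det| < η ^ (S.card + 1) ∧
      η ^ S.card ≤ |(rowMatrix M Sᶜ w).det|} with hA
    have hAm : MeasurableSet A := by
      refine MeasurableSet.inter ?_ ?_
      · exact measurableSet_lt (continuous_abs.comp (continuous_det_rowMatrix M T)).measurable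
          measurable_const
      · exact measurableSet_le measurable_const
          (continuous_abs.comp (continuous_det_rowMatrix M Sᶜ)).measurable
    have hAle : MeasureTheory.Measure.pi (fun _ : ι => unif) A ≤ ENNReal.ofReal √(2 * η) := by
      refine pi_le_of_update hAm z fun w => ?_
      obtain ⟨b, c, hbc⟩ := det_rowMatrix_update M hzT w
      rw [hins] at hbc
      by_cases hw : η ^ S.card ≤ |(rowMatrix M Sᶜ w).det|
      · refine le_trans (MeasureTheory.measure_mono ?_)
          (unif_quadratic_le (rowMatrix M Sᶜ w).det b c hη.le (pow_pos hη S.card) hw)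
        intro s hs
        have h1 := hs.1
        rw [hbc, pow_succ] at h1
        exact h1.le
      · have h1 : {s | Function.update w z s ∈ A} = ∅ := by
          refine Set.eq_empty_of_forall_notMem fun s hs => hw ?_
          have h2 := hs.2
          rwa [rowMatrix_update_of_mem M (by simpa using hz)] at h2
        rw [h1, MeasureTheory.measure_empty]
        exact zero_le
    have hsub : {w | |(rowMatrix M T w).det| < η ^ (S.card + 1)} ⊆
        {w | |(rowMatrix M Sᶜ w).det| < η ^ S.card} ∪ A := by
      intro w hw
      by_cases h : |(rowMatrix M Sᶜ w).det| < η ^ S.card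
      · exact Or.inl h
      · exact Or.inr ⟨hw, not_lt.1 h⟩
    refine (MeasureTheory.measure_mono hsub).trans ((MeasureTheory.measure_union_le _ _).trans ?_)
    refine (add_le_add ih hAle).trans (le_of_eq ?_)
    rw [← ENNReal.ofReal_add (by positivity) (by positivity)]
    push_cast
    ring_nf

end Det

/-! ### Iterated integration over disjoint sets of coordinates -/

/-- A set is small if its sections are small, which are taken successively in disjoint sets `C ℓ` of
coordinates, in the order of decreasing `lev ℓ`. -/
theorem pi_le_prod_of_sections {ι κ : Type*} [Fintype ι] {A : Set (ι → ℝ)} (hA : MeasurableSet A)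
    (𝓛 : Finset κ) (lev : κ → ℕ) (C : κ → Finset ι) (φ : κ → ℝ≥0∞)
    (hdisj : ∀ ℓ ∈ 𝓛, ∀ ℓ' ∈ 𝓛, ℓ ≠ ℓ' → Disjoint (C ℓ) (C ℓ'))
    (hsec : ∀ ℓ ∈ 𝓛, ∀ v : ι → ℝ, MeasureTheory.Measure.pi (fun _ : C ℓ => unif)
      {y | ∃ u ∈ A, (∀ z, (∀ ℓ' ∈ 𝓛, lev ℓ ≤ lev ℓ' → z ∉ C ℓ') → u z = v z) ∧
        ∀ z : C ℓ, u z = y z} ≤ φ ℓ) :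
    MeasureTheory.Measure.pi (fun _ : ι => unif) A ≤ ∏ ℓ ∈ 𝓛, φ ℓ := by
  -- `g` is the marginal of the indicator of `A` over the coordinates of the sets in `T`; it is
  -- nonzero only on the projection of `A`. New sets are inserted with a minimal level, so the
  -- coordinates of higher levels have been integrated out and are only known to exist. This is the
  -- existential quantifier in `hsec`.
  have key : ∀ T : Finset κ, T ⊆ 𝓛 → ∃ g : (ι → ℝ) → ℝ≥0∞, Measurable g ∧
      MeasureTheory.Measure.pi (fun _ : ι => unif) A ≤
        ∫⁻ v, g v ∂MeasureTheory.Measure.pi (fun _ : ι => unif) ∧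
      (∀ v, g v ≤ ∏ ℓ ∈ T, φ ℓ) ∧
      ∀ v, g v ≠ 0 → ∃ u ∈ A, ∀ z, (∀ ℓ ∈ T, z ∉ C ℓ) → u z = v z := by
    intro T
    induction T using Finset.induction_on_min_value lev with
    | empty =>
      intro _
      refine ⟨A.indicator 1, measurable_one.indicator hA, ?_, fun v => ?_, fun v hv => ?_⟩
      · rw [MeasureTheory.lintegral_indicator_one hA]
      · rw [Finset.prod_empty]
        exact Set.indicator_le_self' (fun _ _ => zero_le) v
      · refine ⟨v, ?_, fun _ _ => rfl⟩
        by_contra h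
        exact hv (Set.indicator_of_notMem h _)
    | insert ℓ T hℓ hmin ih =>
      intro hT
      have hℓ𝓛 := hT (Finset.mem_insert_self ℓ T)
      have hT𝓛 : T ⊆ 𝓛 := (Finset.subset_insert ℓ T).trans hT
      obtain ⟨g, hg, hgA, hgle, hgs⟩ := ih hT𝓛
      have hmem : ∀ z, z ∈ C ℓ → ∀ ℓ' ∈ T, z ∉ C ℓ' := fun z hz ℓ' hℓ' hz' =>
        Finset.disjoint_left.1 (hdisj ℓ hℓ𝓛 ℓ' (hT𝓛 hℓ') fun h => hℓ (h ▸ hℓ')) hz hz'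
      set g' := MeasureTheory.lmarginal (fun _ : ι => unif) (C ℓ) g with hg'
      have hupd : ∀ (v : ι → ℝ) (y : C ℓ → ℝ) (u : ι → ℝ),
          (∀ z, (∀ ℓ' ∈ T, z ∉ C ℓ') → u z = Function.updateFinset v (C ℓ) y z) →
          (∀ z, (∀ ℓ' ∈ insert ℓ T, z ∉ C ℓ') → u z = v z) ∧ ∀ z : C ℓ, u z = y z := by
        intro v y u hu
        refine ⟨fun z hz => ?_, fun z => ?_⟩
        · rw [hu z fun ℓ' hℓ' => hz ℓ' (Finset.mem_insert_of_mem hℓ'), Function.updateFinset,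
            dif_neg (hz ℓ (Finset.mem_insert_self ℓ T))]
        · rw [hu z (hmem z z.2), Function.updateFinset, dif_pos z.2]
      refine ⟨g', hg.lmarginal _, ?_, fun v => ?_, fun v hv => ?_⟩
      · refine hgA.trans (le_of_eq ?_)
        refine MeasureTheory.lintegral_eq_of_lmarginal_eq (C ℓ) hg (hg.lmarginal _) ?_
        funext x
        conv_rhs => rw [MeasureTheory.lmarginal]
        have h1 : ∀ y, g' (Function.updateFinset x (C ℓ) y) = g' x := fun y =>
          MeasureTheory.lmarginal_congr _ g fun i hi => by
            rw [Function.updateFinset, dif_neg hi]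
        simp only [h1, MeasureTheory.lintegral_const, MeasureTheory.measure_univ, mul_one]
        rfl
      · set W : Set (C ℓ → ℝ) := {y | g (Function.updateFinset v (C ℓ) y) ≠ 0} with hW
        have hWm : MeasurableSet W := by
          have : Measurable fun y => g (Function.updateFinset v (C ℓ) y) :=
            hg.comp measurable_updateFinset
          exact (this (measurableSet_singleton 0)).compl
        have h1 : ∀ y, g (Function.updateFinset v (C ℓ) y) ≤
            W.indicator (fun _ => ∏ ℓ ∈ T, φ ℓ) y := by
          intro y
          by_cases hy : y ∈ W
          · rw [Set.indicator_of_mem hy]; exact hgle _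
          · rw [Set.indicator_of_notMem hy]
            exact (not_not.1 hy).le
        have h2 : MeasureTheory.Measure.pi (fun _ : C ℓ => unif) W ≤ φ ℓ := by
          refine (MeasureTheory.measure_mono fun y hy => ?_).trans (hsec ℓ hℓ𝓛 v)
          obtain ⟨u, huA, hu⟩ := hgs _ hy
          obtain ⟨h3, h4⟩ := hupd v y u hu
          refine ⟨u, huA, fun z hz => h3 z fun ℓ' hℓ' => ?_, h4⟩
          refine hz ℓ' (hT hℓ') ?_
          rcases Finset.mem_insert.1 hℓ' with rfl | h
          · exact le_rfl
          · exact hmin ℓ' h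
        rw [Finset.prod_insert hℓ, mul_comm]
        calc g' v ≤ ∫⁻ y, W.indicator (fun _ => ∏ ℓ ∈ T, φ ℓ) y
              ∂MeasureTheory.Measure.pi (fun _ : C ℓ => unif) :=
              MeasureTheory.lintegral_mono h1
          _ = (∏ ℓ ∈ T, φ ℓ) * MeasureTheory.Measure.pi (fun _ : C ℓ => unif) W :=
              MeasureTheory.lintegral_indicator_const hWm _
          _ ≤ _ := mul_le_mul_right h2 _
      · have h1 : ∃ y, g (Function.updateFinset v (C ℓ) y) ≠ 0 := by
          by_contra h
          push Not at h
          refine hv ?_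
          rw [hg', MeasureTheory.lmarginal]
          simp only [h, MeasureTheory.lintegral_zero]
        obtain ⟨y, hy⟩ := h1
        obtain ⟨u, huA, hu⟩ := hgs _ hy
        exact ⟨u, huA, (hupd v y u hu).1⟩
  obtain ⟨g, -, hgA, hgle, -⟩ := key 𝓛 (Finset.Subset.refl _)
  refine hgA.trans ((MeasureTheory.lintegral_mono hgle).trans ?_)
  rw [MeasureTheory.lintegral_const, MeasureTheory.measure_univ, mul_one]

/-! ### Blocks of the procedure -/

section Blocks

variable {ε : ℝ} {u u' : Λ → ℝ} {E E' : ℕ → ℝ} {x : Λ} {s : ℝ} {p : ℕ → ℕ} {k : ℕ}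

/-- A step removes whole components on scale `i + 1`, and these are unions of components on scale
`i`. The component of a surviving position is thus not affected. -/
theorem comp_resSet_succ {i : ℕ} (hi : 1 ≤ i) {b : Λ} (hb : b ∈ resSet ε u E (i + 1)) :
    comp (L i) (resSet ε u E i) b = comp (L i) (resSet ε u E (i + 1)) b := by
  obtain ⟨j, rfl⟩ := Nat.exists_eq_add_of_le' hi
  refine Finset.Subset.antisymm (comp_subset_comp le_rfl ?_)
    (comp_subset_comp le_rfl (comp_subset.trans (resSet_succ_subset _)))
  refine Finset.Subset.trans (comp_subset_comp (L_mono ?_) comp_subset) (comp_resSet_subset hb)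
  push_cast
  omega

theorem comp_resSet_eq {i : ℕ} (hi : 1 ≤ i) {m : ℕ} (him : i ≤ m) {b : Λ}
    (hb : b ∈ resSet ε u E m) :
    comp (L i) (resSet ε u E i) b = comp (L i) (resSet ε u E m) b := by
  induction m, him using Nat.le_induction with
  | base => rfl
  | succ m him ih =>
    have hb' := resSet_succ_subset m hb
    rw [ih hb']
    refine Finset.Subset.antisymm (comp_subset_comp le_rfl ?_)
      (comp_subset_comp le_rfl (comp_subset.trans (resSet_succ_subset _)))
    have h1 := comp_resSet_succ (hi.trans him) hb
    refine Finset.Subset.trans (comp_subset_comp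
      (L_mono (show (i : ℤ) ≤ m by exact_mod_cast him)) comp_subset) ?_
    rw [h1]
    exact comp_subset

/-- The components of the resonant sets of earlier steps are determined by a final block. -/
theorem comp_resSet_eq_comp_block {B : Finset Λ} (hB : B = block ε u E x k) {i : ℕ} (hi : 1 ≤ i)
    (hik : i ≤ k) {b : Λ} (hb : b ∈ B) : comp (L i) (resSet ε u E i) b = comp (L i) B b := by
  have hbk : b ∈ resSet ε u E k := by rw [hB] at hb; exact comp_subset hb
  have hBb : B = comp (L k) (resSet ε u E k) b := by
    rw [hB] at hb ⊢; exact (comp_eq hb).symm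
  rw [comp_resSet_eq hi hik hbk]
  refine Finset.Subset.antisymm (comp_subset_comp le_rfl ?_) (comp_subset_comp le_rfl ?_)
  · rw [hBb]
    exact comp_subset_comp (L_mono (by exact_mod_cast hik)) comp_subset
  · rw [hB]
    exact comp_subset.trans comp_subset

theorem block_subset_resSet {i : ℕ} (hik : i ≤ k) : block ε u E x k ⊆ resSet ε u E i :=
  comp_subset.trans (resSet_antitone hik)

theorem Follows.mono (hf : Follows ε u x s p k E) {i : ℕ} (hik : i ≤ k) :
    Follows ε u x s p i E :=
  ⟨hf.1, fun j h1 h2 => hf.2 j h1 (by omega)⟩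

theorem Follows.energy_dist (hf : Follows ε u x s p k E) (j : ℕ) (h1 : 1 ≤ j) (h2 : j < k) :
    |E (j + 1) - E j| ≤ epsAt ε j / 3 := (hf.2 j h1 h2).1.1

/-- If `a < b`, then the elements below `b` include those below `a` and `a` itself, which is
impossible when both numbers are the same finite one. This is why the ranks determine the energies.
-/
theorem eq_of_encard_inter_Iio_eq {S : Set ℝ} {a b : ℝ} {n : ℕ} (ha : a ∈ S) (hb : b ∈ S)
    (hna : (S ∩ Set.Iio a).encard = n) (hnb : (S ∩ Set.Iio b).encard = n) : a = b := by
  have key : ∀ {a b : ℝ}, a ∈ S → (S ∩ Set.Iio a).encard = n → (S ∩ Set.Iio b).encard = n →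
      ¬ a < b := by
    intro a b ha hna hnb hab
    have h1 : insert a (S ∩ Set.Iio a) ⊆ S ∩ Set.Iio b := by
      rintro c (rfl | hc)
      · exact ⟨ha, hab⟩
      · exact ⟨hc.1, lt_trans hc.2 hab⟩
    have h2 := Set.encard_le_encard h1
    rw [Set.encard_insert_of_notMem (fun h => lt_irrefl a h.2), hna, hnb] at h2
    have h3 : ((n + 1 : ℕ) : ℕ∞) ≤ (n : ℕ∞) := by exact_mod_cast h2
    have h4 : n + 1 ≤ n := by exact_mod_cast h3
    omega
  exact le_antisymm (not_lt.1 (key hb hnb hna)) (not_lt.1 (key ha hna hnb))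

/-- By `schur_add_potDiff`, a change of the potential on `R m` enters the `m`-th Schur complement
only on the diagonal, at the very positions where it takes place. -/
theorem truncSchur_eq_of_disjoint {γ lam : ℝ} {R : ℕ → Finset Λ} {m : ℕ} {B : Finset Λ}
    (hR : ∀ i < m, R (i + 1) ⊆ R i) (hu : ∀ z, z ∉ R m → u' z = u z) (hB : ∀ z ∈ B, u' z = u z) :
    truncSchur γ u' lam R m B = truncSchur γ u lam R m B := by
  ext a b
  change schur γ u' lam R m _ a.1 b.1 = schur γ u lam R m _ a.1 b.1
  rw [schur_add_potDiff γ lam hR hu, Matrix.add_apply, potDiff_eq_zero (hB _ a.2), add_zero]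

/-- A component that meets `Y` meets `B`, and so it survives for both potentials, as `B` does. A
component disjoint from `Y` undergoes the same resonance test: `Y` has not been eliminated before,
and the potential is unchanged on the component. -/
theorem resSet_subset_of_agree {Y B : Finset Λ} {m : ℕ}
    (hE : ∀ i, 1 ≤ i → i ≤ m → E i = E' i) (hR : ∀ i < m, resSet ε u E i = resSet ε u' E' i)
    (hY : ∀ z, z ∉ Y → u z = u' z) (hYB : Y ⊆ B) (hB : B ⊆ resSet ε u E m)
    (hB' : B ⊆ resSet ε u' E' m) : resSet ε u E m ⊆ resSet ε u' E' m := by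
  intro z hz
  match m with
  | 0 => exact Finset.mem_univ z
  | 1 =>
    by_cases hzY : z ∈ Y
    · exact hB' (hYB hzY)
    · rw [resSet_one, Finset.mem_filter] at hz ⊢
      rwa [← hY z hzY, ← hE 1 le_rfl le_rfl]
  | m + 2 =>
    by_contra hz'
    have hRm := hR (m + 1) (by omega)
    set C := comp (L ((m : ℤ) + 2)) (resSet ε u E (m + 1)) z with hC
    have hCB : ∀ y ∈ C, y ∉ Y := fun y hy hyY => by
      have h1 := hB' (hYB hyY)
      refine hz' (comp_resSet_subset h1 ?_)
      rw [← hRm]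
      exact mem_comp_comm.1 hy
    have h1 := mem_resSet_add_two.1 hz
    rw [mem_resSet_add_two, ← hRm, not_and, not_not, ← hC] at hz'
    have h2 := hz' h1.1
    refine h1.2 ⟨h2.1, fun h3 => h2.2 ⟨by rw [show m + 2 - 1 = m + 1 by omega, ← hRm]; exact h2.1, ?_⟩⟩
    obtain ⟨-, μ, hμ, hμE⟩ := h3
    rw [show m + 2 - 1 = m + 1 by omega] at hμ ⊢
    refine ⟨μ, ?_, by rwa [← hE (m + 2) (by omega) le_rfl]⟩
    rw [← hE (m + 2) (by omega) le_rfl, ← truncSchur_congr _ _ _ fun i hi => hR i (by omega),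
      truncSchur_eq_of_disjoint (u := u) (fun i _ => resSet_succ_subset i) (fun z hz => ?_)
      (fun z hz => (hY z (hCB z hz)).symm)]
    · exact hμ
    · exact (hY z fun hzY => hz (resSet_succ_subset _ (hB (hYB hzY)))).symm

/-- The energies and resonant sets are not affected by a change of the potential away from the
blocks that are used to define them. -/
theorem Follows.agree (hf : Follows ε u x s p k E) (hf' : Follows ε u' x s p k E') {B Y : Finset Λ}
    (hB : B = block ε u E x k) (hB' : B = block ε u' E' x k) (hY : ∀ z, z ∉ Y → u z = u' z)
    (hYB : Y ⊆ B) (hx : x ∉ Y) {m : ℕ} (hmk : m ≤ k)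
    (hdisj : ∀ i, 1 ≤ i → i < m → Disjoint Y (comp (L i) B x)) :
    ∀ i ≤ m, (1 ≤ i → E i = E' i) ∧ resSet ε u E i = resSet ε u' E' i := by
  intro i
  induction i using Nat.strong_induction_on with
  | _ i ih =>
    intro him
    have hEi : 1 ≤ i → E i = E' i := by
      intro hi
      obtain ⟨i, rfl⟩ := Nat.exists_eq_add_of_le' hi
      rcases Nat.eq_zero_or_pos i with rfl | hi0
      · rw [zero_add, hf.1, hf'.1, hY x hx]
      · obtain ⟨hEi, hRi⟩ := ih i (by omega) (by omega)
        have hRle : ∀ j ≤ i, resSet ε u E j = resSet ε u' E' j := fun j hj =>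
          (ih j (by omega) (by omega)).2
        have h1 := hf.2 i hi0 (by omega)
        have h2 := hf'.2 i hi0 (by omega)
        have hBR : B ⊆ resSet ε u E i := hB ▸ block_subset_resSet (by omega)
        have hbl : block ε u E x i = block ε u' E' x i := by rw [block, block, hRi]
        have hblY : ∀ z ∈ block ε u E x i, u' z = u z := by
          intro z hz
          refine (hY z fun hzY => ?_).symm
          by_cases hxB : x ∈ B
          · rw [block, comp_resSet_eq_comp_block hB hi0 (by omega) hxB] at hz
            exact Finset.disjoint_left.1 (hdisj i hi0 (by omega)) hzY hz
          · rw [hB, block] at hxB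
            have : B = ∅ := by
              rw [hB, block]
              exact comp_eq_empty fun h => hxB (self_mem_comp h)
            rw [this] at hYB
            exact absurd (hYB hzY) (Finset.notMem_empty _)
        have hset : nextEnergies ε u E x i = nextEnergies ε u' E' x i := by
          -- `Y` lies in the resonant set of step `i` and avoids the block of `x`, so the change of
          -- the potential does not enter the equation that determines the next energy.
          have htr : ∀ lam, truncSchur (ε ^ 4) u' lam (resSet ε u' E') i (block ε u E x i) =
              truncSchur (ε ^ 4) u lam (resSet ε u E) i (block ε u E x i) := fun lam => by
            rw [← truncSchur_congr _ _ _ hRle,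
              truncSchur_eq_of_disjoint (u := u) (fun i _ => resSet_succ_subset i)
              (fun z hz => (hY z fun hzY => hz (hBR (hYB hzY))).symm) hblY]
          have hmem : ∀ lam, lam ∈ spectrum ℝ
              (truncSchur (ε ^ 4) u' lam (resSet ε u' E') i (block ε u' E' x i)) ↔
              lam ∈ spectrum ℝ
              (truncSchur (ε ^ 4) u lam (resSet ε u E) i (block ε u E x i)) := fun lam => by
            rw [← hbl, htr]
          ext lam
          change _ ∧ _ ↔ _ ∧ _
          rw [hmem, hEi hi0]
        rw [← hset] at h2
        exact eq_of_encard_inter_Iio_eq h1.1 h2.1 h1.2 h2.2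
    refine ⟨hEi, ?_⟩
    have hBi : B ⊆ resSet ε u E i := hB ▸ block_subset_resSet (by omega)
    have hBi' : B ⊆ resSet ε u' E' i := hB' ▸ block_subset_resSet (by omega)
    have hEle : ∀ j, 1 ≤ j → j ≤ i → E j = E' j := fun j h1 h2 => by
      rcases Nat.lt_or_ge j i with h3 | h3
      · exact (ih j h3 (by omega)).1 h1
      · obtain rfl : j = i := le_antisymm h2 h3
        exact hEi h1
    have hRlt : ∀ j < i, resSet ε u E j = resSet ε u' E' j := fun j hj =>
      (ih j hj (by omega)).2
    exact Finset.Subset.antisymm (resSet_subset_of_agree hEle hRlt hY hYB hBi hBi')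
      (resSet_subset_of_agree (fun j h1 h2 => (hEle j h1 h2).symm) (fun j hj => (hRlt j hj).symm)
        (fun z hz => (hY z hz).symm) hYB hBi' hBi)

end Blocks

/-! ### The leaves of a block -/

/-- The parts of a block `B` of step `k` that contribute a factor to `Phat ε x k B`, with the steps
in which they are resonant. -/
def leaves (x : Λ) : ℕ → Finset Λ → Finset (ℕ × Finset Λ)
  | 0, _ => ∅
  | 1, B => (B.erase x).image fun z => (1, {z})
  | k + 2, B =>
      if IsIsolated k B B ∧ x ∉ B then {(k, B)}
      else (comps (L ((k : ℤ) + 1)) B).biUnion (leaves x (k + 1))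

/-- The factor of `Phat` that belongs to a leaf. -/
def leafBound (ε : ℝ) (ℓ : ℕ × Finset Λ) : ℝ :=
  if ℓ.1 = 1 then 3 * √ε else ε ^ (L ℓ.1 ^ (3 * psi / 5) / 3)

theorem comp_comp {ℓ ℓ' : ℝ} (hℓ : ℓ ≤ ℓ') {B : Finset Λ} {x z : Λ} (hz : z ∈ comp ℓ' B x) :
    comp ℓ (comp ℓ' B x) z = comp ℓ B z := by
  refine Finset.Subset.antisymm (comp_subset_comp le_rfl (comp_subset.trans comp_subset))
    (comp_subset_comp le_rfl ?_)
  rw [← comp_eq hz]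
  exact comp_subset_comp hℓ comp_subset

theorem mem_comps_of_mem_comps {ℓ ℓ' : ℝ} (hℓ : ℓ ≤ ℓ') {B C D : Finset Λ} (hC : C ∈ comps ℓ' B)
    (hD : D ∈ comps ℓ C) : D ∈ comps ℓ B := by
  obtain ⟨z, hz⟩ := nonempty_of_mem_comps hD
  have hzC := subset_of_mem_comps hD hz
  have h1 := comp_eq_of_mem_comps hC hzC
  rw [← comp_eq_of_mem_comps hD hz, ← h1, comp_comp hℓ (by rwa [h1])]
  exact comp_mem_comps (subset_of_mem_comps hC hzC)

theorem comps_self_of_mem_comps {ℓ : ℝ} {B C : Finset Λ} (hC : C ∈ comps ℓ B) :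
    C ∈ comps ℓ C := by
  obtain ⟨z, hz⟩ := nonempty_of_mem_comps hC
  have := comp_mem_comps (ℓ := ℓ) hz
  rwa [comp_self_of_mem_comps hC hz] at this

theorem leaves_spec {x : Λ} {k : ℕ} {B : Finset Λ} (hB : B ∈ comps (L k) B) {ℓ : ℕ × Finset Λ}
    (hℓ : ℓ ∈ leaves x k B) : x ∉ ℓ.2 ∧ ℓ.2 ⊆ B ∧ ℓ.2.Nonempty ∧
      ((ℓ.1 = 1 ∧ 1 ≤ k ∧ ∃ z, ℓ.2 = {z}) ∨
        (ℓ.1 + 2 ≤ k ∧ IsIsolated ℓ.1 ℓ.2 ℓ.2 ∧ ℓ.2 ∈ comps (L ((ℓ.1 : ℤ) + 2)) B)) := by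
  induction k using Nat.strong_induction_on generalizing B with
  | _ k ih =>
    match k with
    | 0 => exact absurd hℓ (Finset.notMem_empty _)
    | 1 =>
      obtain ⟨z, hz, rfl⟩ := Finset.mem_image.1 hℓ
      rw [Finset.mem_erase] at hz
      exact ⟨by simpa using hz.1.symm, by simpa using hz.2, ⟨z, by simp⟩,
        Or.inl ⟨rfl, le_rfl, z, rfl⟩⟩
    | k + 2 =>
      rw [leaves] at hℓ
      split_ifs at hℓ with h1
      · obtain rfl := Finset.mem_singleton.1 hℓ
        refine ⟨h1.2, Finset.Subset.refl _, nonempty_of_mem_comps hB,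
          Or.inr ⟨le_rfl, h1.1, ?_⟩⟩
        push_cast at hB
        exact hB
      · obtain ⟨C, hC, hℓC⟩ := Finset.mem_biUnion.1 hℓ
        have hCC := comps_self_of_mem_comps hC
        obtain ⟨h2, h3, h4, h5⟩ := ih (k + 1) (by omega) (by push_cast; exact hCC) hℓC
        refine ⟨h2, h3.trans (subset_of_mem_comps hC), h4, ?_⟩
        rcases h5 with ⟨h5, -, h6⟩ | ⟨h5, h6, h7⟩
        · exact Or.inl ⟨h5, by omega, h6⟩
        · exact Or.inr ⟨by omega, h6,
            mem_comps_of_mem_comps (L_mono (by exact_mod_cast h5)) hC h7⟩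

theorem leaves_disjoint {x : Λ} {k : ℕ} {B : Finset Λ} (hB : B ∈ comps (L k) B)
    {ℓ ℓ' : ℕ × Finset Λ} (hℓ : ℓ ∈ leaves x k B) (hℓ' : ℓ' ∈ leaves x k B) (hne : ℓ ≠ ℓ') :
    Disjoint ℓ.2 ℓ'.2 := by
  induction k using Nat.strong_induction_on generalizing B with
  | _ k ih =>
    match k with
    | 0 => exact absurd hℓ (Finset.notMem_empty _)
    | 1 =>
      obtain ⟨z, -, rfl⟩ := Finset.mem_image.1 hℓ
      obtain ⟨z', -, rfl⟩ := Finset.mem_image.1 hℓ'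
      rw [Finset.disjoint_singleton]
      exact fun h => hne (by rw [h])
    | k + 2 =>
      rw [leaves] at hℓ hℓ'
      split_ifs at hℓ hℓ' with h1
      · exact absurd ((Finset.mem_singleton.1 hℓ).trans (Finset.mem_singleton.1 hℓ').symm) hne
      · obtain ⟨C, hC, hℓC⟩ := Finset.mem_biUnion.1 hℓ
        obtain ⟨C', hC', hℓC'⟩ := Finset.mem_biUnion.1 hℓ'
        have hCC : C ∈ comps (L ((k + 1 : ℕ) : ℤ)) C := by
          push_cast; exact comps_self_of_mem_comps hC
        have hCC' : C' ∈ comps (L ((k + 1 : ℕ) : ℤ)) C' := by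
          push_cast; exact comps_self_of_mem_comps hC'
        by_cases h : C = C'
        · subst h
          exact ih (k + 1) (by omega) hCC hℓC hℓC'
        · exact Disjoint.mono (leaves_spec hCC hℓC).2.1 (leaves_spec hCC' hℓC').2.1
            (comps_pairwiseDisjoint _ _ hC hC' h)

theorem Phat_eq_prod_leaves (ε : ℝ) {x : Λ} {k : ℕ} {B : Finset Λ} (hB : B ∈ comps (L k) B) :
    Phat ε x k B = ∏ ℓ ∈ leaves x k B, leafBound ε ℓ := by
  induction k using Nat.strong_induction_on generalizing B with
  | _ k ih =>
    match k with
    | 0 => rfl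
    | 1 =>
      rw [leaves, Finset.prod_image fun z _ z' _ h => by simpa using h]
      simp only [leafBound, if_true, Finset.prod_const]
      rw [Phat, Finset.card_erase_eq_ite]
    | k + 2 =>
      rw [leaves, Phat]
      split_ifs with h1
      · rw [Finset.prod_singleton, leafBound, if_neg (by have := h1.1.1; simp only; omega)]
      · have hC : ∀ C ∈ comps (L ((k : ℤ) + 1)) B, C ∈ comps (L ((k + 1 : ℕ) : ℤ)) C :=
          fun C hC => by push_cast; exact comps_self_of_mem_comps hC
        rw [Finset.prod_biUnion]
        · exact Finset.prod_congr rfl fun C hC' => ih (k + 1) (by omega) (hC C hC')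
        · intro C hC1 C' hC1' hne
          refine Finset.disjoint_left.2 fun ℓ hℓ hℓ' => ?_
          obtain ⟨-, h2, ⟨z, hz⟩, -⟩ := leaves_spec (hC C hC1) hℓ
          obtain ⟨-, h2', -, -⟩ := leaves_spec (hC C' hC1') hℓ'
          exact hne (eq_of_mem_comps hC1 hC1' (h2 hz) (h2' hz))

/-! ### The probability that a leaf is resonant -/

theorem leafBound_nonneg {ε : ℝ} (hε : 0 < ε) (ℓ : ℕ × Finset Λ) : 0 ≤ leafBound ε ℓ := by
  rw [leafBound]
  split_ifs <;> positivity

theorem one_le_t (v : ℝ) : 1 ≤ t v := by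
  rw [t]
  exact Real.one_le_sqrt.2 (by nlinarith [sq_nonneg v])

theorem t_sq (v : ℝ) : t v ^ 2 = v ^ 2 + 1 := Real.sq_sqrt (by positivity)

theorem t_le {v : ℝ} (hv : |v| ≤ 1) : t v ≤ 3 / 2 := by
  rw [t]
  refine Real.sqrt_le_iff.2 ⟨by norm_num, ?_⟩
  have := (sq_le_one_iff_abs_le_one v).2 hv
  linarith

/-- The event that `B` is the block of `x` in step `k`. -/
def blockEvent (ε : ℝ) (x : Λ) (s : ℝ) (p : ℕ → ℕ) (k : ℕ) (B : Finset Λ) : Set (Λ → ℝ) :=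
  {u | (∀ z, |u z| ≤ 1) ∧ ∃ E, Follows ε u x s p k E ∧ B = block ε u E x k}

/-- As t ≥ 1 at both positions, resonance with either sign gives |t_z - t_x| ≤ ε. The factor t_z +
t_x ≤ 3 turns this into a condition on u_z², which avoids the square root in t. -/
theorem sq_sub_le_of_mem_resSet_one {ε : ℝ} (hε : 0 < ε) {u : Λ → ℝ} {E : ℕ → ℝ} {x z : Λ} {s : ℝ}
    (hs : s = 1 ∨ s = -1) (hE : E 1 = s * t (u x)) (hu : ∀ z, |u z| ≤ 1) (hz : z ∈ resSet ε u E 1) :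
    |u z ^ 2 - (t (u x) ^ 2 - 1)| ≤ 3 * ε := by
  rw [resSet_one, Finset.mem_filter, hE] at hz
  have h1 := one_le_t (u x)
  have h2 := one_le_t (u z)
  have h3 : |t (u z) - t (u x)| ≤ ε := by
    rcases hz.2 with h | h <;> rcases hs with rfl | rfl <;> rw [abs_le] at h ⊢ <;>
      constructor <;> linarith
  rw [show u z ^ 2 - (t (u x) ^ 2 - 1) = (t (u z) - t (u x)) * (t (u z) + t (u x)) by
    nlinarith [t_sq (u z)], abs_mul, abs_of_pos (show 0 < t (u z) + t (u x) by linarith)]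
  have h4 := t_le (hu z)
  have h5 := t_le (hu x)
  nlinarith [abs_nonneg (t (u z) - t (u x))]

theorem pi_singleton_le (z : Λ) (D : ℝ) {ε : ℝ} (hε : 0 < ε) :
    MeasureTheory.Measure.pi (fun _ : ({z} : Finset Λ) => unif)
      {w | ∀ y, |w y ^ 2 - D| ≤ 3 * ε} ≤ ENNReal.ofReal (3 * √ε) := by
  have h1 : √(2 * (3 * ε)) ≤ 3 * √ε := by
    refine Real.sqrt_le_iff.2 ⟨by positivity, ?_⟩
    rw [mul_pow, Real.sq_sqrt hε.le]
    linarith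
  have h2 := (MeasureTheory.measurePreserving_eval (fun _ : ({z} : Finset Λ) => unif)
    ⟨z, Finset.mem_singleton_self z⟩).measure_preimage (s := {s : ℝ | |s ^ 2 - D| ≤ 3 * ε})
    (measurableSet_le (by fun_prop) measurable_const).nullMeasurableSet
  refine (MeasureTheory.measure_mono fun w hw => ?_).trans
    (h2.le.trans ((unif_sq_sub_le D (by positivity)).trans (ENNReal.ofReal_le_ofReal h1)))
  exact hw _

/-- The sites over a set of positions. -/
def sitesEquiv (C : Finset Λ) : C × Fin 2 ≃ {a : Site Λ // a.1 ∈ C} where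
  toFun a := ⟨(a.1.1, a.2), a.1.2⟩
  invFun a := (⟨a.1.1, a.2⟩, a.1.2)
  left_inv _ := rfl
  right_inv _ := rfl

/-- The matrix h_x contributes at most 2 to a row. The hopping to the neighbours is compared with
e·exp(-|a - b|), whose lattice sum is at most 6·4^d. -/
theorem sum_abs_H_le {γ : ℝ} (hγ : 0 ≤ γ) (hγd : γ * (6 * 4 ^ d) ≤ 1 / 4) {u : Λ → ℝ}
    (hu : ∀ z, |u z| ≤ 1) (a : Site Λ) : ∑ b, |H γ u a b| ≤ 9 / 4 := by
  have h1 : ∀ b : Site Λ, |H γ u a b| ≤ (if b.1 = a.1 then (if b.2 = a.2 then |u a.1| else 1) else 0) +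
      γ * (Real.exp 1 * Real.exp (-(1 * ldist a.1.1 b.1.1))) := by
    intro b
    rw [H]
    refine (abs_add_le _ _).trans (add_le_add ?_ ?_)
    · by_cases hab : a.1 = b.1
      · rw [if_pos hab, if_pos hab.symm]
        obtain ⟨a1, a2⟩ := a
        obtain ⟨b1, b2⟩ := b
        rcases (show a2 = 0 ∨ a2 = 1 by fin_cases a2 <;> simp) with rfl | rfl <;>
        rcases (show b2 = 0 ∨ b2 = 1 by fin_cases b2 <;> simp) with rfl | rfl <;> simp [h]
      · rw [if_neg hab, if_neg (Ne.symm hab), abs_zero]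
    · rw [abs_mul, abs_of_nonneg hγ]
      refine mul_le_mul_of_nonneg_left ?_ hγ
      by_cases hab : ldist a.1.1 b.1.1 = 1 ∧ a.2 = b.2
      · rw [if_pos hab, hab.1, ← Real.exp_add]
        norm_num
      · rw [if_neg hab, abs_zero]
        positivity
  refine (Finset.sum_le_sum fun b _ => h1 b).trans ?_
  rw [Finset.sum_add_distrib, ← Finset.mul_sum]
  have h2 : ∑ b : Site Λ, (if b.1 = a.1 then (if b.2 = a.2 then |u a.1| else 1) else 0) ≤ 2 := by
    rw [Fintype.sum_prod_type]
    rw [Finset.sum_eq_single a.1 (fun b _ hb => by simp [hb]) (by simp)]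
    simp only [if_true]
    have := hu a.1
    obtain ⟨a1, a2⟩ := a
    rw [Fin.sum_univ_two]
    rcases (show a2 = 0 ∨ a2 = 1 by fin_cases a2 <;> simp) with rfl | rfl <;> simp at this ⊢ <;>
      linarith
  have h3 : ∑ b : Site Λ, Real.exp 1 * Real.exp (-(1 * ldist a.1.1 b.1.1)) ≤ 6 * 4 ^ d := by
    have h4 := sum_exp_site_le (h := 1) one_pos a
    rw [← Finset.mul_sum]
    have h5 : Real.exp 1 ≤ 3 := by have := Real.exp_one_lt_d9; linarith
    have h6 : (0 : ℝ) < 4 ^ d := by positivity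
    norm_num at h4
    have := mul_le_mul h5 (by simpa using h4) (Finset.sum_nonneg fun _ _ => (Real.exp_pos _).le)
      zero_le_three
    simp only [one_mul]
    linarith
  have := mul_le_mul_of_nonneg_left h3 hγ
  linarith

/-- The probability that a matrix with random diagonal blocks is nearly singular. -/
theorem pi_abs_det_le {ε : ℝ} (hε : 0 < ε) (hε' : ε ≤ Real.exp (-30)) {j : ℕ} (hj : 2 ≤ j)
    {ι : Type*} [Fintype ι] [Nonempty ι] (hcard : (Fintype.card ι : ℝ) ≤ L j ^ (2 * psi / 5))
    (M : Matrix (ι × Fin 2) (ι × Fin 2) ℝ) :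
    MeasureTheory.Measure.pi (fun _ : ι => unif)
      {w | |(rowMatrix M ∅ w).det| ≤ epsAt ε j * 25 ^ Fintype.card ι} ≤
      ENNReal.ofReal (ε ^ (L j ^ (3 * psi / 5) / 3)) := by
  set n := Fintype.card ι with hn
  have hn1 : 1 ≤ n := Fintype.card_pos
  have hn1' : (1 : ℝ) ≤ n := by exact_mod_cast hn1
  have he := epsAt_pos hε j
  -- Chosen such that η^n is twice the bound on the determinant; the factor 2 provides the strict
  -- inequality in `pi_det_lt_le`.
  set η : ℝ := 25 * (2 * epsAt ε j) ^ (1 / (n : ℝ)) with hη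
  have hη0 : 0 < η := by positivity
  have hηn : η ^ n = 2 * epsAt ε j * 25 ^ n := by
    rw [hη, mul_pow, ← Real.rpow_natCast ((2 * epsAt ε j) ^ (1 / (n : ℝ))), ← Real.rpow_mul (by positivity),
      one_div_mul_cancel (by positivity), Real.rpow_one]
    ring
  have h1 := pi_det_lt_le M hη0 Finset.univ
  rw [Finset.compl_univ, Finset.card_univ, ← hn, hηn] at h1
  refine (MeasureTheory.measure_mono fun w hw => ?_).trans (h1.trans (ENNReal.ofReal_le_ofReal ?_))
  · rw [Set.mem_ofPred_eq] at hw ⊢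
    have : 0 < epsAt ε j * 25 ^ n := by positivity
    rw [mul_assoc]
    linarith
  have hL1 : 1 ≤ L (j : ℤ) := by
    obtain ⟨i, rfl⟩ := Nat.exists_eq_add_of_le' (show 1 ≤ j by omega)
    rw [L_natCast_succ]
    exact one_le_pow₀ (by norm_num)
  set X := L (j : ℤ) ^ (3 * psi / 5) with hX
  have hX1 : 1 ≤ X := Real.one_le_rpow hL1 (by norm_num [psi])
  have hnX : (n : ℝ) ≤ X := hcard.trans (Real.rpow_le_rpow_of_exponent_le hL1 (by norm_num [psi]))
  have hε1 : ε ≤ 1 := hε'.trans (Real.exp_le_one_iff.2 (by norm_num))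
  -- The n-th root reduces the exponent L_j^ψ by the factor n ≤ L_j^(2ψ/5). This is the origin of
  -- the exponent 3ψ/5 in `Phat`.
  have h2 : (2 * epsAt ε j) ^ (1 / (n : ℝ)) ≤ 2 * ε ^ X := by
    rw [Real.mul_rpow (by norm_num) he.le]
    refine mul_le_mul ?_ ?_ (by positivity) (by norm_num)
    · exact Real.rpow_le_self_of_one_le (by norm_num) (by rw [div_le_one (by positivity)]; exact hn1')
    · rw [epsAt, ← Real.rpow_mul hε.le]
      refine Real.rpow_le_rpow_of_exponent_ge hε hε1 ?_
      rw [mul_one_div, le_div_iff₀ (by positivity)]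
      refine (mul_le_mul_of_nonneg_left hcard (by positivity)).trans (le_of_eq ?_)
      rw [hX, ← Real.rpow_add (L_pos _)]
      congr 1
      ring
  have h3 : √(2 * η) ≤ 10 * ε ^ (X / 2) := by
    refine Real.sqrt_le_iff.2 ⟨by positivity, ?_⟩
    rw [mul_pow, ← Real.rpow_natCast (ε ^ (X / 2)), ← Real.rpow_mul hε.le]
    norm_num
    linarith
  -- The square root leaves the exponent X/2. Of this X/3 is kept, and X/6 absorbs the number of
  -- positions and the constants.
  have h4 : ε ^ (X / 2) = ε ^ (X / 3) * ε ^ (X / 6) := by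
    rw [← Real.rpow_add hε]; congr 1; ring
  have h5 : ε ^ (X / 6) ≤ Real.exp (-(5 * X)) := by
    refine (Real.rpow_le_rpow hε.le hε' (by positivity)).trans (le_of_eq ?_)
    rw [← Real.exp_mul]
    congr 1
    ring
  have h6 : X * (10 * Real.exp (-(5 * X))) ≤ 1 := by
    have h7 := Real.quadratic_le_exp_of_nonneg (show 0 ≤ 5 * X by positivity)
    rw [Real.exp_neg, ← mul_assoc, mul_inv_le_iff₀ (Real.exp_pos _), one_mul]
    nlinarith
  calc (n : ℝ) * √(2 * η) ≤ X * (10 * (ε ^ (X / 3) * Real.exp (-(5 * X)))) := by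
        refine mul_le_mul hnX (h3.trans ?_) (Real.sqrt_nonneg _) (by positivity)
        rw [h4]
        gcongr
    _ = ε ^ (X / 3) * (X * (10 * Real.exp (-(5 * X)))) := by ring
    _ ≤ ε ^ (X / 3) * 1 := mul_le_mul_of_nonneg_left h6 (by positivity)
    _ = _ := mul_one _

/-- The three contributions are at most 1/4 from the accumulated corrections, 9/4 from `H` and 2
from `lam`. -/
theorem abs_rowSum_truncSchur_le {ε G : ℝ} (hε : 0 < ε) (hγ : ε ^ 4 * (6 * 4 ^ d) ≤ 1 / 4)
    {u : Λ → ℝ} (hu : ∀ z, |u z| ≤ 1) {E : ℕ → ℝ} {R : ℕ → Finset Λ} {j : ℕ}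
    (hb : LevelBounds ε G u E R j) {lam : ℝ} (hw : InWindow ε E j lam) (hlam : |lam| ≤ 2)
    {C : Finset Λ} (hC : C ⊆ R j) (a : {a : Site Λ // a.1 ∈ C}) :
    ∑ b, |(truncSchur (ε ^ 4) u lam R j C -
      lam • (1 : Matrix {a : Site Λ // a.1 ∈ C} {a : Site Λ // a.1 ∈ C} ℝ)) a b| ≤ 5 := by
  set X := nbhd (L ((j : ℤ) - 1)) C
  have h1 := hb.norm lam hw X a.1 (hC a.2)
  have h2 := sum_abs_H_le (by positivity) hγ hu a.1
  have h3 : ∀ b : {a : Site Λ // a.1 ∈ C},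
      |(truncSchur (ε ^ 4) u lam R j C -
        lam • (1 : Matrix {a : Site Λ // a.1 ∈ C} {a : Site Λ // a.1 ∈ C} ℝ)) a b| ≤
      |schur (ε ^ 4) u lam R j X a.1 b.1 - schur (ε ^ 4) u lam R 0 X a.1 b.1| +
        |H (ε ^ 4) u a.1 b.1| + (if b = a then 2 else 0) := by
    intro b
    have e : (truncSchur (ε ^ 4) u lam R j C -
        lam • (1 : Matrix {a : Site Λ // a.1 ∈ C} {a : Site Λ // a.1 ∈ C} ℝ)) a b =
        (schur (ε ^ 4) u lam R j X a.1 b.1 - schur (ε ^ 4) u lam R 0 X a.1 b.1) +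
        schur (ε ^ 4) u lam R 0 X a.1 b.1 - 
          lam * (1 : Matrix {a : Site Λ // a.1 ∈ C} {a : Site Λ // a.1 ∈ C} ℝ) a b := by
      rw [sub_add_cancel]
      rfl
    rw [e]
    refine (abs_sub _ _).trans (add_le_add ((abs_add_le _ _).trans (add_le_add le_rfl ?_)) ?_)
    · change |if a.1.1 ∈ X ∧ b.1.1 ∈ X then H (ε ^ 4) u a.1 b.1 else 0| ≤ _
      split_ifs
      · exact le_rfl
      · simp
    · rw [Matrix.one_apply]
      split_ifs with h4 h5 h5
      · simpa using hlam
      · exact absurd h4.symm h5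
      · exact absurd h5.symm h4
      · simp
  refine (Finset.sum_le_sum fun b _ => h3 b).trans ?_
  rw [Finset.sum_add_distrib, Finset.sum_add_distrib, Finset.sum_ite_eq' Finset.univ a,
    if_pos (Finset.mem_univ a)]
  have h4 : ∑ b : {a : Site Λ // a.1 ∈ C},
      |schur (ε ^ 4) u lam R j X a.1 b.1 - schur (ε ^ 4) u lam R 0 X a.1 b.1| ≤
      ∑ b with b.1 ∈ R j, |schur (ε ^ 4) u lam R j X a.1 b - schur (ε ^ 4) u lam R 0 X a.1 b| := by
    rw [← Finset.sum_subtype (Finset.univ.filter fun b : Site Λ => b.1 ∈ C) (by simp)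
      (fun b => |schur (ε ^ 4) u lam R j X a.1 b - schur (ε ^ 4) u lam R 0 X a.1 b|)]
    refine Finset.sum_le_sum_of_subset_of_nonneg (fun b hb => ?_) fun _ _ _ => abs_nonneg _
    rw [Finset.mem_filter] at hb ⊢
    exact ⟨hb.1, hC hb.2⟩
  have h5 : ∑ b : {a : Site Λ // a.1 ∈ C}, |H (ε ^ 4) u a.1 b.1| ≤ ∑ b, |H (ε ^ 4) u a.1 b| := by
    rw [← Finset.sum_subtype (Finset.univ.filter fun b : Site Λ => b.1 ∈ C) (by simp)
      (fun b => |H (ε ^ 4) u a.1 b|)]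
    exact Finset.sum_le_sum_of_subset_of_nonneg (Finset.filter_subset _ _) fun _ _ _ => abs_nonneg _
  have h6 : (0 : ℝ) < (1 / 2) ^ j := by positivity
  linarith

theorem isHermitian_truncSchur (γ : ℝ) (u : Λ → ℝ) (lam : ℝ) (R : ℕ → Finset Λ) (k : ℕ)
    (B : Finset Λ) : (truncSchur γ u lam R k B).IsHermitian := by
  ext a b
  exact schur_symm_apply _ _ _ _ _ _ _ _

/-- Resonance of an isolated leaf, in terms of a determinant. -/
theorem abs_det_truncSchur_le {ε G : ℝ} (hε : 0 < ε) (hε' : ε ≤ 1 / 36)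
    (hγ : ε ^ 4 * (6 * 4 ^ d) ≤ 1 / 4) (hG : Real.exp (-G) = ε ^ 4) (hs : ∀ j, StepSmall d G j)
    {u : Λ → ℝ} (hu : ∀ z, |u z| ≤ 1) {E : ℕ → ℝ} {x : Λ} {s : ℝ} (hs1 : s = 1 ∨ s = -1)
    {p : ℕ → ℕ} {k : ℕ} (hf : Follows ε u x s p k E) {B C : Finset Λ} (hB : B = block ε u E x k)
    {j : ℕ} (hjk : j + 2 ≤ k) (hC : IsIsolated j C C) (hCB : C ∈ comps (L ((j : ℤ) + 2)) B) :
    |(truncSchur (ε ^ 4) u (E j) (resSet ε u E) (j - 1) C -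
      E j • (1 : Matrix {a : Site Λ // a.1 ∈ C} {a : Site Λ // a.1 ∈ C} ℝ)).det| ≤
      epsAt ε j * 25 ^ C.card := by
  obtain ⟨i, rfl⟩ := Nat.exists_eq_add_of_le' hC.1
  obtain ⟨z, hz⟩ := nonempty_of_mem_comps hCB
  have hzB := subset_of_mem_comps hCB hz
  have hBR : B ⊆ resSet ε u E (i + 2 + 2) := hB ▸ block_subset_resSet hjk
  have hcomp : C = comp (L (((i + 2 + 2 : ℕ) : ℤ))) (resSet ε u E (i + 2 + 2)) z := by
    rw [comp_resSet_eq_comp_block hB (by omega) hjk hzB]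
    refine (comp_eq_of_mem_comps ?_ hz).symm
    push_cast at hCB ⊢
    exact hCB
  have hCR : C ∈ comps (L (((i + 2 : ℕ) : ℤ) + 2)) (resSet ε u E (i + 2 + 2)) := by
    have := comp_mem_comps (ℓ := L (((i + 2 + 2 : ℕ) : ℤ))) (hBR hzB)
    rw [← hcomp] at this
    push_cast at this ⊢
    exact this
  -- Isolation of `C` as a set becomes isolation in the resonant set of step `i + 1`. Consequently
  -- `C` was tested in step `i + 2`, and it must have been resonant, as it is still present later.
  have hiso := (isIsolated_iff_of_mem_comps ε u E hCR).2 hC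
  rw [show i + 2 - 1 = i + 1 by omega] at hiso
  have hres : IsResonant ε u (E (i + 2)) (resSet ε u E) (i + 2) C := by
    have h1 := (mem_resSet_add_two.1 (resSet_antitone (show i + 2 ≤ i + 2 + 2 by omega)
      (hBR hzB))).2
    have h2 : comp (L ((i : ℤ) + 2)) (resSet ε u E (i + 1)) z = C := by
      have := comp_eq_of_mem_comps hiso.2.1 hz
      push_cast at this
      exact this
    rw [h2] at h1
    by_contra h3
    exact h1 ⟨hiso, h3⟩
  have hdist := hf.energy_dist
  have hb : LevelBounds ε G u E (resSet ε u E) (i + 1) :=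
    levelBounds hε hG (fun j _ => hs j) fun j hj =>
      elimData_resSet hε hε' hdist (show j < k by omega)
  have hw : InWindow ε E (i + 1) (E (i + 2)) := fun m h1 h2 =>
    energy_dist_le hε hε' hdist h1 (by omega) (by omega)
  have hE : |E (i + 2)| ≤ 2 := by
    have h1 := energy_dist_le hε hε' hdist le_rfl (show 1 ≤ i + 2 by omega) (by omega)
    have h2 : |E 1| ≤ 3 / 2 := by
      have h3 := t_le (hu x)
      have h4 := one_le_t (u x)
      rw [hf.1]
      rcases hs1 with rfl | rfl
      · rw [one_mul, abs_of_pos (by linarith)]; exact h3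
      · rw [neg_one_mul, abs_neg, abs_of_pos (by linarith)]; exact h3
    have h3 : epsAt ε 1 = ε := by simp [epsAt, L]
    rw [h3] at h1
    have h4 := abs_sub_abs_le_abs_sub (E (i + 2)) (E 1)
    linarith
  have hCsub : C ⊆ resSet ε u E (i + 1) := subset_of_mem_comps hiso.2.1
  have h1 := abs_det_le (isHermitian_truncSchur (ε ^ 4) u (E (i + 2)) (resSet ε u E) (i + 1) C)
    (K := 5) (by norm_num)
    (abs_rowSum_truncSchur_le hε hγ hu hb hw hE hCsub) hres.2
  rw [show i + 2 - 1 = i + 1 by omega]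
  -- There are two sites over each position, whence 5^(2n) = 25^n.
  have h2 : Fintype.card {a : Site Λ // a.1 ∈ C} = C.card * 2 := by
    rw [← Fintype.card_congr (sitesEquiv C), Fintype.card_prod, Fintype.card_coe, Fintype.card_fin]
  rw [h2, mul_comm C.card, pow_mul] at h1
  norm_num at h1 ⊢
  exact h1

theorem comps_of_comp_eq {ℓ : ℝ} {B : Finset Λ} {x : Λ} (hx : x ∈ B) (hB : comp ℓ B x = B) :
    B ∈ comps ℓ B := by
  have := comp_mem_comps (ℓ := ℓ) hx
  rwa [hB] at this

theorem law_eq_pi (Λ : Finset (Fin d → ℤ)) :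
    law Λ = MeasureTheory.Measure.pi fun _ : Λ => unif := rfl

/-- Two points of a block event that agree away from leaves of steps at least `j` have the same
energies and resonant sets up to step `j`. -/
theorem agree_of_leaves {ε : ℝ} {x : Λ} {s : ℝ} {p : ℕ → ℕ} {k : ℕ} {B : Finset Λ} (hx : x ∈ B)
    (hB : comp (L k) B x = B) {j : ℕ} (hjk : j ≤ k) {u u' v : Λ → ℝ} {E E' : ℕ → ℝ}
    (hf : Follows ε u x s p k E) (hf' : Follows ε u' x s p k E') (hu : B = block ε u E x k)
    (hu' : B = block ε u' E' x k)
    (huv : ∀ z, (∀ ℓ ∈ leaves x k B, j ≤ ℓ.1 → z ∉ ℓ.2) → u z = v z)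
    (huv' : ∀ z, (∀ ℓ ∈ leaves x k B, j ≤ ℓ.1 → z ∉ ℓ.2) → u' z = v z) :
    (∀ z, (∀ ℓ ∈ leaves x k B, j ≤ ℓ.1 → z ∉ ℓ.2) → u z = u' z) ∧
    ∀ i ≤ j, (1 ≤ i → E i = E' i) ∧ resSet ε u E i = resSet ε u' E' i := by
  have hBB := comps_of_comp_eq hx hB
  have h1 : ∀ z, (∀ ℓ ∈ leaves x k B, j ≤ ℓ.1 → z ∉ ℓ.2) → u z = u' z := fun z hz =>
    (huv z hz).trans (huv' z hz).symm
  refine ⟨h1, ?_⟩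
  set Y := ((leaves x k B).filter fun ℓ => j ≤ ℓ.1).biUnion Prod.snd with hY
  have hmem : ∀ {z}, z ∈ Y ↔ ∃ ℓ ∈ leaves x k B, j ≤ ℓ.1 ∧ z ∈ ℓ.2 := by
    intro z
    simp only [hY, Finset.mem_biUnion, Finset.mem_filter, and_assoc]
  refine hf.agree hf' hu hu' (Y := Y) (fun z hz => h1 z fun ℓ hℓ hj hzℓ => hz (hmem.2 ⟨ℓ, hℓ, hj, hzℓ⟩))
    (fun z hz => ?_) (fun hxY => ?_) hjk fun i hi hij => Finset.disjoint_left.2 fun z hz hzx => ?_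
  · obtain ⟨ℓ, hℓ, -, hzℓ⟩ := hmem.1 hz
    exact (leaves_spec hBB hℓ).2.1 hzℓ
  · obtain ⟨ℓ, hℓ, -, hxℓ⟩ := hmem.1 hxY
    exact (leaves_spec hBB hℓ).1 hxℓ
  · obtain ⟨ℓ, hℓ, hjℓ, hzℓ⟩ := hmem.1 hz
    obtain ⟨h2, h3, h4, h5⟩ := leaves_spec hBB hℓ
    rcases h5 with h5 | h5
    · omega
    -- A leaf of step ℓ ≥ j > i is a component of `B` on scale ℓ + 2 and does not contain `x`; so
    -- the smaller block of `x` on scale `i` cannot meet it.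
    · have h6 : comp (L (i : ℤ)) B x ⊆ comp (L ((ℓ.1 : ℤ) + 2)) B x :=
        comp_subset_comp (L_mono (by omega)) comp_subset
      have h7 := comp_eq (h6 hzx)
      rw [comp_eq_of_mem_comps h5.2.2 hzℓ] at h7
      rw [h7] at h2
      exact h2 (self_mem_comp hx)

/-- The probability of a block event is bounded in terms of the leaves of the block. -/
theorem law_blockEvent_le {ε G : ℝ} (hε : 0 < ε) (hε' : ε ≤ Real.exp (-30))
    (hγ : ε ^ 4 * (6 * 4 ^ d) ≤ 1 / 4) (hG : Real.exp (-G) = ε ^ 4) (hs : ∀ j, StepSmall d G j)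
    {x : Λ} {s : ℝ} (hs1 : s = 1 ∨ s = -1) {p : ℕ → ℕ} {k : ℕ} (hk : 1 ≤ k) {B : Finset Λ}
    (hx : x ∈ B) (hB : comp (L k) B x = B) (hA : MeasurableSet (blockEvent ε x s p k B)) :
    law Λ (blockEvent ε x s p k B) ≤ ENNReal.ofReal (Phat ε x k B) := by
  have hBB := comps_of_comp_eq hx hB
  have hε36 : ε ≤ 1 / 36 := by
    refine hε'.trans ?_
    rw [Real.exp_neg, inv_eq_one_div]
    refine one_div_le_one_div_of_le (by norm_num) ?_
    have := Real.quadratic_le_exp_of_nonneg (show (0 : ℝ) ≤ 30 by norm_num)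
    linarith
  rw [law_eq_pi, Phat_eq_prod_leaves ε hBB, ENNReal.ofReal_prod_of_nonneg fun ℓ _ =>
    leafBound_nonneg hε ℓ]
  refine pi_le_prod_of_sections hA (leaves x k B) Prod.fst Prod.snd
    (fun ℓ => ENNReal.ofReal (leafBound ε ℓ)) (fun ℓ hℓ ℓ' hℓ' hne => leaves_disjoint hBB hℓ hℓ' hne)
    fun ℓ hℓ v => ?_
  -- A point `u0` of a nonempty section serves as reference: all other points of the section share
  -- its energies and resonant sets up to the step of the leaf.
  rcases Set.eq_empty_or_nonempty {y : ℓ.2 → ℝ | ∃ u ∈ blockEvent ε x s p k B,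
    (∀ z, (∀ ℓ' ∈ leaves x k B, ℓ.1 ≤ ℓ'.1 → z ∉ ℓ'.2) → u z = v z) ∧
      ∀ z : ℓ.2, u z = y z} with h0 | ⟨y0, u0, ⟨hu0, E0, hf0, hB0⟩, hv0, -⟩
  · rw [h0, MeasureTheory.measure_empty]
    exact zero_le
  obtain ⟨h1, h2, h3, h4⟩ := leaves_spec hBB hℓ
  obtain ⟨j, C⟩ := ℓ
  simp only at h1 h2 h3 h4 hv0 ⊢
  rcases h4 with ⟨rfl, -, z, rfl⟩ | ⟨hjk, hiso, hC⟩
  · rw [leafBound, if_pos rfl]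
    refine (MeasureTheory.measure_mono ?_).trans (pi_singleton_le z (t (u0 x) ^ 2 - 1) hε)
    rintro y ⟨u, ⟨hu, E, hf, hBu⟩, hv, hy⟩ w
    obtain ⟨hagr, -⟩ := agree_of_leaves hx hB hk hf hf0 hBu hB0 hv hv0
    have hux : u x = u0 x := hagr x fun ℓ hℓ _ hxℓ => (leaves_spec hBB hℓ).1 hxℓ
    rw [← hy w, ← hux]
    refine sq_sub_le_of_mem_resSet_one hε hs1 hf.1 hu ?_
    exact (hBu ▸ block_subset_resSet hk : B ⊆ resSet ε u E 1) (h2 w.2)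
  · have hj2 := hiso.1
    rw [leafBound, if_neg (by simp only; omega)]
    have : Nonempty C := h3.to_subtype
    set X := nbhd (L (((j - 1 : ℕ) : ℤ) - 1)) C with hX
    set R := resSet ε u0 E0
    -- The matrix at the reference point without its random diagonal blocks over `C`. For every
    -- other point of the section, the blocks formed with its own potential on `C` are added.
    set M : Matrix (C × Fin 2) (C × Fin 2) ℝ := fun a b =>
      schur (ε ^ 4) u0 (E0 j) R (j - 1) X (a.1.1, a.2) (b.1.1, b.2) -
        E0 j * (1 : Matrix (C × Fin 2) (C × Fin 2) ℝ) a b -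
        (if a.1 = b.1 then h (u0 a.1) a.2 b.2 else 0) with hM
    refine (MeasureTheory.measure_mono ?_).trans
      (pi_abs_det_le hε hε' hj2 (by rw [Fintype.card_coe]; exact hiso.2.2.1) M)
    rintro y ⟨u, ⟨hu, E, hf, hBu⟩, hv, hy⟩
    obtain ⟨hagr, hER⟩ := agree_of_leaves hx hB (show j ≤ k by omega) hf hf0 hBu hB0 hv hv0
    have hdet := abs_det_truncSchur_le hε hε36 hγ hG hs hu hs1 hf hBu hjk hiso hC
    rw [(hER j le_rfl).1 (by omega), truncSchur_congr (R' := R) _ _ _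
      (fun i hi => (hER i (by omega)).2)] at hdet
    rw [Set.mem_ofPred_eq, Fintype.card_coe]
    have hBR : B ⊆ R (j - 1) := hB0 ▸ block_subset_resSet (by omega)
    have key : rowMatrix M ∅ y = Matrix.submatrix (truncSchur (ε ^ 4) u (E0 j) R (j - 1) C -
        E0 j • (1 : Matrix {a : Site Λ // a.1 ∈ C} {a : Site Λ // a.1 ∈ C} ℝ))
        (sitesEquiv C) (sitesEquiv C) := by
      ext a b
      have h5 : rowMatrix M ∅ y a b = M a b + if a.1 = b.1 then h (y a.1) a.2 b.2 else 0 := by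
        rw [rowMatrix, if_neg (Finset.notMem_empty _)]
        split_ifs <;> rfl
      have h6 : schur (ε ^ 4) u (E0 j) R (j - 1) X = schur (ε ^ 4) u0 (E0 j) R (j - 1) X +
          potDiff u0 u X := by
        refine schur_add_potDiff _ _ (fun i _ => resSet_succ_subset i) (fun z hz => ?_) X
        refine hagr z fun ℓ hℓ _ hzℓ => hz (hBR ((leaves_spec hBB hℓ).2.1 hzℓ))
      have hXC : C ⊆ X := subset_nbhd (L_pos _) C
      have h7 : potDiff u0 u X (a.1.1, a.2) (b.1.1, b.2) =
          if a.1 = b.1 then h (y a.1) a.2 b.2 - h (u0 a.1) a.2 b.2 else 0 := by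
        rw [potDiff, if_pos ⟨hXC a.1.2, hXC b.1.2⟩]
        simp only [Subtype.coe_inj, hy]
      have h8 : (1 : Matrix {a : Site Λ // a.1 ∈ C} {a : Site Λ // a.1 ∈ C} ℝ) (sitesEquiv C a)
          (sitesEquiv C b) = (1 : Matrix (C × Fin 2) (C × Fin 2) ℝ) a b := by
        rw [Matrix.one_apply, Matrix.one_apply]
        simp only [EmbeddingLike.apply_eq_iff_eq]
      rw [h5]
      change _ = schur (ε ^ 4) u (E0 j) R (j - 1) X (a.1.1, a.2) (b.1.1, b.2) -
        E0 j * (1 : Matrix {a : Site Λ // a.1 ∈ C} {a : Site Λ // a.1 ∈ C} ℝ) (sitesEquiv C a)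
          (sitesEquiv C b)
      rw [h6, Matrix.add_apply, h7, h8, hM]
      simp only
      split_ifs <;> ring
    rw [key]
    convert hdet using 2
    convert Matrix.det_submatrix_equiv_self (sitesEquiv C) _

/-! ### Measurability of the block events -/

section Measurability

variable {α : Type*} [MeasurableSpace α]

theorem measurable_det {n : Type*} [Fintype n] [DecidableEq n] {M : α → Matrix n n ℝ}
    (hM : ∀ i j, Measurable fun a => M a i j) : Measurable fun a => (M a).det := by
  simp only [Matrix.det_apply]
  exact Finset.measurable_sum _ fun σ _ => (Finset.measurable_prod _ fun i _ => hM _ _).const_smul _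

theorem measurable_inv_apply {n : Type*} [Fintype n] [DecidableEq n] {M : α → Matrix n n ℝ}
    (hM : ∀ i j, Measurable fun a => M a i j) (i j : n) : Measurable fun a => (M a)⁻¹ i j := by
  simp only [Matrix.inv_def, Ring.inverse_eq_inv', Matrix.smul_apply, smul_eq_mul,
    Matrix.adjugate_apply]
  refine (measurable_det hM).inv.mul (measurable_det fun i' j' => ?_)
  simp only [Matrix.updateRow_apply]
  split_ifs
  · exact measurable_const
  · exact hM _ _

theorem measurable_schurStep {F : α → Finset Λ → Matrix (Site Λ) (Site Λ) ℝ} {cl : Λ → Finset Λ}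
    {Q : Finset Λ} {ℓ : ℝ} {lam : α → ℝ} (hF : ∀ X a b, Measurable fun q => F q X a b)
    (hlam : Measurable lam) (X : Finset Λ) (a b : Site Λ) :
    Measurable fun q => schurStep (F q) cl Q ℓ (lam q) X a b := by
  simp only [schurStep, Matrix.sub_apply, Matrix.mul_apply, Matrix.submatrix_apply]
  refine (hF _ _ _).sub (Finset.measurable_sum _ fun i _ => (Finset.measurable_sum _ fun j _ =>
    (hF _ _ _).mul (measurable_inv_apply (fun i' j' => ?_) _ _)).mul (hF _ _ _))
  simp only [Matrix.sub_apply, Matrix.smul_apply, smul_eq_mul]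
  refine Measurable.sub ?_ (hlam.mul_const _)
  change Measurable fun q => if cl i'.1.1 = cl j'.1.1 then _ else _
  split_ifs
  · exact (hF _ _ _).add ((hF _ _ _).sub (hF _ _ _))
  · exact hF _ _ _

theorem measurable_schur (γ : ℝ) (R : ℕ → Finset Λ) {u : α → Λ → ℝ} {lam : α → ℝ}
    (hu : Measurable u) (hlam : Measurable lam) (k : ℕ) (X : Finset Λ) (a b : Site Λ) :
    Measurable fun q => schur γ (u q) (lam q) R k X a b := by
  induction k generalizing X a b with
  | zero =>
    change Measurable fun q => if a.1 ∈ X ∧ b.1 ∈ X then H γ (u q) a b else 0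
    split_ifs
    · simp only [H]
      refine Measurable.add ?_ measurable_const
      split_ifs
      · have h1 : Measurable fun q => u q a.1 := (measurable_pi_apply a.1).comp hu
        obtain ⟨a1, a2⟩ := a
        obtain ⟨b1, b2⟩ := b
        rcases (show a2 = 0 ∨ a2 = 1 by fin_cases a2 <;> simp) with rfl | rfl <;>
        rcases (show b2 = 0 ∨ b2 = 1 by fin_cases b2 <;> simp) with rfl | rfl <;> simp [h] <;>
        fun_prop
      · exact measurable_const
    · exact measurable_const
  | succ k ih =>
    simp only [schur_succ_eq]
    exact measurable_schurStep (fun X a b => ih X a b) hlam X a b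

theorem measurable_det_truncSchur (γ : ℝ) (R : ℕ → Finset Λ) {u : α → Λ → ℝ} {lam mu : α → ℝ}
    (hu : Measurable u) (hlam : Measurable lam) (hmu : Measurable mu) (k : ℕ) (B : Finset Λ) :
    Measurable fun q => (truncSchur γ (u q) (lam q) R k B -
      mu q • (1 : Matrix {a : Site Λ // a.1 ∈ B} {a : Site Λ // a.1 ∈ B} ℝ)).det :=
  measurable_det fun i j => (measurable_schur γ R hu hlam k _ i.1 j.1).sub (hmu.mul_const _)

theorem mem_spectrum_iff_det {n : Type*} [Fintype n] [DecidableEq n] {A : Matrix n n ℝ} {μ : ℝ} :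
    μ ∈ spectrum ℝ A ↔ (A - μ • (1 : Matrix n n ℝ)).det = 0 := by
  rw [spectrum.mem_iff, Algebra.algebraMap_eq_smul_one, ← neg_sub, IsUnit.neg_iff,
    Matrix.isUnit_iff_isUnit_det, isUnit_iff_ne_zero, not_not]

/-- By continuity on the compact set `K`, a zero exists if and only if |f| takes arbitrarily small
values on a countable dense subset of `K`. -/
theorem measurableSet_exists_zero {f : α → ℝ → ℝ} (hf : ∀ τ, Measurable fun a => f a τ) (G : Set α)
    (hG : MeasurableSet G) {K : Set ℝ} (hK : IsCompact K) (hc : ∀ a ∈ G, ContinuousOn (f a) K) :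
    MeasurableSet {a | a ∈ G ∧ ∃ τ ∈ K, f a τ = 0} := by
  rcases K.eq_empty_or_nonempty with rfl | hne
  · simp
  have : Nonempty K := hne.to_subtype
  have : CompactSpace K := isCompact_iff_compactSpace.1 hK
  set D := TopologicalSpace.denseSeq K
  have e : {a | a ∈ G ∧ ∃ τ ∈ K, f a τ = 0} =
      G ∩ ⋂ n : ℕ, ⋃ m : ℕ, {a | |f a (D m)| < 1 / ((n : ℝ) + 1)} := by
    ext a
    simp only [Set.mem_inter_iff, Set.mem_iInter, Set.mem_iUnion, Set.mem_ofPred_eq]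
    refine and_congr_right fun ha => ?_
    have hcont : Continuous fun τ : K => |f a τ| :=
      continuous_abs.comp (continuousOn_iff_continuous_domRestrict.1 (hc a ha))
    constructor
    · rintro ⟨τ, hτ, h0⟩ n
      have hopen : IsOpen {τ : K | |f a τ| < 1 / ((n : ℝ) + 1)} :=
        isOpen_lt hcont continuous_const
      obtain ⟨_, h1, m, rfl⟩ := (TopologicalSpace.denseRange_denseSeq K).inter_open_nonempty _ hopen
        ⟨⟨τ, hτ⟩, by simp only [Set.mem_ofPred_eq, h0, abs_zero]; positivity⟩
      exact ⟨m, h1⟩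
    · intro h1
      obtain ⟨τ, hτK, hτ⟩ := hK.exists_isMinOn hne (hc a ha).abs
      refine ⟨τ, hτK, abs_eq_zero.1 (le_antisymm (le_of_forall_pos_lt_add fun δ hδ => ?_)
        (abs_nonneg _))⟩
      obtain ⟨n, hn⟩ := exists_nat_one_div_lt hδ
      obtain ⟨m, hm⟩ := h1 n
      exact ((hτ (D m).2).trans_lt hm).trans (by linarith)
  rw [e]
  refine hG.inter (MeasurableSet.iInter fun n => MeasurableSet.iUnion fun m =>
    measurableSet_lt ?_ measurable_const)
  exact (hf _).abs

/-- Among n + 1 elements below `b`, the largest can be separated from the others and from `b` by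
rational numbers. Counting is thereby reduced to countably many questions about the existence of an
element in a compact interval. -/
theorem add_one_le_encard_inter_Iio {S : Set ℝ} {b : ℝ} {n : ℕ} :
    ((n + 1 : ℕ) : ℕ∞) ≤ (S ∩ Set.Iio b).encard ↔
      ∃ r s : ℚ, (n : ℕ∞) ≤ (S ∩ Set.Iio (r : ℝ)).encard ∧ (s : ℝ) < b ∧
        ∃ z ∈ Set.Icc (r : ℝ) s, z ∈ S := by
  constructor
  · intro h1
    obtain ⟨T, hTS, hT⟩ := Set.exists_subset_encard_eq h1
    have hTf : T.Finite := Set.finite_of_encard_eq_coe hT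
    have hTne : T.Nonempty := by
      rw [← Set.encard_ne_zero, hT]
      simp
    obtain ⟨z, hz, hmax⟩ := hTf.exists_maximal hTne
    have hlt : ∀ t ∈ T \ {z}, t < z := fun t ht =>
      lt_of_le_of_ne ((le_total t z).elim id fun h => hmax ht.1 h) ht.2
    obtain ⟨r, hr, hrz⟩ : ∃ r : ℚ, (∀ t ∈ T \ {z}, t < r) ∧ (r : ℝ) < z := by
      rcases (T \ {z}).eq_empty_or_nonempty with h0 | h0
      · obtain ⟨r, hr⟩ := exists_rat_lt z
        exact ⟨r, by simp [h0], hr⟩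
      · obtain ⟨t, ht, hmax'⟩ := (hTf.subset Set.sdiff_subset).exists_maximal h0
        obtain ⟨r, hr, hr'⟩ := exists_rat_btwn (hlt t ht)
        exact ⟨r, fun t' ht' => lt_of_le_of_lt ((le_total t' t).elim id fun h => hmax' ht' h) hr, hr'⟩
    obtain ⟨s, hs, hs'⟩ := exists_rat_btwn (show z < b from (hTS hz).2)
    refine ⟨r, s, ?_, hs', z, ⟨hrz.le, hs.le⟩, (hTS hz).1⟩
    have h2 : (T \ {z}).encard = n := by
      have h3 := Set.encard_sdiff_singleton_add_one hz
      rw [hT] at h3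
      push_cast at h3
      exact (WithTop.add_right_cancel ENat.one_ne_top h3)
    rw [← h2]
    exact Set.encard_le_encard fun t ht => ⟨(hTS ht.1).1, hr t ht⟩
  · rintro ⟨r, s, h1, h2, z, hz, hzS⟩
    have h3 : insert z (S ∩ Set.Iio (r : ℝ)) ⊆ S ∩ Set.Iio b := by
      rintro t (rfl | ht)
      · exact ⟨hzS, lt_of_le_of_lt hz.2 h2⟩
      · exact ⟨ht.1, (lt_of_lt_of_le ht.2 (hz.1.trans hz.2)).trans h2⟩
    refine le_trans ?_ (Set.encard_le_encard h3)
    rw [Set.encard_insert_of_notMem fun h => absurd h.2 (not_lt.2 hz.1)]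
    push_cast
    gcongr

theorem measurableSet_le_encard {f : α → ℝ → ℝ} (hf : ∀ τ, Measurable fun a => f a τ) {G : Set α}
    (hG : MeasurableSet G) {w : ℝ} (hc : ∀ a ∈ G, ContinuousOn (f a) (Set.Icc (-w) w)) (n : ℕ)
    {b : α → ℝ} (hb : Measurable b) :
    MeasurableSet {a | a ∈ G ∧
      (n : ℕ∞) ≤ ({τ | τ ∈ Set.Icc (-w) w ∧ f a τ = 0} ∩ Set.Iio (b a)).encard} := by
  induction n generalizing b with
  | zero => simpa using hG
  | succ n ih =>
    simp only [add_one_le_encard_inter_Iio]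
    have e : {a | a ∈ G ∧ ∃ r s : ℚ,
        (n : ℕ∞) ≤ ({τ | τ ∈ Set.Icc (-w) w ∧ f a τ = 0} ∩ Set.Iio (r : ℝ)).encard ∧
        (s : ℝ) < b a ∧ ∃ z ∈ Set.Icc (r : ℝ) s, z ∈ {τ | τ ∈ Set.Icc (-w) w ∧ f a τ = 0}} =
        ⋃ r : ℚ, ⋃ s : ℚ, ({a | a ∈ G ∧
          (n : ℕ∞) ≤ ({τ | τ ∈ Set.Icc (-w) w ∧ f a τ = 0} ∩ Set.Iio (r : ℝ)).encard} ∩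
          {a | (s : ℝ) < b a}) ∩
          {a | a ∈ G ∧ ∃ τ ∈ Set.Icc (r : ℝ) s ∩ Set.Icc (-w) w, f a τ = 0} := by
      ext a
      simp only [Set.mem_iUnion, Set.mem_inter_iff, Set.mem_ofPred_eq]
      constructor
      · rintro ⟨ha, r, s, h1, h2, z, hz, hz', hz0⟩
        exact ⟨r, s, ⟨⟨ha, h1⟩, h2⟩, ha, z, ⟨hz, hz'⟩, hz0⟩
      · rintro ⟨r, s, ⟨⟨ha, h1⟩, h2⟩, -, z, ⟨hz, hz'⟩, hz0⟩
        exact ⟨ha, r, s, h1, h2, z, hz, hz', hz0⟩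
    rw [e]
    refine MeasurableSet.iUnion fun r => MeasurableSet.iUnion fun s =>
      ((ih measurable_const).inter (measurableSet_lt measurable_const hb)).inter
      (measurableSet_exists_zero hf G hG (isCompact_Icc.inter isCompact_Icc) fun a ha =>
        (hc a ha).mono Set.inter_subset_right)

theorem measurableSet_encard_eq {f : α → ℝ → ℝ} (hf : ∀ τ, Measurable fun a => f a τ) {G : Set α}
    (hG : MeasurableSet G) {w : ℝ} (hc : ∀ a ∈ G, ContinuousOn (f a) (Set.Icc (-w) w)) (n : ℕ)
    {b : α → ℝ} (hb : Measurable b) :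
    MeasurableSet {a | a ∈ G ∧
      ({τ | τ ∈ Set.Icc (-w) w ∧ f a τ = 0} ∩ Set.Iio (b a)).encard = n} := by
  have h1 := (measurableSet_le_encard hf hG hc n hb).diff
    (measurableSet_le_encard hf hG hc (n + 1) hb)
  convert h1 using 1
  ext a
  simp only [Set.mem_ofPred_eq, Set.mem_sdiff, not_and, not_le]
  have e : ∀ m : ℕ∞, m = n ↔ (n : ℕ∞) ≤ m ∧ m < ((n + 1 : ℕ) : ℕ∞) := fun m => by
    push_cast
    rw [ENat.lt_add_one_iff (ENat.natCast_ne_top n), and_comm]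
    exact le_antisymm_iff
  rw [e]
  tauto

/-- The first sets of the history take only finitely many values. One may therefore split according
to the value and treat the history as constant. -/
theorem measurableSet_of_history {R : α → ℕ → Finset Λ} {i : ℕ}
    {S : (ℕ → Finset Λ) → Set α}
    (hS : ∀ f, MeasurableSet ({a | ∀ m ≤ i, R a m = f m} ∩ S f))
    (hcongr : ∀ a f g, (∀ m ≤ i, f m = g m) → a ∈ S f → a ∈ S g) :
    MeasurableSet {a | a ∈ S (R a)} := by
  have e : {a | a ∈ S (R a)} = ⋃ f : Fin (i + 1) → Finset Λ,
      ({a | ∀ m ≤ i, R a m = if h : m < i + 1 then f ⟨m, h⟩ else ∅} ∩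
        S fun m => if h : m < i + 1 then f ⟨m, h⟩ else ∅) := by
    ext a
    simp only [Set.mem_iUnion, Set.mem_inter_iff, Set.mem_ofPred_eq]
    constructor
    · intro h
      have h1 : ∀ m ≤ i, R a m = if h : m < i + 1 then R a (⟨m, h⟩ : Fin (i + 1)) else ∅ :=
        fun m hm => by rw [dif_pos (by omega)]
      exact ⟨fun m => R a m, h1, hcongr a _ _ h1 h⟩
    · rintro ⟨f, h1, h2⟩
      exact hcongr a _ _ (fun m hm => (h1 m hm).symm) h2
  rw [e]
  exact MeasurableSet.iUnion fun f => hS _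

end Measurability

/-! ### Measurability of resonant sets, energies and blocks. -/

section BlockMeasurability

variable {ε : ℝ}

theorem resSet_congr_energy {u : Λ → ℝ} {E E' : ℕ → ℝ} {k : ℕ}
    (h : ∀ i, 1 ≤ i → i ≤ k → E i = E' i) : resSet ε u E k = resSet ε u E' k := by
  have : history ε u E k = history ε u E' k := by
    induction k with
    | zero => rfl
    | succ k ih =>
      rw [history, history, ih fun i h1 h2 => h i h1 (by omega), h (k + 1) (by omega) le_rfl]
  rw [resSet, resSet, this]

theorem mem_spectrum_truncSchur_congr {γ lam : ℝ} {u : Λ → ℝ} {R R' : ℕ → Finset Λ} {j : ℕ}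
    {B B' : Finset Λ} (hR : ∀ i ≤ j, R i = R' i) (hB : B = B') :
    lam ∈ spectrum ℝ (truncSchur γ u lam R j B) ↔
      lam ∈ spectrum ℝ (truncSchur γ u lam R' j B') := by
  subst hB
  rw [truncSchur_congr γ u lam hR]

/-- With μ = E + τ the unknown τ ranges over a fixed compact interval, and a zero of the continuous
function τ ↦ det is sought. -/
theorem measurableSet_isResonant (f : ℕ → Finset Λ) (k : ℕ) (C : Finset Λ) :
    MeasurableSet {a : (Λ → ℝ) × (ℕ → ℝ) | IsResonant ε a.1 (a.2 k) f k C} := by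
  by_cases h : IsIsolated k (f (k - 1)) C
  swap
  · simp [IsResonant, h]
  have h1 := measurableSet_exists_zero (α := (Λ → ℝ) × (ℕ → ℝ))
    (f := fun a τ => (truncSchur (ε ^ 4) a.1 (a.2 k) f (k - 1) C -
      (a.2 k + τ) • (1 : Matrix {a : Site Λ // a.1 ∈ C} {a : Site Λ // a.1 ∈ C} ℝ)).det)
    (fun τ => measurable_det_truncSchur _ _ measurable_fst (by fun_prop) (by fun_prop) _ _)
    Set.univ MeasurableSet.univ (isCompact_Icc (a := -epsAt ε k) (b := epsAt ε k)) (fun a _ => by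
      refine Continuous.continuousOn (Continuous.matrix_det ?_)
      fun_prop)
  convert h1 using 1
  ext a
  simp only [IsResonant, h, true_and, Set.mem_ofPred_eq, Set.mem_univ]
  constructor
  · rintro ⟨μ, hμ, hμE⟩
    refine ⟨μ - a.2 k, abs_le.1 hμE, ?_⟩
    rw [add_sub_cancel]
    exact mem_spectrum_iff_det.1 hμ
  · rintro ⟨τ, hτ, h0⟩
    refine ⟨a.2 k + τ, mem_spectrum_iff_det.2 h0, ?_⟩
    rw [add_sub_cancel_left]
    exact abs_le.2 hτ

theorem measurableSet_resSet_eq (i : ℕ) (F : Finset Λ) :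
    MeasurableSet {a : (Λ → ℝ) × (ℕ → ℝ) | resSet ε a.1 a.2 i = F} := by
  induction i using Nat.strong_induction_on generalizing F with
  | _ i ih =>
    have hsuff : (∀ z, MeasurableSet {a : (Λ → ℝ) × (ℕ → ℝ) | z ∈ resSet ε a.1 a.2 i}) →
        MeasurableSet {a : (Λ → ℝ) × (ℕ → ℝ) | resSet ε a.1 a.2 i = F} := by
      intro h
      have e : {a : (Λ → ℝ) × (ℕ → ℝ) | resSet ε a.1 a.2 i = F} =
          ⋂ z : Λ, {a | z ∈ resSet ε a.1 a.2 i ↔ z ∈ F} := by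
        ext a
        simp only [Set.mem_iInter, Set.mem_ofPred_eq, Finset.ext_iff]
      rw [e]
      refine MeasurableSet.iInter fun z => ?_
      by_cases hz : z ∈ F
      · simpa [hz] using h z
      · simp only [hz, iff_false]
        exact (h z).compl
    match i with
    | 0 =>
      refine hsuff fun z => ?_
      have : ∀ a : (Λ → ℝ) × (ℕ → ℝ), z ∈ resSet ε a.1 a.2 0 := fun a => Finset.mem_univ z
      simp [this]
    | 1 =>
      refine hsuff fun z => ?_
      have e : {a : (Λ → ℝ) × (ℕ → ℝ) | z ∈ resSet ε a.1 a.2 1} =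
          {a | |√(a.1 z ^ 2 + 1) - a.2 1| ≤ ε} ∪ {a | |-√(a.1 z ^ 2 + 1) - a.2 1| ≤ ε} := by
        ext a
        rw [Set.mem_ofPred_eq, resSet_one, Finset.mem_filter]
        simp [t]
      rw [e]
      refine MeasurableSet.union ?_ ?_
      · exact measurableSet_le (by fun_prop) measurable_const
      · exact measurableSet_le (by fun_prop) measurable_const
    | i + 2 =>
      refine hsuff fun z => ?_
      simp only [mem_resSet_add_two]
      refine MeasurableSet.inter
        (show MeasurableSet {a : (Λ → ℝ) × (ℕ → ℝ) | z ∈ resSet ε a.1 a.2 (i + 1)} from ?_) ?_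
      · have e : {a : (Λ → ℝ) × (ℕ → ℝ) | z ∈ resSet ε a.1 a.2 (i + 1)} =
            ⋃ F ∈ {F : Finset Λ | z ∈ F}, {a | resSet ε a.1 a.2 (i + 1) = F} := by
          ext a
          simp
        rw [e]
        exact MeasurableSet.biUnion (Set.to_countable _) fun F _ => ih (i + 1) (by omega) F
      · refine measurableSet_of_history (R := fun a : (Λ → ℝ) × (ℕ → ℝ) => resSet ε a.1 a.2)
          (i := i + 1)
          (S := fun f => {a | ¬ (IsIsolated (i + 2) (f (i + 1)) (comp (L ((i : ℤ) + 2)) (f (i + 1)) z) ∧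
            ¬ IsResonant ε a.1 (a.2 (i + 2)) f (i + 2) (comp (L ((i : ℤ) + 2)) (f (i + 1)) z))})
          (fun f => ?_) fun a f g hfg h => ?_
        · refine MeasurableSet.inter ?_ ?_
          · have e : {a : (Λ → ℝ) × (ℕ → ℝ) | ∀ m ≤ i + 1, resSet ε a.1 a.2 m = f m} =
                ⋂ m ∈ Set.Iic (i + 1), {a | resSet ε a.1 a.2 m = f m} := by
              ext a
              simp
            rw [e]
            exact MeasurableSet.biInter (Set.to_countable _) fun m hm =>
              ih m (by simp only [Set.mem_Iic] at hm; omega) _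
          · refine MeasurableSet.compl (MeasurableSet.inter (MeasurableSet.const _) ?_)
            exact (measurableSet_isResonant f (i + 2) _).compl
        · simp only [Set.mem_ofPred_eq] at h ⊢
          rwa [← hfg (i + 1) le_rfl, ← isResonant_congr hfg]

theorem measurableSet_forall_resSet_eq (f : ℕ → Finset Λ) (k : ℕ) :
    MeasurableSet {a : (Λ → ℝ) × (ℕ → ℝ) | ∀ m ≤ k, resSet ε a.1 a.2 m = f m} := by
  have e : {a : (Λ → ℝ) × (ℕ → ℝ) | ∀ m ≤ k, resSet ε a.1 a.2 m = f m} =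
      ⋂ m ∈ Set.Iic k, {a | resSet ε a.1 a.2 m = f m} := by
    ext a
    simp
  rw [e]
  exact MeasurableSet.biInter (Set.to_countable _) fun m _ => measurableSet_resSet_eq _ _

/-- The entries are Lipschitz continuous in the spectral parameter by `LevelBounds.lip`, provided
that it remains in all earlier windows. -/
theorem continuousOn_det_truncSchur {G : ℝ} (hε : 0 < ε) (hε' : ε ≤ 1 / 36)
    (hG : Real.exp (-G) = ε ^ 4) (hs : ∀ j, StepSmall d G j) {u : Λ → ℝ} {E : ℕ → ℝ} {j : ℕ}
    (hj : 1 ≤ j) (hE : ∀ i, 1 ≤ i → i < j → |E (i + 1) - E i| ≤ epsAt ε i / 3) {C : Finset Λ}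
    (hC : C ⊆ resSet ε u E j) :
    ContinuousOn (fun τ => (truncSchur (ε ^ 4) u (E j + τ) (resSet ε u E) j C -
      (E j + τ) • (1 : Matrix {a : Site Λ // a.1 ∈ C} {a : Site Λ // a.1 ∈ C} ℝ)).det)
      (Set.Icc (-(epsAt ε j / 3)) (epsAt ε j / 3)) := by
  have hb : LevelBounds ε G u E (resSet ε u E) j :=
    levelBounds hε hG (fun j _ => hs j) fun i hi => elimData_resSet hε hε' hE hi
  have hw : ∀ τ ∈ Set.Icc (-(epsAt ε j / 3)) (epsAt ε j / 3), InWindow ε E j (E j + τ) := by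
    intro τ hτ i h1 h2
    -- `E j + τ` is inserted as a fictitious next energy, so that `energy_dist_le` places it in all
    -- windows.
    set E' := Function.update E (j + 1) (E j + τ) with hE'
    have hE'i : ∀ i ≤ j, E' i = E i := fun i hi => Function.update_of_ne (by omega) _ _
    have h3 : ∀ i, 1 ≤ i → i < j + 1 → |E' (i + 1) - E' i| ≤ epsAt ε i / 3 := by
      intro i h1 h2
      rcases Nat.lt_or_ge i j with h3 | h3
      · rw [hE'i _ (by omega), hE'i _ (by omega)]
        exact hE i h1 h3
      · obtain rfl : i = j := by omega
        rw [hE'i _ le_rfl, hE', Function.update_self, add_sub_cancel_left]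
        exact abs_le.2 hτ
    have h4 := energy_dist_le hε hε' h3 h1 (show i ≤ j + 1 by omega) le_rfl
    rwa [hE'i _ h2, hE', Function.update_self] at h4
  have hent : ∀ a b : {a : Site Λ // a.1 ∈ C}, ContinuousOn
      (fun τ => truncSchur (ε ^ 4) u (E j + τ) (resSet ε u E) j C a b)
      (Set.Icc (-(epsAt ε j / 3)) (epsAt ε j / 3)) := by
    intro a b
    refine LipschitzOnWith.continuousOn (K := 1) (LipschitzOnWith.of_dist_le_mul fun τ hτ τ' hτ' => ?_)
    have h1 := hb.lip _ _ (hw τ hτ) (hw τ' hτ') (nbhd (L ((j : ℤ) - 1)) C) a.1 (hC a.2)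
    have h2 := Finset.single_le_sum (s := Finset.univ.filter fun b : Site Λ => b.1 ∈ resSet ε u E j)
      (f := fun b => |schur (ε ^ 4) u (E j + τ) (resSet ε u E) j
      (nbhd (L ((j : ℤ) - 1)) C) a.1 b - schur (ε ^ 4) u (E j + τ') (resSet ε u E) j
      (nbhd (L ((j : ℤ) - 1)) C) a.1 b|) (fun _ _ => abs_nonneg _)
      (Finset.mem_filter.2 ⟨Finset.mem_univ b.1, hC b.2⟩)
    rw [Real.dist_eq, Real.dist_eq]
    refine (h2.trans h1).trans ?_
    rw [add_sub_add_left_eq_sub]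
    refine mul_le_mul_of_nonneg_right ?_ (abs_nonneg _)
    have h3 : (0 : ℝ) < (1 / 2) ^ j := by positivity
    rw [NNReal.coe_one]
    linarith
  simp only [Matrix.det_apply]
  refine continuousOn_finsetSum _ fun σ _ => (continuousOn_finsetProd _ fun i _ => ?_).const_smul _
  refine (hent _ _).sub (ContinuousOn.mul ?_ continuousOn_const)
  fun_prop

/-- For a given history, the admissible energies are the zeros of a determinant, shifted by `E j`,
and the rank of an energy is a number of zeros below a bound. The restriction to `W` provides the
continuity in the spectral parameter that the counting requires. -/
theorem measurableSet_inter_nextEnergies {G : ℝ} (hε : 0 < ε) (hε' : ε ≤ 1 / 36)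
    (hG : Real.exp (-G) = ε ^ 4) (hs : ∀ j, StepSmall d G j) (x : Λ) {j : ℕ} (hj : 1 ≤ j)
    (n : ℕ) {W : Set ((Λ → ℝ) × (ℕ → ℝ))} (hW : MeasurableSet W)
    (hE : ∀ a ∈ W, ∀ i, 1 ≤ i → i < j → |a.2 (i + 1) - a.2 i| ≤ epsAt ε i / 3) :
    MeasurableSet {a | a ∈ W ∧ a.2 (j + 1) ∈ nextEnergies ε a.1 a.2 x j ∧
      (nextEnergies ε a.1 a.2 x j ∩ Set.Iio (a.2 (j + 1))).encard = n} := by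
  set N : (ℕ → Finset Λ) → (Λ → ℝ) × (ℕ → ℝ) → Set ℝ := fun f a =>
    {lam | |lam - a.2 j| ≤ epsAt ε j / 3 ∧
      lam ∈ spectrum ℝ (truncSchur (ε ^ 4) a.1 lam f j (comp (L j) (f j) x))} with hN
  refine measurableSet_of_history (R := fun a : (Λ → ℝ) × (ℕ → ℝ) => resSet ε a.1 a.2) (i := j)
    (S := fun f => {a | a ∈ W ∧ a.2 (j + 1) ∈ N f a ∧ (N f a ∩ Set.Iio (a.2 (j + 1))).encard = n})
    (fun f => ?_) fun a f g hfg h => ?_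
  swap
  · have e : N f a = N g a := by
      ext lam
      exact and_congr_right fun _ => mem_spectrum_truncSchur_congr hfg (by rw [hfg j le_rfl])
    simpa only [Set.mem_ofPred_eq, e] using h
  set C := comp (L j) (f j) x with hC
  set w := epsAt ε j / 3 with hw
  set F : (Λ → ℝ) × (ℕ → ℝ) → ℝ → ℝ := fun a τ => (truncSchur (ε ^ 4) a.1 (a.2 j + τ) f j C -
      (a.2 j + τ) • (1 : Matrix {a : Site Λ // a.1 ∈ C} {a : Site Λ // a.1 ∈ C} ℝ)).det with hF
  have hNF : ∀ a, N f a = (fun τ => a.2 j + τ) '' {τ | τ ∈ Set.Icc (-w) w ∧ F a τ = 0} := by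
    intro a
    ext lam
    constructor
    · rintro ⟨h1, h2⟩
      refine ⟨lam - a.2 j, ⟨abs_le.1 h1, ?_⟩, by simp⟩
      simp only [hF, add_sub_cancel]
      exact mem_spectrum_iff_det.1 h2
    · rintro ⟨τ, ⟨h1, h2⟩, rfl⟩
      refine ⟨?_, mem_spectrum_iff_det.2 h2⟩
      rw [add_sub_cancel_left]
      exact abs_le.2 h1
  have hcard : ∀ a b, (N f a ∩ Set.Iio b).encard =
      ({τ | τ ∈ Set.Icc (-w) w ∧ F a τ = 0} ∩ Set.Iio (b - a.2 j)).encard := by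
    intro a b
    have hinj : Function.Injective fun τ => a.2 j + τ := add_right_injective _
    rw [← hinj.encard_image (_ ∩ Set.Iio (b - a.2 j)), Set.image_inter hinj, ← hNF]
    congr 2
    ext lam
    constructor
    · intro h
      exact ⟨lam - a.2 j, sub_lt_sub_right (show lam < b from h) _, by simp⟩
    · rintro ⟨τ, h, rfl⟩
      have h' : τ < b - a.2 j := h
      change a.2 j + τ < b
      linarith
  have hFm : ∀ τ, Measurable fun a => F a τ := fun τ =>
    measurable_det_truncSchur _ _ measurable_fst
      (lam := fun a : (Λ → ℝ) × (ℕ → ℝ) => a.2 j + τ) (mu := fun a => a.2 j + τ)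
      (by fun_prop) (by fun_prop) _ _
  have h1 := measurableSet_encard_eq hFm ((measurableSet_forall_resSet_eq f j).inter hW) (w := w)
    (fun a ha => by
      have h2 := continuousOn_det_truncSchur hε hε' hG hs hj (hE a ha.2) (u := a.1) (C := C)
        (by rw [ha.1 j le_rfl]; exact comp_subset)
      refine h2.congr fun τ _ => ?_
      simp only [hF]
      rw [truncSchur_congr (R' := f) _ _ _ ha.1]) n
    (b := fun a => a.2 (j + 1) - a.2 j) (by fun_prop)
  have h3 : MeasurableSet {a : (Λ → ℝ) × (ℕ → ℝ) | a.2 (j + 1) ∈ N f a} := by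
    refine MeasurableSet.inter (measurableSet_le
      (f := fun a : (Λ → ℝ) × (ℕ → ℝ) => |a.2 (j + 1) - a.2 j|) (by fun_prop) measurable_const) ?_
    have e : {a : (Λ → ℝ) × (ℕ → ℝ) | a.2 (j + 1) ∈
        spectrum ℝ (truncSchur (ε ^ 4) a.1 (a.2 (j + 1)) f j C)} =
        {a | (truncSchur (ε ^ 4) a.1 (a.2 (j + 1)) f j C - a.2 (j + 1) •
          (1 : Matrix {a : Site Λ // a.1 ∈ C} {a : Site Λ // a.1 ∈ C} ℝ)).det = 0} := by
      ext a
      exact mem_spectrum_iff_det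
    change MeasurableSet {a : (Λ → ℝ) × (ℕ → ℝ) | a.2 (j + 1) ∈
        spectrum ℝ (truncSchur (ε ^ 4) a.1 (a.2 (j + 1)) f j C)}
    rw [e]
    exact measurableSet_eq_fun (measurable_det_truncSchur _ _ measurable_fst
      (lam := fun a : (Λ → ℝ) × (ℕ → ℝ) => a.2 (j + 1))
      (mu := fun a : (Λ → ℝ) × (ℕ → ℝ) => a.2 (j + 1)) (by fun_prop)
      (by fun_prop) _ _) measurable_const
  convert h1.inter h3 using 1
  ext a
  simp only [Set.mem_inter_iff, Set.mem_ofPred_eq, hcard]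
  tauto

theorem Follows.congr_energy {u : Λ → ℝ} {x : Λ} {s : ℝ} {p : ℕ → ℕ} {k : ℕ} (hk : 1 ≤ k)
    {E E' : ℕ → ℝ} (h : ∀ i, 1 ≤ i → i ≤ k → E i = E' i) (hf : Follows ε u x s p k E) :
    Follows ε u x s p k E' := by
  refine ⟨by rw [← h 1 le_rfl hk]; exact hf.1, fun j h1 h2 => ?_⟩
  have hR : ∀ i ≤ j, resSet ε u E i = resSet ε u E' i := fun i hi =>
    resSet_congr_energy fun m h3 h4 => h m h3 (by omega)
  have e : nextEnergies ε u E x j = nextEnergies ε u E' x j := by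
    ext lam
    change _ ∧ _ ↔ _ ∧ _
    rw [h j h1 h2.le, mem_spectrum_truncSchur_congr hR
      (show block ε u E x j = block ε u E' x j by rw [block, block, hR j le_rfl])]
  rw [← e, ← h (j + 1) (by omega) h2]
  exact hf.2 j h1 h2

/-- The event is the projection of a measurable set of pairs of a potential and a sequence of
energies, normalised to vanish outside the steps 1, …, k. The ranks make the energies unique, by
`Follows.agree` with an empty set of changes, so the projection is injective and its image is
measurable by the Lusin–Souslin theorem. -/
theorem measurableSet_blockEvent {G : ℝ} (hε : 0 < ε) (hε' : ε ≤ 1 / 36)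
    (hG : Real.exp (-G) = ε ^ 4) (hs : ∀ j, StepSmall d G j) (x : Λ) (s : ℝ) (p : ℕ → ℕ) {k : ℕ}
    (hk : 1 ≤ k) (B : Finset Λ) : MeasurableSet (blockEvent ε x s p k B) := by
  set W : Set ((Λ → ℝ) × (ℕ → ℝ)) :=
    {a | ∀ i, 1 ≤ i → i < k → |a.2 (i + 1) - a.2 i| ≤ epsAt ε i / 3} with hW
  have hWm : MeasurableSet W := by
    simp only [hW, Set.ofPred_forall]
    exact MeasurableSet.iInter fun i => MeasurableSet.iInter fun _ => MeasurableSet.iInter fun _ =>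
      measurableSet_le (by fun_prop) measurable_const
  set Γ : Set ((Λ → ℝ) × (ℕ → ℝ)) := {a | (∀ z, |a.1 z| ≤ 1) ∧ (∀ i, ¬ (1 ≤ i ∧ i ≤ k) → a.2 i = 0) ∧
    Follows ε a.1 x s p k a.2 ∧ B = block ε a.1 a.2 x k} with hΓ
  have hΓm : MeasurableSet Γ := by
    have e : Γ = {a | ∀ z, |a.1 z| ≤ 1} ∩ ({a | ∀ i, ¬ (1 ≤ i ∧ i ≤ k) → a.2 i = 0} ∩
        (({a | a.2 1 = s * t (a.1 x)} ∩ ⋂ j ∈ {j : ℕ | 1 ≤ j ∧ j < k}, {a | a ∈ W ∧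
          a.2 (j + 1) ∈ nextEnergies ε a.1 a.2 x j ∧
            (nextEnergies ε a.1 a.2 x j ∩ Set.Iio (a.2 (j + 1))).encard = p j}) ∩
          ⋃ F ∈ {F : Finset Λ | B = comp (L k) F x}, {a | resSet ε a.1 a.2 k = F})) := by
      ext a
      simp only [hΓ, Set.mem_inter_iff, Set.mem_iInter, Set.mem_iUnion, Set.mem_ofPred_eq,
        exists_prop, block, exists_eq_right']
      refine and_congr_right fun _ => and_congr_right fun _ => and_congr_left fun _ => ?_
      constructor
      · intro hf
        exact ⟨hf.1, fun j hj => ⟨fun i h1 h2 => hf.energy_dist i h1 h2, hf.2 j hj.1 hj.2⟩⟩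
      · rintro ⟨h1, h2⟩
        exact ⟨h1, fun j h3 h4 => (h2 j ⟨h3, h4⟩).2⟩
    rw [e]
    refine MeasurableSet.inter ?_ (MeasurableSet.inter ?_ (MeasurableSet.inter
      (MeasurableSet.inter ?_ ?_) ?_))
    · simp only [Set.ofPred_forall]
      exact MeasurableSet.iInter fun z => measurableSet_le (by fun_prop) measurable_const
    · simp only [Set.ofPred_forall]
      exact MeasurableSet.iInter fun z => MeasurableSet.iInter fun _ =>
        measurableSet_eq_fun (by fun_prop) measurable_const
    · simp only [t]
      exact measurableSet_eq_fun (by fun_prop) (by fun_prop)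
    · refine MeasurableSet.biInter (Set.to_countable _) fun j hj => ?_
      exact measurableSet_inter_nextEnergies hε hε' hG hs x hj.1 (p j) hWm
        fun a ha i h1 h2 => ha i h1 (h2.trans hj.2)
    · exact MeasurableSet.biUnion (Set.to_countable _) fun F _ => measurableSet_resSet_eq _ _
  have himg : blockEvent ε x s p k B = Prod.fst '' Γ := by
    ext u
    constructor
    · rintro ⟨hu, E, hf, hB⟩
      set E' : ℕ → ℝ := fun i => if 1 ≤ i ∧ i ≤ k then E i else 0 with hE'
      have h1 : ∀ i, 1 ≤ i → i ≤ k → E i = E' i := fun i h1 h2 => (if_pos ⟨h1, h2⟩).symm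
      refine ⟨(u, E'), ⟨hu, fun i hi => if_neg hi, hf.congr_energy hk h1, ?_⟩, rfl⟩
      rw [hB, block, block, resSet_congr_energy h1]
    · rintro ⟨⟨u, E⟩, ⟨hu, -, hf, hB⟩, rfl⟩
      exact ⟨hu, E, hf, hB⟩
  rw [himg]
  refine hΓm.image_of_measurable_injOn measurable_fst ?_
  rintro ⟨u, E⟩ ⟨-, h0, hf, hB⟩ ⟨u', E'⟩ ⟨-, h0', hf', hB'⟩ huu
  obtain rfl : u = u' := huu
  have h1 := hf.agree hf' hB hB' (Y := ∅) (fun _ _ => rfl) (Finset.empty_subset _)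
    (Finset.notMem_empty _) le_rfl fun _ _ _ => Finset.disjoint_empty_left _
  refine Prod.ext rfl (funext fun i => ?_)
  by_cases hi : 1 ≤ i ∧ i ≤ k
  · exact (h1 i hi.2).1 hi.1
  · exact (h0 i hi).trans (h0' i hi).symm

end BlockMeasurability

/-! ### From the weighted sums to probabilities -/

theorem Phat_nonneg {ε : ℝ} (hε : 0 < ε) {x : Λ} {k : ℕ} {B : Finset Λ} (hB : B ∈ comps (L k) B) :
    0 ≤ Phat ε x k B := by
  rw [Phat_eq_prod_leaves ε hB]
  exact Finset.prod_nonneg fun ℓ _ => leafBound_nonneg hε ℓ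

theorem law_compl_cube : law Λ {u | ¬ ∀ z, |u z| ≤ 1} = 0 := by
  have hsub : {u : Λ → ℝ | ¬ ∀ z, |u z| ≤ 1} ⊆ ⋃ z : Λ, Function.eval z ⁻¹' {s : ℝ | |s| ≤ 1}ᶜ := by
    intro u hu
    rw [Set.mem_ofPred_eq, not_forall] at hu
    exact Set.mem_iUnion.2 hu
  refine MeasureTheory.measure_mono_null hsub (MeasureTheory.measure_iUnion_null fun z => ?_)
  have hm : MeasurableSet {s : ℝ | |s| ≤ 1}ᶜ :=
    (measurableSet_le measurable_norm measurable_const).compl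
  rw [law_eq_pi, (MeasureTheory.measurePreserving_eval (fun _ : Λ => unif) z).measure_preimage
    hm.nullMeasurableSet, unif, MeasureTheory.Measure.smul_apply,
    MeasureTheory.Measure.restrict_apply hm]
  have : {s : ℝ | |s| ≤ 1}ᶜ ∩ Set.Icc (-1) 1 = ∅ := by
    ext s
    simp only [Set.mem_inter_iff, Set.mem_compl_iff, Set.mem_ofPred_eq, Set.mem_Icc,
      Set.mem_empty_iff_false, iff_false, not_and]
    exact fun h1 h2 h3 => h1 (abs_le.2 ⟨h2, h3⟩)
  rw [this, MeasureTheory.measure_empty, smul_zero]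

/-- Take the first step in which `y` is in the block of `x`. The component of `x` on the preceding
scale is the block of the preceding step, or {x} in the first step, and does not contain `y`; so
this block is counted in `Qhat`. -/
theorem exists_blockEvent {ε : ℝ} {x y : Λ} (hxy : x ≠ y) {s : ℝ} {p : ℕ → ℕ} {k : ℕ} (hk : 1 ≤ k)
    {u : Λ → ℝ} (hu : ∀ z, |u z| ≤ 1) (huk : u ∈ inBlock ε x y s p k) :
    ∃ k' ∈ Finset.Icc 1 k, ∃ B : Finset Λ, (x ∈ B ∧ y ∈ B ∧ comp (L k') B x = B ∧
      (B \ comp (L ((k' : ℤ) - 1)) B x).Nonempty) ∧ u ∈ blockEvent ε x s p k' B := by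
  obtain ⟨E, hf, hy⟩ := huk
  have hex : ∃ m, 1 ≤ m ∧ y ∈ block ε u E x m := ⟨k, hk, hy⟩
  obtain ⟨h1, h2⟩ := Nat.find_spec hex
  have hle : Nat.find hex ≤ k := Nat.find_min' hex ⟨hk, hy⟩
  have hmin := fun m => @Nat.find_min _ _ hex m
  set m := Nat.find hex
  have hx : x ∈ block ε u E x m := self_mem_comp (mem_of_mem_comp h2)
  refine ⟨m, Finset.mem_Icc.2 ⟨h1, hle⟩, block ε u E x m, ⟨hx, h2, comp_self, y,
    Finset.mem_sdiff.2 ⟨h2, fun hy' => ?_⟩⟩, hu, E, hf.mono hle, rfl⟩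
  rcases Nat.lt_or_ge 1 m with h3 | h3
  · obtain ⟨n, hn⟩ := Nat.exists_eq_add_of_le' h1
    rw [show ((m : ℤ) - 1) = (n : ℕ) by omega,
      ← comp_resSet_eq_comp_block rfl (show 1 ≤ n by omega) (show n ≤ m by omega) hx] at hy'
    exact hmin n (by omega) ⟨by omega, hy'⟩
  · rw [comp_of_lt_one _ hx, Finset.mem_singleton] at hy'
    · exact hxy hy'.symm
    · rw [show (m : ℤ) - 1 = 0 by omega]
      norm_num [L]

/-- A union bound over the step and the block of `exists_blockEvent`; the weights ε^(-q n/2) in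
`Qhat` are at least 1 and may be inserted for free. Only the block events have to be measurable. -/
theorem law_inBlock_le {ε G : ℝ} (hε : 0 < ε) (hε' : ε ≤ Real.exp (-30))
    (hγ : ε ^ 4 * (6 * 4 ^ d) ≤ 1 / 4) (hG : Real.exp (-G) = ε ^ 4) (hs : ∀ j, StepSmall d G j)
    (hq : ∀ k, 0 ≤ qSeq k) {x y : Λ} (hxy : x ≠ y) {s : ℝ} (hs1 : s = 1 ∨ s = -1) (p : ℕ → ℕ)
    {k : ℕ} (hk : 1 ≤ k) :
    law Λ (inBlock ε x y s p k) ≤ ENNReal.ofReal (∑ m ∈ Finset.Icc 1 k, Qhat ε m x y) := by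
  have hε1 : ε ≤ 1 := hε'.trans (Real.exp_le_one_iff.2 (by norm_num))
  have hε36 : ε ≤ 1 / 36 := by
    refine hε'.trans ?_
    rw [Real.exp_neg, inv_eq_one_div]
    refine one_div_le_one_div_of_le (by norm_num) ?_
    have := Real.quadratic_le_exp_of_nonneg (show (0 : ℝ) ≤ 30 by norm_num)
    linarith
  set 𝓑 : ℕ → Finset (Finset Λ) := fun m => Finset.univ.filter fun B : Finset Λ =>
    x ∈ B ∧ y ∈ B ∧ comp (L m) B x = B ∧ (B \ comp (L ((m : ℤ) - 1)) B x).Nonempty with h𝓑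
  have hsub : inBlock ε x y s p k ⊆ {u | ¬ ∀ z, |u z| ≤ 1} ∪
      ⋃ m ∈ Finset.Icc 1 k, ⋃ B ∈ 𝓑 m, blockEvent ε x s p m B := by
    intro u hu
    by_cases hc : ∀ z, |u z| ≤ 1
    · obtain ⟨m, hm, B, hB, huB⟩ := exists_blockEvent hxy hk hc hu
      refine Or.inr (Set.mem_biUnion hm (Set.mem_biUnion ?_ huB))
      exact Finset.mem_filter.2 ⟨Finset.mem_univ _, hB⟩
    · exact Or.inl hc
  have hterm : ∀ m ∈ Finset.Icc 1 k, ∀ B ∈ 𝓑 m, 0 ≤ Phat ε x m B ∧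
      law Λ (blockEvent ε x s p m B) ≤ ENNReal.ofReal (Phat ε x m B) := by
    intro m hm B hB
    obtain ⟨-, hx, -, hB, -⟩ := Finset.mem_filter.1 hB
    have hm1 := (Finset.mem_Icc.1 hm).1
    exact ⟨Phat_nonneg hε (comps_of_comp_eq hx hB), law_blockEvent_le hε hε' hγ hG hs hs1 hm1 hx hB
      (measurableSet_blockEvent hε hε36 hG hs x s p hm1 B)⟩
  have hle : ∀ m ∈ Finset.Icc 1 k, ∀ B ∈ 𝓑 m, Phat ε x m B ≤
      Phat ε x m B * ε ^ (-(qSeq m * B.card / 2)) := fun m hm B hB =>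
    le_mul_of_one_le_right (hterm m hm B hB).1 (Real.one_le_rpow_of_pos_of_le_one_of_nonpos hε hε1
      (neg_nonpos.2 (div_nonneg (mul_nonneg (hq m) (Nat.cast_nonneg _)) zero_le_two)))
  have hQ : ∀ m ∈ Finset.Icc 1 k, 0 ≤ Qhat ε m x y := fun m hm => Finset.sum_nonneg fun B hB =>
    (hterm m hm B hB).1.trans (hle m hm B hB)
  calc law Λ (inBlock ε x y s p k)
      ≤ law Λ {u | ¬ ∀ z, |u z| ≤ 1} +
          ∑ m ∈ Finset.Icc 1 k, ∑ B ∈ 𝓑 m, law Λ (blockEvent ε x s p m B) := by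
        refine (MeasureTheory.measure_mono hsub).trans ((MeasureTheory.measure_union_le _ _).trans
          (add_le_add le_rfl ((MeasureTheory.measure_biUnion_finset_le _ _).trans
            (Finset.sum_le_sum fun m _ => MeasureTheory.measure_biUnion_finset_le _ _))))
    _ ≤ ∑ m ∈ Finset.Icc 1 k, ENNReal.ofReal (Qhat ε m x y) := by
        rw [law_compl_cube, zero_add]
        refine Finset.sum_le_sum fun m hm => ?_
        rw [Qhat, ENNReal.ofReal_sum_of_nonneg fun B hB =>
          (hterm m hm B hB).1.trans (hle m hm B hB)]
        exact Finset.sum_le_sum fun B hB => (hterm m hm B hB).2.trans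
          (ENNReal.ofReal_le_ofReal (hle m hm B hB))
    _ = _ := (ENNReal.ofReal_sum_of_nonneg hQ).symm

/-! ### The action of a block -/

/-- A connected set is obtained from the component of a point on a smaller scale by successively
adding components that are linked to the previous ones. -/
theorem comps_induction {ℓ ℓ' : ℝ} {B : Finset Λ} {z : Λ} (hz : z ∈ B) (hB : comp ℓ B z = B)
    {motive : Finset (Finset Λ) → Prop} (base : motive {comp ℓ' B z})
    (step : ∀ 𝒯 ⊆ comps ℓ' B, comp ℓ' B z ∈ 𝒯 → ∀ D ∈ comps ℓ' B, D ∉ 𝒯 → ∀ a ∈ 𝒯.biUnion id,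
      ∀ b ∈ D, ldist a.1 b.1 ≤ ℓ → motive 𝒯 → motive (insert D 𝒯)) : motive (comps ℓ' B) := by
  -- A family of maximal cardinality among those with the property must cover `B`, since otherwise a
  -- link would lead to a further component.
  set 𝒲 := (comps ℓ' B).powerset.filter fun 𝒯 => comp ℓ' B z ∈ 𝒯 ∧ motive 𝒯 with h𝒲
  have hne : 𝒲.Nonempty := ⟨{comp ℓ' B z}, by
    simp only [h𝒲, Finset.mem_filter, Finset.mem_powerset, Finset.singleton_subset_iff,
      Finset.mem_singleton, true_and]
    exact ⟨comp_mem_comps hz, base⟩⟩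
  obtain ⟨𝒯, h𝒯, hmax⟩ := Finset.exists_max_image 𝒲 Finset.card hne
  simp only [h𝒲, Finset.mem_filter, Finset.mem_powerset] at h𝒯 hmax
  obtain ⟨hsub, hz𝒯, hm⟩ := h𝒯
  by_cases hB𝒯 : B ⊆ 𝒯.biUnion id
  · convert hm
    refine Finset.Subset.antisymm (fun D hD => ?_) hsub
    obtain ⟨b, hb⟩ := nonempty_of_mem_comps hD
    obtain ⟨D', hD', hb'⟩ := Finset.mem_biUnion.1 (hB𝒯 (subset_of_mem_comps hD hb))
    rwa [eq_of_mem_comps hD (hsub hD') hb hb']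
  · exfalso
    obtain ⟨a, ha, b, hb, hb𝒯, hab⟩ := exists_link (T := 𝒯.biUnion id) hB
      (Finset.mem_biUnion.2 ⟨_, hz𝒯, self_mem_comp hz⟩) hB𝒯
    have hD := comp_mem_comps (ℓ := ℓ') hb
    have hD𝒯 : comp ℓ' B b ∉ 𝒯 := fun h =>
      hb𝒯 (Finset.mem_biUnion.2 ⟨_, h, self_mem_comp hb⟩)
    have h1 := hmax (insert (comp ℓ' B b) 𝒯) ⟨Finset.insert_subset hD hsub,
      Finset.mem_insert_of_mem hz𝒯, step 𝒯 hsub hz𝒯 _ hD hD𝒯 a ha b (self_mem_comp hb) hab hm⟩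
    rw [Finset.card_insert_of_notMem hD𝒯] at h1
    omega

/-- The exponent of `ε` in the bound `Phat ε x k B`. -/
def action (x : Λ) : ℕ → Finset Λ → ℝ
  | 0, B => ((B.erase x).card : ℝ) / 3
  | k + 1, B =>
      if IsIsolated (k - 1) B B ∧ x ∉ B then L ((k - 1 : ℕ) : ℤ) ^ (3 * psi / 5) / 3
      else ∑ C ∈ comps (L k) B, action x k C

section Action

variable {x : Λ} {k : ℕ} {B : Finset Λ}

theorem action_of_isolated (h : IsIsolated (k - 1) B B ∧ x ∉ B) :
    action x (k + 1) B = L ((k - 1 : ℕ) : ℤ) ^ (3 * psi / 5) / 3 := if_pos h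

theorem action_of_not_isolated (h : ¬ (IsIsolated (k - 1) B B ∧ x ∉ B)) :
    action x (k + 1) B = ∑ C ∈ comps (L k) B, action x k C := if_neg h

theorem one_le_L {j : ℤ} (hj : 1 ≤ j) : 1 ≤ L j := by
  refine le_trans (le_of_eq ?_) (L_mono hj)
  norm_num [L]

/-- For an isolated part the volume condition gives n ≤ L^(2ψ/5) ≤ L^(3ψ/5); otherwise the numbers
add up over the components. -/
theorem card_erase_le_action (x : Λ) (k : ℕ) (B : Finset Λ) :
    ((B.erase x).card : ℝ) / 3 ≤ action x k B := by
  induction k generalizing B with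
  | zero => exact le_rfl
  | succ k ih =>
    by_cases h : IsIsolated (k - 1) B B ∧ x ∉ B
    · rw [action_of_isolated h]
      have hL : 1 ≤ L ((k - 1 : ℕ) : ℤ) := one_le_L (by have := h.1.1; omega)
      have h1 : ((B.erase x).card : ℝ) ≤ B.card := by exact_mod_cast Finset.card_erase_le
      have h2 : L ((k - 1 : ℕ) : ℤ) ^ (2 * psi / 5) ≤ L ((k - 1 : ℕ) : ℤ) ^ (3 * psi / 5) :=
        Real.rpow_le_rpow_of_exponent_le hL (by norm_num [psi])
      have := h.1.2.2.1
      linarith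
    · rw [action_of_not_isolated h]
      refine le_trans ?_ (Finset.sum_le_sum fun C _ => ih C)
      rw [← Finset.sum_div]
      refine div_le_div_of_nonneg_right ?_ (by norm_num)
      have h1 : B.erase x ⊆ (comps (L k) B).biUnion fun C => C.erase x := by
        intro y hy
        rw [Finset.mem_erase] at hy
        exact Finset.mem_biUnion.2 ⟨_, comp_mem_comps hy.2,
          Finset.mem_erase.2 ⟨hy.1, self_mem_comp hy.2⟩⟩
      exact_mod_cast (Finset.card_le_card h1).trans Finset.card_biUnion_le

theorem action_nonneg (x : Λ) (k : ℕ) (B : Finset Λ) : 0 ≤ action x k B :=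
  le_trans (by positivity) (card_erase_le_action x k B)

theorem action_one (x : Λ) (B : Finset Λ) : action x 1 B = ((B.erase x).card : ℝ) / 3 := by
  refine le_antisymm ?_ (card_erase_le_action x 1 B)
  rw [action_of_not_isolated fun h => absurd h.1.1 (by norm_num)]
  simp only [action]
  rw [← Finset.sum_div]
  refine div_le_div_of_nonneg_right ?_ (by norm_num)
  have h1 : (comps (L ((0 : ℕ) : ℤ)) B).biUnion (fun C => C.erase x) ⊆ B.erase x := by
    intro y hy
    obtain ⟨C, hC, hy⟩ := Finset.mem_biUnion.1 hy
    rw [Finset.mem_erase] at hy ⊢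
    exact ⟨hy.1, subset_of_mem_comps hC hy.2⟩
  have h2 : ((comps (L ((0 : ℕ) : ℤ)) B).biUnion fun C => C.erase x).card =
      ∑ C ∈ comps (L ((0 : ℕ) : ℤ)) B, (C.erase x).card :=
    Finset.card_biUnion fun C hC D hD hne => Finset.disjoint_of_subset_left (Finset.erase_subset _ _)
      (Finset.disjoint_of_subset_right (Finset.erase_subset _ _)
        (comps_pairwiseDisjoint _ _ hC hD hne))
  exact_mod_cast h2 ▸ Finset.card_le_card h1

theorem Phat_le_rpow_action {ε : ℝ} (hε : 0 < ε) (hε' : 3 * √ε ≤ ε ^ (1 / 3 : ℝ)) (x : Λ) {k : ℕ}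
    (hk : 1 ≤ k) {B : Finset Λ} (hB : B ∈ comps (L k) B) :
    Phat ε x k B ≤ ε ^ action x k B := by
  induction k, hk using Nat.le_induction generalizing B with
  | base =>
    rw [action_one, Phat]
    have e : (if x ∈ B then B.card - 1 else B.card) = (B.erase x).card :=
      (Finset.card_erase_eq_ite).symm
    rw [e]
    refine (pow_le_pow_left₀ (by positivity) hε' _).trans (le_of_eq ?_)
    rw [← Real.rpow_natCast, ← Real.rpow_mul hε.le]
    congr 1
    ring
  | succ k hk ih =>
    obtain ⟨j, rfl⟩ := Nat.exists_eq_add_of_le' hk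
    rw [Phat, action]
    simp only [Nat.add_sub_cancel]
    split_ifs with h1
    · exact le_rfl
    · rw [Real.rpow_sum_of_pos hε]
      push_cast
      refine Finset.prod_le_prod (fun C hC => Phat_nonneg hε ?_) fun C hC => ih ?_
      · push_cast; exact comps_self_of_mem_comps hC
      · push_cast; exact comps_self_of_mem_comps hC

/-- The exponent 9/2 is 1/χ. The surplus over additivity, 8 times a lower bound for both summands,
is what a link of length L_{k+1} = 8 L_{k-2} needs when two components are joined. It comes from the
mixed terms of (α + β)⁴, with v^(9/2) written as v⁴√v. -/
theorem add_rpow_nine_halves {α β μ : ℝ} (hα : 0 ≤ α) (hβ : 0 ≤ β)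
    (hμα : μ ≤ α ^ (9 / 2 : ℝ)) (hμβ : μ ≤ β ^ (9 / 2 : ℝ)) :
    α ^ (9 / 2 : ℝ) + β ^ (9 / 2 : ℝ) + 8 * μ ≤ (α + β) ^ (9 / 2 : ℝ) := by
  wlog hab : α ≤ β generalizing α β
  · have := this hβ hα hμβ hμα (le_of_not_ge hab)
    rw [add_comm β α] at this
    linarith
  have e : ∀ {v : ℝ}, 0 ≤ v → v ^ (9 / 2 : ℝ) = v ^ 4 * √v := fun {v} hv => by
    rcases hv.eq_or_lt with rfl | hv
    · norm_num
    rw [Real.sqrt_eq_rpow, ← Real.rpow_natCast, ← Real.rpow_add hv]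
    norm_num
  rw [e hα, e hβ, e (add_nonneg hα hβ)] at *
  have h1 : √β ≤ √(α + β) := Real.sqrt_le_sqrt (by linarith)
  have h2 : √α ≤ √β := Real.sqrt_le_sqrt hab
  have h3 := Real.sqrt_nonneg α
  have h4 : β ^ 4 + 9 * α ^ 4 ≤ (α + β) ^ 4 := by
    have h5 : α ^ 2 ≤ β ^ 2 := pow_le_pow_left₀ hα hab 2
    have h6 : α ^ 3 ≤ β ^ 3 := pow_le_pow_left₀ hα hab 3
    have h7 := mul_le_mul_of_nonneg_left h6 hα
    have h8 := mul_le_mul_of_nonneg_left h5 (sq_nonneg α)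
    have h9 : 0 ≤ α ^ 3 * β := by positivity
    nlinarith
  have h5 : α ^ 4 * √α ≤ α ^ 4 * √β := mul_le_mul_of_nonneg_left h2 (by positivity)
  have h6 : (β ^ 4 + 9 * α ^ 4) * √β ≤ (α + β) ^ 4 * √(α + β) :=
    mul_le_mul h4 h1 (Real.sqrt_nonneg _) (by positivity)
  linarith

theorem le_rpow_nine_halves {v ℓ e : ℝ} (hℓ : 1 ≤ ℓ) (he : 2 / 9 ≤ e) (h : ℓ ^ e ≤ v) :
    ℓ ≤ v ^ (9 / 2 : ℝ) := by
  have h0 : 0 < ℓ := by linarith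
  calc ℓ = ℓ ^ (1 : ℝ) := (Real.rpow_one ℓ).symm
    _ ≤ ℓ ^ (e * (9 / 2)) := Real.rpow_le_rpow_of_exponent_le hℓ (by linarith)
    _ = (ℓ ^ e) ^ (9 / 2 : ℝ) := Real.rpow_mul h0.le _ _
    _ ≤ v ^ (9 / 2 : ℝ) := Real.rpow_le_rpow (by positivity) h (by norm_num)

theorem comps_L_zero_card {B : Finset Λ} (hB : B ∈ comps (L 0) B) : ∃ z, B = {z} := by
  obtain ⟨z, hz⟩ := nonempty_of_mem_comps hB
  refine ⟨z, ?_⟩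
  rw [← comp_eq_of_mem_comps hB hz, comp_of_lt_one (by norm_num [L]) hz]

theorem L_sub_one (k : ℤ) : L (k - 1) = 2 * L (k - 2) := by
  rw [← L_succ]; congr 1; ring

theorem L_add_one (k : ℤ) : L (k + 1) = 8 * L (k - 2) := by
  rw [L_succ, show k = k - 2 + 2 by ring, L_add_two, show k - 2 + 2 - 2 = k - 2 by ring]; ring

/-- The action of a block that does not contain `x` controls its diameter and its scale. -/
theorem action_bounds (hB : B ∈ comps (L k) B) (hx : x ∉ B) :
    L ((k : ℤ) - 2) ≤ (3 * action x k B) ^ (9 / 2 : ℝ) ∧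
      ∀ a ∈ B, ∀ b ∈ B, ldist a.1 b.1 ≤ (3 * action x k B) ^ (9 / 2 : ℝ) := by
  induction k generalizing B with
  | zero =>
    obtain ⟨z, rfl⟩ := comps_L_zero_card hB
    have e : 3 * action x 0 {z} = 1 := by
      have : x ∉ ({z} : Finset Λ) := hx
      rw [action, Finset.erase_eq_of_notMem this, Finset.card_singleton]
      norm_num
    rw [e, Real.one_rpow]
    refine ⟨by norm_num [L], fun a ha b hb => ?_⟩
    rw [Finset.mem_singleton.1 ha, Finset.mem_singleton.1 hb, ldist_self]
    norm_num
  | succ k ih =>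
    have hL2 : L (((k + 1 : ℕ) : ℤ) - 2) = L ((k : ℤ) - 1) := by push_cast; congr 1; ring
    rw [hL2]
    have hcard : (B.card : ℝ) ≤ 3 * action x (k + 1) B := by
      have := card_erase_le_action x (k + 1) B
      rw [Finset.erase_eq_of_notMem hx] at this
      linarith
    have hA0 : 0 ≤ 3 * action x (k + 1) B := by have := action_nonneg x (k + 1) B; linarith
    have hcast : 2 ≤ k - 1 → ((k - 1 : ℕ) : ℤ) = (k : ℤ) - 1 := fun h => by omega
    by_cases h : IsIsolated (k - 1) B B ∧ x ∉ B
    · have h2 := hcast h.1.1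
      have e : 3 * action x (k + 1) B = L ((k : ℤ) - 1) ^ (3 * psi / 5) := by
        rw [action_of_isolated h, h2]; ring
      have h3 : L ((k : ℤ) - 1) ≤ (3 * action x (k + 1) B) ^ (9 / 2 : ℝ) :=
        le_rpow_nine_halves (one_le_L (by have := h.1.1; omega)) (by norm_num [psi]) e.ge
      refine ⟨h3, fun a ha b hb => ?_⟩
      have := h.1.2.2.2.2 a ha b hb
      rw [h2] at this
      exact this.trans h3
    · have hact := action_of_not_isolated h
      obtain ⟨z, hz⟩ := nonempty_of_mem_comps hB
      have hBz := comp_eq_of_mem_comps hB hz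
      have hIH : ∀ D ∈ comps (L k) B, L ((k : ℤ) - 2) ≤ (3 * action x k D) ^ (9 / 2 : ℝ) ∧
          ∀ a ∈ D, ∀ b ∈ D, ldist a.1 b.1 ≤ (3 * action x k D) ^ (9 / 2 : ℝ) := fun D hD =>
        ih (comps_self_of_mem_comps hD) fun hxD => hx (subset_of_mem_comps hD hxD)
      have key := comps_induction (ℓ' := L k) hz hBz (motive := fun 𝒯 =>
        L ((k : ℤ) - 2) ≤ (3 * ∑ D ∈ 𝒯, action x k D) ^ (9 / 2 : ℝ) ∧
        ∀ a ∈ 𝒯.biUnion id, ∀ b ∈ 𝒯.biUnion id,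
          ldist a.1 b.1 ≤ (3 * ∑ D ∈ 𝒯, action x k D) ^ (9 / 2 : ℝ)) ?_ ?_
      · rw [← hact, biUnion_comps] at key
        refine ⟨?_, key.2⟩
        -- If the diameter exceeds L_{k-1}, the diameter bound gives the bound on the scale.
        -- Otherwise, unless the scale is trivial, `B` can only fail to be isolated because it has
        -- more than L_{k-1}^(2ψ/5) positions, and then their number suffices, as 2ψ/5 ≥ 2/9.
        by_cases hd : ∀ a ∈ B, ∀ b ∈ B, ldist a.1 b.1 ≤ L ((k : ℤ) - 1)
        · rcases Nat.lt_or_ge (k - 1) 2 with hk | hk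
          · have h1 : L ((k : ℤ) - 1) ≤ 1 := by
              refine (L_mono (show (k : ℤ) - 1 ≤ 1 by omega)).trans (le_of_eq ?_)
              norm_num [L]
            have h2 : (1 : ℝ) ≤ B.card := by exact_mod_cast Finset.card_pos.2 ⟨z, hz⟩
            exact h1.trans (Real.one_le_rpow (h2.trans hcard) (by norm_num))
          · have hk' := hcast hk
            have hcz : comp (L ((k : ℤ) - 1)) B z = B := comp_eq_self_of_diam hz (hd z hz)
            have h1 : L ((k : ℤ) - 1) ^ (2 * psi / 5) < B.card := by
              by_contra hcon
              refine h ⟨⟨hk, ?_, ?_, ?_, ?_⟩, hx⟩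
              · rw [hk']; exact comps_of_comp_eq hz hcz
              · rw [hk']; exact not_lt.1 hcon
              · rw [hk', comps_eq_singleton hz hcz]
                exact fun C hC hne => absurd (Finset.mem_singleton.1 hC) hne
              · rw [hk']; exact hd
            exact le_rpow_nine_halves (one_le_L (by omega)) (by norm_num [psi]) (h1.le.trans hcard)
        · push Not at hd
          obtain ⟨a, ha, b, hb, hab⟩ := hd
          exact hab.le.trans (key.2 a ha b hb)
      · rw [Finset.sum_singleton, Finset.singleton_biUnion]
        exact hIH _ (comp_mem_comps hz)
      · rintro 𝒯 h𝒯 hz𝒯 D hD hD𝒯 a ha b hb hab ⟨h1, h3⟩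
        rw [Finset.sum_insert hD𝒯, mul_add]
        set P := 3 * ∑ D ∈ 𝒯, action x k D with hP
        set Q := 3 * action x k D with hQ
        obtain ⟨h4, h5⟩ := hIH D hD
        have hP0 : 0 ≤ P := mul_nonneg zero_le_three (Finset.sum_nonneg fun D _ => action_nonneg x k D)
        have hQ0 : 0 ≤ Q := mul_nonneg zero_le_three (action_nonneg x k D)
        -- The surplus 8 L_{k-2} is the maximal length L_{k+1} of the link that connects the new
        -- component; the same surplus supplies the doubling of the scale.
        have h6 := add_rpow_nine_halves hQ0 hP0 h4 h1
        have hμ := L_pos ((k : ℤ) - 2)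
        have hab' : ldist a.1 b.1 ≤ 8 * L ((k : ℤ) - 2) := by
          rw [← L_add_one]; exact_mod_cast hab
        refine ⟨by linarith, ?_⟩
        · have hcross : ∀ y ∈ D, ∀ w ∈ 𝒯.biUnion id, ldist y.1 w.1 ≤ (Q + P) ^ (9 / 2 : ℝ) := by
            intro y hy w hw
            have t1 := ldist_triangle y.1 b.1 w.1
            have t2 := ldist_triangle b.1 a.1 w.1
            rw [ldist_comm b.1 a.1] at t2
            have := h5 y hy b hb
            have := h3 a ha w hw
            linarith
          intro y hy w hw
          rw [Finset.biUnion_insert, Finset.mem_union] at hy hw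
          rcases hy with hy | hy <;> rcases hw with hw | hw
          · have := h5 y hy w hw
            linarith
          · exact hcross y hy w hw
          · rw [ldist_comm]
            exact hcross w hw y hy
          · have := h3 y hy w hw
            linarith

end Action

/-! ### Blocks that contain the starting position. -/

section Radius

variable {x : Λ} {k : ℕ} {B : Finset Λ}

/-- Replacing 3 by 9 gains a factor 3^(9/2) ≥ 9. It covers a link, at most 8 times the bound for the
added component, together with the diameter of that component. The part containing `x` may have
action zero, so superadditivity with a surplus is not available there. -/
theorem mul_rpow_nine_halves_le {A : ℝ} (hA : 0 ≤ A) :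
    9 * (3 * A) ^ (9 / 2 : ℝ) ≤ (9 * A) ^ (9 / 2 : ℝ) := by
  have e : (9 * A) ^ (9 / 2 : ℝ) = 3 ^ (9 / 2 : ℝ) * (3 * A) ^ (9 / 2 : ℝ) := by
    rw [← Real.mul_rpow (by norm_num) (by positivity)]; congr 1; ring
  rw [e]
  refine mul_le_mul_of_nonneg_right ?_ (Real.rpow_nonneg (by positivity) _)
  calc (9 : ℝ) = 3 ^ (2 : ℝ) := by norm_num
    _ ≤ 3 ^ (9 / 2 : ℝ) := Real.rpow_le_rpow_of_exponent_le (by norm_num) (by norm_num)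

/-- The action of a block that contains `x` controls its radius. -/
theorem ldist_le_action (hB : B ∈ comps (L k) B) (hx : x ∈ B) :
    ∀ y ∈ B, ldist x.1 y.1 ≤ (9 * action x k B) ^ (9 / 2 : ℝ) := by
  induction k generalizing B with
  | zero =>
    obtain ⟨z, rfl⟩ := comps_L_zero_card hB
    intro y hy
    rw [Finset.mem_singleton.1 hy, Finset.mem_singleton.1 hx, ldist_self]
    exact Real.rpow_nonneg (mul_nonneg (by norm_num) (action_nonneg _ _ _)) _
  | succ k ih =>
    rw [action_of_not_isolated fun h => h.2 hx]
    have key := comps_induction (ℓ' := L k) hx (comp_eq_of_mem_comps hB hx) (motive := fun 𝒯 =>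
        ∀ y ∈ 𝒯.biUnion id, ldist x.1 y.1 ≤ (9 * ∑ D ∈ 𝒯, action x k D) ^ (9 / 2 : ℝ)) ?_ ?_
    · rwa [biUnion_comps] at key
    · rw [Finset.sum_singleton, Finset.singleton_biUnion]
      exact ih (comps_self_of_mem_comps (comp_mem_comps hx)) (self_mem_comp hx)
    · intro 𝒯 h𝒯 hx𝒯 D hD hD𝒯 a ha b hb hab h1
      have hxD : x ∉ D := fun h => hD𝒯 (by rwa [← comp_eq_of_mem_comps hD h])
      obtain ⟨h2, h3⟩ := action_bounds (comps_self_of_mem_comps hD) hxD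
      rw [Finset.sum_insert hD𝒯, mul_add]
      set P := ∑ D ∈ 𝒯, action x k D
      have hP0 : 0 ≤ P := Finset.sum_nonneg fun D _ => action_nonneg x k D
      have hQ0 := action_nonneg x k D
      have h4 := mul_rpow_nine_halves_le hQ0
      have h5 := Real.add_rpow_le_rpow_add (a := 9 * action x k D) (b := 9 * P) (by positivity)
        (by positivity) (p := 9 / 2) (by norm_num)
      have hab' : ldist a.1 b.1 ≤ 8 * L ((k : ℤ) - 2) := by
        rw [← L_add_one]; exact_mod_cast hab
      intro y hy
      rw [Finset.biUnion_insert, Finset.mem_union] at hy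
      rcases hy with hy | hy
      · have := h3 b hb y hy
        have := h1 a ha
        have := ldist_triangle x.1 a.1 y.1
        have := ldist_triangle a.1 b.1 y.1
        linarith
      · have := h1 y hy
        have : 0 ≤ (9 * action x k D) ^ (9 / 2 : ℝ) := by positivity
        linarith

/-- A block that has grown in its last step contains a component on the preceding scale that avoids
`x`, and `action_bounds` applies to this component. -/
theorem L_le_action (hx : x ∈ B) (hk : 1 ≤ k)
    (hne : (B \ comp (L ((k : ℤ) - 1)) B x).Nonempty) :
    L ((k : ℤ) - 2) ≤ (9 * action x k B) ^ (9 / 2 : ℝ) := by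
  obtain ⟨j, rfl⟩ := Nat.exists_eq_add_of_le' hk
  rw [action_of_not_isolated fun h => h.2 hx]
  obtain ⟨y, hy⟩ := hne
  rw [Finset.mem_sdiff, show ((j + 1 : ℕ) : ℤ) - 1 = j by push_cast; ring] at hy
  have hD := comp_mem_comps (ℓ := L j) hy.1
  have hxD : x ∉ comp (L j) B y := fun h => hy.2 (mem_comp_comm.1 h)
  have h1 := (action_bounds (comps_self_of_mem_comps hD) hxD).1
  have h2 := mul_rpow_nine_halves_le (action_nonneg x j (comp (L j) B y))
  have h3 : (9 * action x j (comp (L j) B y)) ^ (9 / 2 : ℝ) ≤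
      (9 * ∑ C ∈ comps (L j) B, action x j C) ^ (9 / 2 : ℝ) := by
    have h4 := Finset.single_le_sum (f := fun C => action x j C) (fun C _ => action_nonneg x j C) hD
    have := action_nonneg x j (comp (L j) B y)
    exact Real.rpow_le_rpow (by positivity) (by linarith) (by norm_num)
  have h4 : L (((j + 1 : ℕ) : ℤ) - 2) = 2 * L ((j : ℤ) - 2) := by
    rw [← L_sub_one]; push_cast; congr 1; ring
  have := L_pos ((j : ℤ) - 2)
  linarith

/-- The positions can be added one at a time, each with a link of length at most ℓ. This crude bound
is used in the first three steps. -/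
theorem ldist_le_card {ℓ : ℝ} (hℓ : 0 ≤ ℓ) (hx : x ∈ B) (hB : comp ℓ B x = B) {y : Λ}
    (hy : y ∈ B) : ldist x.1 y.1 ≤ ℓ * (B.card - 1) := by
  have key := comps_induction (ℓ' := L 0) hx hB (motive := fun 𝒯 =>
    ∀ y ∈ 𝒯.biUnion id, ldist x.1 y.1 ≤ ℓ * (𝒯.card - 1)) ?_ ?_
  · rw [biUnion_comps] at key
    refine (key y hy).trans (mul_le_mul_of_nonneg_left ?_ hℓ)
    have : ((comps (L 0) B).card : ℝ) ≤ B.card := by exact_mod_cast Finset.card_image_le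
    linarith
  · intro y hy
    rw [Finset.singleton_biUnion, id, comp_of_lt_one (by norm_num [L]) hx, Finset.mem_singleton] at hy
    rw [hy, ldist_self, Finset.card_singleton]
    simp
  · intro 𝒯 _ _ D hD hD𝒯 a ha b hb hab h1 y hy
    rw [Finset.card_insert_of_notMem hD𝒯]
    push_cast
    rw [Finset.biUnion_insert, Finset.mem_union] at hy
    rcases hy with hy | hy
    · obtain ⟨z, rfl⟩ := comps_L_zero_card (comps_self_of_mem_comps hD)
      rw [id, Finset.mem_singleton] at hy
      rw [Finset.mem_singleton] at hb
      subst hy hb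
      have := h1 a ha
      have := ldist_triangle x.1 a.1 b.1
      linarith
    · have := h1 y hy
      linarith

end Radius

/-! ### The constants `q_k` -/

/-- The ratio `2 ^ (- psi / 20)`. -/
def qRatio : ℝ := 2 ^ (-psi / 20)

theorem qRatio_pos : 0 < qRatio := Real.rpow_pos_of_pos two_pos _

theorem qRatio_lt_one : qRatio < 1 :=
  Real.rpow_lt_one_of_one_lt_of_neg one_lt_two (by norm_num [psi])

theorem one_half_le_qRatio : 1 / 2 ≤ qRatio := by
  calc (1 / 2 : ℝ) = 2 ^ (-1 : ℝ) := by rw [Real.rpow_neg_one]; norm_num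
    _ ≤ _ := Real.rpow_le_rpow_of_exponent_le one_le_two (by norm_num [psi])

theorem qSeq_add_four (k : ℕ) : qSeq (k + 4) = qSeq (k + 3) * (1 - qRatio ^ (k + 1)) := by
  rw [qSeq, show ((k : ℤ) + 2) = ((k + 1 : ℕ) : ℤ) + 1 by push_cast; ring, L_nat_succ, qRatio,
    ← Real.rpow_natCast, ← Real.rpow_natCast, ← Real.rpow_mul two_pos.le, ← Real.rpow_mul two_pos.le,
    mul_comm (-psi / 20)]

/-- The factors 1 - r^j with r < 1 have a positive infinite product: 1 - X ≥ exp(-X/(1 - r)) for X ≤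
r, and the sum of the exponents is a convergent geometric series. -/
theorem exp_le_qSeq (k : ℕ) : 1 / 7 * Real.exp (-(1 / (1 - qRatio) ^ 2)) ≤ qSeq (k + 3) := by
  have h0 : 0 < 1 - qRatio := by have := qRatio_lt_one; linarith
  have hr0 := qRatio_pos
  have key : 1 / 7 * Real.exp (-(1 / (1 - qRatio) ^ 2 * (1 - qRatio ^ k))) ≤ qSeq (k + 3) := by
    induction k with
    | zero => simp [qSeq]
    | succ k ih =>
      rw [show k + 1 + 3 = k + 4 by ring, qSeq_add_four]
      have hx0 : 0 < qRatio ^ (k + 1) := pow_pos hr0 _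
      have hx1 : qRatio ^ (k + 1) ≤ qRatio := by
        rw [pow_succ]
        exact mul_le_of_le_one_left hr0.le (pow_le_one₀ hr0.le qRatio_lt_one.le)
      set X := qRatio ^ (k + 1) with hX
      have h1 : Real.exp (-(X / (1 - qRatio))) ≤ 1 - X := by
        rw [Real.exp_neg, inv_le_comm₀ (Real.exp_pos _) (by linarith)]
        refine le_trans ?_ (Real.add_one_le_exp _)
        rw [inv_eq_one_div, div_le_iff₀ (by linarith)]
        have h2 : X / (1 - X) ≤ X / (1 - qRatio) :=
          div_le_div_of_nonneg_left hx0.le h0 (by linarith)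
        have h3 : X / (1 - X) * (1 - X) = X := div_mul_cancel₀ _ (by linarith)
        have h4 := mul_le_mul_of_nonneg_right h2 (show 0 ≤ 1 - X by linarith)
        linarith
      refine le_trans ?_ (mul_le_mul ih h1 (Real.exp_pos _).le (le_trans (by positivity) ih))
      rw [mul_assoc, ← Real.exp_add]
      refine mul_le_mul_of_nonneg_left (Real.exp_le_exp.2 ?_) (by norm_num)
      have h5 : 1 / (1 - qRatio) ^ 2 * (qRatio ^ k - X) = qRatio ^ k / (1 - qRatio) := by
        rw [hX, pow_succ]; field_simp; ring
      have h6 : X / (1 - qRatio) ≤ qRatio ^ k / (1 - qRatio) := by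
        refine div_le_div_of_nonneg_right ?_ h0.le
        rw [hX, pow_succ]
        exact mul_le_of_le_one_right (pow_pos hr0 _).le qRatio_lt_one.le
      linarith
  refine le_trans ?_ key
  refine mul_le_mul_of_nonneg_left (Real.exp_le_exp.2 (neg_le_neg ?_)) (by norm_num)
  exact mul_le_of_le_one_right (by positivity) (by have := pow_pos hr0 k; linarith)

theorem exp_le_qSeq' (k : ℕ) : 1 / 7 * Real.exp (-(1 / (1 - qRatio) ^ 2)) ≤ qSeq k := by
  have h0 := exp_le_qSeq 0
  match k with
  | 0 => exact h0.trans (by norm_num [qSeq])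
  | 1 => exact h0.trans (by norm_num [qSeq])
  | 2 => exact h0.trans (by norm_num [qSeq])
  | k + 3 => exact exp_le_qSeq k

theorem qSeq_nonneg (k : ℕ) : 0 ≤ qSeq k := le_trans (by positivity) (exp_le_qSeq' k)

theorem qSeq_add_four_le (k : ℕ) : qSeq (k + 4) ≤ 1 / 14 := by
  induction k with
  | zero =>
    rw [qSeq_add_four]
    have := one_half_le_qRatio
    norm_num [qSeq]
    linarith
  | succ k ih =>
    rw [qSeq_add_four]
    refine le_trans (mul_le_of_le_one_right (qSeq_nonneg _) ?_) ih
    have := pow_pos qRatio_pos (k + 1 + 1)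
    linarith

/-- The action of a block of `x` compensates the weights in `Qhat`. -/
theorem weight_add_le_action {x y : Λ} {k : ℕ} (hk : 1 ≤ k) {B : Finset Λ} (hx : x ∈ B) (hy : y ∈ B)
    (hB : comp (L k) B x = B) (hne : (B \ comp (L ((k : ℤ) - 1)) B x).Nonempty) :
    qSeq k * B.card / 2 + qSeq k * max (ldist x.1 y.1) (L ((k : ℤ) - 2)) ^ chi / 2 +
      action x k B / 10 ≤ action x k B := by
  set A := action x k B with hA
  set M := max (ldist x.1 y.1) (L ((k : ℤ) - 2)) with hM
  have hM0 : 0 ≤ M := le_max_of_le_left (ldist_nonneg _ _)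
  have hq := qSeq_nonneg k
  set m : ℝ := (B.card : ℝ) - 1 with hm
  have hmA : m ≤ 3 * A := by
    have h1 := card_erase_le_action x k B
    rw [Finset.card_erase_of_mem hx, Nat.cast_sub (Finset.card_pos.2 ⟨x, hx⟩)] at h1
    push_cast at h1
    linarith
  have hm1 : 1 ≤ m := by
    obtain ⟨z, hz⟩ := hne
    rw [Finset.mem_sdiff] at hz
    have hzx : x ≠ z := fun h => hz.2 (h ▸ self_mem_comp hx)
    have h2 : ({x, z} : Finset Λ).card ≤ B.card := Finset.card_le_card fun w hw => by
      rcases Finset.mem_insert.1 hw with rfl | hw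
      · exact hx
      · rw [Finset.mem_singleton.1 hw]; exact hz.1
    rw [Finset.card_pair hzx] at h2
    have : (2 : ℝ) ≤ B.card := by exact_mod_cast h2
    linarith
  have hcard : (B.card : ℝ) = m + 1 := by rw [hm]; ring
  rw [hcard]
  -- For k ≤ 3 everything is linear in m = n - 1: as M ≤ L_k m, both terms together are at most
  -- (q_k/2)(2 + C)m ≤ (3/10)m ≤ (9/10)A.
  have hsmall : ∀ {C : ℝ}, M ≤ L k * m → L k ^ chi ≤ C → qSeq k / 2 * (2 + C) ≤ 3 / 10 →
      qSeq k * (m + 1) / 2 + qSeq k * M ^ chi / 2 + A / 10 ≤ A := by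
    intro C h1 h2 h3
    have h4 : M ^ chi ≤ C * m := by
      refine (Real.rpow_le_rpow hM0 h1 (by norm_num [chi, psi])).trans ?_
      rw [Real.mul_rpow (L_pos _).le (by linarith)]
      refine mul_le_mul h2 ?_ (by positivity) (le_trans (Real.rpow_nonneg (L_pos _).le _) h2)
      exact Real.rpow_le_self_of_one_le hm1 (by norm_num [chi, psi])
    have h5 := mul_le_mul_of_nonneg_left h4 hq
    have h6 := mul_le_mul_of_nonneg_right h3 (show 0 ≤ m by linarith)
    have h7 := mul_le_mul_of_nonneg_left hm1 hq
    nlinarith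
  have hML : M ≤ L k * m := by
    refine max_le (ldist_le_card (L_pos _).le hx hB hy) ?_
    exact (L_mono (by omega)).trans (le_mul_of_one_le_right (L_pos _).le hm1)
  have hsqrt : ∀ {v w : ℝ}, 1 ≤ v → 0 ≤ w → v ≤ w ^ 2 → v ^ chi ≤ w := fun {v w} hv hw h => by
    refine (Real.rpow_le_rpow_of_exponent_le hv (show chi ≤ 1 / 2 by norm_num [chi, psi])).trans ?_
    rw [← Real.sqrt_eq_rpow]
    exact Real.sqrt_le_iff.2 ⟨hw, h⟩
  rcases (show k = 1 ∨ k = 2 ∨ k = 3 ∨ 4 ≤ k by omega) with h | h | h | h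
  · subst h
    refine hsmall (C := 1) hML (hsqrt ?_ ?_ ?_) ?_ <;> norm_num [L, qSeq]
  · subst h
    refine hsmall (C := 3 / 2) hML (hsqrt ?_ ?_ ?_) ?_ <;> norm_num [L, qSeq]
  · subst h
    refine hsmall (C := 2) hML (hsqrt ?_ ?_ ?_) ?_ <;> norm_num [L, qSeq]
  · have h1 : M ≤ (9 * A) ^ (9 / 2 : ℝ) :=
      max_le (ldist_le_action (comps_of_comp_eq hx hB) hx y hy) (L_le_action hx hk hne)
    have h2 : M ^ chi ≤ 9 * A := by
      refine (Real.rpow_le_rpow hM0 h1 (by norm_num [chi, psi])).trans (le_of_eq ?_)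
      rw [← Real.rpow_mul (by linarith)]
      norm_num [chi, psi]
    have h3 : qSeq k ≤ 1 / 14 := by
      obtain ⟨j, rfl⟩ := Nat.exists_eq_add_of_le' h
      exact qSeq_add_four_le j
    -- Here m + 1 ≤ 2m ≤ 6A and M^χ ≤ 9A. With q_k ≤ 1/14 both terms together are at most 15A/28,
    -- which is below 9A/10.
    have h4 : m + 1 + M ^ chi ≤ 15 * A := by linarith
    have h5 := mul_le_mul h3 h4 (by positivity) (by norm_num)
    have hA0 : 0 ≤ A := by linarith
    linarith

/-! ### Sums over sets that are visited by closed walks -/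

section Tour

variable {ι : Type*}

/-- The product of the weights of the steps of a walk. -/
def pathWeight (f : ι → ι → ℝ) : List ι → ℝ
  | [] => 1
  | [_] => 1
  | a :: b :: l => f a b * pathWeight f (b :: l)

/-- There is a closed walk that starts at `z` and visits exactly the points of `S`, and its weight
is at least `w`. -/
def Tour (f : ι → ι → ℝ) (z : ι) (S : Finset ι) (w : ℝ) : Prop :=
  ∃ W : List ι, W.head? = some z ∧ W.getLast? = some z ∧ W.toFinset = S ∧ w ≤ pathWeight f W

variable {f : ι → ι → ℝ}

theorem pathWeight_append (s : List ι) (a : ι) (l : List ι) :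
    pathWeight f (s ++ a :: l) = pathWeight f (s ++ [a]) * pathWeight f (a :: l) := by
  induction s with
  | nil => simp [pathWeight]
  | cons c s ih =>
    cases s with
    | nil => simp [pathWeight]
    | cons c' s =>
      simp only [List.cons_append, pathWeight] at ih ⊢
      rw [ih, mul_assoc]

theorem pathWeight_nonneg (hf : ∀ a b, 0 ≤ f a b) : ∀ l : List ι, 0 ≤ pathWeight f l
  | [] => zero_le_one
  | [_] => zero_le_one
  | _ :: b :: l => mul_nonneg (hf _ _) (pathWeight_nonneg hf (b :: l))

theorem tour_singleton (z : ι) : Tour f z {z} 1 := ⟨[z], rfl, rfl, by simp, le_rfl⟩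

/-- A tour is extended by an excursion to a second tour. -/
theorem Tour.graft (hf : ∀ a b, 0 ≤ f a b) {z a b : ι} {S S' : Finset ι} {w w' : ℝ}
    (hw' : 0 ≤ w') (h : Tour f z S w) (h' : Tour f b S' w') (ha : a ∈ S) :
    Tour f z (S ∪ S') (w * (f a b * w' * f b a)) := by
  obtain ⟨W, hW1, hW2, rfl, hW⟩ := h
  obtain ⟨W', hW1', hW2', rfl, hW'⟩ := h'
  obtain ⟨s, l, rfl⟩ := List.append_of_mem (List.mem_toFinset.1 ha)
  obtain ⟨r, rfl⟩ : ∃ r, W' = r ++ [b] := by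
    rcases List.eq_nil_or_concat W' with rfl | ⟨r, c, rfl⟩
    · simp at hW1'
    · rw [List.concat_eq_append] at hW2' ⊢
      rw [List.getLast?_concat, Option.some.injEq] at hW2'
      exact ⟨r, by rw [← hW2']⟩
  obtain ⟨r', hr'⟩ : ∃ r', r ++ [b] = b :: r' := by
    cases h : r ++ [b] with
    | nil => simp at h
    | cons c r' =>
      rw [h, List.head?_cons, Option.some.injEq] at hW1'
      exact ⟨r', by rw [hW1']⟩
  -- The first tour is interrupted at `a` by a step to `b`, the second tour and a step back to `a`.
  refine ⟨s ++ a :: ((r ++ [b]) ++ a :: l), ?_, ?_, ?_, ?_⟩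
  · cases s with
    | nil => simpa using hW1
    | cons c s => simpa using hW1
  · rw [List.getLast?_append] at hW2 ⊢
    rw [List.getLast?_cons, List.getLast?_append]
    cases hl : (a :: l).getLast? with
    | none => simp at hl
    | some c =>
      rw [hl] at hW2
      simpa using hW2
  · ext c
    simp only [List.mem_toFinset, List.mem_append, List.mem_cons, Finset.mem_union]
    tauto
  · have h1 : pathWeight f (s ++ a :: ((r ++ [b]) ++ a :: l)) =
        pathWeight f (s ++ [a]) * (f a b * (pathWeight f (r ++ [b]) * (f b a * pathWeight f (a :: l)))) := by
      rw [pathWeight_append, List.append_assoc, List.singleton_append]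
      have h2 : pathWeight f (a :: (r ++ b :: a :: l)) = f a b * pathWeight f (r ++ b :: a :: l) := by
        have h3 : r ++ b :: a :: l = b :: (r' ++ a :: l) := by
          rw [← List.singleton_append (l := a :: l), ← List.append_assoc, hr', List.cons_append]
        rw [h3]
        rfl
      rw [h2, pathWeight_append r b]
      rfl
    rw [h1]
    have h4 := pathWeight_append (f := f) s a l
    have h5 : w * w' ≤ pathWeight f (s ++ a :: l) * pathWeight f (r ++ [b]) :=
      mul_le_mul hW hW' hw' (pathWeight_nonneg hf _)
    have h6 : 0 ≤ f a b * f b a := mul_nonneg (hf _ _) (hf _ _)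
    calc w * (f a b * w' * f b a) = w * w' * (f a b * f b a) := by ring
      _ ≤ pathWeight f (s ++ a :: l) * pathWeight f (r ++ [b]) * (f a b * f b a) :=
        mul_le_mul_of_nonneg_right h5 h6
      _ = _ := by rw [h4]; ring

theorem Tour.mono {z : ι} {S : Finset ι} {w w' : ℝ} (h : Tour f z S w) (hw : w' ≤ w) :
    Tour f z S w' := by
  obtain ⟨W, h1, h2, h3, h4⟩ := h
  exact ⟨W, h1, h2, h3, hw.trans h4⟩

variable [Fintype ι]

/-- The lists of length `m`. -/
def listsOf (ι : Type*) [Fintype ι] : ℕ → Finset (List ι)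
  | 0 => {[]}
  | m + 1 => (Finset.univ ×ˢ listsOf ι m).image fun p => p.1 :: p.2

theorem mem_listsOf {m : ℕ} {l : List ι} : l ∈ listsOf ι m ↔ l.length = m := by
  induction m generalizing l with
  | zero => simp [listsOf]
  | succ m ih =>
    rw [listsOf, Finset.mem_image]
    constructor
    · rintro ⟨p, hp, rfl⟩
      rw [List.length_cons, ih.1 (Finset.mem_product.1 hp).2]
    · intro h
      cases l with
      | nil => simp at h
      | cons a l =>
        exact ⟨(a, l), Finset.mem_product.2 ⟨Finset.mem_univ _, ih.2 (by simpa using h)⟩, rfl⟩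

theorem sum_pathWeight_le (hf : ∀ a b, 0 ≤ f a b) {s : ℝ} (hs : ∀ z, ∑ a, f z a ≤ s) (m : ℕ)
    (z : ι) : ∑ l ∈ listsOf ι m, pathWeight f (z :: l) ≤ s ^ m := by
  induction m generalizing z with
  | zero => simp [listsOf, pathWeight]
  | succ m ih =>
    rw [listsOf, Finset.sum_image fun p _ p' _ h => by
      simp only [List.cons.injEq] at h
      exact Prod.ext h.1 h.2, Finset.sum_product]
    simp only [pathWeight, ← Finset.mul_sum]
    have hs0 : 0 ≤ s := (Finset.sum_nonneg fun a _ => hf z a).trans (hs z)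
    calc ∑ a, f z a * ∑ l ∈ listsOf ι m, pathWeight f (a :: l)
        ≤ ∑ a, f z a * s ^ m :=
          Finset.sum_le_sum fun a _ => mul_le_mul_of_nonneg_left (ih a) (hf z a)
      _ = (∑ a, f z a) * s ^ m := (Finset.sum_mul _ _ _).symm
      _ ≤ s * s ^ m := mul_le_mul_of_nonneg_right (hs z) (pow_nonneg hs0 m)
      _ = s ^ (m + 1) := (pow_succ' s m).symm

theorem sum_Icc_pow_le {s : ℝ} (hs0 : 0 ≤ s) (hs : s ≤ 1 / 2) (M : ℕ) :
    ∑ m ∈ Finset.Icc 1 M, s ^ m ≤ 1 := by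
  have key : ∑ m ∈ Finset.Icc 1 M, s ^ m ≤ 1 - (1 / 2) ^ M := by
    induction M with
    | zero => simp
    | succ M ih =>
      rw [Finset.sum_Icc_succ_top (by omega)]
      have := pow_le_pow_left₀ hs0 hs (M + 1)
      rw [pow_succ (1 / 2 : ℝ)] at this ⊢
      linarith
  have : (0 : ℝ) < (1 / 2) ^ M := by positivity
  linarith

/-- The sum over all sets that are visited by a tour from `x`. -/
theorem sum_tour_le (hf : ∀ a b, 0 ≤ f a b) {s : ℝ} (hs : ∀ z, ∑ a, f z a ≤ s) (hs' : s ≤ 1 / 2)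
    (x : ι) (𝓑 : Finset (Finset ι)) (w : Finset ι → ℝ)
    (h : ∀ B ∈ 𝓑, B ≠ {x} ∧ Tour f x B (w B)) : ∑ B ∈ 𝓑, w B ≤ 1 := by
  have hs0 : 0 ≤ s := (Finset.sum_nonneg fun a _ => hf x a).trans (hs x)
  -- A walk is chosen for every set. The set is recovered as the set of visited points, so distinct
  -- sets have distinct walks, and B ≠ {x} excludes the walk without steps.
  have h1 : ∀ B : Finset ι, ∃ l : List ι, B ∈ 𝓑 →
      l ≠ [] ∧ (x :: l).toFinset = B ∧ w B ≤ pathWeight f (x :: l) := by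
    intro B
    by_cases hB : B ∈ 𝓑
    · obtain ⟨hne, W, hW1, -, hW3, hW4⟩ := h B hB
      cases W with
      | nil => simp at hW1
      | cons c l =>
        rw [List.head?_cons, Option.some.injEq] at hW1
        subst hW1
        refine ⟨l, fun _ => ⟨fun hl => hne ?_, hW3, hW4⟩⟩
        rw [← hW3, hl]
        simp
    · exact ⟨[], fun h => absurd h hB⟩
  choose l hl using h1
  set M := 𝓑.sup fun B => (l B).length
  calc ∑ B ∈ 𝓑, w B ≤ ∑ B ∈ 𝓑, pathWeight f (x :: l B) :=
        Finset.sum_le_sum fun B hB => (hl B hB).2.2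
    _ = ∑ l' ∈ 𝓑.image l, pathWeight f (x :: l') := by
        rw [Finset.sum_image]
        intro B hB B' hB' e
        rw [← (hl B hB).2.1, ← (hl B' hB').2.1, e]
    _ ≤ ∑ l' ∈ (Finset.Icc 1 M).biUnion fun m => listsOf ι m, pathWeight f (x :: l') := by
        refine Finset.sum_le_sum_of_subset_of_nonneg (fun l' hl' => ?_)
          fun _ _ _ => pathWeight_nonneg hf _
        obtain ⟨B, hB, rfl⟩ := Finset.mem_image.1 hl'
        refine Finset.mem_biUnion.2 ⟨(l B).length, Finset.mem_Icc.2 ⟨?_, ?_⟩, mem_listsOf.2 rfl⟩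
        · exact List.length_pos_of_ne_nil (hl B hB).1
        · exact Finset.le_sup (f := fun B => (l B).length) hB
    _ = ∑ m ∈ Finset.Icc 1 M, ∑ l' ∈ listsOf ι m, pathWeight f (x :: l') := by
        refine Finset.sum_biUnion fun m _ m' _ hne => Finset.disjoint_left.2 fun l' h1 h2 => ?_
        exact hne ((mem_listsOf.1 h1).symm.trans (mem_listsOf.1 h2))
    _ ≤ ∑ m ∈ Finset.Icc 1 M, s ^ m := Finset.sum_le_sum fun m _ => sum_pathWeight_le hf hs m x
    _ ≤ 1 := sum_Icc_pow_le hs0 hs' M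

end Tour

/-! ### Tours through blocks -/

/-- The weight of a step of a tour. -/
def stepWeight (θ : ℝ) (a b : Λ) : ℝ :=
  if a = b then 0 else Real.exp (-(θ * ldist a.1 b.1 ^ (1 / 9 : ℝ)))

theorem stepWeight_nonneg (θ : ℝ) (a b : Λ) : 0 ≤ stepWeight θ a b := by
  rw [stepWeight]; split_ifs <;> positivity

/-- The excursion uses the link in both directions; hence the factor 2 in all exponents, with every
link counted once in `c`. -/
theorem graft_stepWeight {θ : ℝ} {z a b : Λ} {S S' : Finset Λ} {c c' : ℝ}
    (h : Tour (stepWeight θ) z S (Real.exp (-(2 * θ * c))))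
    (h' : Tour (stepWeight θ) b S' (Real.exp (-(2 * θ * c')))) (ha : a ∈ S) (hab : a ≠ b) :
    Tour (stepWeight θ) z (S ∪ S')
      (Real.exp (-(2 * θ * (c + c' + ldist a.1 b.1 ^ (1 / 9 : ℝ))))) := by
  have := h.graft (stepWeight_nonneg θ) (Real.exp_pos _).le h' ha
  rw [stepWeight, stepWeight, if_neg hab, if_neg hab.symm, ldist_comm b.1 a.1, ← Real.exp_add,
    ← Real.exp_add, ← Real.exp_add] at this
  rw [show -(2 * θ * (c + c' + ldist a.1 b.1 ^ (1 / 9 : ℝ))) =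
    -(2 * θ * c) + (-(θ * ldist a.1 b.1 ^ (1 / 9 : ℝ)) + -(2 * θ * c') +
      -(θ * ldist a.1 b.1 ^ (1 / 9 : ℝ))) by ring]
  convert this

theorem tour_star (θ : ℝ) (z : Λ) (S : Finset Λ) (hz : z ∉ S) :
    Tour (stepWeight θ) z (insert z S)
      (Real.exp (-(2 * θ * ∑ y ∈ S, ldist z.1 y.1 ^ (1 / 9 : ℝ)))) := by
  induction S using Finset.induction_on with
  | empty => simpa using tour_singleton (f := stepWeight θ) z
  | insert y S hy ih =>
    rw [Finset.mem_insert, not_or] at hz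
    have h1 : Tour (stepWeight θ) y {y} (Real.exp (-(2 * θ * 0))) := by
      simpa using tour_singleton (f := stepWeight θ) y
    have h2 := graft_stepWeight (ih hz.2) h1 (Finset.mem_insert_self z S) hz.1
    rw [Finset.sum_insert hy]
    convert h2 using 1
    · ext w
      simp only [Finset.mem_insert, Finset.mem_union, Finset.mem_singleton]
      tauto
    · congr 3
      ring

/-- The constant in the bound on the length of a tour through a block in terms of the action. -/
def tourConst (k : ℕ) : ℝ := 120 - 100 / L k ^ (1 / 9 : ℝ)

theorem two_rpow_ninth : (107 / 100 : ℝ) ≤ 2 ^ (1 / 9 : ℝ) ∧ (2 : ℝ) ^ (1 / 9 : ℝ) ≤ 109 / 100 := by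
  have h : ((2 : ℝ) ^ (1 / 9 : ℝ)) ^ 9 = 2 := by
    rw [← Real.rpow_natCast, ← Real.rpow_mul two_pos.le]
    norm_num
  constructor
  · by_contra hc
    have := pow_lt_pow_left₀ (not_le.1 hc) (by positivity) (n := 9) (by norm_num)
    rw [h] at this
    norm_num at this
  · by_contra hc
    have := pow_lt_pow_left₀ (not_le.1 hc) (by positivity) (n := 9) (by norm_num)
    rw [h] at this
    norm_num at this

theorem three_le_tourConst (k : ℕ) : 3 ≤ tourConst k := by
  have h1 : (2 : ℝ)⁻¹ ^ (1 / 9 : ℝ) ≤ L k ^ (1 / 9 : ℝ) := by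
    refine Real.rpow_le_rpow (by norm_num) ?_ (by norm_num)
    refine le_trans (le_of_eq ?_) (L_mono (show (0 : ℤ) ≤ k by omega))
    norm_num [L]
  rw [Real.inv_rpow two_pos.le] at h1
  have h2 := two_rpow_ninth
  have h3 : (1 / (109 / 100) : ℝ) ≤ L k ^ (1 / 9 : ℝ) := by
    refine le_trans ?_ h1
    rw [← one_div]
    exact one_div_le_one_div_of_le (by linarith) h2.2
  rw [tourConst]
  have h4 : 100 / L k ^ (1 / 9 : ℝ) ≤ 109 := by
    rw [div_le_iff₀ (by linarith)]
    linarith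
  linarith

/-- With ℓ = L_{k-2}, the n joints on scale k + 1 cost at most n(8ℓ)^(1/9), whereas the action is at
least nℓ^(2/9)/3. The cost is therefore of order A·ℓ^(-1/9), which is summable over the scales; the
increment of `tourConst` is made to cover it. -/
theorem mul_rpow_ninth_le {ℓ n A : ℝ} (hℓ : 0 < ℓ) (h : n * ℓ ^ (2 / 9 : ℝ) ≤ 3 * A) (hA : 0 ≤ A) :
    n * (8 * ℓ) ^ (1 / 9 : ℝ) ≤
      (100 / (4 * ℓ) ^ (1 / 9 : ℝ) - 100 / (8 * ℓ) ^ (1 / 9 : ℝ)) * A := by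
  obtain ⟨hg1, hg2⟩ := two_rpow_ninth
  set g := (2 : ℝ) ^ (1 / 9 : ℝ) with hg
  set y := ℓ ^ (1 / 9 : ℝ) with hy
  have hy0 : 0 < y := Real.rpow_pos_of_pos hℓ _
  have hg0 : 0 < g := by linarith
  have e8 : (8 * ℓ) ^ (1 / 9 : ℝ) = g ^ 3 * y := by
    rw [Real.mul_rpow (by norm_num) hℓ.le, hg, ← Real.rpow_natCast, ← Real.rpow_mul two_pos.le,
      show (8 : ℝ) = 2 ^ (3 : ℝ) by norm_num, ← Real.rpow_mul two_pos.le]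
    norm_num
    rw [hy]
  have e4 : (4 * ℓ) ^ (1 / 9 : ℝ) = g ^ 2 * y := by
    rw [Real.mul_rpow (by norm_num) hℓ.le, hg, ← Real.rpow_natCast, ← Real.rpow_mul two_pos.le,
      show (4 : ℝ) = 2 ^ (2 : ℝ) by norm_num, ← Real.rpow_mul two_pos.le]
    norm_num
    rw [hy]
  have e2 : ℓ ^ (2 / 9 : ℝ) = y ^ 2 := by
    rw [hy, ← Real.rpow_natCast, ← Real.rpow_mul hℓ.le]
    norm_num
  rw [e2] at h
  rw [e8, e4]
  have h1 : (100 / (g ^ 2 * y) - 100 / (g ^ 3 * y)) * A = 100 * (g - 1) * A / (g ^ 3 * y) := by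
    field_simp
  rw [h1, le_div_iff₀ (by positivity)]
  have h2 : 3 * g ^ 6 ≤ 100 * (g - 1) := by
    have := pow_le_pow_left₀ hg0.le hg2 6
    norm_num at this
    linarith
  calc n * (g ^ 3 * y) * (g ^ 3 * y) = n * y ^ 2 * g ^ 6 := by ring
    _ ≤ 3 * A * g ^ 6 := mul_le_mul_of_nonneg_right h (by positivity)
    _ = 3 * g ^ 6 * A := by ring
    _ ≤ _ := mul_le_mul_of_nonneg_right h2 hA

/-- Every block is visited by a tour whose length is bounded by the action of the block. -/
theorem exists_tour (θ : ℝ) (x : Λ) {k : ℕ} {B : Finset Λ} (hB : B ∈ comps (L k) B) {z : Λ}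
    (hz : z ∈ B) : ∃ c, c ≤ tourConst k * action x k B ∧
      Tour (stepWeight θ) z B (Real.exp (-(2 * θ * c))) := by
  induction k generalizing B z with
  | zero =>
    obtain ⟨z', rfl⟩ := comps_L_zero_card hB
    rw [Finset.mem_singleton] at hz
    subst hz
    have := three_le_tourConst 0
    refine ⟨0, mul_nonneg (by linarith) (action_nonneg x 0 _), ?_⟩
    simpa using tour_singleton (f := stepWeight θ) z
  | succ k ih =>
    have hA0 := action_nonneg x (k + 1) B
    by_cases h : IsIsolated (k - 1) B B ∧ x ∉ B
    · refine ⟨∑ y ∈ B.erase z, ldist z.1 y.1 ^ (1 / 9 : ℝ), ?_, ?_⟩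
      · have hL : 1 ≤ L ((k - 1 : ℕ) : ℤ) := one_le_L (by have := h.1.1; omega)
        have h1 : ∑ y ∈ B.erase z, ldist z.1 y.1 ^ (1 / 9 : ℝ) ≤
            ∑ y ∈ B.erase z, L ((k - 1 : ℕ) : ℤ) ^ (1 / 9 : ℝ) :=
          Finset.sum_le_sum fun y hy => Real.rpow_le_rpow (ldist_nonneg _ _)
            (h.1.2.2.2.2 z hz y (Finset.mem_of_mem_erase hy)) (by norm_num)
        rw [Finset.sum_const, nsmul_eq_mul] at h1
        have h2 : ((B.erase z).card : ℝ) ≤ L ((k - 1 : ℕ) : ℤ) ^ (2 * psi / 5) :=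
          le_trans (by exact_mod_cast Finset.card_erase_le) h.1.2.2.1
        -- An isolated block is toured as a star: at most L^(2ψ/5) excursions of cost at most
        -- L^(1/9) each. This fits into the action since 2ψ/5 + 1/9 = 17/45 < 18/45 = 3ψ/5.
        have h3 : L ((k - 1 : ℕ) : ℤ) ^ (2 * psi / 5) * L ((k - 1 : ℕ) : ℤ) ^ (1 / 9 : ℝ) ≤
            L ((k - 1 : ℕ) : ℤ) ^ (3 * psi / 5) := by
          rw [← Real.rpow_add (L_pos _)]
          exact Real.rpow_le_rpow_of_exponent_le hL (by norm_num [psi])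
        have h4 : L ((k - 1 : ℕ) : ℤ) ^ (3 * psi / 5) = 3 * action x (k + 1) B := by
          rw [action_of_isolated h]; ring
        have h5 := mul_le_mul_of_nonneg_right h2 (Real.rpow_nonneg (L_pos ((k - 1 : ℕ) : ℤ)).le (1 / 9))
        have h6 := mul_le_mul_of_nonneg_right (three_le_tourConst (k + 1)) hA0
        linarith
      · have := tour_star θ z (B.erase z) (Finset.notMem_erase z B)
        rwa [Finset.insert_erase hz] at this
    · have hact := action_of_not_isolated h
      have key := comps_induction (ℓ' := L k) hz (comp_eq_of_mem_comps hB hz) (motive := fun 𝒯 =>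
        ∃ c, c ≤ tourConst k * ∑ D ∈ 𝒯, action x k D +
            ((𝒯.card : ℝ) - 1) * L ((k : ℤ) + 1) ^ (1 / 9 : ℝ) ∧
          Tour (stepWeight θ) z (𝒯.biUnion id) (Real.exp (-(2 * θ * c)))) ?_ ?_
      · obtain ⟨c, hc, ht⟩ := key
        rw [biUnion_comps] at ht
        refine ⟨c, ?_, ht⟩
        rw [← hact] at hc
        -- The number of joints is one less than the number of components. At most one component
        -- contains `x`, and every other one has action at least L_{k-2}^(2/9)/3.
        have hn : (((comps (L k) B).card : ℝ) - 1) * L ((k : ℤ) - 2) ^ (2 / 9 : ℝ) ≤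
            3 * action x (k + 1) B := by
          set 𝒯 := (comps (L k) B).filter fun D => x ∉ D with h𝒯
          have h1 : (comps (L k) B).card ≤ 𝒯.card + 1 := by
            have h2 : 𝒯.card + ((comps (L k) B).filter fun D => ¬ x ∉ D).card =
                (comps (L k) B).card := by
              rw [h𝒯]
              convert Finset.card_filter_add_card_filter_not (s := comps (L k) B) fun D => x ∉ D
            have h3 : ((comps (L k) B).filter fun D => ¬ x ∉ D).card ≤ 1 :=
              Finset.card_le_one.2 fun D hD D' hD' => by
                simp only [Finset.mem_filter, not_not] at hD hD'
                exact eq_of_mem_comps hD.1 hD'.1 hD.2 hD'.2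
            omega
          have h1' : ((comps (L k) B).card : ℝ) - 1 ≤ 𝒯.card := by
            have : ((comps (L k) B).card : ℝ) ≤ 𝒯.card + 1 := by exact_mod_cast h1
            linarith
          have h4 : ∀ D ∈ 𝒯, L ((k : ℤ) - 2) ^ (2 / 9 : ℝ) ≤ 3 * action x k D := by
            intro D hD
            rw [h𝒯, Finset.mem_filter] at hD
            have h5 := (action_bounds (comps_self_of_mem_comps hD.1) hD.2).1
            have h6 : 0 ≤ 3 * action x k D := mul_nonneg (by norm_num) (action_nonneg x k D)
            refine (Real.rpow_le_rpow (L_pos _).le h5 (by norm_num)).trans (le_of_eq ?_)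
            rw [← Real.rpow_mul h6]
            norm_num
          calc (((comps (L k) B).card : ℝ) - 1) * L ((k : ℤ) - 2) ^ (2 / 9 : ℝ)
              ≤ 𝒯.card * L ((k : ℤ) - 2) ^ (2 / 9 : ℝ) :=
                mul_le_mul_of_nonneg_right h1' (Real.rpow_nonneg (L_pos _).le _)
            _ = ∑ D ∈ 𝒯, L ((k : ℤ) - 2) ^ (2 / 9 : ℝ) := by rw [Finset.sum_const, nsmul_eq_mul]
            _ ≤ ∑ D ∈ 𝒯, 3 * action x k D := Finset.sum_le_sum h4
            _ ≤ ∑ D ∈ comps (L k) B, 3 * action x k D :=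
                Finset.sum_le_sum_of_subset_of_nonneg (Finset.filter_subset _ _)
                  fun D _ _ => mul_nonneg (by norm_num) (action_nonneg x k D)
            _ = _ := by rw [← Finset.mul_sum, hact]
        have h7 := mul_rpow_ninth_le (L_pos _) hn hA0
        rw [← L_add_one, ← L_add_two, show (k : ℤ) - 2 + 2 = k by ring] at h7
        rw [show tourConst (k + 1) = 120 - 100 / L ((k : ℤ) + 1) ^ (1 / 9 : ℝ) by
          rw [tourConst]; push_cast; rfl]
        rw [tourConst] at hc
        linarith
      · obtain ⟨c, hc, ht⟩ := ih (comps_self_of_mem_comps (comp_mem_comps hz))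
          (self_mem_comp (ℓ := L k) hz)
        refine ⟨c, ?_, ?_⟩
        · rw [Finset.sum_singleton, Finset.card_singleton]
          simpa using hc
        · rwa [Finset.singleton_biUnion]
      · rintro 𝒯 h𝒯 - D hD hD𝒯 a ha b hb hab ⟨c, hc, ht⟩
        obtain ⟨c', hc', ht'⟩ := ih (comps_self_of_mem_comps hD) hb
        have hne : a ≠ b := by
          rintro rfl
          obtain ⟨D', hD', haD'⟩ := Finset.mem_biUnion.1 ha
          exact hD𝒯 (eq_of_mem_comps hD (h𝒯 hD') hb haD' ▸ hD')
        refine ⟨c + c' + ldist a.1 b.1 ^ (1 / 9 : ℝ), ?_, ?_⟩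
        · rw [Finset.sum_insert hD𝒯, Finset.card_insert_of_notMem hD𝒯]
          have h1 : ldist a.1 b.1 ^ (1 / 9 : ℝ) ≤ L ((k : ℤ) + 1) ^ (1 / 9 : ℝ) :=
            Real.rpow_le_rpow (ldist_nonneg _ _) (by exact_mod_cast hab) (by norm_num)
          push_cast
          linarith
        · rw [Finset.biUnion_insert, Finset.union_comm]
          exact graft_stepWeight ht ht' ha hne

/-! ### The weighted sums -/

/-- With t = |n|^(1/9) one has exp(-t) ≤ 18!/t^18 = 18!/n². -/
theorem summable_exp_ninth :
    Summable fun n : ℤ => Real.exp (-(|(n : ℝ)| ^ (1 / 9 : ℝ))) := by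
  have h1 : Summable fun n : ℤ => (18).factorial * (1 / (n : ℝ) ^ 2) :=
    (Real.summable_one_div_int_pow.2 one_lt_two).mul_left _
  refine Summable.of_norm_bounded_eventually h1 ?_
  rw [Filter.eventually_cofinite]
  refine (Set.finite_singleton (0 : ℤ)).subset fun n hn => ?_
  by_contra h0
  refine hn ?_
  have hn0 : (n : ℝ) ≠ 0 := Int.cast_ne_zero.2 h0
  set t := |(n : ℝ)| ^ (1 / 9 : ℝ) with ht
  have ht0 : 0 ≤ t := Real.rpow_nonneg (abs_nonneg _) _
  have h2 : t ^ 18 = (n : ℝ) ^ 2 := by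
    rw [ht, ← Real.rpow_natCast, ← Real.rpow_mul (abs_nonneg _),
      show (1 / 9 * (18 : ℕ) : ℝ) = (2 : ℕ) by norm_num, Real.rpow_natCast, sq_abs]
  have h3 := Real.pow_div_factorial_le_exp t ht0 18
  rw [h2] at h3
  rw [Real.norm_eq_abs, Real.abs_exp, Real.exp_neg, inv_le_comm₀ (Real.exp_pos _) (by positivity)]
  refine le_trans (le_of_eq ?_) h3
  field_simp

/-- Since d·|x - z|^(1/9) dominates the sum of |x_i - z_i|^(1/9), the part d of θ makes the sum
factorise over the coordinates. The rest of θ gives a small prefactor, because a step has length at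
least 1. -/
theorem sum_stepWeight_le (d : ℕ) : ∃ θ₀ : ℝ, 0 ≤ θ₀ ∧ ∀ θ, θ₀ ≤ θ →
    ∀ (Λ : Finset (Fin d → ℤ)) (z : Λ), ∑ a, stepWeight θ z a ≤ 1 / 2 := by
  set C := ∑' n : ℤ, Real.exp (-(|(n : ℝ)| ^ (1 / 9 : ℝ))) with hC
  have hC0 : 0 ≤ C := tsum_nonneg fun n => (Real.exp_pos _).le
  have h1 : ∀ (m : ℤ) (S : Finset ℤ),
      ∑ n ∈ S, Real.exp (-(|(m : ℝ) - n| ^ (1 / 9 : ℝ))) ≤ C := by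
    intro m S
    have := summable_exp_ninth.sum_le_tsum (S.image fun n => m - n) fun n _ => (Real.exp_pos _).le
    rw [Finset.sum_image fun a _ b _ e => sub_right_injective e] at this
    simpa only [Int.cast_sub] using this
  have h2 : ∀ (x : Fin d → ℤ) (S : Finset (Fin d → ℤ)),
      ∑ z ∈ S, Real.exp (-(d * ldist x z ^ (1 / 9 : ℝ))) ≤ C ^ d := by
    intro x S
    have hsub : S ⊆ Fintype.piFinset fun i => S.image fun z => z i := fun z hz =>
      Fintype.mem_piFinset.2 fun i => Finset.mem_image_of_mem _ hz
    have e : ∀ z : Fin d → ℤ, Real.exp (-(d * ldist x z ^ (1 / 9 : ℝ))) ≤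
        ∏ i, Real.exp (-(|(x i : ℝ) - z i| ^ (1 / 9 : ℝ))) := fun z => by
      rw [← Real.exp_sum, Finset.sum_neg_distrib]
      refine Real.exp_le_exp.2 (neg_le_neg ?_)
      refine (Finset.sum_le_card_nsmul _ _ (ldist x z ^ (1 / 9 : ℝ)) fun i _ => ?_).trans
        (le_of_eq (by simp))
      exact Real.rpow_le_rpow (abs_nonneg _) (Finset.single_le_sum
        (f := fun i => |(x i : ℝ) - z i|) (fun i _ => abs_nonneg _) (Finset.mem_univ i))
        (by norm_num)
    refine (Finset.sum_le_sum fun z _ => e z).trans ?_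
    refine (Finset.sum_le_sum_of_subset_of_nonneg hsub fun n _ _ =>
      Finset.prod_nonneg fun i _ => (Real.exp_pos _).le).trans ?_
    rw [← Finset.prod_univ_sum (fun i => S.image fun z => z i)
      (fun i (n : ℤ) => Real.exp (-(|(x i : ℝ) - n| ^ (1 / 9 : ℝ))))]
    refine (Finset.prod_le_prod (fun i _ => Finset.sum_nonneg fun n _ => (Real.exp_pos _).le)
      fun i _ => h1 (x i) _).trans ?_
    simp
  refine ⟨d + 2 * C ^ d, by positivity, fun θ hθ Λ z => ?_⟩
  have hCd : 0 ≤ C ^ d := pow_nonneg hC0 d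
  have h3 : ∀ a : Λ, stepWeight θ z a ≤
      Real.exp (-(θ - d)) * Real.exp (-(d * ldist z.1 a.1 ^ (1 / 9 : ℝ))) := by
    intro a
    rw [stepWeight]
    split_ifs with h
    · positivity
    · rw [← Real.exp_add]
      refine Real.exp_le_exp.2 ?_
      have : 1 ≤ ldist z.1 a.1 ^ (1 / 9 : ℝ) := Real.one_le_rpow (one_le_ldist' h) (by norm_num)
      nlinarith
  have h4 : Real.exp (-(θ - d)) * C ^ d ≤ 1 / 2 := by
    rw [Real.exp_neg, inv_mul_le_iff₀ (Real.exp_pos _)]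
    have := Real.add_one_le_exp (θ - d)
    linarith
  calc ∑ a, stepWeight θ z a
      ≤ ∑ a : Λ, Real.exp (-(θ - d)) * Real.exp (-(d * ldist z.1 a.1 ^ (1 / 9 : ℝ))) :=
        Finset.sum_le_sum fun a _ => h3 a
    _ = Real.exp (-(θ - d)) *
          ∑ a ∈ Finset.univ.image fun a : Λ => a.1, Real.exp (-(d * ldist z.1 a ^ (1 / 9 : ℝ))) := by
        rw [← Finset.mul_sum, Finset.sum_image fun a _ b _ e => Subtype.ext e]
    _ ≤ Real.exp (-(θ - d)) * C ^ d := mul_le_mul_of_nonneg_left (h2 _ _) (Real.exp_pos _).le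
    _ ≤ 1 / 2 := h4

/-- After `weight_add_le_action` every term carries the spare factor ε^(action/10). A tour of cost
`c` has weight exp(-2θc) with c ≤ 120·action, and θ = -log ε/2400 is adjusted to this: 2·120/2400 =
1/10. -/
theorem Qhat_le {ε : ℝ} (hε : 0 < ε) (hε1 : ε ≤ 1) (hε' : 3 * √ε ≤ ε ^ (1 / 3 : ℝ))
    (hs : ∀ z : Λ, ∑ a, stepWeight (-Real.log ε / 2400) z a ≤ 1 / 2) {k : ℕ} (hk : 1 ≤ k)
    (x y : Λ) :
    Qhat ε k x y ≤ ε ^ (qSeq k * max (ldist x.1 y.1) (L ((k : ℤ) - 2)) ^ chi / 2) := by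
  set M := qSeq k * max (ldist x.1 y.1) (L ((k : ℤ) - 2)) ^ chi / 2 with hM
  rw [Qhat]
  set 𝓑 : Finset (Finset Λ) := Finset.univ.filter fun B => x ∈ B ∧ y ∈ B ∧ comp (L k) B x = B ∧
      (B \ comp (L ((k : ℤ) - 1)) B x).Nonempty with h𝓑
  have hlog : 0 ≤ -Real.log ε := neg_nonneg.2 (Real.log_nonpos hε.le hε1)
  have h1 : ∀ B ∈ 𝓑, Phat ε x k B * ε ^ (-(qSeq k * B.card / 2)) ≤
      ε ^ M * ε ^ (action x k B / 10) := by
    intro B hB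
    obtain ⟨hx, hy, hc, hne⟩ := (Finset.mem_filter.1 hB).2
    refine (mul_le_mul_of_nonneg_right
      (Phat_le_rpow_action hε hε' x hk (comps_of_comp_eq hx hc)) (Real.rpow_nonneg hε.le _)).trans ?_
    rw [← Real.rpow_add hε, ← Real.rpow_add hε]
    refine Real.rpow_le_rpow_of_exponent_ge hε hε1 ?_
    have := weight_add_le_action hk hx hy hc hne
    linarith
  have h2 : ∑ B ∈ 𝓑, ε ^ (action x k B / 10) ≤ 1 := by
    refine sum_tour_le (f := stepWeight (-Real.log ε / 2400)) (stepWeight_nonneg _) hs le_rfl x 𝓑 _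
      fun B hB => ?_
    obtain ⟨hx, hy, hc, hne⟩ := (Finset.mem_filter.1 hB).2
    refine ⟨?_, ?_⟩
    · rintro rfl
      obtain ⟨z, hz⟩ := hne
      rw [Finset.mem_sdiff, Finset.mem_singleton] at hz
      exact hz.2 (hz.1 ▸ self_mem_comp (Finset.mem_singleton_self z))
    · obtain ⟨c, hc', ht⟩ := exists_tour (-Real.log ε / 2400) x (comps_of_comp_eq hx hc) hx
      refine ht.mono ?_
      rw [Real.rpow_def_of_pos hε]
      refine Real.exp_le_exp.2 ?_
      have h3 : tourConst k ≤ 120 := by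
        rw [tourConst]
        have : 0 ≤ 100 / L k ^ (1 / 9 : ℝ) := div_nonneg (by norm_num) (Real.rpow_nonneg (L_pos _).le _)
        linarith
      have h4 : c ≤ 120 * action x k B :=
        hc'.trans (mul_le_mul_of_nonneg_right h3 (action_nonneg x k B))
      have h5 := mul_le_mul_of_nonneg_left h4 hlog
      linarith
  calc ∑ B ∈ 𝓑, Phat ε x k B * ε ^ (-(qSeq k * B.card / 2))
      ≤ ∑ B ∈ 𝓑, ε ^ M * ε ^ (action x k B / 10) := Finset.sum_le_sum h1
    _ = ε ^ M * ∑ B ∈ 𝓑, ε ^ (action x k B / 10) := (Finset.mul_sum _ _ _).symm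
    _ ≤ ε ^ M * 1 := mul_le_mul_of_nonneg_left h2 (Real.rpow_nonneg hε.le _)
    _ = ε ^ M := mul_one _

/-- A linear minorant of the exponential growth in `m`; it suffices for a geometric series over the
steps. -/
theorem div_ten_le_L_rpow_chi {m : ℕ} (hm : 1 ≤ m) : (m : ℝ) / 10 ≤ L ((m : ℤ) - 2) ^ chi := by
  have h1 : L ((m : ℤ) - 2) ^ chi = Real.exp (Real.log 2 * (((m : ℝ) - 3) * (2 / 9))) := by
    rw [L, ← Real.rpow_intCast, ← Real.rpow_mul two_pos.le, Real.rpow_def_of_pos two_pos]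
    push_cast
    rw [chi, psi]
    congr 2
    ring
  rw [h1]
  have h2 := Real.add_one_le_exp (Real.log 2 * (((m : ℝ) - 3) * (2 / 9)))
  have h3 := Real.log_two_gt_d9
  have h4 := Real.log_two_lt_d9
  have hm' : (1 : ℝ) ≤ m := by exact_mod_cast hm
  refine le_trans ?_ h2
  nlinarith

/-- The maximum dominates the mean of D^χ and m/10. As q_m ≥ 2q, half of the exponent yields the
claimed decay, and the other half a geometric factor ε^(qm/20). -/
theorem sum_rpow_le {ε q : ℝ} (hε : 0 < ε) (hε1 : ε ≤ 1) (hq0 : 0 ≤ q) (hq : ∀ k, 2 * q ≤ qSeq k)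
    (hs : ε ^ (q / 20) ≤ 1 / 2) {D : ℝ} (hD : 0 ≤ D) (k : ℕ) :
    ∑ m ∈ Finset.Icc 1 k, ε ^ (qSeq m * max D (L ((m : ℤ) - 2)) ^ chi / 2) ≤
      ε ^ (q * D ^ chi / 2) := by
  have h1 : ∀ m ∈ Finset.Icc 1 k, ε ^ (qSeq m * max D (L ((m : ℤ) - 2)) ^ chi / 2) ≤
      ε ^ (q * D ^ chi / 2) * (ε ^ (q / 20)) ^ m := by
    intro m hm
    have hm1 := (Finset.mem_Icc.1 hm).1
    rw [← Real.rpow_natCast, ← Real.rpow_mul hε.le, ← Real.rpow_add hε]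
    refine Real.rpow_le_rpow_of_exponent_ge hε hε1 ?_
    have hchi : (0 : ℝ) ≤ chi := by norm_num [chi, psi]
    have h2 : D ^ chi ≤ max D (L ((m : ℤ) - 2)) ^ chi :=
      Real.rpow_le_rpow hD (le_max_left _ _) hchi
    have h3 : L ((m : ℤ) - 2) ^ chi ≤ max D (L ((m : ℤ) - 2)) ^ chi :=
      Real.rpow_le_rpow (L_pos _).le (le_max_right _ _) hchi
    have h4 := div_ten_le_L_rpow_chi hm1
    have h5 : D ^ chi + (m : ℝ) / 10 ≤ 2 * max D (L ((m : ℤ) - 2)) ^ chi := by linarith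
    have h6 := mul_le_mul_of_nonneg_left h5 hq0
    have h7 := mul_le_mul_of_nonneg_right (hq m)
      (Real.rpow_nonneg (hD.trans (le_max_left D (L ((m : ℤ) - 2)))) chi)
    linarith
  refine (Finset.sum_le_sum h1).trans ?_
  rw [← Finset.mul_sum]
  exact mul_le_of_le_one_right (Real.rpow_nonneg hε.le _)
    (sum_Icc_pow_le (Real.rpow_nonneg hε.le _) hs k)

/-- All smallness conditions hold for small `ε`. -/
theorem exists_threshold (d : ℕ) {q : ℝ} (hq : 0 < q) : ∃ ε₀ : ℝ, 0 < ε₀ ∧ ∀ ε, 0 < ε → ε < ε₀ →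
    ε ≤ Real.exp (-30) ∧ ε ^ 4 * (6 * 4 ^ d) ≤ 1 / 4 ∧ 3 * √ε ≤ ε ^ (1 / 3 : ℝ) ∧
      ε ^ (q / 20) ≤ 1 / 2 ∧ (∀ j, StepSmall d (4 * -Real.log ε) j) ∧
      ∀ (Λ : Finset (Fin d → ℤ)) (z : Λ), ∑ a, stepWeight (-Real.log ε / 2400) z a ≤ 1 / 2 := by
  obtain ⟨G₀, hG1, hG₀⟩ := exists_stepSmall d
  obtain ⟨θ₀, hθ0, hθ₀⟩ := sum_stepWeight_le d
  set T : ℝ := 30 + G₀ + 2400 * θ₀ + 20 / q + 24 * 4 ^ d with hT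
  refine ⟨Real.exp (-T), Real.exp_pos _, fun ε hε hε' => ?_⟩
  have hl : T ≤ -Real.log ε := by
    have := (Real.log_lt_log hε hε').le
    rw [Real.log_exp] at this
    linarith
  set l := -Real.log ε with hldef
  have he : ε = Real.exp (-l) := by rw [hldef, neg_neg, Real.exp_log hε]
  have hq' : 0 < 20 / q := by positivity
  have hd : (0 : ℝ) < 24 * 4 ^ d := by positivity
  refine ⟨?_, ?_, ?_, ?_, fun j => hG₀ _ (by linarith) j, fun Λ z => hθ₀ _ (by linarith) Λ z⟩
  · rw [he]
    exact Real.exp_le_exp.2 (by linarith)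
  · have h1 : ε ^ 4 ≤ ε := by
      have : ε ≤ 1 := by rw [he]; exact Real.exp_le_one_iff.2 (by linarith)
      exact pow_le_of_le_one hε.le this (by norm_num)
    have h2 : ε * (24 * 4 ^ d) ≤ 1 := by
      rw [he, Real.exp_neg, inv_mul_le_iff₀ (Real.exp_pos _)]
      have := Real.add_one_le_exp l
      linarith
    have h3 := mul_le_mul_of_nonneg_right h1 hd.le
    linarith
  · have h1 : (3 : ℝ) ≤ Real.exp (l / 6) := by
      have := Real.add_one_le_exp (l / 6)
      linarith
    have h2 : √ε = Real.exp (-l / 2) := by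
      rw [Real.sqrt_eq_rpow, he, ← Real.exp_mul]; congr 1; ring
    have h3 : ε ^ (1 / 3 : ℝ) = Real.exp (l / 6) * Real.exp (-l / 2) := by
      rw [he, ← Real.exp_mul, ← Real.exp_add]; congr 1; ring
    rw [h2, h3]
    exact mul_le_mul_of_nonneg_right h1 (Real.exp_pos _).le
  · have h1 : 1 ≤ l * (q / 20) := by
      have h2 : 20 / q ≤ l := by linarith
      calc (1 : ℝ) = 20 / q * (q / 20) := by field_simp
        _ ≤ l * (q / 20) := mul_le_mul_of_nonneg_right h2 (by positivity)
    have h3 : ε ^ (q / 20) = (Real.exp (l * (q / 20)))⁻¹ := by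
      rw [he, ← Real.exp_mul, ← Real.exp_neg]; congr 1; ring
    rw [h3, inv_le_comm₀ (Real.exp_pos _) (by norm_num)]
    have := Real.add_one_le_exp (l * (q / 20))
    norm_num
    linarith

end BlockAnderson

end

open BlockAnderson


/-! ### Proof of the theorem. -/

theorem mainTheorem9 :
    ∃ q : ℝ, 0 < q ∧ (∀ k : ℕ, 1 ≤ k → q < qSeq k) ∧
      ∀ d : ℕ, ∃ ε₀ : ℝ, 0 < ε₀ ∧ ∀ ε : ℝ, 0 < ε → ε < ε₀ →
        ∀ (a b : Fin d → ℤ) (x y : Finset.Icc a b) (k : ℕ), 1 ≤ k →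
          Qhat ε k x y ≤ ε ^ (qSeq k * max (ldist x.1 y.1) (L ((k : ℤ) - 2)) ^ chi / 2) ∧
          ∀ (s : ℝ) (p : ℕ → ℕ), s = 1 ∨ s = -1 →
            law (Finset.Icc a b) (inBlock ε x y s p k) ≤
              ENNReal.ofReal (ε ^ (q * ldist x.1 y.1 ^ chi / 2)) := by
  have hpos : 0 < 1 / 7 * Real.exp (-(1 / (1 - qRatio) ^ 2)) := by positivity
  -- Half of the uniform lower bound of the q_k: the other half is spent on the sum over the steps,
  -- and it makes q < q_k strict.
  set q := 1 / 7 * Real.exp (-(1 / (1 - qRatio) ^ 2)) / 2 with hq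
  have hq0 : 0 < q := by linarith
  have hqk : ∀ k, 2 * q ≤ qSeq k := fun k => by
    have := exp_le_qSeq' k
    linarith
  refine ⟨q, hq0, fun k _ => by linarith [hqk k], fun d => ?_⟩
  obtain ⟨ε₀, hε₀, hsmall⟩ := exists_threshold d hq0
  refine ⟨ε₀, hε₀, fun ε hε hlt a b x y k hk => ?_⟩
  obtain ⟨h30, hγ, hsqrt, hhalf, hstep, hsum⟩ := hsmall ε hε hlt
  have hε1 : ε ≤ 1 := h30.trans (Real.exp_le_one_iff.2 (by norm_num))
  have hQ : ∀ m, 1 ≤ m →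
      Qhat ε m x y ≤ ε ^ (qSeq m * max (ldist x.1 y.1) (L ((m : ℤ) - 2)) ^ chi / 2) :=
    fun m hm => Qhat_le hε hε1 hsqrt (hsum _) hm x y
  refine ⟨hQ k hk, fun s p hs => ?_⟩
  -- For x = y the block of `x` need not have grown in any step, but the claimed bound is then ε^0 =
  -- 1, since χ ≠ 0.
  by_cases hxy : x = y
  · have hchi : chi ≠ 0 := by norm_num [chi, psi]
    have : MeasureTheory.IsProbabilityMeasure (law (Finset.Icc a b)) := by
      rw [law_eq_pi]
      infer_instance
    rw [hxy, ldist_self, Real.zero_rpow hchi, mul_zero, zero_div, Real.rpow_zero,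
      ENNReal.ofReal_one]
    exact MeasureTheory.prob_le_one
  · have hG : Real.exp (-(4 * -Real.log ε)) = ε ^ 4 := by
      rw [show -(4 * -Real.log ε) = (4 : ℕ) * Real.log ε by push_cast; ring, Real.exp_nat_mul,
        Real.exp_log hε]
    refine (law_inBlock_le hε h30 hγ hG hstep qSeq_nonneg hxy hs p hk).trans
      (ENNReal.ofReal_le_ofReal ?_)
    exact (Finset.sum_le_sum fun m hm => hQ m (Finset.mem_Icc.1 hm).1).trans
      (sum_rpow_le hε hε1 hq0.le hqk hhalf (ldist_nonneg _ _) k)
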